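/- Fix $y_0>0$ and $0<\xi_*<\xi^*<y_0/\sqrt2$, and let $\mathcal O=[\xi_*,\xi^*]$, $\mathbb T=\mathbb R/2\pi\mathbb Z$ with its normalized Lebesgue measure. **Orbit.** For $\xi_0\in(0,y_0/\sqrt2)$ let $(J,\phi)$ be the global solution of $$\dot J=-\Big[\tfrac1{y_0^2-J\sin^2\phi}+\tfrac1{y_0^2+J\cos^2\phi}\Big]\sin(2\phi)J,\qquad \dot\phi=\tfrac1J+\tfrac{\sin^2\phi}{y_0^2-J\sin^2\phi}-\tfrac{\cos^2\phi}{y_0^2+J\cos^2\phi},\qquad J(0)=\xi_0^2,\ \phi(0)=\tfrac\pi2$$ (the leapfrogging point vortex orbit in polar coordinates), let $T(\xi_0)>0$ be its period ($J(t+T)=J(t)$, $\phi(t+T)=\phi(t)+2\pi$), $\omega_0=\omega(\xi_0)=2\pi/T(\xi_0)$, and set $q(\varphi)=J(\varphi/\omega_0)$, $\Theta(\varphi)=\phi(\varphi/\omega_0)$, $\widehat\Theta(\varphi)=\Theta(\varphi)-\varphi$, $\mathtt w_3=\mathrm i\sqrt q\sin\Theta+\mathrm iy_0$, $\mathtt w_4=\sqrt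 q\cos\Theta+\mathrm iy_0$, $\beta=\frac{e^{-2\mathrm i\widehat\Theta}}{q}-\frac{e^{2\mathrm i\varphi}}{\mathtt w_3^2}-\frac{e^{2\mathrm i\varphi}}{\mathtt w_4^2}$. **Exceptional set.** Let $\rho_1=\frac{\mathrm i}{\omega_0}\big(\omega_0+\frac1{2\mathtt w_3^2}\big)$, $\rho_2=-\frac{\mathrm i}{4\omega_0}\beta$, $\rho_3=-\frac{\mathrm i}{2\omega_0\mathtt w_4^2}$, $\rho_4=\frac{\mathrm i e^{-2\mathrm i\widehat\Theta}}{2\omega_0q}$, and $$A(\xi_0,\varphi)=\begin{pmatrix}\rho_1(\varphi)&\rho_2(\varphi)&\rho_3(\varphi)&\rho_4(\varphi)\\ \overline{\rho_2(\varphi)}&\overline{\rho_1(\varphi)}&\overline{\rho_4(\varphi)}&\overline{\rho_3(\varphi)}\\ \rho_3(\varphi+\pi)&\rho_4(\varphi+\pi)&\rho_1(\varphi+\pi)&\rho_2(\varphi+\pi)\\ \overline{\rho_4(\varphi+\pi)}&\overline{\rho_3(\varphi+\pi)}&\overline{\rho_2(\varphi+\pi)}&\overline{\rho_1(\varphi+\pi)}\end{pmatrix}.$$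 Let $\mathcal M_0$ solve $\mathcal M_0'=A(\xi_0,\cdot)\mathcal M_0$, $\mathcal M_0(0)=\mathrm{Id}$, let $\mathbb S=\{\xi_0\in(0,y_0/\sqrt2):\det(\mathcal M_0(2\pi)-\mathrm{Id})=0\}$ and, for $0<\sigma<1$, $\mathcal O_\sigma=\{\xi_0\in\mathcal O:\ |\xi_0-x|\ge\sigma\ \text{for all } x\in\mathbb S\}$. **Spaces.** $\|h\|_{H^s}^2=\sum_{\ell,j}(1+\ell^2+j^2)^s|h_{\ell,j}|^2$ is the Sobolev norm of functions of $(\varphi,\theta)\in\mathbb T^2$, and for $\lambda\in(0,1)$ $$\|h\|_s^{\mathrm{Lip}(\lambda)}=\sup_{\xi\in\mathcal O}\|h(\xi)\|_{H^s}+\lambda\sup_{\xi_1\ne\xi_2\in\mathcal O}\frac{\|h(\xi_1)-h(\xi_2)\|_{H^{s-1}}}{|\xi_1-\xi_2|},$$ with the analogous norm $\|\cdot\|^{\mathrm{Lip}(\lambda)}$ for scalar functions of $\xi\in\mathcal O$. $\Pi$ is the projector on the spatial (i.e. in $\theta$) modes $\pm1$, and $X^s_\circ$ is the space of families $h:\mathcal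 O\to H^s(\mathbb T^2,\mathbb C)$ with zero $\theta$-average, $\Pi h=h$ and $\|h\|_s^{\mathrm{Lip}(\lambda)}<\infty$. **Operator.** For $\varepsilon>0$ and $\mathtt c_2:\mathcal O\to\mathbb R$ let $$\mathbb L_1=\varepsilon^2\omega_0\partial_\varphi+\mathtt c\,\partial_\theta-\tfrac12\mathcal H-\varepsilon^2\partial_\theta\mathcal Q_1,\qquad \mathtt c=\tfrac12-\varepsilon^2(\omega_0-\varepsilon\mathtt c_2),$$ where $\mathcal H e^{\mathrm ij\theta}=\mathrm i\,\mathrm{sign}(j)e^{\mathrm ij\theta}$ and $$\mathcal Q_1[h](\varphi,\theta)=\int_{\mathbb T}h(\varphi,\eta)\,\mathrm{Re}\Big\{\tfrac{e^{\mathrm i(\theta-\eta)}}{\mathtt w_3^2(\varphi)}-\tfrac12\beta(\varphi)e^{\mathrm i(\theta+\eta)}\Big\}d\eta+\int_{\mathbb T}h(\varphi+\pi,\eta)\,\mathrm{Re}\Big\{\tfrac{e^{\mathrm i(\theta+\eta-2\widehat\Theta(\varphi))}}{q(\varphi)}-\tfrac{e^{\mathrm i(\theta-\eta)}}{\mathtt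 w_4^2(\varphi)}\Big\}d\eta.$$ **Proposition.** The set $\mathbb S$ is countable and has no accumulation point other than, possibly, $y_0/\sqrt2$. There exists $\mathtt n\in\mathbb N$ (depending only on $y_0,\xi_*,\xi^*$) such that for every bound $K$ there are $\varepsilon_1>0$ and constants $C(s)$ (depending only on $y_0,\xi_*,\xi^*,K$, and $C(s)$ on $s$) with the following property. Let $\lambda,\sigma\in(0,1)$ and $\varepsilon>0$ satisfy $$\varepsilon\sigma^{-\mathtt n}\le\varepsilon_1,$$ and let $\mathtt c_2$ be any function with $\|\mathtt c_2\|^{\mathrm{Lip}(\lambda)}\le K$. Then there is a linear operator $\mathtt S$ which, for every $s>1$, maps $X^{s-1}_\circ$ to $X^s_\circ$, maps real-valued functions to real-valued functions, satisfies $$\|\mathtt S h\|_s^{\mathrm{Lip}(\lambda)}\le C(s)\,\varepsilon^{-2}\sigma^{-\mathtt n}\,\|h\|_{s-1}^{\mathrm{Lip}(\lambda)}\qquad(h\in X^{s-1}_\circ),$$ and for which $(\Pi\mathbb L_1\Pi)\mathtt S h=h$ at every parameter $\xi_0\in\mathcal O_\sigma$. -/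

import Mathlib

noncomputable section

namespace Leapfrog

/-! ### The leapfrogging orbit of the point vortices -/

/-- `(J, ϕ)` is the global solution, in polar coordinates `η + i ξ = √J e^{iϕ}`, of the reduced
four point vortex system started from `(η, ξ) = (0, ξ₀)`, the total height being `y₀`. -/
structure IsPointVortexOrbit (y₀ ξ₀ : ℝ) (J ϕ : ℝ → ℝ) : Prop where
  J_zero : J 0 = ξ₀ ^ 2
  ϕ_zero : ϕ 0 = Real.pi / 2
  J_deriv : ∀ t, HasDerivAt J
    (-(1 / (y₀ ^ 2 - J t * Real.sin (ϕ t) ^ 2) + 1 / (y₀ ^ 2 + J t * Real.cos (ϕ t) ^ 2))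
      * Real.sin (2 * ϕ t) * J t) t
  ϕ_deriv : ∀ t, HasDerivAt ϕ
    (1 / J t + Real.sin (ϕ t) ^ 2 / (y₀ ^ 2 - J t * Real.sin (ϕ t) ^ 2)
      - Real.cos (ϕ t) ^ 2 / (y₀ ^ 2 + J t * Real.cos (ϕ t) ^ 2)) t

/-- The orbit, as a pair `(J, ϕ)` of functions of time. -/
def orbit (y₀ ξ₀ : ℝ) : (ℝ → ℝ) × (ℝ → ℝ) :=
  Classical.epsilon fun γ : (ℝ → ℝ) × (ℝ → ℝ) => IsPointVortexOrbit y₀ ξ₀ γ.1 γ.2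

/-- The period `T(ξ₀)` of the orbit. -/
def period (y₀ ξ₀ : ℝ) : ℝ :=
  sInf {T : ℝ | 0 < T ∧ ∀ t, (orbit y₀ ξ₀).1 (t + T) = (orbit y₀ ξ₀).1 t ∧
    (orbit y₀ ξ₀).2 (t + T) = (orbit y₀ ξ₀).2 t + 2 * Real.pi}

/-- The frequency `ω₀ = ω(ξ₀) = 2π / T(ξ₀)`. -/
def omega (y₀ ξ₀ : ℝ) : ℝ := 2 * Real.pi / period y₀ ξ₀

/-- `q`, the squared modulus of `η + i ξ` as a function of `φ = ω₀ t`. -/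
def q (y₀ ξ₀ φ : ℝ) : ℝ := (orbit y₀ ξ₀).1 (φ / omega y₀ ξ₀)

/-- `Θ`, the argument of `η + i ξ` as a function of `φ = ω₀ t`. -/
def Theta (y₀ ξ₀ φ : ℝ) : ℝ := (orbit y₀ ξ₀).2 (φ / omega y₀ ξ₀)

/-- `Θ̂(φ) = Θ(φ) - φ`. -/
def ThetaHat (y₀ ξ₀ φ : ℝ) : ℝ := Theta y₀ ξ₀ φ - φ

def w₃ (y₀ ξ₀ φ : ℝ) : ℂ :=
  Complex.I * (Real.sqrt (q y₀ ξ₀ φ) * Real.sin (Theta y₀ ξ₀ φ) : ℝ) + Complex.I * y₀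

def w₄ (y₀ ξ₀ φ : ℝ) : ℂ :=
  (Real.sqrt (q y₀ ξ₀ φ) * Real.cos (Theta y₀ ξ₀ φ) : ℝ) + Complex.I * y₀

/-- `e^{-2iΘ̂} / q`. -/
def κ (y₀ ξ₀ φ : ℝ) : ℂ :=
  Complex.exp (-(2 * Complex.I * ThetaHat y₀ ξ₀ φ)) / (q y₀ ξ₀ φ : ℂ)

/-- `e^{-2iΘ̂} / q - e^{2iφ} / w₃² - e^{2iφ} / w₄²`. -/
def β (y₀ ξ₀ φ : ℝ) : ℂ :=
  κ y₀ ξ₀ φ - Complex.exp (2 * Complex.I * φ) / w₃ y₀ ξ₀ φ ^ 2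
    - Complex.exp (2 * Complex.I * φ) / w₄ y₀ ξ₀ φ ^ 2

/-! ### The monodromy matrix and the exceptional set -/

def ρ₁ (y₀ ξ₀ φ : ℝ) : ℂ :=
  Complex.I / omega y₀ ξ₀ * (omega y₀ ξ₀ + 1 / (2 * w₃ y₀ ξ₀ φ ^ 2))

def ρ₂ (y₀ ξ₀ φ : ℝ) : ℂ := -(Complex.I / (4 * omega y₀ ξ₀)) * β y₀ ξ₀ φ

def ρ₃ (y₀ ξ₀ φ : ℝ) : ℂ := -(Complex.I / (2 * omega y₀ ξ₀ * w₄ y₀ ξ₀ φ ^ 2))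

def ρ₄ (y₀ ξ₀ φ : ℝ) : ℂ := Complex.I / (2 * omega y₀ ξ₀) * κ y₀ ξ₀ φ

open ComplexConjugate in
/-- The matrix `A(0, ξ₀, φ)` of the unperturbed `4 × 4` system satisfied by
`(h₁(φ), h₋₁(φ), h₁(φ + π), h₋₁(φ + π))`. -/
def A (y₀ ξ₀ φ : ℝ) : Matrix (Fin 4) (Fin 4) ℂ :=
  let ψ := φ + Real.pi
  !![ρ₁ y₀ ξ₀ φ, ρ₂ y₀ ξ₀ φ, ρ₃ y₀ ξ₀ φ, ρ₄ y₀ ξ₀ φ;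
     conj (ρ₂ y₀ ξ₀ φ), conj (ρ₁ y₀ ξ₀ φ), conj (ρ₄ y₀ ξ₀ φ), conj (ρ₃ y₀ ξ₀ φ);
     ρ₃ y₀ ξ₀ ψ, ρ₄ y₀ ξ₀ ψ, ρ₁ y₀ ξ₀ ψ, ρ₂ y₀ ξ₀ ψ;
     conj (ρ₄ y₀ ξ₀ ψ), conj (ρ₃ y₀ ξ₀ ψ), conj (ρ₂ y₀ ξ₀ ψ), conj (ρ₁ y₀ ξ₀ ψ)]

/-- `M` is the fundamental matrix of `H' = A(0, ξ₀, φ) H` normalised at `φ = 0`. -/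
structure IsFundamentalMatrix (y₀ ξ₀ : ℝ) (M : ℝ → Matrix (Fin 4) (Fin 4) ℂ) : Prop where
  zero : M 0 = 1
  deriv : ∀ φ i j, HasDerivAt (fun t => M t i j) ((A y₀ ξ₀ φ * M φ) i j) φ

/-- The set `𝕊` of the `ξ₀ ∈ (0, y₀/√2)` for which the monodromy matrix `M(2π)` has the
eigenvalue `1`. -/
def exceptionalSet (y₀ : ℝ) : Set ℝ :=
  {ξ₀ | ξ₀ ∈ Set.Ioo 0 (y₀ / Real.sqrt 2) ∧
    ∃ M, IsFundamentalMatrix y₀ ξ₀ M ∧ (M (2 * Real.pi) - 1).det = 0}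

/-- The set `𝒪_σ` of the `ξ₀ ∈ [ξl, ξu]` at distance at least `σ` from `𝕊`. -/
def goodSet (y₀ ξl ξu σ : ℝ) : Set (Set.Icc ξl ξu) :=
  {ξ₀ | ∀ x ∈ exceptionalSet y₀, σ ≤ |(ξ₀ : ℝ) - x|}

/-! ### Functions on the torus, Sobolev and Lipschitz norms -/

instance two_pi_pos_fact : Fact (0 < 2 * Real.pi) := ⟨Real.two_pi_pos⟩

/-- The circle `ℝ / 2πℤ`. -/
abbrev Circ : Type := AddCircle (2 * Real.pi)

/-- The normalised Lebesgue measure on the circle. -/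
abbrev dCirc : MeasureTheory.Measure Circ := AddCircle.haarAddCircle

/-- `L²(𝕋², ℂ)`, for the normalised Lebesgue measure; the variables are `(φ, θ)`. -/
abbrev L2 : Type := MeasureTheory.Lp ℂ 2 (dCirc.prod dCirc)

/-- The Fourier coefficient of `h` at `e^{i(ℓφ + jθ)}`, where `k = (ℓ, j)`. -/
def coeff (h : Circ × Circ → ℂ) (k : ℤ × ℤ) : ℂ :=
  ∫ p, fourier (-k.1) p.1 * fourier (-k.2) p.2 * h p ∂(dCirc.prod dCirc)

/-- The `H^s(𝕋²)` norm, with value `∞` outside `H^s`. -/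
def sobolevNorm (s : ℝ) (h : L2) : ENNReal :=
  (∑' k : ℤ × ℤ,
    ENNReal.ofReal ((1 + (k.1 : ℝ) ^ 2 + (k.2 : ℝ) ^ 2) ^ s * ‖coeff h k‖ ^ 2)) ^ (1 / 2 : ℝ)

/-- The norm `‖h‖_s^{Lip(λ)}` of a family of functions on the torus depending on `ξ ∈ O`. -/
def lipSobolevNorm {O : Set ℝ} (lam s : ℝ) (h : O → L2) : ENNReal :=
  (⨆ ξ, sobolevNorm s (h ξ)) + ENNReal.ofReal lam *
    ⨆ (ξ₁ : O) (ξ₂ : O) (_ : ξ₁ ≠ ξ₂),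
      sobolevNorm (s - 1) (h ξ₁ - h ξ₂) / ENNReal.ofReal |(ξ₁ : ℝ) - ξ₂|

/-- The norm `‖c‖^{Lip(λ)}` of a real function of `ξ ∈ O`. -/
def lipNorm {O : Set ℝ} (lam : ℝ) (c : O → ℝ) : ENNReal :=
  (⨆ ξ, ENNReal.ofReal |c ξ|) + ENNReal.ofReal lam *
    ⨆ (ξ₁ : O) (ξ₂ : O) (_ : ξ₁ ≠ ξ₂),
      ENNReal.ofReal |c ξ₁ - c ξ₂| / ENNReal.ofReal |(ξ₁ : ℝ) - ξ₂|

/-- The projector `Π` on the spatial modes `±1`. -/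
def modeProj (h : Circ × Circ → ℂ) (p : Circ × Circ) : ℂ :=
  (∫ η, h (p.1, η) * fourier (-1) η ∂dCirc) * fourier 1 p.2 +
    (∫ η, h (p.1, η) * fourier 1 η ∂dCirc) * fourier (-1) p.2

/-- The space `X^s = Lip_λ(O, H^s_0)`; as a set it is independent of `λ > 0`, which only enters
the norm. -/
def X {O : Set ℝ} (lam s : ℝ) : Set (O → L2) :=
  {h | lipSobolevNorm lam s h < ⊤ ∧ ∀ ξ, ∀ᵐ φ ∂dCirc, ∫ θ, h ξ (φ, θ) ∂dCirc = 0}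

/-- The space `X^s_∘` of the elements of `X^s` which are localised on the spatial modes `±1`. -/
def Xmode {O : Set ℝ} (lam s : ℝ) : Set (O → L2) :=
  {h | h ∈ X lam s ∧ ∀ ξ, modeProj (h ξ) =ᵐ[dCirc.prod dCirc] h ξ}

/-- All the functions of the family are real-valued. -/
def IsRealFamily {O : Set ℝ} (h : O → L2) : Prop :=
  ∀ ξ, ∀ᵐ p ∂(dCirc.prod dCirc), (h ξ p).im = 0

/-! ### The operator `Π 𝕃₁ Π` -/

/-- The value at a point of the circle of a `2π`-periodic function on the line. -/
def onCircle (f : ℝ → ℂ) (φ : Circ) : ℂ := AddCircle.liftIco (2 * Real.pi) 0 f φ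

/-- The integral operator `𝒬₁`, with the time delay `π`. -/
def Q₁ (y₀ ξ₀ : ℝ) (h : Circ × Circ → ℂ) (p : Circ × Circ) : ℂ :=
  (∫ η, h (p.1, η) *
    (((onCircle (fun φ => 1 / w₃ y₀ ξ₀ φ ^ 2) p.1 * fourier 1 (p.2 - η)
      - 1 / 2 * onCircle (β y₀ ξ₀) p.1 * fourier 1 (p.2 + η)).re : ℝ) : ℂ) ∂dCirc) +
  ∫ η, h (p.1 + ((Real.pi : ℝ) : Circ), η) *
    (((onCircle (κ y₀ ξ₀) p.1 * fourier 1 (p.2 + η)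
      - onCircle (fun φ => 1 / w₄ y₀ ξ₀ φ ^ 2) p.1 * fourier 1 (p.2 - η)).re : ℝ) : ℂ) ∂dCirc

/-- The Fourier coefficients of the periodic distribution `𝕃₁ h`, where
`𝕃₁ = ε² ω₀ ∂_φ + c ∂_θ - ½ ℋ - ε² ∂_θ 𝒬₁` and `ℋ` is the Hilbert transform, that is, the
Fourier multiplier `i sign j`. -/
def L₁ (y₀ ξ₀ ε c : ℝ) (h : Circ × Circ → ℂ) (k : ℤ × ℤ) : ℂ :=
  ε ^ 2 * omega y₀ ξ₀ * (Complex.I * k.1 * coeff h k) + c * (Complex.I * k.2 * coeff h k)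
    - 1 / 2 * (Complex.I * (k.2.sign : ℂ) * coeff h k)
    - ε ^ 2 * (Complex.I * k.2 * coeff (Q₁ y₀ ξ₀ h) k)

/-- The Fourier coefficients of `Π 𝕃₁ Π h`. -/
def PiL₁Pi (y₀ ξ₀ ε c : ℝ) (h : Circ × Circ → ℂ) (k : ℤ × ℤ) : ℂ :=
  if |k.2| = 1 then L₁ y₀ ξ₀ ε c (modeProj h) k else 0

/-- The transport coefficient `c = ½ - ε² (ω₀ - ε c₂)`. -/
def speed (y₀ ξ₀ ε c₂ : ℝ) : ℝ := 1 / 2 - ε ^ 2 * (omega y₀ ξ₀ - ε * c₂)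

end Leapfrog

end

/-! On the spatial modes ±1 the operator degenerates: the order-one parts of `𝚌∂_θ` and of `½ℋ`
cancel, so `Π𝕃₁Π` is exactly `ε²ω₀` times `∂_φ - A`, up to a diagonal term of size `ε|c₂|/ω₀`
(`PiL₁Pi_synth`). Here `A` mixes the two modes and contains the delay `φ ↦ φ + π`. Adjoining the
values at `φ + π` turns the delay equation into a local 4 × 4 system, whose 2π-periodic solvability
is decided by `det(M(2π) - 1)`. Two things are then required: this determinant must vanish rarely,
and in a quantitative way, as a function of `ξ₀`; and its lower bound must be converted into Sobolev
and Lipschitz bounds for the inverse.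

The determinant. Conservation of energy makes `J` an explicit function of the angle (`levelj_rel`,
`hasDerivAt_levelJ`), and the angle increases along the orbit, so it can serve as time. In this
variable, after conjugation by `diag(e^{iφ}, e^{-iφ}, e^{iφ}, e^{-iφ})`, the frequency and the
factor `1/J` drop out (`A_mul_frame`). The coefficients are then holomorphic in the parameter,
across `ξ₀ = 0` as well, and the monodromy is computed over the fixed interval `[π/2, 5π/2]`. Hence
`charDet` is real analytic on `(-y₀/√2, y₀/√2)`. At `ξ₀ = 0` the system splits into two pairs which
a further rotation makes autonomous, with exponents `±i√(1 - γ²)` for `γ = 1/4` and `γ = -3/4`;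
these do not belong to `iℤ`, so `charDet` is nonzero at 0 (`charDet_zero_ne_zero`). The identity
theorem excludes accumulation of zeros inside the interval, and finite order of vanishing with
compactness gives `|charDet| ≥ c σ^n` at distance `σ` from the zeros (`exists_charDet_lower_bound`).

The inverse. Gronwall and the adjugate matrix bound a periodic solution by the sup of the source
over the determinant (`exists_periodic_ode_bound`). In Sobolev norms this loses derivatives; the
loss is repaired by the parametrix `(∂_φ + 1)⁻¹` (`exists_apriori`). The diagonal term is absorbed
when `ε` is small against `σ^n` (`KernelBound.apriori_addDiag`), and uniqueness gives existence
because `(∂_φ + 1)⁻¹` is compact (`KernelBound.exists_solution`). The operator `A` enters through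
the rapid off-diagonal decay of its Fourier matrix, which holds uniformly and in a Lipschitz way in
`ξ₀` by repeated integration by parts in the angle (`exists_kernelBound`). Lipschitz dependence of
the inverse is the resolvent identity (`exists_inverse_family`). A cutoff in `ξ₀`, equal to 1 on
`𝒪_σ` and supported at distance at least `σ/2` from `𝕊`, then extends the inverse to all of `𝒪`
(`exists_right_inverse`). -/

noncomputable section

namespace Leapfrog

section

open scoped ENNReal NNReal

/-! ### Weighted `ℓ²` norms and kernels with rapid off-diagonal decay -/

/-- The `ℓ²` norm of a family of extended nonnegative numbers. -/
def l2 {ι : Type*} (f : ι → ℝ≥0∞) : ℝ≥0∞ := (∑' i, f i ^ 2) ^ (1 / 2 : ℝ)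

section l2

variable {ι : Type*} {f g : ι → ℝ≥0∞}

lemma l2_mono (h : ∀ i, f i ≤ g i) : l2 f ≤ l2 g := by
  unfold l2
  gcongr with i
  exact h i

lemma l2_sq (f : ι → ℝ≥0∞) : l2 f ^ 2 = ∑' i, f i ^ 2 := by
  rw [l2, ← ENNReal.rpow_natCast, ← ENNReal.rpow_mul]
  norm_num

lemma l2_le_of_sq_le {c : ℝ≥0∞} (h : ∑' i, f i ^ 2 ≤ c ^ 2) : l2 f ≤ c := by
  rw [← l2_sq] at h
  exact (ENNReal.pow_le_pow_left_iff two_ne_zero).1 h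

lemma l2_const_mul (c : ℝ≥0∞) (f : ι → ℝ≥0∞) : l2 (fun i => c * f i) = c * l2 f := by
  have h : l2 (fun i => c * f i) ^ 2 = (c * l2 f) ^ 2 := by
    rw [l2_sq, mul_pow, l2_sq, ← ENNReal.tsum_mul_left]
    simp [mul_pow]
  exact (ENNReal.pow_right_strictMono two_ne_zero).injective h

lemma l2_add_le (f g : ι → ℝ≥0∞) : l2 (fun i => f i + g i) ≤ l2 f + l2 g := by
  let _ : MeasurableSpace ι := ⊤
  have h := ENNReal.lintegral_Lp_add_le (μ := MeasureTheory.Measure.count) (p := 2)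
    (measurable_from_top (f := f)).aemeasurable (measurable_from_top (f := g)).aemeasurable
    (by norm_num)
  simpa [l2, MeasureTheory.lintegral_count] using h

/-- Cauchy–Schwarz for the splitting `f g = √f · (√f g)`, which is the form used by the Schur test.
-/
lemma tsum_mul_sq_le (f g : ι → ℝ≥0∞) :
    (∑' i, f i * g i) ^ 2 ≤ (∑' i, f i) * ∑' i, f i * g i ^ 2 := by
  let _ : MeasurableSpace ι := ⊤
  have h := ENNReal.lintegral_mul_le_Lp_mul_Lq (μ := MeasureTheory.Measure.count)
    (p := 2) (q := 2) Real.HolderConjugate.two_two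
    (measurable_from_top (f := fun i => f i ^ (1 / 2 : ℝ))).aemeasurable
    (measurable_from_top (f := fun i => f i ^ (1 / 2 : ℝ) * g i)).aemeasurable
  simp only [Pi.mul_apply, MeasureTheory.lintegral_count, ENNReal.rpow_ofNat, mul_pow] at h
  have e1 : ∀ i, (f i ^ (1 / 2 : ℝ)) ^ 2 = f i := fun i => by
    rw [← ENNReal.rpow_natCast, ← ENNReal.rpow_mul]; norm_num
  have e2 : ∀ i, f i ^ (1 / 2 : ℝ) * (f i ^ (1 / 2 : ℝ) * g i) = f i * g i := fun i => by
    rw [← mul_assoc, ← sq, e1]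
  simp only [e1, e2] at h
  calc (∑' i, f i * g i) ^ 2
      ≤ ((∑' i, f i) ^ (1 / 2 : ℝ) * (∑' i, f i * g i ^ 2) ^ (1 / 2 : ℝ)) ^ 2 := by gcongr
    _ = _ := by
      rw [mul_pow]
      simp only [← ENNReal.rpow_natCast, ← ENNReal.rpow_mul]
      norm_num

/-- **Schur test.** -/
lemma l2_tsum_le {k : ι → ι → ℝ≥0∞} {C : ℝ≥0∞} (h₁ : ∀ i, ∑' j, k i j ≤ C)
    (h₂ : ∀ j, ∑' i, k i j ≤ C) (f : ι → ℝ≥0∞) :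
    l2 (fun i => ∑' j, k i j * f j) ≤ C * l2 f := by
  apply l2_le_of_sq_le
  calc ∑' i, (∑' j, k i j * f j) ^ 2
      ≤ ∑' i, C * ∑' j, k i j * f j ^ 2 := by
        gcongr with i
        exact (tsum_mul_sq_le _ _).trans (by gcongr; exact h₁ i)
    _ = C * ∑' j, (∑' i, k i j) * f j ^ 2 := by
        rw [ENNReal.tsum_mul_left, ENNReal.tsum_comm]
        simp [ENNReal.tsum_mul_right]
    _ ≤ C * ∑' j, C * f j ^ 2 := by
        gcongr with j
        exact h₂ j
    _ = (C * l2 f) ^ 2 := by rw [ENNReal.tsum_mul_left, mul_pow, l2_sq]; ring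

end l2

/-- The modes `e^{i(ℓφ ± θ)}`. -/
abbrev Idx : Type := ℤ × ℤˣ

/-- The weight `(1 + ℓ² + j²)^{1/2}` at the modes `j = ±1`. -/
def bracket (i : Idx) : ℝ := Real.sqrt (2 + (i.1 : ℝ) ^ 2)

lemma bracket_sq (i : Idx) : bracket i ^ 2 = 2 + (i.1 : ℝ) ^ 2 :=
  Real.sq_sqrt (by positivity)

lemma bracket_pos (i : Idx) : 0 < bracket i := Real.sqrt_pos.2 (by positivity)

lemma one_le_bracket (i : Idx) : 1 ≤ bracket i := by
  have := bracket_sq i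
  have := bracket_pos i
  nlinarith [sq_nonneg (i.1 : ℝ)]

/-- `1 + |ℓ - m|`. -/
def gap (i j : Idx) : ℝ := 1 + |(i.1 : ℝ) - j.1|

lemma one_le_gap (i j : Idx) : 1 ≤ gap i j := by unfold gap; linarith [abs_nonneg ((i.1 : ℝ) - j.1)]

lemma gap_pos (i j : Idx) : 0 < gap i j := zero_lt_one.trans_le (one_le_gap i j)

lemma gap_comm (i j : Idx) : gap i j = gap j i := by unfold gap; rw [abs_sub_comm]

lemma bracket_le (i j : Idx) : bracket i ≤ 2 * gap i j * bracket j := by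
  have hg := gap_pos i j
  have hj := bracket_pos j
  refine abs_le_of_sq_le_sq' ?_ (by positivity) |>.2
  rw [mul_pow, bracket_sq, bracket_sq]
  set d := (i.1 : ℝ) - j.1 with hd
  have hi : (i.1 : ℝ) = j.1 + d := by rw [hd]; ring
  have h1 : d ^ 2 = |d| ^ 2 := (sq_abs d).symm
  have h2 : gap i j = 1 + |d| := rfl
  rw [h2, hi]
  have := abs_nonneg d
  nlinarith [sq_nonneg ((j.1 : ℝ) - d), sq_nonneg ((j.1 : ℝ) * |d|), mul_nonneg this (sq_nonneg (j.1 : ℝ))]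

/-- Peetre's inequality. Negative exponents are included, by exchanging `i` and `j`, because the
estimates below pass through `H^{-1}`. -/
lemma bracket_rpow_le (s : ℝ) (i j : Idx) :
    bracket i ^ s ≤ (2 * gap i j) ^ |s| * bracket j ^ s := by
  have hi := bracket_pos i
  have hj := bracket_pos j
  have hg := gap_pos i j
  rcases le_total 0 s with h | h
  · rw [abs_of_nonneg h, ← Real.mul_rpow (by positivity) hj.le]
    exact Real.rpow_le_rpow hi.le (bracket_le i j) h
  · rw [abs_of_nonpos h]
    have h1 := Real.rpow_le_rpow hj.le (bracket_le j i) (neg_nonneg.2 h)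
    rw [gap_comm, Real.mul_rpow (by positivity) hi.le, Real.rpow_neg hj.le, Real.rpow_neg hi.le] at h1
    have a1 : 0 < bracket i ^ s := Real.rpow_pos_of_pos hi s
    have a2 : 0 < bracket j ^ s := Real.rpow_pos_of_pos hj s
    rw [← div_eq_mul_inv, inv_eq_one_div, div_le_div_iff₀ a2 a1] at h1
    linarith

/-- The `H^s` norm of the sequence of Fourier coefficients of a function with modes `±1`. -/
def seqNorm (s : ℝ) (u : Idx → ℂ) : ℝ≥0∞ := l2 fun i => ENNReal.ofReal (bracket i ^ s) * ‖u i‖ₑ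

lemma seqNorm_add_le (s : ℝ) (u v : Idx → ℂ) :
    seqNorm s (fun i => u i + v i) ≤ seqNorm s u + seqNorm s v := by
  refine (l2_mono fun i => ?_).trans (l2_add_le _ _)
  rw [← mul_add]
  gcongr
  exact enorm_add_le _ _

lemma seqNorm_const_mul (s : ℝ) (c : ℂ) (u : Idx → ℂ) :
    seqNorm s (fun i => c * u i) = ‖c‖ₑ * seqNorm s u := by
  rw [seqNorm, seqNorm, ← l2_const_mul]
  congr 1
  funext i
  rw [enorm_mul]
  ring

lemma seqNorm_mono_fun {s : ℝ} {u v : Idx → ℂ} (h : ∀ i, ‖u i‖ ≤ ‖v i‖) :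
    seqNorm s u ≤ seqNorm s v := by
  refine l2_mono fun i => ?_
  gcongr
  exact enorm_le_iff_norm_le.2 (h i)

lemma seqNorm_neg (s : ℝ) (u : Idx → ℂ) : seqNorm s (fun i => -u i) = seqNorm s u := by
  simp [seqNorm]

lemma seqNorm_sub_le (s : ℝ) (u v : Idx → ℂ) :
    seqNorm s (fun i => u i - v i) ≤ seqNorm s u + seqNorm s v := by
  simpa [sub_eq_add_neg, seqNorm_neg] using seqNorm_add_le s u (fun i => -v i)

lemma seqNorm_mono {s t : ℝ} (h : s ≤ t) (u : Idx → ℂ) : seqNorm s u ≤ seqNorm t u := by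
  refine l2_mono fun i => ?_
  gcongr
  exact one_le_bracket i

lemma seqNorm_zero (s : ℝ) : seqNorm s (fun _ => 0) = 0 := by
  simp [seqNorm, l2]

lemma eq_zero_of_seqNorm_eq_zero {s : ℝ} {u : Idx → ℂ} (h : seqNorm s u = 0) : u = 0 := by
  have h1 := l2_sq (fun i => ENNReal.ofReal (bracket i ^ s) * ‖u i‖ₑ)
  rw [← seqNorm, h] at h1
  have h2 := ENNReal.tsum_eq_zero.1 (h1.symm.trans (zero_pow two_ne_zero))
  funext i
  have := h2 i
  have hp := Real.rpow_pos_of_pos (bracket_pos i) s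
  simpa [hp.not_ge] using this

/-- Rapid off-diagonal decay of an infinite matrix. -/
def KernelBound (c : ℕ → ℝ≥0) (a : Idx → Idx → ℂ) : Prop :=
  ∀ k i j, ‖a i j‖ ≤ c k * (gap i j ^ k)⁻¹

/-- The order of decay needed to act on `H^s`. -/
def decayOrder (s : ℝ) : ℕ := ⌈|s|⌉₊ + 2

lemma summable_inv_one_add_abs_sq : Summable fun d : ℤ => ((1 + |(d : ℝ)|) ^ 2)⁻¹ := by
  have h : Summable fun d : ℤ => 2 * (1 / (1 + (d : ℝ) ^ 2) : ℝ) := by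
    apply Summable.mul_left
    have h1 : Summable fun n : ℕ => (1 / (1 + (n : ℝ) ^ 2) : ℝ) := by
      refine Summable.of_nonneg_of_le (fun n => by positivity) (fun n => ?_)
        ((summable_nat_add_iff 1).2 (Real.summable_one_div_nat_pow.2 one_lt_two) |>.mul_left 2)
      rw [mul_one_div, div_le_div_iff₀ (by positivity) (by positivity)]
      push_cast
      nlinarith [sq_nonneg ((n : ℝ) - 1)]
    exact Summable.of_nat_of_neg (by simpa using h1) (by simpa using h1)
  refine Summable.of_nonneg_of_le (fun d => by positivity) (fun d => ?_) h
  rw [mul_one_div, inv_eq_one_div, div_le_div_iff₀ (by positivity) (by positivity)]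
  nlinarith [sq_abs (d : ℝ), abs_nonneg (d : ℝ)]

/-- `∑_j (1 + |ℓ - m|)⁻²`. -/
def gapSum : ℝ≥0 := 2 * (∑' d : ℤ, ((1 + |(d : ℝ)|) ^ 2)⁻¹).toNNReal

lemma tsum_gap (i : Idx) : ∑' j, ENNReal.ofReal ((gap i j ^ 2)⁻¹) ≤ gapSum := by
  rw [ENNReal.tsum_prod (f := fun a b => ENNReal.ofReal ((gap i (a, b) ^ 2)⁻¹)),
    ENNReal.tsum_comm, tsum_fintype]
  have h : ∀ b : ℤˣ, ∑' a : ℤ, ENNReal.ofReal ((gap i (a, b) ^ 2)⁻¹) =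
      ((∑' d : ℤ, ((1 + |(d : ℝ)|) ^ 2)⁻¹).toNNReal : ℝ≥0∞) := by
    intro b
    rw [← ENNReal.ofReal, ENNReal.ofReal_tsum_of_nonneg (fun _ => by positivity)
      summable_inv_one_add_abs_sq, ← (Equiv.subLeft i.1).tsum_eq]
    simp [gap]
  simp only [h, Finset.sum_const, gapSum]
  simp

/-- The constant of the Schur test on `H^s`. -/
def schurConst (s : ℝ) : ℝ≥0 := (2 : ℝ≥0) ^ |s| * gapSum

/-- Action of an infinite matrix on a sequence. -/
def kmul (a : Idx → Idx → ℂ) (u : Idx → ℂ) (i : Idx) : ℂ := ∑' j, a i j * u j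

variable {c : ℕ → ℝ≥0} {a : Idx → Idx → ℂ}

/-- Moving the weight across the kernel costs `gap ^ |s|`; the decay pays for it and leaves the
summable kernel `gap⁻²`, to which the Schur test applies. The absolute values stand inside the sum
so that the bound also yields convergence of the rows. -/
lemma KernelBound.l2_le (ha : KernelBound c a) (s : ℝ) (u : Idx → ℂ) :
    l2 (fun i => ENNReal.ofReal (bracket i ^ s) * ∑' j, ‖a i j‖ₑ * ‖u j‖ₑ) ≤
      c (decayOrder s) * schurConst s * seqNorm s u := by
  set C : ℝ≥0∞ := c (decayOrder s) * schurConst s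
  set k : Idx → Idx → ℝ≥0∞ := fun i j =>
    (c (decayOrder s) * (2 : ℝ≥0) ^ |s| : ℝ≥0) * ENNReal.ofReal ((gap i j ^ 2)⁻¹)
  have hk : ∀ i, ∑' j, k i j ≤ C := by
    intro i
    simp only [k, ENNReal.tsum_mul_left]
    refine (mul_le_mul_right (tsum_gap i) _).trans (le_of_eq ?_)
    simp only [C, schurConst]
    push_cast
    ring
  have hk' : ∀ j, ∑' i, k i j ≤ C := by
    intro j
    have : ∀ i, k i j = k j i := fun i => by simp only [k, gap_comm]
    simp only [this, hk]
  refine (l2_mono fun i => ?_).trans (l2_tsum_le hk hk' _)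
  rw [← ENNReal.tsum_mul_left]
  refine ENNReal.tsum_le_tsum fun j => ?_
  have hreal : bracket i ^ s * ‖a i j‖ ≤
      (c (decayOrder s) * (2 : ℝ≥0) ^ |s| : ℝ≥0) * (gap i j ^ 2)⁻¹ * bracket j ^ s := by
    have hg := gap_pos i j
    have hb := Real.rpow_pos_of_pos (bracket_pos j) s
    have h1 := ha (decayOrder s) i j
    have h2 := bracket_rpow_le s i j
    have h3 : gap i j ^ |s| * gap i j ^ 2 ≤ gap i j ^ (decayOrder s) := by
      rw [decayOrder, pow_add]
      gcongr
      rw [← Real.rpow_natCast]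
      exact Real.rpow_le_rpow_of_exponent_le (one_le_gap i j) (Nat.le_ceil _)
    have h4 : gap i j ^ |s| * (gap i j ^ (decayOrder s))⁻¹ ≤ (gap i j ^ 2)⁻¹ := by
      rw [← div_eq_mul_inv, inv_eq_one_div, div_le_div_iff₀ (by positivity) (by positivity)]
      linarith
    calc bracket i ^ s * ‖a i j‖
        ≤ ((2 * gap i j) ^ |s| * bracket j ^ s) *
            (c (decayOrder s) * (gap i j ^ (decayOrder s))⁻¹) := by gcongr
      _ = c (decayOrder s) * 2 ^ |s| * (gap i j ^ |s| * (gap i j ^ (decayOrder s))⁻¹)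
            * bracket j ^ s := by
          rw [Real.mul_rpow (by norm_num) hg.le]; ring
      _ ≤ c (decayOrder s) * 2 ^ |s| * (gap i j ^ 2)⁻¹ * bracket j ^ s := by gcongr
      _ = _ := by push_cast; ring
  have h := ENNReal.ofReal_le_ofReal hreal
  have hi := (Real.rpow_pos_of_pos (bracket_pos i) s).le
  rw [ENNReal.ofReal_mul hi, ofReal_norm, ENNReal.ofReal_mul (by positivity),
    ENNReal.ofReal_mul (by positivity), ENNReal.ofReal_coe_nnreal] at h
  calc _ = ENNReal.ofReal (bracket i ^ s) * ‖a i j‖ₑ * ‖u j‖ₑ := by ring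
    _ ≤ _ * ‖u j‖ₑ := mul_le_mul_left h _
    _ = _ := by ring

lemma KernelBound.seqNorm_kmul_le (ha : KernelBound c a) (s : ℝ) (u : Idx → ℂ) :
    seqNorm s (kmul a u) ≤ c (decayOrder s) * schurConst s * seqNorm s u := by
  refine (l2_mono fun i => ?_).trans (ha.l2_le s u)
  gcongr
  refine enorm_tsum_le_tsum_enorm.trans ?_
  simp [enorm_mul]

lemma l2_apply_le {ι : Type*} (f : ι → ℝ≥0∞) (i : ι) : f i ≤ l2 f := by
  rw [← ENNReal.pow_le_pow_left_iff two_ne_zero, l2_sq]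
  exact ENNReal.le_tsum i

/-- `kmul` is a `tsum`, equal to 0 when the row is not summable, so its additivity has to be bought
with this convergence. -/
lemma KernelBound.summable (ha : KernelBound c a) {s : ℝ} {u : Idx → ℂ} (hu : seqNorm s u ≠ ∞)
    (i : Idx) : Summable fun j => a i j * u j := by
  have h := (l2_apply_le _ i).trans (ha.l2_le s u)
  have hb := Real.rpow_pos_of_pos (bracket_pos i) s
  have h1 : ∑' j, ‖a i j‖ₑ * ‖u j‖ₑ ≠ ∞ := by
    intro h2
    rw [h2, ENNReal.mul_top (by simpa using hb)] at h
    exact ENNReal.mul_ne_top (ENNReal.mul_ne_top ENNReal.coe_ne_top ENNReal.coe_ne_top) hu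
      (top_le_iff.1 h)
  have h2 : Summable fun j => ‖a i j * u j‖₊ := by
    rw [← ENNReal.tsum_coe_ne_top_iff_summable]
    simpa [enorm] using h1
  exact Summable.of_norm (NNReal.summable_coe.2 h2)

/-! ### The operator `∂_φ - A` on sequences -/

/-- Coefficients of `(∂_φ + 1)⁻¹ u`. -/
def smooth (u : Idx → ℂ) (i : Idx) : ℂ := u i / (1 + Complex.I * i.1)

/-- Coefficients of `∂_φ u - A u`. -/
def transport (a : Idx → Idx → ℂ) (u : Idx → ℂ) (i : Idx) : ℂ := Complex.I * i.1 * u i - kmul a u i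

lemma norm_one_add_I_mul (i : Idx) : bracket i ≤ 2 * ‖(1 + Complex.I * i.1 : ℂ)‖ := by
  refine abs_le_of_sq_le_sq' ?_ (by positivity) |>.2
  have h : ‖(1 + Complex.I * i.1 : ℂ)‖ ^ 2 = 1 + (i.1 : ℝ) ^ 2 := by
    rw [← Complex.normSq_eq_norm_sq, Complex.normSq_apply]
    simp [sq]
  rw [mul_pow, h, bracket_sq]
  nlinarith [sq_nonneg (i.1 : ℝ)]

lemma one_add_I_mul_ne_zero (i : Idx) : (1 + Complex.I * i.1 : ℂ) ≠ 0 := by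
  intro h
  have := norm_one_add_I_mul i
  rw [h, norm_zero] at this
  linarith [bracket_pos i]

lemma seqNorm_smooth_le (s : ℝ) (u : Idx → ℂ) : seqNorm (s + 1) (smooth u) ≤ 2 * seqNorm s u := by
  rw [seqNorm, seqNorm, ← l2_const_mul]
  refine l2_mono fun i => ?_
  have h : bracket i ^ (s + 1) * ‖smooth u i‖ ≤ 2 * (bracket i ^ s * ‖u i‖) := by
    have h0 := norm_pos_iff.2 (one_add_I_mul_ne_zero i)
    rw [smooth, norm_div, Real.rpow_add_one (bracket_pos i).ne', mul_div_assoc', div_le_iff₀ h0]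
    have := norm_one_add_I_mul i
    have hb := (Real.rpow_pos_of_pos (bracket_pos i) s).le
    calc _ = bracket i ^ s * ‖u i‖ * bracket i := by ring
      _ ≤ bracket i ^ s * ‖u i‖ * (2 * ‖(1 + Complex.I * i.1 : ℂ)‖) := by gcongr
      _ = _ := by ring
  have h := ENNReal.ofReal_le_ofReal h
  have hb := fun t => (Real.rpow_pos_of_pos (bracket_pos i) t).le
  rwa [ENNReal.ofReal_mul (hb _), ENNReal.ofReal_mul (by norm_num), ENNReal.ofReal_mul (hb _),
    ofReal_norm, ofReal_norm, ENNReal.ofReal_ofNat] at h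

/-- The identity `(∂_φ + 1)u = (∂_φ - A)u + (u + Au)`: the unknown is recovered from its source and
from itself, with one derivative gained. -/
lemma smooth_transport (a : Idx → Idx → ℂ) (u : Idx → ℂ) :
    smooth (fun i => transport a u i + (u i + kmul a u i)) = u := by
  funext i
  rw [smooth, div_eq_iff (one_add_I_mul_ne_zero i), transport]
  ring

/-- So `smooth g` solves the equation with source `g` up to an error one derivative smoother than
`g`: it is a parametrix. -/
lemma transport_smooth (a : Idx → Idx → ℂ) (g : Idx → ℂ) (i : Idx) :
    transport a (smooth g) i = g i - (smooth g i + kmul a (smooth g) i) := by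
  have h : smooth g i * (1 + Complex.I * i.1) = g i := div_mul_cancel₀ _ (one_add_I_mul_ne_zero i)
  rw [transport]
  linear_combination h

lemma KernelBound.transport_add (ha : KernelBound c a) {s : ℝ} {u v : Idx → ℂ}
    (hu : seqNorm s u ≠ ∞) (hv : seqNorm s v ≠ ∞) (i : Idx) :
    transport a (fun j => u j + v j) i = transport a u i + transport a v i := by
  simp only [transport, kmul, mul_add, (ha.summable hu i).tsum_add (ha.summable hv i)]
  ring

lemma transport_const_mul (k : ℂ) (u : Idx → ℂ) (i : Idx) :
    transport a (fun j => k * u j) i = k * transport a u i := by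
  simp only [transport, kmul, mul_left_comm _ k, tsum_mul_left]
  ring

lemma KernelBound.transport_sub (ha : KernelBound c a) {s : ℝ} {u v : Idx → ℂ}
    (hu : seqNorm s u ≠ ∞) (hv : seqNorm s v ≠ ∞) (i : Idx) :
    transport a (fun j => u j - v j) i = transport a u i - transport a v i := by
  simp only [transport, kmul, mul_sub, (ha.summable hu i).tsum_sub (ha.summable hv i)]
  ring

lemma KernelBound.seqNorm_add_kmul_le (ha : KernelBound c a) (s : ℝ) (u : Idx → ℂ) :
    seqNorm s (fun i => u i + kmul a u i) ≤
      (1 + c (decayOrder s) * schurConst s : ℝ≥0) * seqNorm s u := by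
  refine (seqNorm_add_le _ _ _).trans ?_
  push_cast
  rw [add_mul, one_mul]
  gcongr
  exact ha.seqNorm_kmul_le s u

lemma KernelBound.seqNorm_transport_le (ha : KernelBound c a) (s : ℝ) (u : Idx → ℂ) :
    seqNorm s (transport a u) ≤ (1 + c (decayOrder s) * schurConst s : ℝ≥0) * seqNorm (s + 1) u := by
  refine (seqNorm_sub_le s (fun i => Complex.I * i.1 * u i) (kmul a u)).trans ?_
  push_cast
  rw [add_mul, one_mul]
  refine add_le_add (l2_mono fun i => ?_) ((ha.seqNorm_kmul_le s u).trans ?_)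
  · have h : bracket i ^ s * ‖Complex.I * i.1 * u i‖ ≤ bracket i ^ (s + 1) * ‖u i‖ := by
      have hb := (Real.rpow_pos_of_pos (bracket_pos i) s).le
      have h1 : |(i.1 : ℝ)| ≤ bracket i := Real.abs_le_sqrt (by linarith)
      rw [Real.rpow_add_one (bracket_pos i).ne', norm_mul, norm_mul, Complex.norm_I, one_mul,
        Complex.norm_intCast, mul_assoc]
      gcongr
    have h := ENNReal.ofReal_le_ofReal h
    have hb := fun t => (Real.rpow_pos_of_pos (bracket_pos i) t).le
    rwa [ENNReal.ofReal_mul (hb _), ENNReal.ofReal_mul (hb _), ofReal_norm, ofReal_norm] at h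
  · gcongr
    exact seqNorm_mono (by linarith) u

/-- Solutions of `∂_φ u - A u = g` gain one derivative. -/
lemma exists_seqNorm_le_of_transport (c : ℕ → ℝ≥0) (s : ℝ) :
    ∃ C : ℝ≥0, ∀ a, KernelBound c a → ∀ u,
      seqNorm s u ≤ C * (seqNorm 0 u + seqNorm (s - 1) (transport a u)) := by
  -- Bootstrap on an integer above `s`: each step lowers `s` by one, and for `s ≤ 0` the bound is
  -- the monotonicity of the norms.
  obtain ⟨n, hn⟩ := exists_nat_ge s
  induction n generalizing s with
  | zero =>
    refine ⟨1, fun a _ u => ?_⟩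
    rw [ENNReal.coe_one, one_mul]
    exact (seqNorm_mono (by simpa using hn) u).trans le_self_add
  | succ n ih =>
    obtain ⟨C, hC⟩ := ih (s - 1) (by push_cast at hn; linarith)
    set D : ℝ≥0 := 1 + c (decayOrder (s - 1)) * schurConst (s - 1)
    refine ⟨2 * (1 + D * C), fun a ha u => ?_⟩
    have h1 : seqNorm s u ≤ 2 * seqNorm (s - 1) (fun i => transport a u i + (u i + kmul a u i)) := by
      have := seqNorm_smooth_le (s - 1) (fun i => transport a u i + (u i + kmul a u i))
      rwa [smooth_transport, sub_add_cancel] at this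
    set g := seqNorm (s - 1) (transport a u)
    calc seqNorm s u ≤ 2 * (g + D * seqNorm (s - 1) u) := by
          refine h1.trans ?_
          gcongr
          exact (seqNorm_add_le _ _ _).trans (by gcongr; exact ha.seqNorm_add_kmul_le _ u)
      _ ≤ 2 * (g + D * (C * (seqNorm 0 u + g))) := by
          gcongr
          refine (hC a ha u).trans ?_
          gcongr
          exact seqNorm_mono (by linarith) _
      _ ≤ 2 * ((seqNorm 0 u + g) + D * (C * (seqNorm 0 u + g))) := by
          gcongr
          exact le_add_self
      _ = _ := by push_cast; ring

end

/-! ### A priori estimates: extension to all of `ℓ²` and diagonal perturbations -/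

section

open scoped ENNReal NNReal

variable {c : ℕ → ℝ≥0} {a : Idx → Idx → ℂ}

lemma seqNorm_sub_indicator_tendsto {s : ℝ} {v : Idx → ℂ} (hv : seqNorm s v ≠ ∞) :
    Filter.Tendsto (fun F : Finset Idx => seqNorm s (fun i => v i - (F : Set Idx).indicator v i))
      Filter.atTop (nhds 0) := by
  set f : Idx → ℝ≥0∞ := fun i => (ENNReal.ofReal (bracket i ^ s) * ‖v i‖ₑ) ^ 2
  have hf : ∑' i, f i ≠ ∞ := by
    rw [← l2_sq]
    exact ENNReal.pow_ne_top hv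
  have h := (ENNReal.tendsto_tsum_compl_atTop_zero hf).ennrpow_const (1 / 2)
  rw [ENNReal.zero_rpow_of_pos (by norm_num)] at h
  refine h.congr fun F => ?_
  rw [seqNorm, l2]
  congr 1
  have : (∑' b : { x // x ∉ F }, f b) = ∑' i, ((F : Set Idx)ᶜ).indicator f i :=
    tsum_subtype ((F : Set Idx)ᶜ) f
  rw [this]
  congr 1
  funext i
  by_cases hi : i ∈ F <;> simp [hi, f]

/-- An a priori estimate on finitely supported sequences extends to `H²`. -/
lemma KernelBound.apriori_extend (ha : KernelBound c a) {δ C₀ : ℝ≥0}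
    (hap : ∀ v : Idx → ℂ, v.support.Finite →
      δ * seqNorm 0 v ≤ C₀ * seqNorm 1 (transport a v))
    {v : Idx → ℂ} (hv : seqNorm 2 v ≠ ∞) : δ * seqNorm 0 v ≤ C₀ * seqNorm 1 (transport a v) := by
  set D : ℝ≥0 := 1 + c (decayOrder 1) * schurConst 1
  -- Apply the hypothesis to the truncation of `v` to `F`. The tail is measured in `H²` because
  -- `transport` maps `H²` to `H¹`, and it vanishes in the limit over `F`.
  have key : ∀ F : Finset Idx, δ * seqNorm 0 v ≤ C₀ * seqNorm 1 (transport a v) +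
      (C₀ * D + δ : ℝ≥0) * seqNorm 2 (fun i => v i - (F : Set Idx).indicator v i) := by
    intro F
    set vF := (F : Set Idx).indicator v
    set r := fun i => v i - vF i
    have hr : seqNorm 2 r ≠ ∞ := by
      refine ne_top_of_le_ne_top hv (seqNorm_mono_fun fun i => ?_)
      by_cases hi : i ∈ F <;> simp [hi, r, vF]
    have h1 : seqNorm 0 v ≤ seqNorm 0 vF + seqNorm 0 r := by
      simpa [r] using seqNorm_add_le 0 vF r
    have h2 := hap vF (F.finite_toSet.subset Set.support_indicator_subset)
    have h3 : seqNorm 1 (transport a vF) ≤ seqNorm 1 (transport a v) + D * seqNorm 2 r := by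
      have : transport a vF = fun i => transport a v i - transport a r i := by
        funext i
        rw [← ha.transport_sub hv hr]
        simp [r]
      rw [this]
      refine (seqNorm_sub_le _ _ _).trans ?_
      gcongr
      have := ha.seqNorm_transport_le 1 r
      norm_num at this
      simpa [D] using this
    calc δ * seqNorm 0 v ≤ δ * (seqNorm 0 vF + seqNorm 0 r) := by gcongr
      _ ≤ C₀ * seqNorm 1 (transport a vF) + δ * seqNorm 2 r := by
          rw [mul_add]
          gcongr
          exact seqNorm_mono (by norm_num) _
      _ ≤ C₀ * (seqNorm 1 (transport a v) + D * seqNorm 2 r) + δ * seqNorm 2 r := by gcongr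
      _ = _ := by push_cast; ring
  have hlim := (seqNorm_sub_indicator_tendsto hv)
  have hlim2 := (ENNReal.Tendsto.const_mul (a := ((C₀ * D + δ : ℝ≥0) : ℝ≥0∞)) hlim
    (Or.inr ENNReal.coe_ne_top)).const_add (C₀ * seqNorm 1 (transport a v))
  rw [mul_zero, add_zero] at hlim2
  exact ge_of_tendsto' hlim2 key

lemma seqNorm_transport_ne_top (ha : KernelBound c a) {u : Idx → ℂ} (hu : seqNorm 0 u ≠ ∞) :
    seqNorm (-1) (transport a u) ≠ ∞ := by
  refine ne_top_of_le_ne_top ?_ (ha.seqNorm_transport_le (-1) u)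
  norm_num
  exact ENNReal.mul_ne_top (by simp [ENNReal.mul_eq_top]) hu

/-- The a priori estimate, improved by two derivatives. -/
lemma exists_apriori (c : ℕ → ℝ≥0) (C₀ : ℝ≥0) : ∃ C : ℝ≥0, ∀ (a : Idx → Idx → ℂ) (δ : ℝ≥0),
    δ ≤ 1 → KernelBound c a →
    (∀ v : Idx → ℂ, v.support.Finite → δ * seqNorm 0 v ≤ C₀ * seqNorm 1 (transport a v)) →
    ∀ u, seqNorm 0 u ≠ ∞ → δ * seqNorm 0 u ≤ C * seqNorm (-1) (transport a u) := by
  obtain ⟨C₂, hC₂⟩ := exists_seqNorm_le_of_transport c 2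
  set D₀ : ℝ≥0 := 1 + c (decayOrder 0) * schurConst 0
  set D₁ : ℝ≥0 := 1 + c (decayOrder 1) * schurConst 1
  refine ⟨C₀ * (D₁ * (2 * (D₀ * 2))) + 2 + 2 * (D₀ * 2), fun a δ hδ ha hap u hu => ?_⟩
  set g := transport a u
  have hg : seqNorm (-1) g ≠ ∞ := seqNorm_transport_ne_top ha hu
  -- Two parametrix steps: `u - Γ₁` has source `g₁` in `H⁰`, and `v = u - Γ₁ - Γ₂` has source `g₂`
  -- in `H¹`, which is regular enough for the hypothesis. The corrections are controlled by `g` in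
  -- `H⁻¹`.
  set Γ₁ := smooth g
  set g₁ : Idx → ℂ := fun i => Γ₁ i + kmul a Γ₁ i
  set Γ₂ := smooth g₁
  set g₂ : Idx → ℂ := fun i => Γ₂ i + kmul a Γ₂ i
  have n1 : seqNorm 0 Γ₁ ≤ 2 * seqNorm (-1) g := by simpa using seqNorm_smooth_le (-1) g
  have n2 : seqNorm 0 g₁ ≤ D₀ * (2 * seqNorm (-1) g) :=
    (ha.seqNorm_add_kmul_le 0 Γ₁).trans (by gcongr)
  have n3 : seqNorm 1 Γ₂ ≤ 2 * (D₀ * (2 * seqNorm (-1) g)) := by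
    have := seqNorm_smooth_le 0 g₁
    rw [zero_add] at this
    exact this.trans (by gcongr)
  have n4 : seqNorm 1 g₂ ≤ D₁ * (2 * (D₀ * (2 * seqNorm (-1) g))) :=
    (ha.seqNorm_add_kmul_le 1 Γ₂).trans (by gcongr)
  have n3' : seqNorm 0 Γ₂ ≤ 2 * (D₀ * (2 * seqNorm (-1) g)) :=
    (seqNorm_mono zero_le_one _).trans n3
  have t2 : (2 : ℝ≥0∞) * seqNorm (-1) g ≠ ∞ := ENNReal.mul_ne_top (by simp) hg
  have t3 : (2 : ℝ≥0∞) * (D₀ * (2 * seqNorm (-1) g)) ≠ ∞ :=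
    ENNReal.mul_ne_top (by simp) (ENNReal.mul_ne_top ENNReal.coe_ne_top t2)
  have f1 : seqNorm 0 Γ₁ ≠ ∞ := ne_top_of_le_ne_top t2 n1
  have f2 : seqNorm 0 Γ₂ ≠ ∞ := ne_top_of_le_ne_top t3 n3'
  have f12 : seqNorm 0 (fun i => Γ₁ i + Γ₂ i) ≠ ∞ :=
    ne_top_of_le_ne_top (ENNReal.add_ne_top.2 ⟨f1, f2⟩) (seqNorm_add_le _ _ _)
  set v : Idx → ℂ := fun i => u i - (Γ₁ i + Γ₂ i)
  have hv : seqNorm 0 v ≠ ∞ :=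
    ne_top_of_le_ne_top (ENNReal.add_ne_top.2 ⟨hu, f12⟩) (seqNorm_sub_le _ _ _)
  have hvg : transport a v = g₂ := by
    funext i
    rw [ha.transport_sub hu f12, ha.transport_add f1 f2, transport_smooth, transport_smooth]
    simp only [g₂, g₁, Γ₁, Γ₂, g]
    ring
  -- The estimate was extended from finite sequences to `H²` only; elliptic regularity places `v`
  -- there.
  have hv2 : seqNorm 2 v ≠ ∞ := by
    refine ne_top_of_le_ne_top ?_ (hC₂ a ha v)
    rw [hvg]
    refine ENNReal.mul_ne_top ENNReal.coe_ne_top (ENNReal.add_ne_top.2 ⟨hv, ?_⟩)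
    norm_num
    exact ne_top_of_le_ne_top (ENNReal.mul_ne_top ENNReal.coe_ne_top t3) n4
  have e1 := ha.apriori_extend hap hv2
  rw [hvg] at e1
  have e2 : seqNorm 0 u ≤ seqNorm 0 v + (seqNorm 0 Γ₁ + seqNorm 0 Γ₂) := by
    have := seqNorm_add_le 0 v (fun i => Γ₁ i + Γ₂ i)
    simp only [v, sub_add_cancel] at this
    exact this.trans (by gcongr; exact seqNorm_add_le _ _ _)
  have hδ' : (δ : ℝ≥0∞) ≤ 1 := by exact_mod_cast hδ
  calc δ * seqNorm 0 u ≤ δ * (seqNorm 0 v + (seqNorm 0 Γ₁ + seqNorm 0 Γ₂)) := by gcongr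
    _ ≤ C₀ * seqNorm 1 g₂ + 1 * (seqNorm 0 Γ₁ + seqNorm 0 Γ₂) := by
        rw [mul_add]; gcongr
    _ ≤ C₀ * (D₁ * (2 * (D₀ * (2 * seqNorm (-1) g)))) +
        1 * (2 * seqNorm (-1) g + 2 * (D₀ * (2 * seqNorm (-1) g))) := by gcongr
    _ = _ := by push_cast; ring

/-- Perturbation of a matrix by a diagonal one. -/
def addDiag (a : Idx → Idx → ℂ) (μ : Idx → ℂ) (i j : Idx) : ℂ := a i j + if j = i then μ i else 0

lemma KernelBound.add {c' : ℕ → ℝ≥0} {b : Idx → Idx → ℂ} (ha : KernelBound c a)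
    (hb : KernelBound c' b) : KernelBound (fun k => c k + c' k) (fun i j => a i j + b i j) := by
  intro k i j
  refine (norm_add_le _ _).trans ((add_le_add (ha k i j) (hb k i j)).trans (le_of_eq ?_))
  push_cast
  ring

lemma kernelBound_diag {μ : Idx → ℂ} {m : ℝ≥0} (hμ : ∀ i, ‖μ i‖ ≤ m) :
    KernelBound (fun _ => m) (fun i j => if j = i then μ i else 0) := by
  intro k i j
  beta_reduce
  split_ifs with h
  · subst h
    simpa [gap] using hμ j
  · have := gap_pos i j
    rw [norm_zero]
    positivity

lemma KernelBound.kmul_addDiag (ha : KernelBound c a) {s : ℝ} {u : Idx → ℂ} (hu : seqNorm s u ≠ ∞)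
    (μ : Idx → ℂ) (i : Idx) : kmul (addDiag a μ) u i = kmul a u i + μ i * u i := by
  have h : HasSum (fun j => (if j = i then μ i else 0) * u j) (μ i * u i) := by
    convert hasSum_ite_eq i (μ i * u i) using 2 with j
    split_ifs with h <;> simp [h]
  simp only [kmul, addDiag, add_mul]
  rw [(ha.summable hu i).tsum_add h.summable, h.tsum_eq]

lemma KernelBound.transport_addDiag (ha : KernelBound c a) {s : ℝ} {u : Idx → ℂ}
    (hu : seqNorm s u ≠ ∞) (μ : Idx → ℂ) (i : Idx) :
    transport (addDiag a μ) u i = transport a u i - μ i * u i := by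
  rw [transport, ha.kmul_addDiag hu, transport]
  ring

/-- The a priori estimate is stable under small diagonal perturbations. -/
lemma KernelBound.apriori_addDiag (ha : KernelBound c a) {C δ m : ℝ≥0}
    (hap : ∀ u, seqNorm 0 u ≠ ∞ → δ * seqNorm 0 u ≤ C * seqNorm (-1) (transport a u))
    {μ : Idx → ℂ} (hμ : ∀ i, ‖μ i‖ ≤ m) (hm : 2 * (C * m) ≤ δ) {u : Idx → ℂ}
    (hu : seqNorm 0 u ≠ ∞) :
    δ * seqNorm 0 u ≤ 2 * C * seqNorm (-1) (transport (addDiag a μ) u) := by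
  set G := seqNorm (-1) (transport (addDiag a μ) u)
  have h1 : seqNorm (-1) (transport a u) ≤ G + m * seqNorm 0 u := by
    have : transport a u = fun i => transport (addDiag a μ) u i + μ i * u i := by
      funext i
      rw [ha.transport_addDiag hu]
      ring
    rw [this]
    refine (seqNorm_add_le _ _ _).trans ?_
    gcongr
    calc seqNorm (-1) (fun i => μ i * u i) ≤ seqNorm 0 (fun i => μ i * u i) :=
          seqNorm_mono (by norm_num) _
      _ ≤ seqNorm 0 (fun i => ((m : ℝ) : ℂ) * u i) := by
          refine seqNorm_mono_fun fun i => ?_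
          rw [norm_mul, norm_mul]
          gcongr
          simpa using hμ i
      _ = m * seqNorm 0 u := by
          rw [seqNorm_const_mul]
          congr 1
          rw [← ofReal_norm]
          simp
  have h2 := (hap u hu).trans (mul_le_mul_right h1 (C : ℝ≥0∞))
  have hm' : 2 * ((C : ℝ≥0∞) * m) ≤ δ := by exact_mod_cast hm
  -- The perturbation eats at most half of the doubled left side. Cancelling the common term in
  -- `ℝ≥0∞` is legitimate since `u` has finite norm.
  have h3 : δ * seqNorm 0 u + δ * seqNorm 0 u ≤ 2 * C * G + δ * seqNorm 0 u := by
    calc _ = 2 * (δ * seqNorm 0 u) := by ring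
      _ ≤ 2 * (C * (G + m * seqNorm 0 u)) := by gcongr
      _ = 2 * C * G + 2 * (C * m) * seqNorm 0 u := by ring
      _ ≤ _ := by gcongr
  exact (ENNReal.add_le_add_iff_right (ENNReal.mul_ne_top ENNReal.coe_ne_top hu)).1 h3

/-! ### Solvability -/

/-- Square summable sequences. -/
abbrev Seq2 : Type := lp (fun _ : Idx => ℂ) 2

lemma seqNorm_zero_sq (u : Idx → ℂ) : seqNorm 0 u ^ 2 = ∑' i, ‖u i‖ₑ ^ 2 := by
  rw [seqNorm, l2_sq]
  simp

lemma memℓp_of_seqNorm {u : Idx → ℂ} (h : seqNorm 0 u ≠ ∞) : Memℓp u 2 := by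
  rw [memℓp_gen_iff (by norm_num)]
  have h1 : ∑' i, ‖u i‖ₑ ^ 2 ≠ ∞ := by
    rw [← seqNorm_zero_sq]
    exact ENNReal.pow_ne_top h
  have h2 : Summable fun i => ‖u i‖₊ ^ 2 := by
    rw [← ENNReal.tsum_coe_ne_top_iff_summable]
    simpa [enorm] using h1
  have h3 := NNReal.summable_coe.2 h2
  simpa using h3

lemma seqNorm_coe (u : Seq2) : seqNorm 0 u = ENNReal.ofReal ‖u‖ := by
  have h : seqNorm 0 u ^ 2 = ENNReal.ofReal ‖u‖ ^ 2 := by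
    rw [seqNorm_zero_sq, ← ENNReal.ofReal_pow (norm_nonneg _)]
    have h1 := lp.hasSum_norm (p := 2) (by norm_num) u
    simp only [ENNReal.toReal_ofNat, Real.rpow_ofNat] at h1
    rw [← h1.tsum_eq, ENNReal.ofReal_tsum_of_nonneg (fun _ => by positivity) h1.summable]
    congr 1
    funext i
    rw [ENNReal.ofReal_pow (norm_nonneg _), ofReal_norm]
  exact (ENNReal.pow_right_strictMono two_ne_zero).injective h

lemma seqNorm_coe_ne_top (u : Seq2) : seqNorm 0 u ≠ ∞ := by
  rw [seqNorm_coe]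
  exact ENNReal.ofReal_ne_top

/-- A linear map on sequences which is bounded in `ℓ²`. -/
def seqCLM (f : (Idx → ℂ) → Idx → ℂ) (D : ℝ≥0) (hf : ∀ u, seqNorm 0 (f u) ≤ D * seqNorm 0 u)
    (hadd : ∀ u v : Seq2, f (⇑u + ⇑v) = f u + f v) (hsmul : ∀ (k : ℂ) (u : Seq2), f (k • ⇑u) = k • f u) :
    Seq2 →L[ℂ] Seq2 :=
  LinearMap.mkContinuous
    { toFun := fun u => ⟨f u, memℓp_of_seqNorm (ne_top_of_le_ne_top
        (ENNReal.mul_ne_top ENNReal.coe_ne_top (seqNorm_coe_ne_top u)) (hf u))⟩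
      map_add' := fun u v => Subtype.ext (hadd u v)
      map_smul' := fun k u => Subtype.ext (hsmul k u) } D (fun u => by
        have h := hf u
        rw [seqNorm_coe, ← ENNReal.ofReal_coe_nnreal, ← ENNReal.ofReal_mul (by positivity)] at h
        refine (ENNReal.ofReal_le_ofReal_iff (by positivity)).1 (le_trans (le_of_eq ?_) h)
        rw [← seqNorm_coe]
        rfl)

/-- An infinite matrix with rapid off-diagonal decay, as an operator on `ℓ²`. -/
def KernelBound.clm (ha : KernelBound c a) : Seq2 →L[ℂ] Seq2 :=
  seqCLM (kmul a) (c (decayOrder 0) * schurConst 0)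
    (fun u => by simpa using ha.seqNorm_kmul_le 0 u)
    (fun u v => by
      funext i
      simp only [kmul, Pi.add_apply, mul_add, (ha.summable (seqNorm_coe_ne_top u) i).tsum_add
        (ha.summable (seqNorm_coe_ne_top v) i)])
    (fun k u => by
      funext i
      simp only [kmul, Pi.smul_apply, smul_eq_mul, mul_left_comm _ k, tsum_mul_left])

/-- `(∂_φ + 1)⁻¹`, as an operator on `ℓ²`. -/
def smoothCLM : Seq2 →L[ℂ] Seq2 :=
  seqCLM smooth 2
    (fun u => (seqNorm_mono zero_le_one _).trans (by simpa using seqNorm_smooth_le 0 u))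
    (fun u v => by funext i; simp [smooth, add_div])
    (fun k u => by funext i; simp [smooth, mul_div_assoc])

/-- The multiplier is at most `1/(N + 1)` off the finitely many modes with `|ℓ| ≤ N`, so the
operator is a norm limit of finite rank truncations. -/
lemma isCompactOperator_smoothCLM : IsCompactOperator smoothCLM := by
  set F : ℕ → Finset Idx := fun N => Finset.Icc (-(N : ℤ)) N ×ˢ Finset.univ
  set K : ℕ → Seq2 →L[ℂ] Seq2 := fun N => ∑ i ∈ F N,
    (lp.evalCLM ℂ (fun _ : Idx => ℂ) 2 i).smulRight (lp.single 2 i (1 + Complex.I * i.1 : ℂ)⁻¹)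
  have hK : ∀ N (u : Seq2) i, K N u i = if i ∈ F N then smooth u i else 0 := by
    intro N u i
    simp only [K, sum_apply, ContinuousLinearMap.smulRight_apply,
      lp.coeFn_sum, Finset.sum_apply, lp.coeFn_smul, Pi.smul_apply, lp.single_apply]
    simp [smooth, div_eq_mul_inv, Pi.single_apply]
    rfl
  refine isCompactOperator_of_tendsto (l := Filter.atTop) (F := K) ?_ ?_
  · rw [tendsto_iff_norm_sub_tendsto_zero]
    have hlim : Filter.Tendsto (fun N : ℕ => 1 / ((N : ℝ) + 1)) Filter.atTop (nhds 0) :=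
      tendsto_one_div_add_atTop_nhds_zero_nat
    refine squeeze_zero (fun _ => norm_nonneg _) (fun N => ?_) hlim
    refine ContinuousLinearMap.opNorm_le_bound _ (by positivity) fun u => ?_
    have h : seqNorm 0 (fun i => ((K N - smoothCLM) u : Seq2) i) ≤
        seqNorm 0 (fun i => ((1 / ((N : ℝ) + 1) : ℝ) : ℂ) * u i) := by
      refine seqNorm_mono_fun fun i => ?_
      have e : ((K N - smoothCLM) u : Seq2) i = K N u i - smooth u i := rfl
      rw [e, hK, norm_mul, Complex.norm_real, Real.norm_of_nonneg (by positivity)]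
      split_ifs with hi
      · simp only [sub_self, norm_zero]
        positivity
      · have h1 : (N : ℝ) + 1 ≤ |(i.1 : ℝ)| := by
          have : (N : ℤ) + 1 ≤ |i.1| := by
            by_contra hc
            refine hi (Finset.mem_product.2 ⟨Finset.mem_Icc.2 (abs_le.1 (by omega)), Finset.mem_univ _⟩)
          exact_mod_cast this
        have h2 : |(i.1 : ℝ)| ≤ ‖(1 + Complex.I * i.1 : ℂ)‖ := by
          simpa using Complex.abs_im_le_norm (1 + Complex.I * i.1 : ℂ)
        rw [zero_sub, norm_neg, smooth, norm_div, div_eq_inv_mul, one_div]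
        gcongr
        exact h1.trans h2
    rw [seqNorm_const_mul, seqNorm_coe, seqNorm_coe, ← ofReal_norm,
      ← ENNReal.ofReal_mul (norm_nonneg _), ENNReal.ofReal_le_ofReal_iff (by positivity),
      Complex.norm_real, Real.norm_of_nonneg (by positivity)] at h
    exact h
  · refine Filter.Eventually.of_forall fun N => ?_
    have : ∀ s : Finset Idx, IsCompactOperator (∑ i ∈ s,
        (lp.evalCLM ℂ (fun _ : Idx => ℂ) 2 i).smulRight
          (lp.single 2 i (1 + Complex.I * i.1 : ℂ)⁻¹) : Seq2 →L[ℂ] Seq2) := by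
      intro s
      induction s using Finset.induction_on with
      | empty => simpa using isCompactOperator_zero
      | insert i s hi ih =>
        rw [Finset.sum_insert hi]
        refine IsCompactOperator.add ?_ ih
        exact (isCompactOperator_of_locallyCompactSpace_dom
          (lp.evalCLM ℂ (fun _ : Idx => ℂ) 2 i)).clm_comp
          (ContinuousLinearMap.toSpanSingleton ℂ (lp.single 2 i (1 + Complex.I * i.1 : ℂ)⁻¹ : Seq2))
    exact this (F N)

/-- **Fredholm alternative**: uniqueness implies solvability. -/
lemma KernelBound.exists_solution (ha : KernelBound c a)
    (huniq : ∀ u : Seq2, transport a u = 0 → u = 0) :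
    ∃ S : Seq2 →L[ℂ] Seq2, ∀ g : Seq2, transport a (S g) = g := by
  -- The equation `transport a u = g` is equivalent to `u - T u = smooth g` with `T` compact, and an
  -- eigenvector of `T` for the eigenvalue 1 is a solution with zero source.
  set T : Seq2 →L[ℂ] Seq2 := smoothCLM ∘L (1 + ha.clm)
  have hT : IsCompactOperator T := isCompactOperator_smoothCLM.comp_clm (1 + ha.clm)
  have hTa : ∀ (u : Seq2) i, T u i * (1 + Complex.I * i.1) = u i + kmul a u i := fun u i =>
    div_mul_cancel₀ _ (one_add_I_mul_ne_zero i)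
  rcases hT.hasEigenvalue_or_mem_resolventSet (one_ne_zero (α := ℂ)) with h | h
  · obtain ⟨u, hu, hu0⟩ := h.exists_hasEigenvector
    refine absurd (huniq u ?_) hu0
    have hTu : T u = u := by simpa using Module.End.mem_eigenspace_iff.1 hu
    funext i
    have := hTa u i
    rw [hTu] at this
    simp only [transport, Pi.zero_apply]
    linear_combination this
  · rw [spectrum.mem_resolventSet_iff, map_one] at h
    obtain ⟨V, hV⟩ := h
    refine ⟨(↑V⁻¹ : Seq2 →L[ℂ] Seq2) ∘L smoothCLM, fun g => ?_⟩
    set w : Seq2 := ((↑V⁻¹ : Seq2 →L[ℂ] Seq2) ∘L smoothCLM) g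
    have hw : (1 - T) w = smoothCLM g := by
      rw [← hV]
      change ((V : Seq2 →L[ℂ] Seq2) * (↑V⁻¹ : Seq2 →L[ℂ] Seq2)) (smoothCLM g) = _
      rw [V.mul_inv]
      rfl
    funext i
    have h1 : w i - T w i = smooth g i := congrFun (congrArg Subtype.val hw) i
    have h2 : smooth g i * (1 + Complex.I * i.1) = g i :=
      div_mul_cancel₀ _ (one_add_I_mul_ne_zero i)
    have h3 := hTa w i
    rw [transport]
    linear_combination h3 + (1 + Complex.I * i.1) * h1 + h2

/-- The small factor `δ` is lost only once, at the lowest regularity: the constant of the bootstrap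
to `H^s` does not involve `δ`. -/
lemma exists_seqNorm_le (c : ℕ → ℝ≥0) (C : ℝ≥0) {s : ℝ} (hs : 0 ≤ s) :
    ∃ C' : ℝ≥0, ∀ (a : Idx → Idx → ℂ) (δ : ℝ≥0), δ ≤ 1 → KernelBound c a → ∀ u : Idx → ℂ,
      δ * seqNorm 0 u ≤ C * seqNorm (-1) (transport a u) →
      δ * seqNorm s u ≤ C' * seqNorm (s - 1) (transport a u) := by
  obtain ⟨D, hD⟩ := exists_seqNorm_le_of_transport c s
  refine ⟨D * (C + 1), fun a δ hδ ha u h => ?_⟩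
  have hδ' : (δ : ℝ≥0∞) ≤ 1 := by exact_mod_cast hδ
  calc δ * seqNorm s u ≤ δ * (D * (seqNorm 0 u + seqNorm (s - 1) (transport a u))) := by
        gcongr; exact hD a ha u
    _ = D * (δ * seqNorm 0 u + δ * seqNorm (s - 1) (transport a u)) := by ring
    _ ≤ D * (C * seqNorm (s - 1) (transport a u) + 1 * seqNorm (s - 1) (transport a u)) := by
        refine mul_le_mul_right (add_le_add (h.trans ?_) (mul_le_mul_left hδ' _)) _
        gcongr
        exact seqNorm_mono (by linarith) _
    _ = _ := by push_cast; ring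

/-- Resolvent identity. -/
lemma KernelBound.transport_sub_sub {c' : ℕ → ℝ≥0} {b : Idx → Idx → ℂ} (ha : KernelBound c a)
    (hb : KernelBound c' b) {u v : Idx → ℂ} (hu : seqNorm 0 u ≠ ∞) (hv : seqNorm 0 v ≠ ∞)
    (i : Idx) : transport a (fun j => u j - v j) i =
      (transport a u i - transport b v i) + kmul (fun i j => a i j - b i j) v i := by
  rw [ha.transport_sub hu hv]
  simp only [transport, kmul, sub_mul, (ha.summable hv i).tsum_sub (hb.summable hv i)]
  ring

end

section

open scoped ENNReal NNReal Nat

/-! ### Linear differential equations depending on a complex parameter -/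

section LinearODE

open Set MeasureTheory Filter Topology

variable {E : Type*} [NormedRing E] [NormedAlgebra ℂ E] {a b : ℝ}

/-- `f ↦ (t ↦ ∫_{t₀}^t f)`. -/
def primitive (h : a ≤ b) (t₀ : Icc a b) : C(Icc a b, E) →L[ℂ] C(Icc a b, E) :=
  LinearMap.mkContinuous
    { toFun := fun f => ⟨fun t => ∫ s in (t₀ : ℝ)..t, f.IccExtend h s,
        (intervalIntegral.continuous_primitive
          (fun _ _ => (f.IccExtend h).continuous.intervalIntegrable _ _) _).comp
            continuous_subtype_val⟩
      map_add' := fun f g => by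
        ext t
        exact intervalIntegral.integral_add ((f.IccExtend h).continuous.intervalIntegrable _ _)
          ((g.IccExtend h).continuous.intervalIntegrable _ _)
      map_smul' := fun k f => by
        ext t
        exact intervalIntegral.integral_smul k _ }
    (b - a) (fun f => by
      rw [ContinuousMap.norm_le _ (mul_nonneg (sub_nonneg.2 h) (norm_nonneg _))]
      intro t
      have h1 := intervalIntegral.norm_integral_le_of_norm_le_const (a := t₀) (b := t)
        (f := f.IccExtend h) (C := ‖f‖) (fun s _ => f.norm_coe_le_norm _)
      refine h1.trans ?_
      rw [mul_comm]
      gcongr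
      rw [abs_le]
      constructor <;> linarith [t.2.1, t.2.2, t₀.2.1, t₀.2.2])

lemma primitive_apply (h : a ≤ b) (t₀ : Icc a b) (f : C(Icc a b, E)) (t : Icc a b) :
    primitive h t₀ f t = ∫ s in (t₀ : ℝ)..t, f.IccExtend h s := rfl

/-- `f ↦ (t ↦ ∫_{t₀}^t B f)`. -/
def volterra (h : a ≤ b) (t₀ : Icc a b) (B : C(Icc a b, E)) : C(Icc a b, E) →L[ℂ] C(Icc a b, E) :=
  primitive h t₀ ∘L ContinuousLinearMap.mul ℂ C(Icc a b, E) B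

/-- The iterated integrals run over simplices, whence the factorial; no smallness of `B` or of the
interval is needed. -/
lemma norm_volterra_pow_apply_le (h : a ≤ b) (t₀ : Icc a b) (B f : C(Icc a b, E)) (n : ℕ)
    (t : Icc a b) :
    ‖(volterra h t₀ B ^ n) f t‖ ≤ (‖B‖ ^ n / n !) * ‖f‖ * |(t : ℝ) - t₀| ^ n := by
  induction n generalizing t with
  | zero => simpa using f.norm_coe_le_norm t
  | succ n ih =>
    set g := (volterra h t₀ B ^ n) f with hg
    have e : (volterra h t₀ B ^ (n + 1)) f t = ∫ s in (t₀ : ℝ)..t, (B * g).IccExtend h s := by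
      rw [pow_succ']
      rfl
    rw [e]
    have hb : ∀ᵐ s ∂(volume.restrict (uIoc (t₀ : ℝ) t)), ‖(B * g).IccExtend h s‖ ≤
        (‖B‖ ^ (n + 1) / n ! * ‖f‖) * |s - t₀| ^ n := by
      refine (ae_restrict_mem measurableSet_uIoc).mono fun s hs => ?_
      have hs' : s ∈ Icc a b :=
        (uIoc_subset_uIcc.trans (uIcc_subset_Icc t₀.2 t.2)) hs
      have e1 : (B * g).IccExtend h s = B ⟨s, hs'⟩ * g ⟨s, hs'⟩ := by
        simp [ContinuousMap.IccExtend, IccExtend_of_mem h _ hs']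
      rw [e1]
      refine (norm_mul_le _ _).trans ?_
      calc ‖B ⟨s, hs'⟩‖ * ‖g ⟨s, hs'⟩‖
          ≤ ‖B‖ * ((‖B‖ ^ n / n !) * ‖f‖ * |s - t₀| ^ n) := by
            gcongr
            · exact B.norm_coe_le_norm _
            · exact ih ⟨s, hs'⟩
        _ = _ := by ring
    refine (intervalIntegral.norm_integral_le_abs_of_norm_le hb
      (Continuous.intervalIntegrable (by fun_prop) _ _)).trans (le_of_eq ?_)
    rw [intervalIntegral.integral_const_mul, abs_mul, intervalIntegral.abs_intervalIntegral_eq,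
      integral_pow_abs_sub_uIoc, abs_of_nonneg (by positivity), abs_of_nonneg (by positivity),
      Nat.factorial_succ]
    push_cast
    field_simp

/-- The unit `1 - x ^ n` is the product of `1 - x` and a geometric sum commuting with it, and
commuting factors of a unit are units. -/
lemma isUnit_one_sub_of_norm_pow_lt_one {R : Type*} [NormedRing R] [HasSummableGeomSeries R]
    {x : R} {n : ℕ} (h : ‖x ^ n‖ < 1) : IsUnit (1 - x) := by
  have hu := isUnit_one_sub_of_norm_lt_one h
  rw [← mul_neg_geom_sum] at hu
  have hc : Commute (1 - x) (∑ i ∈ Finset.range n, x ^ i) :=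
    (Commute.one_left _).sub_left (Commute.sum_right _ _ _ fun i _ => (Commute.refl _).pow_right i)
  exact (hc.isUnit_mul_iff.1 hu).1

lemma isUnit_one_sub_volterra [CompleteSpace E] (h : a ≤ b) (t₀ : Icc a b) (B : C(Icc a b, E)) :
    IsUnit (1 - volterra h t₀ B) := by
  have hlim := FloorSemiring.tendsto_pow_div_factorial_atTop (‖B‖ * (b - a))
  obtain ⟨n, hn⟩ := (hlim.eventually_lt_const (zero_lt_one)).exists
  have hnorm : ‖volterra h t₀ B ^ n‖ < 1 := by
    refine lt_of_le_of_lt (ContinuousLinearMap.opNorm_le_bound _ ?_ fun f => ?_) hn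
    · have := sub_nonneg.2 h
      positivity
    · have := sub_nonneg.2 h
      rw [ContinuousMap.norm_le _ (by positivity)]
      intro t
      refine (norm_volterra_pow_apply_le h t₀ B f n t).trans ?_
      have ht : |(t : ℝ) - t₀| ≤ b - a := by
        rw [abs_le]
        constructor <;> linarith [t.2.1, t.2.2, t₀.2.1, t₀.2.2]
      calc _ ≤ (‖B‖ ^ n / n !) * ‖f‖ * (b - a) ^ n := by gcongr
        _ = _ := by rw [mul_pow]; ring
  exact isUnit_one_sub_of_norm_pow_lt_one (R := C(Icc a b, E) →L[ℂ] C(Icc a b, E)) hnorm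

/-- The solution of `N' = B N`, `N(t₀) = 1`. -/
def linSol (h : a ≤ b) (t₀ : Icc a b) (B : C(Icc a b, E)) : C(Icc a b, E) :=
  Ring.inverse (1 - volterra h t₀ B) 1

lemma linSol_eq [CompleteSpace E] (h : a ≤ b) (t₀ : Icc a b) (B : C(Icc a b, E)) (t : Icc a b) :
    linSol h t₀ B t = 1 + ∫ s in (t₀ : ℝ)..t, (B * linSol h t₀ B).IccExtend h s := by
  have h1 : (1 - volterra h t₀ B) (linSol h t₀ B) = 1 := by
    have := Ring.mul_inverse_cancel _ (isUnit_one_sub_volterra h t₀ B)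
    exact congrArg (fun T : C(Icc a b, E) →L[ℂ] C(Icc a b, E) => T 1) this
  have h2 : linSol h t₀ B t - volterra h t₀ B (linSol h t₀ B) t = 1 :=
    congrArg (fun f : C(Icc a b, E) => f t) h1
  rw [eq_add_of_sub_eq h2]
  rfl

lemma analyticAt_clm_comp {F G : Type*} [NormedAddCommGroup F] [NormedSpace ℂ F]
    [NormedAddCommGroup G] [NormedSpace ℂ G] (L : F →L[ℂ] G) {f : ℂ → F} {z : ℂ}
    (hf : AnalyticAt ℂ f z) : AnalyticAt ℂ (fun w => L (f w)) z :=
  (L.analyticAt _).comp hf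

lemma analyticAt_inverse_comp {R : Type*} [NormedRing R] [NormedAlgebra ℂ R]
    [HasSummableGeomSeries R] {f : ℂ → R} {z : ℂ} (hf : AnalyticAt ℂ f z) (hu : IsUnit (f z)) :
    AnalyticAt ℂ (fun w => Ring.inverse (f w)) z :=
  AnalyticAt.comp (g := Ring.inverse) (by simpa using analyticAt_inverse (𝕜 := ℂ) hu.unit) hf

lemma analyticAt_inverse_one_sub_comp_mul {R : Type*} [NormedRing R] [NormedAlgebra ℂ R]
    [CompleteSpace R] (P : R →L[ℂ] R) {f : ℂ → R} {z : ℂ} (hf : AnalyticAt ℂ f z)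
    (hu : IsUnit (1 - P ∘L ContinuousLinearMap.mul ℂ R (f z))) :
    AnalyticAt ℂ (fun w => Ring.inverse (1 - P ∘L ContinuousLinearMap.mul ℂ R (f w)) (1 : R)) z := by
  have h1 : AnalyticAt ℂ (fun w => P ∘L ContinuousLinearMap.mul ℂ R (f w)) z :=
    analyticAt_clm_comp (ContinuousLinearMap.compL ℂ R R R P)
      (analyticAt_clm_comp (ContinuousLinearMap.mul ℂ R) hf)
  exact analyticAt_clm_comp (ContinuousLinearMap.apply ℂ R (1 : R))
    (analyticAt_inverse_comp (analyticAt_const.sub h1) hu)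

/-- Analytic dependence on parameters costs nothing once the solution is written `(1 - V_B)⁻¹ 1`:
the Volterra operator `V_B` is linear in `B`, and inversion is analytic on units. -/
lemma analyticAt_linSol [CompleteSpace E] (h : a ≤ b) (t₀ : Icc a b) {B : ℂ → C(Icc a b, E)} {z : ℂ}
    (hB : AnalyticAt ℂ B z) : AnalyticAt ℂ (fun w => linSol h t₀ (B w)) z :=
  analyticAt_inverse_one_sub_comp_mul (R := C(Icc a b, E)) (primitive h t₀) hB
    (isUnit_one_sub_volterra h t₀ (B z))

/-- A family of functions which is jointly continuous and holomorphic in the parameter is a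
holomorphic family of elements of the space of continuous functions. -/
lemma analyticAt_continuousMap {F : Type*} [NormedAddCommGroup F] [NormedSpace ℂ F]
    [CompleteSpace F] {f : ℂ → ℝ → F} {z₀ : ℂ}
    (hf : ∀ t ∈ Icc a b, ∀ᶠ p : ℂ × ℝ in 𝓝 (z₀, t),
      ContinuousAt (Function.uncurry f) p ∧ DifferentiableAt ℂ (fun z => f z p.2) p.1) :
    ∃ g : ℂ → C(Icc a b, F), AnalyticAt ℂ g z₀ ∧ ∀ᶠ z in 𝓝 z₀, ∀ t : Icc a b, g z t = f z t := by
  have h1 := isCompact_Icc.eventually_forall_of_forall_eventually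
    (P := fun z t => ContinuousAt (Function.uncurry f) (z, t) ∧
      DifferentiableAt ℂ (fun z => f z t) z) hf
  obtain ⟨r, hr, hball⟩ := Metric.nhds_basis_closedBall.eventually_iff.1 h1
  lift r to ℝ≥0 using hr.le
  have hr' : 0 < r := hr
  set G : Metric.closedBall z₀ (r : ℝ) → C(Icc a b, F) := fun z =>
    ⟨fun t => f z t, continuous_iff_continuousAt.2 fun t =>
      ((hball z.2 t t.2).1.comp (f := fun t : Icc a b => ((z : ℂ), (t : ℝ)))
        (by fun_prop : Continuous fun t : Icc a b => ((z : ℂ), (t : ℝ))).continuousAt)⟩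
  have hG : Continuous G := by
    apply ContinuousMap.continuous_of_continuous_uncurry
    refine continuous_iff_continuousAt.2 fun p => ?_
    exact ((hball p.1.2 p.2 p.2.2).1.comp
      (f := fun p : Metric.closedBall z₀ (r : ℝ) × Icc a b => ((p.1 : ℂ), (p.2 : ℝ)))
        (by fun_prop : Continuous fun p : Metric.closedBall z₀ (r : ℝ) × Icc a b =>
          ((p.1 : ℂ), (p.2 : ℝ))).continuousAt)
  -- The value 0 off the closed disc is arbitrary; only the disc is used.
  set g : ℂ → C(Icc a b, F) := Function.extend Subtype.val G 0
  have hgG : ∀ z (hz : z ∈ Metric.closedBall z₀ (r : ℝ)), g z = G ⟨z, hz⟩ := fun z hz =>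
    Subtype.val_injective.extend_apply G 0 ⟨z, hz⟩
  have hg : ContinuousOn g (Metric.closedBall z₀ r) := by
    rw [continuousOn_iff_continuous_domRestrict]
    convert hG using 1
    funext z
    exact hgG z z.2
  have hci : CircleIntegrable g z₀ r :=
    (hg.mono Metric.sphere_subset_closedBall).circleIntegrable r.2
  have hps := hasFPowerSeriesOn_cauchy_integral hci hr'
  -- Cauchy's formula holds in the space of continuous functions because it holds after each
  -- evaluation; its right-hand side is already known to be a power series with values in that
  -- space.
  have heq : ∀ z ∈ Metric.ball z₀ (r : ℝ),
      (2 * Real.pi * Complex.I : ℂ)⁻¹ • (∮ w in C(z₀, r), (w - z)⁻¹ • g w) = g z := by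
    intro z hz
    ext t
    set ev : C(Icc a b, F) →L[ℂ] F := ContinuousMap.evalCLM ℂ t
    have hI : IntervalIntegrable (fun θ : ℝ => deriv (circleMap z₀ r) θ •
        ((circleMap z₀ r θ - z)⁻¹ • g (circleMap z₀ r θ))) volume 0 (2 * Real.pi) := by
      apply ContinuousOn.intervalIntegrable
      have hc : Continuous fun θ => g (circleMap z₀ r θ) :=
        hg.comp_continuous (continuous_circleMap z₀ r)
          fun θ => circleMap_mem_closedBall z₀ r.2 θ
      have hne : ∀ θ, circleMap z₀ r θ - z ≠ 0 := fun θ h0 => by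
        have := circleMap_mem_sphere z₀ r.coe_nonneg θ
        rw [sub_eq_zero.1 h0] at this
        exact (Metric.mem_ball.1 hz).ne this
      simp only [deriv_circleMap]
      refine Continuous.continuousOn ?_
      exact ((continuous_circleMap 0 r).mul continuous_const).smul
        ((((continuous_circleMap z₀ r).sub continuous_const).inv₀ hne).smul hc)
    have h2 : ev (∮ w in C(z₀, r), (w - z)⁻¹ • g w) = ∮ w in C(z₀, r), (w - z)⁻¹ • g w t := by
      rw [circleIntegral, circleIntegral, ← ContinuousLinearMap.intervalIntegral_comp_comm ev hI]
      rfl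
    have h3 := Complex.two_pi_I_inv_smul_circleIntegral_sub_inv_smul_of_differentiable_on_off_countable
      (c := z₀) (R := r) (f := fun w => g w t) Set.countable_empty hz
      ((ContinuousMap.evalCLM ℂ t : C(Icc a b, F) →L[ℂ] F).continuous.comp_continuousOn hg)
      (fun x hx => by
        have hx' : ∀ᶠ w in 𝓝 x, f w t = g w t := by
          filter_upwards [Metric.isOpen_ball.mem_nhds hx.1] with w hw
          rw [hgG w (Metric.ball_subset_closedBall hw)]
          rfl
        exact ((hball (Metric.ball_subset_closedBall hx.1) t t.2).2).congr_of_eventuallyEq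
          (hx'.mono fun _ h => h.symm))
    calc _ = (2 * Real.pi * Complex.I : ℂ)⁻¹ • ev (∮ w in C(z₀, r), (w - z)⁻¹ • g w) := rfl
      _ = _ := by rw [h2, h3]
  refine ⟨g, hps.analyticAt.congr ?_, ?_⟩
  · filter_upwards [Metric.ball_mem_nhds z₀ hr] with z hz using heq z hz
  · filter_upwards [Metric.ball_mem_nhds z₀ hr] with z hz t
    rw [hgG z (Metric.ball_subset_closedBall hz)]
    rfl

end LinearODE

end

/-! ### Linear differential equations on the line: uniqueness and global existence -/

section

section LinearODE

open Set MeasureTheory Filter Topology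
open scoped NNReal

variable {E : Type*} [NormedRing E] [NormedAlgebra ℂ E] {a b : ℝ}

lemma linear_ode_unique {B N N' : ℝ → E} (hB : ContinuousOn B (Icc a b)) {t₀ : ℝ}
    (ht₀ : t₀ ∈ Ioo a b)
    (hN : ∀ t ∈ Ioo a b, HasDerivAt N (B t * N t) t)
    (hN' : ∀ t ∈ Ioo a b, HasDerivAt N' (B t * N' t) t) (h : N t₀ = N' t₀) :
    EqOn N N' (Ioo a b) := by
  obtain ⟨C, hC⟩ := isCompact_Icc.exists_bound_of_continuousOn hB
  refine ODE_solution_unique_of_mem_Ioo (v := fun t x => B t * x) (K := C.toNNReal)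
    (s := fun _ => univ) (fun t ht => ?_) ht₀ (fun t ht => ⟨hN t ht, mem_univ _⟩)
    (fun t ht => ⟨hN' t ht, mem_univ _⟩) h
  refine (LipschitzWith.of_dist_le_mul fun x y => ?_).lipschitzOnWith
  rw [dist_eq_norm, dist_eq_norm, ← mul_sub]
  refine (norm_mul_le _ _).trans ?_
  gcongr
  exact (hC t (Ioo_subset_Icc_self ht)).trans (Real.le_coe_toNNReal C)

lemma hasDerivAt_linSol [CompleteSpace E] (h : a ≤ b) (t₀ : Icc a b) (B : C(Icc a b, E)) {t : ℝ}
    (ht : t ∈ Ioo a b) :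
    HasDerivAt ((linSol h t₀ B).IccExtend h)
      (B.IccExtend h t * (linSol h t₀ B).IccExtend h t) t := by
  set g := (B * linSol h t₀ B).IccExtend h
  have h1 : HasDerivAt (fun t => 1 + ∫ s in (t₀ : ℝ)..t, g s) (g t) t :=
    (intervalIntegral.integral_hasDerivAt_right (g.continuous.intervalIntegrable _ _)
      (g.continuous.stronglyMeasurableAtFilter _ _) g.continuous.continuousAt).const_add 1
  have h2 : g t = B.IccExtend h t * (linSol h t₀ B).IccExtend h t := rfl
  rw [← h2]
  refine h1.congr_of_eventuallyEq ?_
  filter_upwards [isOpen_Ioo.mem_nhds ht] with s hs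
  have hs' := Ioo_subset_Icc_self hs
  have := linSol_eq h t₀ B ⟨s, hs'⟩
  rw [ContinuousMap.coe_IccExtend, IccExtend_of_mem h _ hs', this]

lemma linSol_self [CompleteSpace E] (h : a ≤ b) (t₀ : Icc a b) (B : C(Icc a b, E)) :
    linSol h t₀ B t₀ = 1 := by
  rw [linSol_eq]
  simp

lemma exists_linear_ode_solution [CompleteSpace E] {B : ℝ → E} (hB : Continuous B) (t₀ : ℝ) :
    ∃ N : ℝ → E, N t₀ = 1 ∧ ∀ t, HasDerivAt N (B t * N t) t := by
  have hloc : ∀ n : ℕ, ∃ N : ℝ → E, N t₀ = 1 ∧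
      ∀ t ∈ Ioo (t₀ - (n + 1)) (t₀ + (n + 1)), HasDerivAt N (B t * N t) t := by
    intro n
    have hn : (0 : ℝ) < n + 1 := by positivity
    have h : t₀ - (n + 1) ≤ t₀ + (n + 1) := by linarith
    set B' : C(Icc (t₀ - ((n : ℝ) + 1)) (t₀ + (n + 1)), E) := ⟨fun t => B t, by fun_prop⟩
    have ht : t₀ ∈ Icc (t₀ - ((n : ℝ) + 1)) (t₀ + (n + 1)) := ⟨by linarith, by linarith⟩
    refine ⟨(linSol h ⟨t₀, ht⟩ B').IccExtend h, ?_, fun t ht' => ?_⟩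
    · rw [ContinuousMap.coe_IccExtend, IccExtend_of_mem h _ ht]
      exact linSol_self _ _ _
    · have h1 := hasDerivAt_linSol h ⟨t₀, ht⟩ B' ht'
      have h2 : B'.IccExtend h t = B t := by
        rw [ContinuousMap.coe_IccExtend, IccExtend_of_mem h _ (Ioo_subset_Icc_self ht')]
        rfl
      rwa [h2] at h1
  choose N hN0 hN using hloc
  have hagree : ∀ n m : ℕ, n ≤ m → EqOn (N n) (N m) (Ioo (t₀ - (n + 1)) (t₀ + (n + 1))) := by
    intro n m hnm
    have hn : (0 : ℝ) < n + 1 := by positivity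
    have hnm' : (n : ℝ) ≤ m := by exact_mod_cast hnm
    refine linear_ode_unique hB.continuousOn ⟨by linarith, by linarith⟩ (hN n)
      (fun t ht => hN m t ⟨by linarith [ht.1], by linarith [ht.2]⟩) ((hN0 n).trans (hN0 m).symm)
  -- The solutions on growing intervals agree where both are defined. The half-length `n + 1` puts
  -- `t` in the open interval of index `⌈|t - t₀|⌉₊`.
  refine ⟨fun t => N ⌈|t - t₀|⌉₊ t, by simpa using hN0 0, fun t => ?_⟩
  have hmem : ∀ s, s ∈ Ioo (t₀ - (⌈|s - t₀|⌉₊ + 1 : ℝ)) (t₀ + (⌈|s - t₀|⌉₊ + 1)) := fun s => by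
    have h1 := Nat.le_ceil |s - t₀|
    have h2 := abs_le.1 (h1)
    constructor <;> linarith [h2.1, h2.2]
  set n := ⌈|t - t₀|⌉₊ with hn
  refine (hN n t (hmem t)).congr_of_eventuallyEq ?_
  filter_upwards [isOpen_Ioo.mem_nhds (hmem t)] with s hs
  rcases le_total n ⌈|s - t₀|⌉₊ with h | h
  · exact (hagree _ _ h hs).symm
  · exact hagree _ _ h (hmem s)

end LinearODE

end

section

open Real Set Filter Topology

/-! ### The energy level of the orbit as a graph over the angle -/

section Level

/-- The linear coefficient of the quadratic equation satisfied by `J / ξ²`. -/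
def levelP (y ξ ϕ : ℝ) : ℝ := y ^ 4 - 2 * y ^ 2 * ξ ^ 2 * cos ϕ ^ 2

/-- The discriminant of the quadratic equation satisfied by `J / ξ²`. -/
def levelR (y ξ ϕ : ℝ) : ℝ := levelP y ξ ϕ ^ 2 + 4 * y ^ 4 * ξ ^ 4 * (sin ϕ * cos ϕ) ^ 2

/-- `J / ξ²` as a function of the angle on the energy level through `(ξ², π/2)`. -/
def levelj (y ξ ϕ : ℝ) : ℝ := 2 * y ^ 4 / (levelP y ξ ϕ + √(levelR y ξ ϕ))

/-- `J` as a function of the angle on the energy level through `(ξ², π/2)`. -/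
def levelJ (y ξ ϕ : ℝ) : ℝ := ξ ^ 2 * levelj y ξ ϕ

/-- `y² - J sin² ϕ`. -/
def denS (y ξ ϕ : ℝ) : ℝ := y ^ 2 - levelJ y ξ ϕ * sin ϕ ^ 2

/-- `y² + J cos² ϕ`. -/
def denC (y ξ ϕ : ℝ) : ℝ := y ^ 2 + levelJ y ξ ϕ * cos ϕ ^ 2

/-- `J` times the angular velocity on the energy level. -/
def levelΨ (y ξ ϕ : ℝ) : ℝ := y ^ 2 / denS y ξ ϕ + y ^ 2 / denC y ξ ϕ - 1

variable {y ξ : ℝ}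

lemma levelP_pos (hy : 0 < y) (hξ : 2 * ξ ^ 2 < y ^ 2) (ϕ : ℝ) : 0 < levelP y ξ ϕ := by
  have h1 := cos_sq_le_one ϕ
  have h2 := sq_nonneg (cos ϕ)
  have h3 : 2 * ξ ^ 2 * cos ϕ ^ 2 < y ^ 2 := by nlinarith [sq_nonneg ξ]
  have h4 : 0 < y ^ 2 := by positivity
  have : levelP y ξ ϕ = y ^ 2 * (y ^ 2 - 2 * ξ ^ 2 * cos ϕ ^ 2) := by unfold levelP; ring
  rw [this]
  exact mul_pos h4 (by linarith)

lemma levelR_pos (hy : 0 < y) (hξ : 2 * ξ ^ 2 < y ^ 2) (ϕ : ℝ) : 0 < levelR y ξ ϕ := by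
  have := levelP_pos hy hξ ϕ
  unfold levelR
  positivity

lemma levelj_pos (hy : 0 < y) (hξ : 2 * ξ ^ 2 < y ^ 2) (ϕ : ℝ) : 0 < levelj y ξ ϕ := by
  have := levelP_pos hy hξ ϕ
  have := levelR_pos hy hξ ϕ
  unfold levelj
  positivity

lemma levelJ_pos (hy : 0 < y) (hξ0 : 0 < ξ) (hξ : 2 * ξ ^ 2 < y ^ 2) (ϕ : ℝ) :
    0 < levelJ y ξ ϕ := by
  have := levelj_pos hy hξ ϕ
  unfold levelJ
  positivity

lemma levelJ_nonneg (hy : 0 < y) (hξ : 2 * ξ ^ 2 < y ^ 2) (ϕ : ℝ) :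
    0 ≤ levelJ y ξ ϕ := by
  have := levelj_pos hy hξ ϕ
  unfold levelJ
  positivity

/-- Conservation of energy as a quadratic equation. Its positive root is written with `P + √R` in
the denominator, instead of the leading coefficient, so that it stays regular where `ξ sin ϕ cos ϕ =
0`, in particular at `ξ = 0`. -/
lemma levelj_rel (hy : 0 < y) (hξ : 2 * ξ ^ 2 < y ^ 2) (ϕ : ℝ) :
    ξ ^ 4 * (sin ϕ * cos ϕ) ^ 2 * levelj y ξ ϕ ^ 2 + levelP y ξ ϕ * levelj y ξ ϕ = y ^ 4 := by
  have hP := levelP_pos hy hξ ϕ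
  have hR := levelR_pos hy hξ ϕ
  have hs := sq_sqrt hR.le
  have hs0 := sqrt_pos.2 hR
  have hR' : levelR y ξ ϕ = levelP y ξ ϕ ^ 2 + 4 * y ^ 4 * ξ ^ 4 * (sin ϕ * cos ϕ) ^ 2 := rfl
  unfold levelj
  set r := √(levelR y ξ ϕ)
  set P := levelP y ξ ϕ
  have hpr : P + r ≠ 0 := by positivity
  rw [hR'] at hs
  field_simp
  linear_combination (-1 : ℝ) * hs

/-- For `ξ ≠ 0` this says that `(y² - J sin² ϕ)(y² + J cos² ϕ)/J` keeps the value it has at `(ξ²,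
π/2)`. It also supplies the positivity of `denS`. -/
lemma denS_mul_denC (hy : 0 < y) (hξ : 2 * ξ ^ 2 < y ^ 2) (ϕ : ℝ) :
    denS y ξ ϕ * denC y ξ ϕ = levelj y ξ ϕ * (y ^ 2 * (y ^ 2 - ξ ^ 2)) := by
  have h := levelj_rel hy hξ ϕ
  have hsc := sin_sq_add_cos_sq ϕ
  unfold denS denC levelJ
  unfold levelP at h
  linear_combination (-1 : ℝ) * h - y ^ 2 * ξ ^ 2 * levelj y ξ ϕ * hsc

lemma denC_pos (hy : 0 < y) (hξ : 2 * ξ ^ 2 < y ^ 2) (ϕ : ℝ) : 0 < denC y ξ ϕ := by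
  have := levelJ_nonneg hy hξ ϕ
  unfold denC
  positivity

lemma denS_pos (hy : 0 < y) (hξ : 2 * ξ ^ 2 < y ^ 2) (ϕ : ℝ) : 0 < denS y ξ ϕ := by
  have h := denS_mul_denC hy hξ ϕ
  have h1 := denC_pos hy hξ ϕ
  have h2 := levelj_pos hy hξ ϕ
  have h3 : 0 < y ^ 2 - ξ ^ 2 := by nlinarith [sq_nonneg ξ]
  refine pos_of_mul_pos_left (b := denC y ξ ϕ) ?_ h1.le
  rw [h]
  positivity

/-- The term `y² / denS` alone is at least 1. Since the angular velocity never vanishes, the angle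
can replace time. -/
lemma levelΨ_pos (hy : 0 < y) (hξ : 2 * ξ ^ 2 < y ^ 2) (ϕ : ℝ) : 0 < levelΨ y ξ ϕ := by
  have h1 := denC_pos hy hξ ϕ
  have h2 := denS_pos hy hξ ϕ
  have h3 : 1 ≤ y ^ 2 / denS y ξ ϕ := by
    rw [one_le_div h2]
    have := levelJ_nonneg hy hξ ϕ
    unfold denS
    nlinarith [sq_nonneg (sin ϕ), mul_nonneg this (sq_nonneg (sin ϕ))]
  have h4 : 0 < y ^ 2 / denC y ξ ϕ := by positivity
  unfold levelΨ
  linarith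

/-- The last factor is the derivative in `j` of the quadratic, that is, the divisor of implicit
differentiation; this identifies it with the angular velocity. -/
lemma levelΨ_mul (hy : 0 < y) (hξ : 2 * ξ ^ 2 < y ^ 2) (ϕ : ℝ) :
    levelΨ y ξ ϕ * (denS y ξ ϕ * denC y ξ ϕ) =
      levelj y ξ ϕ * (2 * ξ ^ 4 * (sin ϕ * cos ϕ) ^ 2 * levelj y ξ ϕ + levelP y ξ ϕ) := by
  have h1 := (denC_pos hy hξ ϕ).ne'
  have h2 := (denS_pos hy hξ ϕ).ne'
  have h := levelj_rel hy hξ ϕ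
  have e : levelΨ y ξ ϕ * (denS y ξ ϕ * denC y ξ ϕ) =
      y ^ 2 * denC y ξ ϕ + y ^ 2 * denS y ξ ϕ - denS y ξ ϕ * denC y ξ ϕ := by
    unfold levelΨ
    field_simp
  rw [e]
  unfold denS denC levelJ
  linear_combination (-1 : ℝ) * h

lemma levelΨ_div_levelJ (hy : 0 < y) (hξ0 : 0 < ξ) (hξ : 2 * ξ ^ 2 < y ^ 2) (ϕ : ℝ) :
    1 / levelJ y ξ ϕ + sin ϕ ^ 2 / denS y ξ ϕ - cos ϕ ^ 2 / denC y ξ ϕ =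
      levelΨ y ξ ϕ / levelJ y ξ ϕ := by
  have h0 := (levelJ_pos hy hξ0 hξ ϕ).ne'
  have h1 := (denC_pos hy hξ ϕ).ne'
  have h2 := (denS_pos hy hξ ϕ).ne'
  unfold levelΨ
  rw [eq_div_iff h0]
  have e1 : levelJ y ξ ϕ * sin ϕ ^ 2 = y ^ 2 - denS y ξ ϕ := by unfold denS; ring
  have e2 : levelJ y ξ ϕ * cos ϕ ^ 2 = denC y ξ ϕ - y ^ 2 := by unfold denC; ring
  field_simp
  linear_combination denC y ξ ϕ * e1 - denS y ξ ϕ * e2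

lemma differentiable_levelj (hy : 0 < y) (hξ : 2 * ξ ^ 2 < y ^ 2) :
    Differentiable ℝ (levelj y ξ) := by
  intro ϕ
  have hP := levelP_pos hy hξ ϕ
  have hR := levelR_pos hy hξ ϕ
  have dP : DifferentiableAt ℝ (levelP y ξ) ϕ := by unfold levelP; fun_prop
  have dR : DifferentiableAt ℝ (levelR y ξ) ϕ := by unfold levelR; fun_prop
  unfold levelj
  exact DifferentiableAt.fun_div (by fun_prop) (dP.add (dR.sqrt hR.ne')) (by positivity)

/-- Implicit differentiation of `levelj_rel`. The value is `J̇ / ϕ̇` for the vortex field, so the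
level curve is a trajectory up to reparametrisation. -/
lemma hasDerivAt_levelJ (hy : 0 < y) (hξ : 2 * ξ ^ 2 < y ^ 2) (ϕ : ℝ) :
    HasDerivAt (levelJ y ξ) (-(1 / denS y ξ ϕ + 1 / denC y ξ ϕ) * sin (2 * ϕ) *
      levelJ y ξ ϕ ^ 2 / levelΨ y ξ ϕ) ϕ := by
  set j' := deriv (levelj y ξ) ϕ
  have hj : HasDerivAt (levelj y ξ) j' ϕ := (differentiable_levelj hy hξ ϕ).hasDerivAt
  have hP : HasDerivAt (levelP y ξ) (4 * y ^ 2 * ξ ^ 2 * (sin ϕ * cos ϕ)) ϕ := by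
    have := (((hasDerivAt_cos ϕ).fun_pow 2).const_mul (2 * y ^ 2 * ξ ^ 2)).const_sub (y ^ 4)
    refine this.congr_deriv ?_
    norm_num
    ring
  have hsc : HasDerivAt (fun ϕ => (sin ϕ * cos ϕ) ^ 2)
      (2 * (sin ϕ * cos ϕ) * (cos ϕ ^ 2 - sin ϕ ^ 2)) ϕ := by
    have := ((hasDerivAt_sin ϕ).fun_mul (hasDerivAt_cos ϕ)).fun_pow 2
    refine this.congr_deriv ?_
    push_cast
    ring
  have hrel := ((hsc.const_mul (ξ ^ 4)).fun_mul (hj.fun_pow 2)).fun_add (hP.fun_mul hj)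
  have hconst : HasDerivAt (fun ϕ => ξ ^ 4 * (sin ϕ * cos ϕ) ^ 2 * levelj y ξ ϕ ^ 2 +
      levelP y ξ ϕ * levelj y ξ ϕ) 0 ϕ := by
    have : (fun ϕ => ξ ^ 4 * (sin ϕ * cos ϕ) ^ 2 * levelj y ξ ϕ ^ 2 +
      levelP y ξ ϕ * levelj y ξ ϕ) = fun _ => y ^ 4 := funext (levelj_rel hy hξ)
    rw [this]
    exact hasDerivAt_const _ _
  have heq := hrel.unique hconst
  norm_num at heq
  refine (hj.const_mul (ξ ^ 2)).congr_deriv ?_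
  have h1 := (denC_pos hy hξ ϕ).ne'
  have h2 := (denS_pos hy hξ ϕ).ne'
  have h3 := (levelΨ_pos hy hξ ϕ).ne'
  have h4 := levelj_pos hy hξ ϕ
  rw [eq_div_iff h3, sin_two_mul]
  have hm := levelΨ_mul hy hξ ϕ
  have h12 : denS y ξ ϕ * denC y ξ ϕ ≠ 0 := mul_ne_zero h2 h1
  have hsum : denS y ξ ϕ + denC y ξ ϕ =
      2 * y ^ 2 + ξ ^ 2 * levelj y ξ ϕ * (cos ϕ ^ 2 - sin ϕ ^ 2) := by
    unfold denS denC levelJ; ring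
  apply mul_right_cancel₀ h12
  have e : -(1 / denS y ξ ϕ + 1 / denC y ξ ϕ) * (2 * sin ϕ * cos ϕ) * levelJ y ξ ϕ ^ 2 *
      (denS y ξ ϕ * denC y ξ ϕ) =
      -(denS y ξ ϕ + denC y ξ ϕ) * (2 * sin ϕ * cos ϕ) * (ξ ^ 2 * levelj y ξ ϕ) ^ 2 := by
    unfold levelJ
    field_simp
    ring
  rw [e, hsum, mul_assoc, hm]
  linear_combination (ξ ^ 2 * levelj y ξ ϕ) * heq

lemma levelJ_pi_div_two (hy : 0 < y) : levelJ y ξ (π / 2) = ξ ^ 2 := by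
  have h : √((y ^ 4) ^ 2) = y ^ 4 := sqrt_sq (by positivity)
  simp only [levelJ, levelj, levelP, levelR, cos_pi_div_two, sin_pi_div_two]
  norm_num
  rw [h]
  have : y ≠ 0 := hy.ne'
  field_simp
  norm_num

lemma levelj_add_pi (ϕ : ℝ) : levelj y ξ (ϕ + π) = levelj y ξ ϕ := by
  simp [levelj, levelP, levelR]

lemma levelJ_add_pi (ϕ : ℝ) : levelJ y ξ (ϕ + π) = levelJ y ξ ϕ := by
  simp [levelJ, levelj_add_pi]

lemma levelΨ_add_pi (ϕ : ℝ) : levelΨ y ξ (ϕ + π) = levelΨ y ξ ϕ := by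
  simp [levelΨ, denS, denC, levelJ_add_pi]

end Level

end

/-! ### The orbit in time: existence, uniqueness, period and frequency -/

section

open Real Set Filter Topology

section Orbit

variable {y ξ : ℝ}

/-- Time spent per unit of angle. -/
def slowness (y ξ ϕ : ℝ) : ℝ := levelJ y ξ ϕ / levelΨ y ξ ϕ

/-- The time at which the orbit reaches the angle `ϕ`. -/
def timeMap (y ξ ϕ : ℝ) : ℝ := ∫ s in (π / 2)..ϕ, slowness y ξ s

lemma slowness_pos (hy : 0 < y) (hξ0 : 0 < ξ) (hξ : 2 * ξ ^ 2 < y ^ 2) (ϕ : ℝ) :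
    0 < slowness y ξ ϕ := div_pos (levelJ_pos hy hξ0 hξ ϕ) (levelΨ_pos hy hξ ϕ)

lemma continuous_levelJ (hy : 0 < y) (hξ : 2 * ξ ^ 2 < y ^ 2) : Continuous (levelJ y ξ) :=
  continuous_iff_continuousAt.2 fun ϕ => (hasDerivAt_levelJ hy hξ ϕ).continuousAt

lemma continuous_levelΨ (hy : 0 < y) (hξ : 2 * ξ ^ 2 < y ^ 2) : Continuous (levelΨ y ξ) := by
  have hJ := continuous_levelJ hy hξ
  have h1 : Continuous (denS y ξ) := by unfold denS; fun_prop
  have h2 : Continuous (denC y ξ) := by unfold denC; fun_prop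
  unfold levelΨ
  exact ((continuous_const.div h1 fun ϕ => (denS_pos hy hξ ϕ).ne').add
    (continuous_const.div h2 fun ϕ => (denC_pos hy hξ ϕ).ne')).sub continuous_const

lemma continuous_slowness (hy : 0 < y) (hξ : 2 * ξ ^ 2 < y ^ 2) : Continuous (slowness y ξ) :=
  (continuous_levelJ hy hξ).div (continuous_levelΨ hy hξ) fun ϕ => (levelΨ_pos hy hξ ϕ).ne'

lemma periodic_slowness : Function.Periodic (slowness y ξ) π := fun ϕ => by
  simp [slowness, levelJ_add_pi, levelΨ_add_pi]

lemma hasDerivAt_timeMap (hy : 0 < y) (hξ : 2 * ξ ^ 2 < y ^ 2) (ϕ : ℝ) :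
    HasDerivAt (timeMap y ξ) (slowness y ξ ϕ) ϕ :=
  (continuous_slowness hy hξ).integral_hasStrictDerivAt _ _ |>.hasDerivAt

lemma timeMap_self : timeMap y ξ (π / 2) = 0 := by simp [timeMap]

/-- Half of the period. -/
def halfPeriod (y ξ : ℝ) : ℝ := ∫ s in (0 : ℝ)..π, slowness y ξ s

lemma timeMap_add_pi (hy : 0 < y) (hξ : 2 * ξ ^ 2 < y ^ 2) (ϕ : ℝ) :
    timeMap y ξ (ϕ + π) = timeMap y ξ ϕ + halfPeriod y ξ := by
  have hi : ∀ a b, IntervalIntegrable (slowness y ξ) MeasureTheory.volume a b := fun a b =>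
    (continuous_slowness hy hξ).intervalIntegrable a b
  rw [timeMap, ← intervalIntegral.integral_add_adjacent_intervals (hi _ ϕ) (hi _ _),
    periodic_slowness.intervalIntegral_add_eq ϕ 0, zero_add]
  rfl

lemma halfPeriod_pos (hy : 0 < y) (hξ0 : 0 < ξ) (hξ : 2 * ξ ^ 2 < y ^ 2) : 0 < halfPeriod y ξ :=
  intervalIntegral.intervalIntegral_pos_of_pos ((continuous_slowness hy hξ).intervalIntegrable _ _)
    (slowness_pos hy hξ0 hξ) pi_pos

lemma strictMono_timeMap (hy : 0 < y) (hξ0 : 0 < ξ) (hξ : 2 * ξ ^ 2 < y ^ 2) :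
    StrictMono (timeMap y ξ) :=
  strictMono_of_hasDerivAt_pos (hasDerivAt_timeMap hy hξ) (slowness_pos hy hξ0 hξ)

lemma surjective_timeMap (hy : 0 < y) (hξ0 : 0 < ξ) (hξ : 2 * ξ ^ 2 < y ^ 2) :
    Function.Surjective (timeMap y ξ) := by
  have hi : ∀ a b, IntervalIntegrable (slowness y ξ) MeasureTheory.volume a b := fun a b =>
    (continuous_slowness hy hξ).intervalIntegrable a b
  have e : timeMap y ξ = fun ϕ => (∫ s in (π / 2)..0, slowness y ξ s) + ∫ s in (0 : ℝ)..ϕ, slowness y ξ s := by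
    funext ϕ
    exact (intervalIntegral.integral_add_adjacent_intervals (hi _ _) (hi _ _)).symm
  have hc : Continuous (timeMap y ξ) := continuous_iff_continuousAt.2 fun ϕ =>
    (hasDerivAt_timeMap hy hξ ϕ).continuousAt
  refine hc.surjective ?_ ?_
  · rw [e]
    exact tendsto_atTop_add_const_left _ _ (periodic_slowness.tendsto_atTop_intervalIntegral_of_pos
      (halfPeriod_pos hy hξ0 hξ) pi_pos)
  · rw [e]
    exact tendsto_atBot_add_const_left _ _ (periodic_slowness.tendsto_atBot_intervalIntegral_of_pos
      (halfPeriod_pos hy hξ0 hξ) pi_pos)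

/-- The angle at time `t`. -/
def angle (y ξ : ℝ) : ℝ → ℝ := Function.invFun (timeMap y ξ)

lemma timeMap_angle (hy : 0 < y) (hξ0 : 0 < ξ) (hξ : 2 * ξ ^ 2 < y ^ 2) (t : ℝ) :
    timeMap y ξ (angle y ξ t) = t :=
  Function.rightInverse_invFun (surjective_timeMap hy hξ0 hξ) t

lemma angle_timeMap (hy : 0 < y) (hξ0 : 0 < ξ) (hξ : 2 * ξ ^ 2 < y ^ 2) (ϕ : ℝ) :
    angle y ξ (timeMap y ξ ϕ) = ϕ :=
  Function.leftInverse_invFun (strictMono_timeMap hy hξ0 hξ).injective ϕ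

lemma continuous_angle (hy : 0 < y) (hξ0 : 0 < ξ) (hξ : 2 * ξ ^ 2 < y ^ 2) :
    Continuous (angle y ξ) := by
  have hm : StrictMono (angle y ξ) := fun s t hst => by
    rw [← (strictMono_timeMap hy hξ0 hξ).lt_iff_lt, timeMap_angle hy hξ0 hξ,
      timeMap_angle hy hξ0 hξ]
    exact hst
  exact hm.monotone.continuous_of_surjective fun ϕ => ⟨_, angle_timeMap hy hξ0 hξ ϕ⟩

lemma hasDerivAt_angle (hy : 0 < y) (hξ0 : 0 < ξ) (hξ : 2 * ξ ^ 2 < y ^ 2) (t : ℝ) :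
    HasDerivAt (angle y ξ) (levelΨ y ξ (angle y ξ t) / levelJ y ξ (angle y ξ t)) t := by
  have h := HasDerivAt.of_local_left_inverse (continuous_angle hy hξ0 hξ).continuousAt
    (hasDerivAt_timeMap hy hξ (angle y ξ t)) (slowness_pos hy hξ0 hξ _).ne'
    (Eventually.of_forall (timeMap_angle hy hξ0 hξ))
  rwa [slowness, inv_div] at h

lemma angle_zero (hy : 0 < y) (hξ0 : 0 < ξ) (hξ : 2 * ξ ^ 2 < y ^ 2) : angle y ξ 0 = π / 2 := by
  rw [← timeMap_self (y := y) (ξ := ξ), angle_timeMap hy hξ0 hξ]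

lemma angle_add_halfPeriod (hy : 0 < y) (hξ0 : 0 < ξ) (hξ : 2 * ξ ^ 2 < y ^ 2) (t : ℝ) :
    angle y ξ (t + halfPeriod y ξ) = angle y ξ t + π := by
  conv_lhs => rw [← timeMap_angle hy hξ0 hξ t, ← timeMap_add_pi hy hξ, angle_timeMap hy hξ0 hξ]

lemma isPointVortexOrbit_angle (hy : 0 < y) (hξ0 : 0 < ξ) (hξ : 2 * ξ ^ 2 < y ^ 2) :
    IsPointVortexOrbit y ξ (fun t => levelJ y ξ (angle y ξ t)) (angle y ξ) where
  J_zero := by rw [angle_zero hy hξ0 hξ, levelJ_pi_div_two hy]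
  ϕ_zero := angle_zero hy hξ0 hξ
  J_deriv t := by
    have h := (hasDerivAt_levelJ hy hξ (angle y ξ t)).comp t (hasDerivAt_angle hy hξ0 hξ t)
    refine h.congr_deriv ?_
    have h1 := (levelJ_pos hy hξ0 hξ (angle y ξ t)).ne'
    have h2 := (levelΨ_pos hy hξ (angle y ξ t)).ne'
    change _ = -(1 / denS y ξ (angle y ξ t) + 1 / denC y ξ (angle y ξ t)) * _ * _
    field_simp
  ϕ_deriv t := by
    have h := hasDerivAt_angle hy hξ0 hξ t
    rw [← levelΨ_div_levelJ hy hξ0 hξ] at h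
    exact h

/-- The vector field of the point vortex system. -/
def vortexField (y : ℝ) (p : ℝ × ℝ) : ℝ × ℝ :=
  (-(1 / (y ^ 2 - p.1 * sin p.2 ^ 2) + 1 / (y ^ 2 + p.1 * cos p.2 ^ 2)) * sin (2 * p.2) * p.1,
    1 / p.1 + sin p.2 ^ 2 / (y ^ 2 - p.1 * sin p.2 ^ 2) - cos p.2 ^ 2 / (y ^ 2 + p.1 * cos p.2 ^ 2))

lemma contDiffAt_vortexField {p : ℝ × ℝ} (h1 : p.1 ≠ 0) (h2 : y ^ 2 - p.1 * sin p.2 ^ 2 ≠ 0)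
    (h3 : y ^ 2 + p.1 * cos p.2 ^ 2 ≠ 0) : ContDiffAt ℝ 1 (vortexField y) p := by
  unfold vortexField
  fun_prop (disch := assumption)

/-- A competing solution might a priori meet a vanishing denominator. But the set of agreement is
closed, and it is open because the field is `C¹`, hence locally Lipschitz, near every point of the
explicit orbit. -/
lemma isPointVortexOrbit_unique (hy : 0 < y) (hξ0 : 0 < ξ) (hξ : 2 * ξ ^ 2 < y ^ 2)
    {J ϕ : ℝ → ℝ} (h : IsPointVortexOrbit y ξ J ϕ) :
    J = (fun t => levelJ y ξ (angle y ξ t)) ∧ ϕ = angle y ξ := by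
  have h₀ := isPointVortexOrbit_angle hy hξ0 hξ
  set f : ℝ → ℝ × ℝ := fun t => (J t, ϕ t)
  set g : ℝ → ℝ × ℝ := fun t => (levelJ y ξ (angle y ξ t), angle y ξ t)
  have hf : ∀ t, HasDerivAt f (vortexField y (f t)) t := fun t => (h.J_deriv t).prodMk (h.ϕ_deriv t)
  have hg : ∀ t, HasDerivAt g (vortexField y (g t)) t := fun t =>
    (h₀.J_deriv t).prodMk (h₀.ϕ_deriv t)
  have hfc : Continuous f := continuous_iff_continuousAt.2 fun t => (hf t).continuousAt
  have hgc : Continuous g := continuous_iff_continuousAt.2 fun t => (hg t).continuousAt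
  have hopen : IsOpen {t | f t = g t} := by
    rw [isOpen_iff_mem_nhds]
    intro t ht
    have hcd : ContDiffAt ℝ 1 (vortexField y) (g t) := contDiffAt_vortexField
      (levelJ_pos hy hξ0 hξ _).ne' (denS_pos hy hξ _).ne' (denC_pos hy hξ _).ne'
    obtain ⟨K, s, hs, hK⟩ := hcd.exists_lipschitzOnWith
    have hs' : s ∈ 𝓝 (f t) := by rw [show f t = g t from ht]; exact hs
    exact ODE_solution_unique_of_eventually (v := fun _ => vortexField y) (s := fun _ => s)
      (Eventually.of_forall fun _ => hK)
      ((Eventually.of_forall hf).and (hfc.continuousAt.eventually hs'))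
      ((Eventually.of_forall hg).and (hgc.continuousAt.eventually hs)) ht
  have hclopen : IsClopen {t | f t = g t} := ⟨isClosed_eq hfc hgc, hopen⟩
  have h0 : f 0 = g 0 := Prod.ext (h.J_zero.trans h₀.J_zero.symm) (h.ϕ_zero.trans h₀.ϕ_zero.symm)
  have huniv := hclopen.eq_univ ⟨0, h0⟩
  have hall : ∀ t, f t = g t := eq_univ_iff_forall.1 huniv
  exact ⟨funext fun t => congrArg Prod.fst (hall t), funext fun t => congrArg Prod.snd (hall t)⟩

lemma orbit_eq (hy : 0 < y) (hξ0 : 0 < ξ) (hξ : 2 * ξ ^ 2 < y ^ 2) :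
    orbit y ξ = (fun t => levelJ y ξ (angle y ξ t), angle y ξ) := by
  have h := Classical.epsilon_spec (p := fun γ : (ℝ → ℝ) × (ℝ → ℝ) => IsPointVortexOrbit y ξ γ.1 γ.2)
    ⟨(fun t => levelJ y ξ (angle y ξ t), angle y ξ), isPointVortexOrbit_angle hy hξ0 hξ⟩
  obtain ⟨h1, h2⟩ := isPointVortexOrbit_unique hy hξ0 hξ h
  exact Prod.ext h1 h2

/-- The infimum is over a single point: the increment `2π` of the angle from `t = 0` determines the
time, the time map being a function of the angle. -/
lemma period_eq (hy : 0 < y) (hξ0 : 0 < ξ) (hξ : 2 * ξ ^ 2 < y ^ 2) :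
    period y ξ = 2 * halfPeriod y ξ := by
  have hT : ∀ t, angle y ξ (t + 2 * halfPeriod y ξ) = angle y ξ t + 2 * π := fun t => by
    rw [two_mul, ← add_assoc, angle_add_halfPeriod hy hξ0 hξ, angle_add_halfPeriod hy hξ0 hξ]
    ring
  have hset : {T : ℝ | 0 < T ∧ ∀ t, (orbit y ξ).1 (t + T) = (orbit y ξ).1 t ∧
      (orbit y ξ).2 (t + T) = (orbit y ξ).2 t + 2 * π} = {2 * halfPeriod y ξ} := by
    ext T
    simp only [mem_ofPred_eq, mem_singleton_iff, orbit_eq hy hξ0 hξ]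
    constructor
    · rintro ⟨-, h⟩
      have h1 := (h 0).2
      rw [← hT 0, zero_add, zero_add] at h1
      rw [← timeMap_angle hy hξ0 hξ T, h1, timeMap_angle hy hξ0 hξ]
    · rintro rfl
      refine ⟨by linarith [halfPeriod_pos hy hξ0 hξ], fun t => ⟨?_, hT t⟩⟩
      rw [hT, two_mul, ← add_assoc, levelJ_add_pi, levelJ_add_pi]
  rw [period, hset, csInf_singleton]

lemma omega_eq (hy : 0 < y) (hξ0 : 0 < ξ) (hξ : 2 * ξ ^ 2 < y ^ 2) :
    omega y ξ = π / halfPeriod y ξ := by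
  have := (halfPeriod_pos hy hξ0 hξ).ne'
  rw [omega, period_eq hy hξ0 hξ]
  field_simp

lemma omega_pos (hy : 0 < y) (hξ0 : 0 < ξ) (hξ : 2 * ξ ^ 2 < y ^ 2) : 0 < omega y ξ := by
  rw [omega_eq hy hξ0 hξ]
  exact div_pos pi_pos (halfPeriod_pos hy hξ0 hξ)

lemma Theta_eq (hy : 0 < y) (hξ0 : 0 < ξ) (hξ : 2 * ξ ^ 2 < y ^ 2) (φ : ℝ) :
    Theta y ξ φ = angle y ξ (φ / omega y ξ) := by
  rw [Theta, orbit_eq hy hξ0 hξ]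

lemma q_eq (hy : 0 < y) (hξ0 : 0 < ξ) (hξ : 2 * ξ ^ 2 < y ^ 2) (φ : ℝ) :
    q y ξ φ = levelJ y ξ (Theta y ξ φ) := by
  rw [Theta_eq hy hξ0 hξ, q, orbit_eq hy hξ0 hξ]

lemma Theta_zero (hy : 0 < y) (hξ0 : 0 < ξ) (hξ : 2 * ξ ^ 2 < y ^ 2) : Theta y ξ 0 = π / 2 := by
  rw [Theta_eq hy hξ0 hξ, zero_div, angle_zero hy hξ0 hξ]

lemma Theta_add_pi (hy : 0 < y) (hξ0 : 0 < ξ) (hξ : 2 * ξ ^ 2 < y ^ 2) (φ : ℝ) :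
    Theta y ξ (φ + π) = Theta y ξ φ + π := by
  have h : (φ + π) / omega y ξ = φ / omega y ξ + halfPeriod y ξ := by
    have := (halfPeriod_pos hy hξ0 hξ).ne'
    rw [omega_eq hy hξ0 hξ]
    field_simp
  rw [Theta_eq hy hξ0 hξ, Theta_eq hy hξ0 hξ, h, angle_add_halfPeriod hy hξ0 hξ]

lemma Theta_two_pi (hy : 0 < y) (hξ0 : 0 < ξ) (hξ : 2 * ξ ^ 2 < y ^ 2) (φ : ℝ) :
    Theta y ξ (φ + 2 * π) = Theta y ξ φ + 2 * π := by
  rw [two_mul, ← add_assoc, Theta_add_pi hy hξ0 hξ, Theta_add_pi hy hξ0 hξ]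
  ring

lemma hasDerivAt_Theta (hy : 0 < y) (hξ0 : 0 < ξ) (hξ : 2 * ξ ^ 2 < y ^ 2) (φ : ℝ) :
    HasDerivAt (Theta y ξ) ((slowness y ξ (Theta y ξ φ))⁻¹ * (omega y ξ)⁻¹) φ := by
  have h1 : HasDerivAt (fun φ : ℝ => φ / omega y ξ) ((omega y ξ)⁻¹) φ := by
    simpa using (hasDerivAt_id φ).div_const (omega y ξ)
  have h2 := (hasDerivAt_angle hy hξ0 hξ (φ / omega y ξ)).comp φ h1
  have h3 : Theta y ξ = angle y ξ ∘ fun φ : ℝ => φ / omega y ξ :=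
    funext (Theta_eq hy hξ0 hξ)
  rw [h3, slowness, inv_div]
  exact h2

end Orbit

end

section

open Set Filter Topology Complex

/-! ### Holomorphic extension of the coefficients -/

section Holomorphic

attribute [local fun_prop] analyticAt_fst analyticAt_snd

/-- Holomorphic extension of `levelP`. -/
def cP (y : ℝ) (z ϕ : ℂ) : ℂ := y ^ 4 - 2 * y ^ 2 * z ^ 2 * cos ϕ ^ 2

/-- Holomorphic extension of `levelR`. -/
def cR (y : ℝ) (z ϕ : ℂ) : ℂ := cP y z ϕ ^ 2 + 4 * y ^ 4 * z ^ 4 * (sin ϕ * cos ϕ) ^ 2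

/-- Holomorphic extension of `levelj`. -/
def cj (y : ℝ) (z ϕ : ℂ) : ℂ := 2 * y ^ 4 / (cP y z ϕ + cR y z ϕ ^ (1 / 2 : ℂ))

/-- Holomorphic extension of `√J`. -/
def cr (y : ℝ) (z ϕ : ℂ) : ℂ := z * cj y z ϕ ^ (1 / 2 : ℂ)

/-- Holomorphic extension of `levelJ`. -/
def cJ (y : ℝ) (z ϕ : ℂ) : ℂ := z ^ 2 * cj y z ϕ

/-- Holomorphic extension of `denS`. -/
def cS (y : ℝ) (z ϕ : ℂ) : ℂ := y ^ 2 - cJ y z ϕ * sin ϕ ^ 2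

/-- Holomorphic extension of `denC`. -/
def cC (y : ℝ) (z ϕ : ℂ) : ℂ := y ^ 2 + cJ y z ϕ * cos ϕ ^ 2

/-- Holomorphic extension of `levelΨ`. -/
def cΨ (y : ℝ) (z ϕ : ℂ) : ℂ := y ^ 2 / cS y z ϕ + y ^ 2 / cC y z ϕ - 1

/-- Holomorphic extension of `1 / w₃²`. -/
def g₃ (y : ℝ) (z ϕ : ℂ) : ℂ := -(1 / (cr y z ϕ * sin ϕ + y) ^ 2)

/-- Holomorphic extension of `1 / w₄²` (for `i = I`) or of its conjugate (for `i = -I`). -/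
def g₄ (y : ℝ) (i z ϕ : ℂ) : ℂ := 1 / (cr y z ϕ * cos ϕ + i * y) ^ 2

/-- `e^{-2iϕ}`. -/
def g₀ (i ϕ : ℂ) : ℂ := exp (-(2 * i * ϕ))

variable {y ξ : ℝ}

lemma cP_ofReal (ϕ : ℝ) : cP y ξ ϕ = levelP y ξ ϕ := by simp [cP, levelP]

lemma cR_ofReal (ϕ : ℝ) : cR y ξ ϕ = levelR y ξ ϕ := by simp [cR, levelR, cP_ofReal]

lemma ofReal_cpow_half {x : ℝ} (hx : 0 ≤ x) : (x : ℂ) ^ (1 / 2 : ℂ) = (√x : ℝ) := by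
  rw [Real.sqrt_eq_rpow, Complex.ofReal_cpow hx]
  simp

lemma cj_ofReal (hy : 0 < y) (hξ : 2 * ξ ^ 2 < y ^ 2) (ϕ : ℝ) : cj y ξ ϕ = levelj y ξ ϕ := by
  rw [cj, cP_ofReal, cR_ofReal, ofReal_cpow_half (levelR_pos hy hξ ϕ).le, levelj]
  simp

lemma cJ_ofReal (hy : 0 < y) (hξ : 2 * ξ ^ 2 < y ^ 2) (ϕ : ℝ) : cJ y ξ ϕ = levelJ y ξ ϕ := by
  rw [cJ, cj_ofReal hy hξ, levelJ]
  simp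

lemma cS_ofReal (hy : 0 < y) (hξ : 2 * ξ ^ 2 < y ^ 2) (ϕ : ℝ) : cS y ξ ϕ = denS y ξ ϕ := by
  rw [cS, cJ_ofReal hy hξ, denS]
  simp

lemma cC_ofReal (hy : 0 < y) (hξ : 2 * ξ ^ 2 < y ^ 2) (ϕ : ℝ) : cC y ξ ϕ = denC y ξ ϕ := by
  rw [cC, cJ_ofReal hy hξ, denC]
  simp

lemma cΨ_ofReal (hy : 0 < y) (hξ : 2 * ξ ^ 2 < y ^ 2) (ϕ : ℝ) : cΨ y ξ ϕ = levelΨ y ξ ϕ := by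
  rw [cΨ, cS_ofReal hy hξ, cC_ofReal hy hξ, levelΨ]
  simp

/-- Signed square root of `J`. -/
def levelr (y ξ ϕ : ℝ) : ℝ := ξ * √(levelj y ξ ϕ)

lemma cr_ofReal (hy : 0 < y) (hξ : 2 * ξ ^ 2 < y ^ 2) (ϕ : ℝ) : cr y ξ ϕ = levelr y ξ ϕ := by
  rw [cr, cj_ofReal hy hξ, ofReal_cpow_half (levelj_pos hy hξ ϕ).le, levelr]
  simp

lemma levelr_sq (hy : 0 < y) (hξ : 2 * ξ ^ 2 < y ^ 2) (ϕ : ℝ) :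
    levelr y ξ ϕ ^ 2 = levelJ y ξ ϕ := by
  rw [levelr, mul_pow, Real.sq_sqrt (levelj_pos hy hξ ϕ).le, levelJ]

lemma levelr_eq (hξ0 : 0 < ξ) (ϕ : ℝ) : levelr y ξ ϕ = √(levelJ y ξ ϕ) := by
  rw [levelr, levelJ, Real.sqrt_mul (sq_nonneg ξ), Real.sqrt_sq hξ0.le]

/-- `denS > 0` reads `r² sin² ϕ < y²`, which is insensitive to the sign of `ξ`; the continuation
through `ξ = 0` relies on this. -/
lemma levelr_sin_add_ne_zero (hy : 0 < y) (hξ : 2 * ξ ^ 2 < y ^ 2) (ϕ : ℝ) :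
    levelr y ξ ϕ * Real.sin ϕ + y ≠ 0 := by
  intro h
  have h1 := denS_pos hy hξ ϕ
  rw [denS, ← levelr_sq hy hξ] at h1
  have h2 : levelr y ξ ϕ * Real.sin ϕ = -y := by linarith
  have h3 : levelr y ξ ϕ ^ 2 * Real.sin ϕ ^ 2 = y ^ 2 := by rw [← mul_pow, h2]; ring
  linarith

lemma add_I_mul_ne_zero (hy : 0 < y) {i : ℂ} (hi : i = I ∨ i = -I) (x : ℝ) :
    (x : ℂ) + i * y ≠ 0 := by
  intro h
  have := congrArg Complex.im h
  rcases hi with rfl | rfl <;> simp at this <;> exact hy.ne' this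

lemma analyticAt_cP (p : ℂ × ℂ) : AnalyticAt ℂ (fun p : ℂ × ℂ => cP y p.1 p.2) p := by
  unfold cP
  fun_prop

lemma analyticAt_cR (p : ℂ × ℂ) : AnalyticAt ℂ (fun p : ℂ × ℂ => cR y p.1 p.2) p := by
  have := analyticAt_cP (y := y) p
  unfold cR
  fun_prop

lemma analyticAt_cj (hy : 0 < y) (hξ : 2 * ξ ^ 2 < y ^ 2) (ϕ : ℝ) :
    AnalyticAt ℂ (fun p : ℂ × ℂ => cj y p.1 p.2) (ξ, ϕ) := by
  have hR := levelR_pos hy hξ ϕ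
  have hP := levelP_pos hy hξ ϕ
  have h1 : AnalyticAt ℂ (fun p : ℂ × ℂ => cR y p.1 p.2 ^ (1 / 2 : ℂ)) (ξ, ϕ) :=
    (analyticAt_cR _).cpow analyticAt_const (by
      change cR y ξ ϕ ∈ slitPlane
      rw [cR_ofReal]
      exact ofReal_mem_slitPlane.2 hR)
  refine analyticAt_const.div ((analyticAt_cP _).add h1) ?_
  change cP y ξ ϕ + cR y ξ ϕ ^ (1 / 2 : ℂ) ≠ 0
  rw [cP_ofReal, cR_ofReal, ofReal_cpow_half hR.le, ← ofReal_add, ofReal_ne_zero]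
  positivity

lemma analyticAt_cr (hy : 0 < y) (hξ : 2 * ξ ^ 2 < y ^ 2) (ϕ : ℝ) :
    AnalyticAt ℂ (fun p : ℂ × ℂ => cr y p.1 p.2) (ξ, ϕ) :=
  analyticAt_fst.mul ((analyticAt_cj hy hξ ϕ).cpow analyticAt_const (by
    change cj y ξ ϕ ∈ slitPlane
    rw [cj_ofReal hy hξ]
    exact ofReal_mem_slitPlane.2 (levelj_pos hy hξ ϕ)))

lemma analyticAt_cJ (hy : 0 < y) (hξ : 2 * ξ ^ 2 < y ^ 2) (ϕ : ℝ) :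
    AnalyticAt ℂ (fun p : ℂ × ℂ => cJ y p.1 p.2) (ξ, ϕ) :=
  (analyticAt_fst.pow 2).mul (analyticAt_cj hy hξ ϕ)

lemma analyticAt_cΨ (hy : 0 < y) (hξ : 2 * ξ ^ 2 < y ^ 2) (ϕ : ℝ) :
    AnalyticAt ℂ (fun p : ℂ × ℂ => cΨ y p.1 p.2) (ξ, ϕ) := by
  have hJ := analyticAt_cJ hy hξ ϕ
  have h1 : cS y ξ ϕ ≠ 0 := by
    rw [cS_ofReal hy hξ, ofReal_ne_zero]
    exact (denS_pos hy hξ ϕ).ne'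
  have h2 : cC y ξ ϕ ≠ 0 := by
    rw [cC_ofReal hy hξ, ofReal_ne_zero]
    exact (denC_pos hy hξ ϕ).ne'
  unfold cS at h1
  unfold cC at h2
  unfold cΨ cS cC
  fun_prop (disch := assumption)

lemma cΨ_ne_zero (hy : 0 < y) (hξ : 2 * ξ ^ 2 < y ^ 2) (ϕ : ℝ) : cΨ y ξ ϕ ≠ 0 := by
  rw [cΨ_ofReal hy hξ, ofReal_ne_zero]
  exact (levelΨ_pos hy hξ ϕ).ne'

lemma analyticAt_g₃ (hy : 0 < y) (hξ : 2 * ξ ^ 2 < y ^ 2) (ϕ : ℝ) :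
    AnalyticAt ℂ (fun p : ℂ × ℂ => g₃ y p.1 p.2) (ξ, ϕ) := by
  have h1 := analyticAt_cr hy hξ ϕ
  have h2 : (cr y ξ ϕ * sin ϕ + y) ^ 2 ≠ 0 := by
    rw [cr_ofReal hy hξ]
    have := levelr_sin_add_ne_zero hy hξ ϕ
    exact pow_ne_zero 2 (by exact_mod_cast this)
  unfold g₃
  fun_prop (disch := assumption)

lemma analyticAt_g₄ (hy : 0 < y) (hξ : 2 * ξ ^ 2 < y ^ 2) (ϕ : ℝ) {i : ℂ} (hi : i = I ∨ i = -I) :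
    AnalyticAt ℂ (fun p : ℂ × ℂ => g₄ y i p.1 p.2) (ξ, ϕ) := by
  have h1 := analyticAt_cr hy hξ ϕ
  have h2 : (cr y ξ ϕ * cos ϕ + i * y) ^ 2 ≠ 0 := by
    rw [cr_ofReal hy hξ]
    have := add_I_mul_ne_zero hy hi (levelr y ξ ϕ * Real.cos ϕ)
    exact pow_ne_zero 2 (by push_cast at this; exact this)
  unfold g₄
  fun_prop (disch := assumption)

/-- Entries of the linear system with respect to the angle, in the rotating frame. -/
def b₁ (y : ℝ) (i z ϕ : ℂ) : ℂ := cJ y z ϕ / cΨ y z ϕ * (i / 2 * g₃ y z ϕ)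

/-- Entries of the linear system with respect to the angle, in the rotating frame. -/
def b₂ (y : ℝ) (i z ϕ : ℂ) : ℂ :=
  1 / cΨ y z ϕ * (-(i / 4) * (g₀ i ϕ - cJ y z ϕ * g₃ y z ϕ - cJ y z ϕ * g₄ y i z ϕ))

/-- Entries of the linear system with respect to the angle, in the rotating frame. -/
def b₃ (y : ℝ) (i z ϕ : ℂ) : ℂ := cJ y z ϕ / cΨ y z ϕ * (-(i / 2) * g₄ y i z ϕ)

/-- Entries of the linear system with respect to the angle, in the rotating frame. -/
def b₄ (y : ℝ) (i z ϕ : ℂ) : ℂ := 1 / cΨ y z ϕ * (i / 2 * g₀ i ϕ)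

/-- The matrix of the linear system with respect to the angle, in the rotating frame. -/
def Bmat (y : ℝ) (z ϕ : ℂ) : Matrix (Fin 4) (Fin 4) ℂ :=
  let ψ := ϕ + Real.pi
  !![b₁ y I z ϕ, b₂ y I z ϕ, b₃ y I z ϕ, b₄ y I z ϕ;
     b₂ y (-I) z ϕ, b₁ y (-I) z ϕ, b₄ y (-I) z ϕ, b₃ y (-I) z ϕ;
     b₃ y I z ψ, b₄ y I z ψ, b₁ y I z ψ, b₂ y I z ψ;
     b₄ y (-I) z ψ, b₃ y (-I) z ψ, b₂ y (-I) z ψ, b₁ y (-I) z ψ]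

/-- `ξ` may be zero or negative: in the angle variable the singular factor `1/J` has been cancelled
by the slowness `J/Ψ`, and `ω₀` does not appear. -/
lemma analyticAt_Bmat (hy : 0 < y) (hξ : 2 * ξ ^ 2 < y ^ 2) (ϕ : ℝ) (k l : Fin 4) :
    AnalyticAt ℂ (fun p : ℂ × ℂ => Bmat y p.1 p.2 k l) (ξ, ϕ) := by
  have key : ∀ (i : ℂ), (i = I ∨ i = -I) → ∀ ϕ : ℝ,
      AnalyticAt ℂ (fun p : ℂ × ℂ => b₁ y i p.1 p.2) (ξ, ϕ) ∧
      AnalyticAt ℂ (fun p : ℂ × ℂ => b₂ y i p.1 p.2) (ξ, ϕ) ∧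
      AnalyticAt ℂ (fun p : ℂ × ℂ => b₃ y i p.1 p.2) (ξ, ϕ) ∧
      AnalyticAt ℂ (fun p : ℂ × ℂ => b₄ y i p.1 p.2) (ξ, ϕ) := by
    intro i hi ϕ
    have h1 := analyticAt_cJ hy hξ ϕ
    have h2 := analyticAt_cΨ hy hξ ϕ
    have h3 := analyticAt_g₃ hy hξ ϕ
    have h4 := analyticAt_g₄ hy hξ ϕ hi
    have h5 := cΨ_ne_zero hy hξ ϕ
    have h6 : AnalyticAt ℂ (fun p : ℂ × ℂ => g₀ i p.2) ((ξ : ℂ), (ϕ : ℂ)) := by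
      unfold g₀
      fun_prop
    unfold b₁ b₂ b₃ b₄
    refine ⟨?_, ?_, ?_, ?_⟩ <;> fun_prop (disch := assumption)
  have hI := key I (Or.inl rfl)
  have hI' := key (-I) (Or.inr rfl)
  have shift : ∀ f : ℂ → ℂ → ℂ, AnalyticAt ℂ (fun p : ℂ × ℂ => f p.1 p.2) (ξ, (ϕ + Real.pi : ℝ)) →
      AnalyticAt ℂ (fun p : ℂ × ℂ => f p.1 (p.2 + Real.pi)) (ξ, ϕ) := by
    intro f hf
    have h : AnalyticAt ℂ (fun p : ℂ × ℂ => (p.1, p.2 + (Real.pi : ℂ))) ((ξ : ℂ), (ϕ : ℂ)) := by fun_prop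
    exact AnalyticAt.comp (g := fun p : ℂ × ℂ => f p.1 p.2) (by simpa using hf) h
  have a1 := hI ϕ
  have a2 := hI' ϕ
  have a3 := hI (ϕ + Real.pi)
  have a4 := hI' (ϕ + Real.pi)
  fin_cases k <;> fin_cases l
  exacts [a1.1, a1.2.1, a1.2.2.1, a1.2.2.2, a2.2.1, a2.1, a2.2.2.2, a2.2.2.1,
    shift (b₃ y I) a3.2.2.1, shift (b₄ y I) a3.2.2.2, shift (b₁ y I) a3.1, shift (b₂ y I) a3.2.1,
    shift (b₄ y (-I)) a4.2.2.2, shift (b₃ y (-I)) a4.2.2.1, shift (b₂ y (-I)) a4.2.1,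
    shift (b₁ y (-I)) a4.1]

end Holomorphic

end

/-! ### The coefficients of the system in the angle variable -/

section

open Set Filter Topology Complex ComplexConjugate

section Coefficients

variable {y ξ : ℝ}

lemma conj_cΨ (hy : 0 < y) (hξ : 2 * ξ ^ 2 < y ^ 2) (ϕ : ℝ) : conj (cΨ y ξ ϕ) = cΨ y ξ ϕ := by
  rw [cΨ_ofReal hy hξ, conj_ofReal]

lemma conj_cJ (hy : 0 < y) (hξ : 2 * ξ ^ 2 < y ^ 2) (ϕ : ℝ) : conj (cJ y ξ ϕ) = cJ y ξ ϕ := by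
  rw [cJ_ofReal hy hξ, conj_ofReal]

lemma conj_g₃ (hy : 0 < y) (hξ : 2 * ξ ^ 2 < y ^ 2) (ϕ : ℝ) : conj (g₃ y ξ ϕ) = g₃ y ξ ϕ := by
  simp [g₃, cr_ofReal hy hξ, ← ofReal_sin]

lemma conj_g₄ (hy : 0 < y) (hξ : 2 * ξ ^ 2 < y ^ 2) (i : ℂ) (ϕ : ℝ) :
    conj (g₄ y i ξ ϕ) = g₄ y (conj i) ξ ϕ := by
  simp [g₄, cr_ofReal hy hξ, ← ofReal_cos]

lemma conj_g₀ (i : ℂ) (ϕ : ℝ) : conj (g₀ i ϕ) = g₀ (conj i) ϕ := by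
  simp [g₀, ← exp_conj, conj_ofNat]

lemma conj_b (hy : 0 < y) (hξ : 2 * ξ ^ 2 < y ^ 2) (ϕ : ℝ) :
    conj (b₁ y I ξ ϕ) = b₁ y (-I) ξ ϕ ∧ conj (b₂ y I ξ ϕ) = b₂ y (-I) ξ ϕ ∧
    conj (b₃ y I ξ ϕ) = b₃ y (-I) ξ ϕ ∧ conj (b₄ y I ξ ϕ) = b₄ y (-I) ξ ϕ := by
  simp [b₁, b₂, b₃, b₄, conj_cΨ hy hξ, conj_cJ hy hξ, conj_g₃ hy hξ, conj_g₄ hy hξ, conj_g₀, conj_ofNat]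

lemma inv_w₃_sq (hy : 0 < y) (hξ0 : 0 < ξ) (hξ : 2 * ξ ^ 2 < y ^ 2) (φ : ℝ) :
    1 / w₃ y ξ φ ^ 2 = g₃ y ξ (Theta y ξ φ) := by
  have h : w₃ y ξ φ = I * (levelr y ξ (Theta y ξ φ) * sin (Theta y ξ φ) + y) := by
    rw [w₃, q_eq hy hξ0 hξ, ← levelr_eq hξ0]
    push_cast
    ring
  rw [h, g₃, cr_ofReal hy hξ, mul_pow, I_sq, neg_one_mul, one_div_neg_eq_neg_one_div]

lemma inv_w₄_sq (hy : 0 < y) (hξ0 : 0 < ξ) (hξ : 2 * ξ ^ 2 < y ^ 2) (φ : ℝ) :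
    1 / w₄ y ξ φ ^ 2 = g₄ y I ξ (Theta y ξ φ) := by
  rw [w₄, q_eq hy hξ0 hξ, ← levelr_eq hξ0, g₄, cr_ofReal hy hξ]
  push_cast
  ring

lemma κ_eq (hy : 0 < y) (hξ0 : 0 < ξ) (hξ : 2 * ξ ^ 2 < y ^ 2) (φ : ℝ) :
    κ y ξ φ = exp (2 * I * φ) * (g₀ I (Theta y ξ φ) / cJ y ξ (Theta y ξ φ)) := by
  rw [κ, q_eq hy hξ0 hξ, cJ_ofReal hy hξ, g₀, ThetaHat, mul_div_assoc', ← exp_add]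
  push_cast
  ring_nf

lemma β_eq (hy : 0 < y) (hξ0 : 0 < ξ) (hξ : 2 * ξ ^ 2 < y ^ 2) (φ : ℝ) :
    β y ξ φ = exp (2 * I * φ) * (g₀ I (Theta y ξ φ) / cJ y ξ (Theta y ξ φ) -
      g₃ y ξ (Theta y ξ φ) - g₄ y I ξ (Theta y ξ φ)) := by
  rw [β, κ_eq hy hξ0 hξ, ← inv_w₃_sq hy hξ0 hξ, ← inv_w₄_sq hy hξ0 hξ]
  ring

lemma cJ_ne_zero (hy : 0 < y) (hξ0 : 0 < ξ) (hξ : 2 * ξ ^ 2 < y ^ 2) (ϕ : ℝ) : cJ y ξ ϕ ≠ 0 := by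
  rw [cJ_ofReal hy hξ, ofReal_ne_zero]
  exact (levelJ_pos hy hξ0 hξ ϕ).ne'

/-- The derivative of the angle with respect to `φ = ω₀ t`. -/
def angleSpeed (y ξ φ : ℝ) : ℝ := (slowness y ξ (Theta y ξ φ))⁻¹ * (omega y ξ)⁻¹

lemma angleSpeed_eq (hy : 0 < y) (hξ : 2 * ξ ^ 2 < y ^ 2) (φ : ℝ) :
    (angleSpeed y ξ φ : ℂ) =
      cΨ y ξ (Theta y ξ φ) / (cJ y ξ (Theta y ξ φ) * omega y ξ) := by
  rw [angleSpeed, slowness, cΨ_ofReal hy hξ, cJ_ofReal hy hξ]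
  push_cast
  rw [inv_div]
  ring

lemma ρ_eq (hy : 0 < y) (hξ0 : 0 < ξ) (hξ : 2 * ξ ^ 2 < y ^ 2) (φ : ℝ) :
    ρ₁ y ξ φ = I + b₁ y I ξ (Theta y ξ φ) * angleSpeed y ξ φ ∧
    ρ₂ y ξ φ = exp (2 * I * φ) * (b₂ y I ξ (Theta y ξ φ) * angleSpeed y ξ φ) ∧
    ρ₃ y ξ φ = b₃ y I ξ (Theta y ξ φ) * angleSpeed y ξ φ ∧
    ρ₄ y ξ φ = exp (2 * I * φ) * (b₄ y I ξ (Theta y ξ φ) * angleSpeed y ξ φ) := by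
  have h1 := cΨ_ne_zero hy hξ (Theta y ξ φ)
  have h2 := cJ_ne_zero hy hξ0 hξ (Theta y ξ φ)
  have h3 : (omega y ξ : ℂ) ≠ 0 := ofReal_ne_zero.2 (omega_pos hy hξ0 hξ).ne'
  have e3 := inv_w₃_sq hy hξ0 hξ φ
  have e4 := inv_w₄_sq hy hξ0 hξ φ
  have e1 : 1 / (2 * w₃ y ξ φ ^ 2) = 1 / 2 * g₃ y ξ (Theta y ξ φ) := by rw [← e3]; ring
  have e2 : I / (2 * (omega y ξ : ℂ) * w₄ y ξ φ ^ 2) =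
      I / (2 * (omega y ξ : ℂ)) * g₄ y I ξ (Theta y ξ φ) := by rw [← e4]; ring
  rw [angleSpeed_eq hy hξ, ρ₁, ρ₂, ρ₃, ρ₄, e1, e2, β_eq hy hξ0 hξ, κ_eq hy hξ0 hξ, b₁, b₂, b₃, b₄]
  refine ⟨?_, ?_, ?_, ?_⟩ <;> field_simp

/-- The diagonal of the rotating frame. -/
def frame (φ : ℝ) (k : Fin 4) : ℂ := ![exp (I * φ), exp (-(I * φ)), exp (I * φ), exp (-(I * φ))] k

/-- The generator of the rotating frame. -/
def frameGen (k : Fin 4) : ℂ := ![I, -I, I, -I] k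

lemma frame_ne_zero (φ : ℝ) (k : Fin 4) : frame φ k ≠ 0 := by
  fin_cases k <;> simp [frame]

lemma hasDerivAt_frame (φ : ℝ) (k : Fin 4) :
    HasDerivAt (fun φ => frame φ k) (frameGen k * frame φ k) φ := by
  have h : HasDerivAt (fun φ : ℝ => I * (φ : ℂ)) I φ := by
    simpa using (hasDerivAt_id φ).ofReal_comp.const_mul I
  have h1 : HasDerivAt (fun φ : ℝ => exp (I * φ)) (I * exp (I * φ)) φ := by
    simpa [mul_comm] using h.cexp
  have h2 : HasDerivAt (fun φ : ℝ => exp (-(I * φ))) (-I * exp (-(I * φ))) φ := by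
    simpa [mul_comm] using h.neg.cexp
  fin_cases k
  exacts [h1, h2, h1, h2]

/-- The relation `A D = D' + D B Θ'`: the summand `i` of `ρ₁` is the derivative of the frame, and
the phases `e^{2iφ}` of `ρ₂`, `ρ₄` are those it removes. Since `e^{2iφ}` is π-periodic, the same
frame serves the delayed components. -/
lemma A_mul_frame (hy : 0 < y) (hξ0 : 0 < ξ) (hξ : 2 * ξ ^ 2 < y ^ 2) (φ : ℝ) (k l : Fin 4) :
    A y ξ φ k l * frame φ l = (if k = l then frameGen k * frame φ k else 0) +
      frame φ k * (Bmat y ξ (Theta y ξ φ) k l * angleSpeed y ξ φ) := by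
  obtain ⟨r1, r2, r3, r4⟩ := ρ_eq hy hξ0 hξ φ
  obtain ⟨s1, s2, s3, s4⟩ := ρ_eq hy hξ0 hξ (φ + Real.pi)
  obtain ⟨c1, c2, c3, c4⟩ := conj_b hy hξ (Theta y ξ φ)
  obtain ⟨d1, d2, d3, d4⟩ := conj_b hy hξ (Theta y ξ φ + Real.pi)
  have hsp : angleSpeed y ξ (φ + Real.pi) = angleSpeed y ξ φ := by
    rw [angleSpeed, angleSpeed, Theta_add_pi hy hξ0 hξ, periodic_slowness]
  have hexp : exp (2 * I * (φ + Real.pi : ℝ)) = exp (2 * I * φ) := by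
    rw [show 2 * I * ((φ + Real.pi : ℝ) : ℂ) = 2 * I * φ + 2 * Real.pi * I by push_cast; ring,
      exp_periodic]
  rw [Theta_add_pi hy hξ0 hξ, hsp] at s1 s2 s3 s4
  rw [hexp] at s2 s4
  have hconj : conj (exp (2 * I * φ)) = (exp (I * φ))⁻¹ * (exp (I * φ))⁻¹ := by
    rw [← exp_conj, ← exp_neg, ← exp_add]
    congr 1
    simp [conj_ofNat]
    ring
  have e1 : exp (2 * I * φ) = exp (I * φ) * exp (I * φ) := by rw [← exp_add]; ring_nf
  have e3 : exp (I * φ) ≠ 0 := exp_ne_zero _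
  rw [e1] at r2 r4 s2 s4 hconj
  push_cast at s1 s2 s3 s4 d1 d2 d3 d4
  fin_cases k <;> fin_cases l <;>
    simp only [A, frame, frameGen, Bmat, r1, r2, r3, r4, s1, s2, s3, s4, c1, c2, c3, c4, d1, d2, d3,
      d4, hconj, exp_neg, map_add, map_mul, conj_I, conj_ofReal, Matrix.of_apply, Matrix.cons_val',
      Matrix.cons_val_zero, Matrix.cons_val_one, Matrix.cons_val, Fin.zero_eta, Fin.mk_one,
      Fin.reduceFinMk, Fin.isValue] <;>
    simp <;> field_simp

end Coefficients

end

/-! ### The propagator and the analyticity of the characteristic determinant -/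

section

open Set Filter Topology Complex ComplexConjugate

section Monodromy

attribute [local instance] Matrix.linftyOpNormedRing Matrix.linftyOpNormedAlgebra

/-- The space of `4 × 4` complex matrices. -/
abbrev Mat4 := Matrix (Fin 4) (Fin 4) ℂ

/-- The `(i, j)` entry, as a continuous linear form. -/
def entryCLM (i j : Fin 4) : Mat4 →L[ℂ] ℂ :=
  LinearMap.toContinuousLinearMap (Matrix.entryLinearMap ℂ ℂ i j)

lemma sum_smul_single (M : Mat4) : M = ∑ i, ∑ j, M i j • Matrix.single i j (1 : ℂ) := by
  conv_lhs => rw [Matrix.matrix_eq_sum_single M]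
  simp

lemma hasDerivAt_matrix {N : ℝ → Mat4} {N' : Mat4} {t : ℝ} :
    HasDerivAt N N' t ↔ ∀ i j, HasDerivAt (fun t => N t i j) (N' i j) t := by
  refine ⟨fun h i j => ((entryCLM i j).restrictScalars ℝ).hasFDerivAt.comp_hasDerivAt t h,
    fun h => ?_⟩
  have h1 : HasDerivAt (fun t => ∑ i, ∑ j, N t i j • Matrix.single i j (1 : ℂ))
      (∑ i, ∑ j, N' i j • Matrix.single i j (1 : ℂ)) t :=
    HasDerivAt.fun_sum fun i _ => HasDerivAt.fun_sum fun j _ => (h i j).smul_const _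
  rw [← sum_smul_single] at h1
  exact h1.congr_of_eventuallyEq (Eventually.of_forall fun s => sum_smul_single _)

lemma continuousAt_matrix {X : Type*} [TopologicalSpace X] {N : X → Mat4} {x : X}
    (h : ∀ i j, ContinuousAt (fun t => N t i j) x) : ContinuousAt N x := by
  have h1 : ContinuousAt (fun t => ∑ i, ∑ j, N t i j • Matrix.single i j (1 : ℂ)) x :=
    tendsto_finsetSum _ fun i _ => tendsto_finsetSum _ fun j _ => (h i j).smul tendsto_const_nhds
  exact h1.congr (Eventually.of_forall fun s => (sum_smul_single _).symm)

lemma differentiableAt_matrix {N : ℂ → Mat4} {z : ℂ}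
    (h : ∀ i j, DifferentiableAt ℂ (fun t => N t i j) z) : DifferentiableAt ℂ N z := by
  have h1 : DifferentiableAt ℂ (fun t => ∑ i, ∑ j, N t i j • Matrix.single i j (1 : ℂ)) z :=
    DifferentiableAt.fun_sum fun i _ => DifferentiableAt.fun_sum fun j _ => (h i j).smul_const _
  exact h1.congr_of_eventuallyEq (Eventually.of_forall fun s => sum_smul_single _)

variable {y ξ : ℝ}

lemma continuous_Bmat_apply (hy : 0 < y) (hξ : 2 * ξ ^ 2 < y ^ 2) (i j : Fin 4) :
    Continuous fun ϕ : ℝ => Bmat y ξ ϕ i j := by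
  refine continuous_iff_continuousAt.2 fun ϕ => ?_
  exact ContinuousAt.comp (f := fun ϕ : ℝ => ((ξ : ℂ), (ϕ : ℂ)))
    (analyticAt_Bmat hy hξ ϕ i j).continuousAt (by fun_prop)

lemma continuous_Bmat (hy : 0 < y) (hξ : 2 * ξ ^ 2 < y ^ 2) :
    Continuous fun ϕ : ℝ => Bmat y ξ ϕ :=
  continuous_iff_continuousAt.2 fun _ =>
    continuousAt_matrix fun i j => (continuous_Bmat_apply hy hξ i j).continuousAt

/-- The fundamental matrix, in the rotating frame and with respect to the angle. -/
def propagator (y ξ : ℝ) : ℝ → Mat4 :=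
  Classical.epsilon fun N => N (Real.pi / 2) = 1 ∧ ∀ t : ℝ, HasDerivAt N (Bmat y ξ t * N t) t

lemma propagator_spec (hy : 0 < y) (hξ : 2 * ξ ^ 2 < y ^ 2) :
    propagator y ξ (Real.pi / 2) = 1 ∧
      ∀ t : ℝ, HasDerivAt (propagator y ξ) (Bmat y ξ t * propagator y ξ t) t :=
  Classical.epsilon_spec (exists_linear_ode_solution (continuous_Bmat hy hξ) (Real.pi / 2))

/-- The characteristic determinant, whose zeros form the exceptional set. -/
def charDet (y ξ : ℝ) : ℂ := (propagator y ξ (5 * Real.pi / 2) - 1).det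

lemma analyticAt_det {f : ℂ → Mat4} {z : ℂ} (hf : AnalyticAt ℂ f z) :
    AnalyticAt ℂ (fun w => (f w).det) z := by
  simp only [Matrix.det_apply]
  refine Finset.analyticAt_fun_sum _ fun σ _ => ?_
  have : AnalyticAt ℂ (fun w => ∏ i, f w (σ i) i) z :=
    Finset.analyticAt_fun_prod _ fun i _ => analyticAt_clm_comp (entryCLM (σ i) i) hf
  have h2 := (analyticAt_const (v := (((Equiv.Perm.sign σ : ℤˣ) : ℤ) : ℂ))).mul this
  refine h2.congr (Eventually.of_forall fun w => ?_)
  simp [Units.smul_def]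

lemma exists_analyticAt_charDet (hy : 0 < y) (hξ : 2 * ξ ^ 2 < y ^ 2) :
    ∃ G : ℂ → ℂ, AnalyticAt ℂ G ξ ∧ ∀ᶠ x : ℝ in 𝓝 ξ, G x = charDet y x := by
  -- One unit is added on both sides so that `π/2` and `5π/2` are interior points, as the uniqueness
  -- statement requires.
  set a : ℝ := Real.pi / 2 - 1
  set b : ℝ := 5 * Real.pi / 2 + 1
  have hpi := Real.pi_pos
  have hab : a ≤ b := by simp only [a, b]; linarith
  obtain ⟨g, hg, hgB⟩ := analyticAt_continuousMap (a := a) (b := b) (z₀ := (ξ : ℂ))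
    (f := fun z t => Bmat y z t) (by
      intro t _
      have h1 : ∀ i j, ∀ᶠ p : ℂ × ℝ in 𝓝 ((ξ : ℂ), t),
          AnalyticAt ℂ (fun p : ℂ × ℂ => Bmat y p.1 p.2 i j) (p.1, (p.2 : ℂ)) := fun i j =>
        (show ContinuousAt (fun p : ℂ × ℝ => (p.1, (p.2 : ℂ))) ((ξ : ℂ), t) by fun_prop).eventually
          (analyticAt_Bmat hy hξ t i j).eventually_analyticAt
      have h2 := eventually_all.2 fun i => eventually_all.2 (h1 i)
      filter_upwards [h2] with p hp
      refine ⟨continuousAt_matrix fun i j => ?_, differentiableAt_matrix fun i j => ?_⟩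
      · exact ContinuousAt.comp (f := fun p : ℂ × ℝ => (p.1, (p.2 : ℂ)))
          (g := fun p : ℂ × ℂ => Bmat y p.1 p.2 i j) (hp i j).continuousAt (by fun_prop)
      · exact DifferentiableAt.comp p.1 (f := fun z : ℂ => (z, (p.2 : ℂ)))
          (g := fun p : ℂ × ℂ => Bmat y p.1 p.2 i j) (hp i j).differentiableAt (by fun_prop))
  have ht₀ : Real.pi / 2 ∈ Ioo a b := ⟨by simp only [a]; linarith, by simp only [b]; linarith⟩
  have ht₁ : 5 * Real.pi / 2 ∈ Ioo a b := ⟨by simp only [a]; linarith, by simp only [b]; linarith⟩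
  set τ₀ : Icc a b := ⟨_, Ioo_subset_Icc_self ht₀⟩
  set τ₁ : Icc a b := ⟨_, Ioo_subset_Icc_self ht₁⟩
  have hsol : AnalyticAt ℂ (fun z => linSol hab τ₀ (g z) τ₁) ξ :=
    analyticAt_clm_comp (ContinuousMap.evalCLM ℂ τ₁) (analyticAt_linSol hab τ₀ hg)
  refine ⟨fun z => (linSol hab τ₀ (g z) τ₁ - 1).det, analyticAt_det (hsol.sub analyticAt_const), ?_⟩
  have h3 : ∀ᶠ x : ℝ in 𝓝 ξ, ∀ t : Icc a b, g x t = Bmat y x t :=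
    (continuous_ofReal.tendsto ξ).eventually hgB
  have h4 : ∀ᶠ x : ℝ in 𝓝 ξ, 2 * x ^ 2 < y ^ 2 :=
    (by fun_prop : Continuous fun x : ℝ => 2 * x ^ 2).continuousAt.eventually_lt_const hξ
  filter_upwards [h3, h4] with x hx hx2
  obtain ⟨hp0, hp⟩ := propagator_spec hy hx2
  have heq := linear_ode_unique (N := (linSol hab τ₀ (g x)).IccExtend hab) (N' := propagator y x)
    (continuous_Bmat hy hx2).continuousOn ht₀
    (fun t ht => by
      have := hasDerivAt_linSol hab τ₀ (g x) ht
      have h5 : (g x).IccExtend hab t = Bmat y x t := by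
        rw [ContinuousMap.coe_IccExtend, IccExtend_of_mem hab (g x) (Ioo_subset_Icc_self ht), hx]
      rwa [h5] at this)
    (fun t _ => hp t)
    (by
      rw [hp0, ContinuousMap.coe_IccExtend, IccExtend_of_mem hab _ (Ioo_subset_Icc_self ht₀)]
      exact linSol_self hab τ₀ (g x)) ht₁
  rw [ContinuousMap.coe_IccExtend, IccExtend_of_mem hab _ (Ioo_subset_Icc_self ht₁)] at heq
  simp only [charDet, ← heq]
  rfl

lemma analyticAt_charDet (hy : 0 < y) (hξ : 2 * ξ ^ 2 < y ^ 2) :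
    AnalyticAt ℝ (charDet y) ξ := by
  obtain ⟨G, hG, hGe⟩ := exists_analyticAt_charDet hy hξ
  have h : AnalyticAt ℝ (fun x : ℝ => G x) ξ :=
    AnalyticAt.comp (g := G) (f := fun x : ℝ => (x : ℂ)) hG.restrictScalars
      (Complex.ofRealCLM.analyticAt ξ)
  exact h.congr hGe

lemma continuous_Theta (hy : 0 < y) (hξ0 : 0 < ξ) (hξ : 2 * ξ ^ 2 < y ^ 2) :
    Continuous (Theta y ξ) :=
  continuous_iff_continuousAt.2 fun φ => (hasDerivAt_Theta hy hξ0 hξ φ).continuousAt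

lemma continuous_angleSpeed (hy : 0 < y) (hξ0 : 0 < ξ) (hξ : 2 * ξ ^ 2 < y ^ 2) :
    Continuous (angleSpeed y ξ) :=
  (((continuous_slowness hy hξ).comp (continuous_Theta hy hξ0 hξ)).inv₀
    fun _ => (slowness_pos hy hξ0 hξ _).ne').mul continuous_const

lemma continuous_frame (k : Fin 4) : Continuous fun φ => frame φ k :=
  continuous_iff_continuousAt.2 fun φ => (hasDerivAt_frame φ k).continuousAt

lemma continuous_A (hy : 0 < y) (hξ0 : 0 < ξ) (hξ : 2 * ξ ^ 2 < y ^ 2) (k l : Fin 4) :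
    Continuous fun φ => A y ξ φ k l := by
  have h1 := continuous_Theta hy hξ0 hξ
  have h2 := (continuous_Bmat_apply hy hξ k l).comp h1
  have h3 := continuous_ofReal.comp (continuous_angleSpeed hy hξ0 hξ)
  have h4 : (fun φ => A y ξ φ k l) = fun φ => ((if k = l then frameGen k * frame φ k else 0) +
      frame φ k * (Bmat y ξ (Theta y ξ φ) k l * angleSpeed y ξ φ)) * (frame φ l)⁻¹ := by
    funext φ
    rw [← A_mul_frame hy hξ0 hξ, mul_inv_cancel_right₀ (frame_ne_zero φ l)]
  rw [h4]
  refine Continuous.mul (Continuous.add ?_ ((continuous_frame k).mul (h2.mul h3)))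
    ((continuous_frame l).inv₀ fun φ => frame_ne_zero φ l)
  split_ifs
  · exact continuous_const.mul (continuous_frame k)
  · exact continuous_const

/-- Product rule for `D(φ) N(Θ(φ))` combined with `A_mul_frame`; the start is right because `Θ(0) =
π/2` and `D(0) = 1`. -/
lemma isFundamentalMatrix_propagator (hy : 0 < y) (hξ0 : 0 < ξ) (hξ : 2 * ξ ^ 2 < y ^ 2) :
    IsFundamentalMatrix y ξ fun φ => Matrix.of fun i j => frame φ i * propagator y ξ (Theta y ξ φ) i j where
  zero := by
    ext i j
    simp only [Matrix.of_apply]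
    rw [Theta_zero hy hξ0 hξ, (propagator_spec hy hξ).1]
    fin_cases i <;> simp [frame]
  deriv φ i j := by
    have h1 := hasDerivAt_matrix.1 ((propagator_spec hy hξ).2 (Theta y ξ φ)) i j
    have h2 := h1.scomp φ (hasDerivAt_Theta hy hξ0 hξ φ)
    refine ((hasDerivAt_frame φ i).mul h2).congr_deriv ?_
    simp only [Matrix.mul_apply, Matrix.of_apply, ← mul_assoc, A_mul_frame hy hξ0 hξ, add_mul,
      Finset.sum_add_distrib, ite_mul, zero_mul, Finset.sum_ite_eq, Finset.mem_univ, if_true]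
    congr 1
    rw [real_smul, ← angleSpeed, Finset.mul_sum, Finset.mul_sum]
    refine Finset.sum_congr rfl fun k _ => ?_
    ring

lemma IsFundamentalMatrix.unique (hy : 0 < y) (hξ0 : 0 < ξ) (hξ : 2 * ξ ^ 2 < y ^ 2)
    {M M' : ℝ → Mat4} (h : IsFundamentalMatrix y ξ M) (h' : IsFundamentalMatrix y ξ M') :
    M = M' := by
  funext φ
  have hA : Continuous (A y ξ) := continuous_iff_continuousAt.2 fun _ =>
    continuousAt_matrix fun i j => (continuous_A hy hξ0 hξ i j).continuousAt
  have h0 := abs_nonneg φ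
  refine linear_ode_unique (a := -|φ| - 1) (b := |φ| + 1) (t₀ := 0) hA.continuousOn
    ⟨by linarith, by linarith⟩ (fun t _ => hasDerivAt_matrix.2 (h.deriv t))
    (fun t _ => hasDerivAt_matrix.2 (h'.deriv t)) (h.zero.trans h'.zero.symm)
    ⟨by linarith [neg_abs_le φ], by linarith [le_abs_self φ]⟩

lemma two_mul_sq_lt (hξ0 : 0 < ξ) (h : ξ < y / √2) : 2 * ξ ^ 2 < y ^ 2 := by
  have h2 : (0 : ℝ) < √2 := by positivity
  rw [lt_div_iff₀ h2] at h
  have h3 : (ξ * √2) ^ 2 < y ^ 2 := by gcongr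
  rw [mul_pow, Real.sq_sqrt (by norm_num)] at h3
  linarith

/-- The frame is the identity again at `φ = 2π`, where the angle is `5π/2`, so the monodromy matrix
in the original variables is that of the propagator. -/
lemma det_isFundamentalMatrix (hy : 0 < y) (hξ0 : 0 < ξ) (hξ : 2 * ξ ^ 2 < y ^ 2)
    {M : ℝ → Mat4} (h : IsFundamentalMatrix y ξ M) : (M (2 * Real.pi) - 1).det = charDet y ξ := by
  rw [h.unique hy hξ0 hξ (isFundamentalMatrix_propagator hy hξ0 hξ), charDet]
  congr 2
  have h1 := Theta_two_pi hy hξ0 hξ 0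
  rw [zero_add, Theta_zero hy hξ0 hξ] at h1
  ext i j
  simp only [Matrix.of_apply]
  rw [h1, show Real.pi / 2 + 2 * Real.pi = 5 * Real.pi / 2 by ring]
  have e : exp (I * (2 * Real.pi)) = 1 := by rw [mul_comm, exp_two_pi_mul_I]
  have e' : exp (-(I * (2 * Real.pi))) = 1 := by rw [exp_neg, e, inv_one]
  fin_cases i <;> simp [frame, e, e']

lemma mem_exceptionalSet_iff (hy : 0 < y) (hξ : ξ ∈ Ioo 0 (y / √2)) :
    ξ ∈ exceptionalSet y ↔ charDet y ξ = 0 := by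
  have h2 := two_mul_sq_lt hξ.1 hξ.2
  constructor
  · rintro ⟨-, M, hM, hdet⟩
    rw [← det_isFundamentalMatrix hy hξ.1 h2 hM, hdet]
  · intro h
    have hM := isFundamentalMatrix_propagator hy hξ.1 h2
    exact ⟨hξ, _, hM, by rw [det_isFundamentalMatrix hy hξ.1 h2 hM, h]⟩

end Monodromy

end

/-! ### Structure of the exceptional set -/

section

open Set Filter Topology Complex ComplexConjugate

section ExceptionalSet

attribute [local instance] Matrix.linftyOpNormedRing Matrix.linftyOpNormedAlgebra

/-- With `P = e^{it}p` and `R = e^{-it}r` the system is autonomous, with matrix `i[[1, γ], [-γ,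
-1]]` and eigenvalues `±iμ`. The combination is a left eigenvector, hence is multiplied by
`e^{2πiμ}` over a period, while the hypotheses make it periodic; and `0 < μ² < 1` keeps `μ` from
being an integer. -/
lemma resonant_combination_eq_zero {γ μ : ℝ} (hγ : γ ≠ 0) (hμ : μ ^ 2 = 1 - γ ^ 2) (hμ0 : μ ≠ 0)
    {p r : ℝ → ℂ} (hp : ∀ t : ℝ, HasDerivAt p (I * γ * exp (-(2 * I * t)) * r t) t)
    (hr : ∀ t : ℝ, HasDerivAt r (-(I * γ * exp (2 * I * t) * p t)) t) {t₀ : ℝ}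
    (hp2 : p (t₀ + 2 * Real.pi) = p t₀) (hr2 : r (t₀ + 2 * Real.pi) = r t₀) :
    exp (I * t₀) * p t₀ + (1 - μ) / γ * (exp (-(I * t₀)) * r t₀) = 0 := by
  have hγ' : (γ : ℂ) ≠ 0 := ofReal_ne_zero.2 hγ
  have hμ' : (μ : ℂ) ^ 2 = 1 - (γ : ℂ) ^ 2 := by exact_mod_cast congrArg ofReal hμ
  set Y : ℝ → ℂ := fun t => exp (I * t) * p t + (1 - μ) / γ * (exp (-(I * t)) * r t) with hY
  have hlin : ∀ (c : ℂ) (t : ℝ), HasDerivAt (fun t : ℝ => exp (c * t)) (exp (c * t) * c) t :=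
    fun c t => by simpa using ((hasDerivAt_id t).ofReal_comp.const_mul c).cexp
  have hYd : ∀ t, HasDerivAt Y (I * μ * Y t) t := by
    intro t
    have h1 := (hlin I t).mul (hp t)
    have h2 := (hlin (-I) t).mul (hr t)
    have h3 := h1.add (h2.const_mul (((1 : ℂ) - μ) / γ))
    have e1 : exp (-(2 * I * t)) = exp (-(I * t)) * exp (-(I * t)) := by rw [← exp_add]; ring_nf
    have e2 : exp (2 * I * t) = exp (I * t) * exp (I * t) := by rw [← exp_add]; ring_nf
    have e3 : exp (I * t) * exp (-(I * t)) = 1 := by rw [← exp_add]; simp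
    simp only [neg_mul] at h3
    refine h3.congr_deriv ?_
    simp only [hY, e1, e2]
    have e4 : exp (I * t) * (I * γ * (exp (-(I * t)) * exp (-(I * t))) * r t) =
        I * γ * exp (-(I * t)) * r t := by linear_combination (I * γ * exp (-(I * t)) * r t) * e3
    have e5 : exp (-(I * t)) * -(I * γ * (exp (I * t) * exp (I * t)) * p t) =
        -(I * γ * exp (I * t) * p t) := by linear_combination (-(I * γ * exp (I * t) * p t)) * e3
    rw [e4, e5]
    field_simp
    linear_combination (exp (-(I * t)) * r t) * hμ'
  have hconst : ∀ t, HasDerivAt (fun t : ℝ => exp (-(I * μ) * t) * Y t) 0 t := by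
    intro t
    refine ((hlin (-(I * μ)) t).mul (hYd t)).congr_deriv ?_
    ring
  have h1 := is_const_of_deriv_eq_zero (fun t => (hconst t).differentiableAt)
    (fun t => (hconst t).deriv) (t₀ + 2 * Real.pi) t₀
  have hYp : Y (t₀ + 2 * Real.pi) = Y t₀ := by
    have e1 : exp (I * (t₀ + 2 * Real.pi : ℝ)) = exp (I * t₀) := by
      rw [show I * ((t₀ + 2 * Real.pi : ℝ) : ℂ) = I * t₀ + 2 * Real.pi * I by push_cast; ring,
        exp_periodic]
    simp only [hY, hp2, hr2, exp_neg, e1]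
  rw [hYp, show -(I * μ) * ((t₀ + 2 * Real.pi : ℝ) : ℂ) =
    -(I * μ) * t₀ + -(2 * Real.pi * μ * I) by push_cast; ring, exp_add] at h1
  have h2 : exp (-(I * μ) * t₀) * Y t₀ * (exp (-(2 * Real.pi * μ * I)) - 1) = 0 := by
    linear_combination h1
  rcases mul_eq_zero.1 h2 with h3 | h3
  · exact (mul_eq_zero.1 h3).resolve_left (exp_ne_zero _)
  · exfalso
    obtain ⟨n, hn⟩ := exp_eq_one_iff.1 (sub_eq_zero.1 h3)
    have hpi : (Real.pi : ℂ) ≠ 0 := ofReal_ne_zero.2 Real.pi_ne_zero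
    have h4 : (-μ : ℂ) = n := by
      have : (2 * Real.pi * I : ℂ) ≠ 0 := by simp [hpi]
      apply mul_right_cancel₀ this
      linear_combination hn
    have h5 : -μ = n := by exact_mod_cast h4
    have h6 : (n : ℝ) ^ 2 = 1 - γ ^ 2 := by rw [← h5, ← hμ]; ring
    have h7 : n ^ 2 < 1 := by
      have : (n : ℝ) ^ 2 < 1 := by have := sq_pos_of_ne_zero hγ; linarith
      exact_mod_cast this
    have h8 : n = 0 := by nlinarith [sq_nonneg n, sq_nonneg (n-1), sq_nonneg (n+1)]
    rw [h8] at h5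
    exact hμ0 (by simpa using h5)

lemma periodic_pair_eq_zero {γ : ℝ} (hγ : γ ≠ 0) (hγ1 : γ ^ 2 < 1)
    {p r : ℝ → ℂ} (hp : ∀ t : ℝ, HasDerivAt p (I * γ * exp (-(2 * I * t)) * r t) t)
    (hr : ∀ t : ℝ, HasDerivAt r (-(I * γ * exp (2 * I * t) * p t)) t) {t₀ : ℝ}
    (hp2 : p (t₀ + 2 * Real.pi) = p t₀) (hr2 : r (t₀ + 2 * Real.pi) = r t₀) :
    p t₀ = 0 ∧ r t₀ = 0 := by
  set μ := √(1 - γ ^ 2)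
  have hpos : 0 < 1 - γ ^ 2 := by linarith
  have hμ0 : μ ≠ 0 := (Real.sqrt_pos.2 hpos).ne'
  have hμ : μ ^ 2 = 1 - γ ^ 2 := Real.sq_sqrt hpos.le
  have h1 := resonant_combination_eq_zero hγ hμ hμ0 hp hr hp2 hr2
  have h2 := resonant_combination_eq_zero (μ := -μ) hγ (by rw [neg_sq, hμ]) (neg_ne_zero.2 hμ0)
    hp hr hp2 hr2
  have hγ' : (γ : ℂ) ≠ 0 := ofReal_ne_zero.2 hγ
  have hμ' : (μ : ℂ) ≠ 0 := ofReal_ne_zero.2 hμ0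
  push_cast at h2
  have h3 : (2 * μ / γ : ℂ) * (exp (-(I * t₀)) * r t₀) = 0 := by linear_combination h2 - h1
  have h4 : r t₀ = 0 := by simpa [hγ', hμ', exp_ne_zero] using h3
  rw [h4] at h1
  exact ⟨by simpa [exp_ne_zero] using h1, h4⟩

variable {y ξ : ℝ}

lemma Bmat_zero (hy : 0 < y) (ϕ : ℂ) : Bmat y 0 ϕ =
    !![0, -(I / 4) * exp (-(2 * I * ϕ)), 0, I / 2 * exp (-(2 * I * ϕ));
       I / 4 * exp (2 * I * ϕ), 0, -(I / 2) * exp (2 * I * ϕ), 0;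
       0, I / 2 * exp (-(2 * I * ϕ)), 0, -(I / 4) * exp (-(2 * I * ϕ));
       -(I / 2) * exp (2 * I * ϕ), 0, I / 4 * exp (2 * I * ϕ), 0] := by
  have hy' : (y : ℂ) ≠ 0 := ofReal_ne_zero.2 hy.ne'
  have hJ : ∀ ϕ, cJ y 0 ϕ = 0 := fun ϕ => by simp [cJ]
  have hΨ : ∀ ϕ, cΨ y 0 ϕ = 1 := fun ϕ => by simp [cΨ, cS, cC, hJ, hy']
  have e1 : exp (-(2 * I * (ϕ + Real.pi))) = exp (-(2 * I * ϕ)) := by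
    rw [show -(2 * I * (ϕ + Real.pi)) = -(2 * I * ϕ) - 2 * Real.pi * I by ring,
      exp_periodic.sub_eq]
  have e2 : exp (2 * I * (ϕ + Real.pi)) = exp (2 * I * ϕ) := by
    rw [show 2 * I * (ϕ + Real.pi) = 2 * I * ϕ + 2 * Real.pi * I by ring, exp_periodic]
  ext i j
  fin_cases i <;> fin_cases j <;> simp [Bmat, b₁, b₂, b₃, b₄, hJ, hΨ, g₀, e1, e2, neg_div]

/-- A kernel vector is the datum of a 2π-periodic solution of the limit system. That system commutes
with the exchange of the delayed and undelayed components, so the sums and the differences solve two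
separate pairs, neither of which is resonant. -/
lemma charDet_zero_ne_zero (hy : 0 < y) : charDet y 0 ≠ 0 := by
  have h0 : 2 * (0 : ℝ) ^ 2 < y ^ 2 := by simpa using pow_pos hy 2
  intro hdet
  obtain ⟨v, hv, hv0⟩ := Matrix.exists_mulVec_eq_zero_iff.2 hdet
  obtain ⟨hN0, hN⟩ := propagator_spec hy h0
  set N := propagator y 0
  set x : ℝ → Fin 4 → ℂ := fun t => (N t).mulVec v with hx
  have hx0 : x (Real.pi / 2) = v := by simp [hx, hN0]
  have hx1 : x (5 * Real.pi / 2) = v := by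
    rw [Matrix.sub_mulVec, Matrix.one_mulVec, sub_eq_zero] at hv0
    exact hv0
  have hxd : ∀ (t : ℝ) i, HasDerivAt (fun t => x t i) ((Bmat y 0 t).mulVec (x t) i) t := by
    intro t i
    have h1 : HasDerivAt (fun t => ∑ j, N t i j * v j) (∑ j, (Bmat y 0 t * N t) i j * v j) t :=
      HasDerivAt.fun_sum fun j _ => (hasDerivAt_matrix.1 (by simpa using hN t) i j).mul_const _
    refine h1.congr_deriv ?_
    rw [hx, Matrix.mulVec_mulVec]
    rfl
  have h5 : Real.pi / 2 + 2 * Real.pi = 5 * Real.pi / 2 := by ring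
  -- The sign `s` selects the sum or the difference; the coupling is `γ = -1/4 + s/2`, that is `1/4`
  -- or `-3/4`.
  have key : ∀ s : ℝ, (s = 1 ∨ s = -1) →
      v 0 + s * v 2 = 0 ∧ v 1 + s * v 3 = 0 := by
    intro s hs
    have hs2 : (s : ℂ) * s = 1 := by rcases hs with rfl | rfl <;> simp
    have hγ : (-1 / 4 + s / 2 : ℝ) ≠ 0 := by rcases hs with rfl | rfl <;> norm_num
    have hγ1 : (-1 / 4 + s / 2 : ℝ) ^ 2 < 1 := by rcases hs with rfl | rfl <;> norm_num
    have hp : ∀ t : ℝ, HasDerivAt (fun t => x t 0 + s * x t 2)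
        (I * ((-1 / 4 + s / 2 : ℝ) : ℂ) * exp (-(2 * I * t)) * (x t 1 + s * x t 3)) t := by
      intro t
      refine ((hxd t 0).add ((hxd t 2).const_mul (s : ℂ))).congr_deriv ?_
      simp only [Bmat_zero hy, Matrix.mulVec, dotProduct, Fin.sum_univ_four, Matrix.of_apply,
        Matrix.cons_val', Matrix.cons_val]
      push_cast
      linear_combination (-I * exp (-(2 * I * t)) * x t 3 / 2) * hs2
    have hr : ∀ t : ℝ, HasDerivAt (fun t => x t 1 + s * x t 3)
        (-(I * ((-1 / 4 + s / 2 : ℝ) : ℂ) * exp (2 * I * t) * (x t 0 + s * x t 2))) t := by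
      intro t
      refine ((hxd t 1).add ((hxd t 3).const_mul (s : ℂ))).congr_deriv ?_
      simp only [Bmat_zero hy, Matrix.mulVec, dotProduct, Fin.sum_univ_four, Matrix.of_apply,
        Matrix.cons_val', Matrix.cons_val]
      push_cast
      linear_combination (I * exp (2 * I * t) * x t 2 / 2) * hs2
    have := periodic_pair_eq_zero hγ hγ1 hp hr (t₀ := Real.pi / 2)
      (by rw [h5, hx1, hx0]) (by rw [h5, hx1, hx0])
    rwa [hx0] at this
  obtain ⟨a1, a2⟩ := key 1 (Or.inl rfl)
  obtain ⟨a3, a4⟩ := key (-1) (Or.inr rfl)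
  push_cast at a1 a2 a3 a4
  apply hv
  funext i
  fin_cases i
  · change v 0 = 0
    linear_combination (a1 + a3) / 2
  · change v 1 = 0
    linear_combination (a2 + a4) / 2
  · change v 2 = 0
    linear_combination (a1 - a3) / 2
  · change v 3 = 0
    linear_combination (a2 - a4) / 2

lemma two_mul_sq_lt_of_abs (h : |ξ| < y / √2) : 2 * ξ ^ 2 < y ^ 2 := by
  rcases eq_or_ne ξ 0 with rfl | h0
  · have h2 : (0 : ℝ) < √2 := by positivity
    have hy : 0 < y := by
      rw [abs_zero, lt_div_iff₀ h2] at h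
      linarith
    simpa using sq_pos_of_ne_zero hy.ne'
  · rw [← sq_abs]
    exact two_mul_sq_lt (abs_pos.2 h0) h

/-- Identity theorem on the symmetric interval. Working on both sides of 0 is what excludes
accumulation of the exceptional set at 0 itself. -/
lemma not_eventually_charDet_eq_zero (hy : 0 < y) {x : ℝ} (hx : |x| < y / √2) :
    ¬ ∃ᶠ z in 𝓝[≠] x, charDet y z = 0 := by
  intro h
  have hU : AnalyticOnNhd ℝ (charDet y) (Ioo (-(y / √2)) (y / √2)) := fun z hz =>
    analyticAt_charDet hy (two_mul_sq_lt_of_abs (abs_lt.2 hz))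
  have := hU.eqOn_zero_of_preconnected_of_frequently_eq_zero isPreconnected_Ioo (abs_lt.1 hx) h
  have hpos : 0 < y / √2 := (abs_nonneg x).trans_lt hx
  exact charDet_zero_ne_zero hy (this ⟨by linarith, hpos⟩)

lemma accPt_exceptionalSet (hy : 0 < y) {x : ℝ} (hx : AccPt x (𝓟 (exceptionalSet y))) :
    x = y / √2 := by
  have hcl : x ∈ Icc 0 (y / √2) :=
    isClosed_Icc.closure_subset_iff.2 (fun z hz => Ioo_subset_Icc_self hz.1)
      (mem_closure_iff_clusterPt.2 hx.clusterPt)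
  by_contra hne
  have hlt : |x| < y / √2 := by
    rw [abs_of_nonneg hcl.1]
    exact lt_of_le_of_ne hcl.2 hne
  refine not_eventually_charDet_eq_zero hy hlt ?_
  exact (accPt_iff_frequently_nhdsNE.1 hx).mono fun z hz => (mem_exceptionalSet_iff hy hz.1).1 hz

lemma countable_exceptionalSet (hy : 0 < y) : (exceptionalSet y).Countable := by
  have hfin : ∀ n : ℕ, (exceptionalSet y ∩ Icc 0 (y / √2 - 1 / (n + 1))).Finite := by
    intro n
    by_contra hinf
    obtain ⟨x, hx, hacc⟩ := Set.Infinite.exists_accPt_of_subset_isCompact hinf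
      (isCompact_Icc (a := 0) (b := y / √2 - 1 / ((n : ℝ) + 1))) inter_subset_right
    have h1 := accPt_exceptionalSet hy (hacc.mono (principal_mono.2 inter_subset_left))
    have h2 := hx.2
    have h3 : (0 : ℝ) < 1 / ((n : ℝ) + 1) := by positivity
    linarith
  refine (countable_iUnion fun n => (hfin n).countable).mono fun x hx => ?_
  obtain ⟨n, hn⟩ := exists_nat_one_div_lt (sub_pos.2 hx.1.2)
  exact mem_iUnion.2 ⟨n, hx, hx.1.1.le, by linarith⟩

/-- The characteristic determinant is bounded below by a power of the distance to the exceptional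
set. -/
lemma exists_charDet_lower_bound (hy : 0 < y) {ξl ξu : ℝ} (hl : 0 < ξl) (hu : ξu < y / √2) :
    ∃ (n : ℕ) (c : ℝ), 0 < c ∧ ∀ ξ ∈ Icc ξl ξu, ∀ σ : ℝ, 0 < σ → σ < 1 →
      (∀ x ∈ exceptionalSet y, σ ≤ |ξ - x|) → c * σ ^ n ≤ ‖charDet y ξ‖ := by
  -- The property is local: for a union, take the larger exponent and the smaller constant, which is
  -- harmless because `σ < 1`.
  refine isCompact_Icc.induction_on (p := fun s => ∃ (n : ℕ) (c : ℝ), 0 < c ∧ ∀ ξ ∈ s, ∀ σ : ℝ,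
    0 < σ → σ < 1 → (∀ x ∈ exceptionalSet y, σ ≤ |ξ - x|) → c * σ ^ n ≤ ‖charDet y ξ‖)
    ⟨0, 1, one_pos, by simp⟩ (fun s t hst => fun ⟨n, c, hc, h⟩ => ⟨n, c, hc, fun ξ hξ => h ξ (hst hξ)⟩)
    ?_ ?_
  · rintro s t ⟨n, c, hc, h⟩ ⟨n', c', hc', h'⟩
    refine ⟨max n n', min c c', lt_min hc hc', fun ξ hξ σ hσ hσ1 hx => ?_⟩
    rcases hξ with hξ | hξ
    · refine le_trans ?_ (h ξ hξ σ hσ hσ1 hx)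
      exact mul_le_mul (min_le_left _ _) (pow_le_pow_of_le_one hσ.le hσ1.le (le_max_left _ _))
        (by positivity) hc.le
    · refine le_trans ?_ (h' ξ hξ σ hσ hσ1 hx)
      exact mul_le_mul (min_le_right _ _) (pow_le_pow_of_le_one hσ.le hσ1.le (le_max_right _ _))
        (by positivity) hc'.le
  · intro x hx
    have hx0 : 0 < x := hl.trans_le hx.1
    have hxu : x < y / √2 := hx.2.trans_lt hu
    have habs : |x| < y / √2 := by rwa [abs_of_pos hx0]
    have han := analyticAt_charDet hy (two_mul_sq_lt_of_abs habs)
    have hne : ¬ ∀ᶠ z in 𝓝 x, charDet y z = 0 := fun h =>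
      not_eventually_charDet_eq_zero hy habs (h.filter_mono nhdsWithin_le_nhds).frequently
    by_cases h0 : charDet y x = 0
    -- Near a zero of order `n` the modulus is `|ξ - x| ^ n` times a factor bounded below, and `|ξ -
    -- x| ≥ σ` because `x` is itself exceptional.
    · obtain ⟨n, g, hg, hg0, hfg⟩ := han.exists_eventuallyEq_pow_smul_nonzero_iff.2 hne
      have hg1 : ∀ᶠ z in 𝓝 x, ‖g x‖ / 2 < ‖g z‖ :=
        hg.continuousAt.norm.eventually_const_lt (half_lt_self (norm_pos_iff.2 hg0))
      refine ⟨_, mem_nhdsWithin_of_mem_nhds (hfg.and hg1), n, ‖g x‖ / 2,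
        half_pos (norm_pos_iff.2 hg0), fun ξ hξ σ hσ hσ1 hd => ?_⟩
      rw [hξ.1, norm_smul, norm_pow, Real.norm_eq_abs, mul_comm]
      have := hd x ((mem_exceptionalSet_iff hy ⟨hx0, hxu⟩).2 h0)
      exact mul_le_mul (by gcongr) hξ.2.le (by positivity) (by positivity)
    · have hg1 : ∀ᶠ z in 𝓝 x, ‖charDet y x‖ / 2 < ‖charDet y z‖ :=
        han.continuousAt.norm.eventually_const_lt (half_lt_self (norm_pos_iff.2 h0))
      refine ⟨_, mem_nhdsWithin_of_mem_nhds hg1, 0, ‖charDet y x‖ / 2,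
        half_pos (norm_pos_iff.2 h0), fun ξ hξ σ hσ hσ1 hd => ?_⟩
      have : ‖charDet y x‖ / 2 < ‖charDet y ξ‖ := hξ
      simpa using this.le

end ExceptionalSet

end

/-! ### Analytic symbols in the angle and their oscillatory integrals -/

section

open Set Filter Topology Complex ComplexConjugate MeasureTheory

section Symbols

variable {y : ℝ}

/-- The domain of the variables `(ξ, ϕ)`. -/
def symDomain (y : ℝ) : Set (ℝ × ℝ) := {p | 0 < p.1 ∧ 2 * p.1 ^ 2 < y ^ 2}

/-- Functions of `(ξ, ϕ)` which are real analytic, and `2π`-periodic in the angle. -/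
structure IsSymbol (y : ℝ) (g : ℝ × ℝ → ℂ) : Prop where
  analytic : ∀ p ∈ symDomain y, AnalyticAt ℝ g p
  periodic : ∀ p, g (p + (0, 2 * Real.pi)) = g p

lemma isOpen_symDomain : IsOpen (symDomain y) :=
  (isOpen_lt continuous_const continuous_fst).inter
    (isOpen_lt (continuous_const.mul (continuous_fst.pow 2)) continuous_const)

lemma analyticAt_ofReal_prod {G : ℂ × ℂ → ℂ} {p : ℝ × ℝ} (h : AnalyticAt ℂ G (p.1, p.2)) :
    AnalyticAt ℝ (fun p : ℝ × ℝ => G (p.1, p.2)) p := by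
  have h1 : AnalyticAt ℝ (fun p : ℝ × ℝ => ((p.1 : ℂ), (p.2 : ℂ))) p :=
    AnalyticAt.prod ((Complex.ofRealCLM.analyticAt _).comp analyticAt_fst)
      ((Complex.ofRealCLM.analyticAt _).comp analyticAt_snd)
  exact AnalyticAt.comp (g := G) (h.restrictScalars (𝕜 := ℝ)) h1

/-- Expressed in the angle, the half period is the integral of a holomorphic family over an interval
which does not depend on the parameter. -/
lemma analyticAt_halfPeriod (hy : 0 < y) {ξ : ℝ} (hξ : 2 * ξ ^ 2 < y ^ 2) :
    AnalyticAt ℝ (fun x => (halfPeriod y x : ℂ)) ξ := by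
  obtain ⟨g, hg, hgB⟩ := analyticAt_continuousMap (a := 0) (b := Real.pi) (z₀ := (ξ : ℂ))
    (f := fun z t => cJ y z t / cΨ y z t) (by
      intro t _
      have h1 : ∀ᶠ p : ℂ × ℝ in 𝓝 ((ξ : ℂ), t),
          AnalyticAt ℂ (fun p : ℂ × ℂ => cJ y p.1 p.2 / cΨ y p.1 p.2) (p.1, (p.2 : ℂ)) :=
        (show ContinuousAt (fun p : ℂ × ℝ => (p.1, (p.2 : ℂ))) ((ξ : ℂ), t) by fun_prop).eventually
          ((analyticAt_cJ hy hξ t).div (analyticAt_cΨ hy hξ t)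
            (cΨ_ne_zero hy hξ t)).eventually_analyticAt
      filter_upwards [h1] with p hp
      refine ⟨?_, ?_⟩
      · exact ContinuousAt.comp (f := fun p : ℂ × ℝ => (p.1, (p.2 : ℂ)))
          (g := fun p : ℂ × ℂ => cJ y p.1 p.2 / cΨ y p.1 p.2) hp.continuousAt (by fun_prop)
      · exact DifferentiableAt.comp p.1 (f := fun z : ℂ => (z, (p.2 : ℂ)))
          (g := fun p : ℂ × ℂ => cJ y p.1 p.2 / cΨ y p.1 p.2) hp.differentiableAt (by fun_prop))
  set τ₀ : Icc 0 Real.pi := ⟨0, le_rfl, Real.pi_pos.le⟩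
  set τ₁ : Icc 0 Real.pi := ⟨Real.pi, Real.pi_pos.le, le_rfl⟩
  have hprim : AnalyticAt ℂ (fun z => primitive Real.pi_pos.le τ₀ (g z) τ₁) ξ :=
    analyticAt_clm_comp (ContinuousMap.evalCLM ℂ τ₁)
      (analyticAt_clm_comp (primitive Real.pi_pos.le τ₀) hg)
  have h2 : AnalyticAt ℝ (fun x : ℝ => primitive Real.pi_pos.le τ₀ (g x) τ₁) ξ :=
    AnalyticAt.comp (g := fun z => primitive Real.pi_pos.le τ₀ (g z) τ₁) (f := fun x : ℝ => (x : ℂ))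
      hprim.restrictScalars (Complex.ofRealCLM.analyticAt ξ)
  refine h2.congr ?_
  have h3 : ∀ᶠ x : ℝ in 𝓝 ξ, ∀ t : Icc 0 Real.pi, g x t = cJ y x t / cΨ y x t :=
    (continuous_ofReal.tendsto ξ).eventually hgB
  have h4 : ∀ᶠ x : ℝ in 𝓝 ξ, 2 * x ^ 2 < y ^ 2 :=
    (by fun_prop : Continuous fun x : ℝ => 2 * x ^ 2).continuousAt.eventually_lt_const hξ
  filter_upwards [h3, h4] with x hx hx2
  rw [primitive_apply, halfPeriod, ← intervalIntegral.integral_ofReal]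
  refine intervalIntegral.integral_congr fun t ht => ?_
  rw [uIcc_of_le Real.pi_pos.le] at ht
  change (g x).IccExtend _ t = _
  rw [ContinuousMap.coe_IccExtend, IccExtend_of_mem _ _ ht, hx, cJ_ofReal hy hx2, cΨ_ofReal hy hx2,
    slowness, ofReal_div]

lemma analyticAt_omega (hy : 0 < y) {ξ : ℝ} (hξ0 : 0 < ξ) (hξ : 2 * ξ ^ 2 < y ^ 2) :
    AnalyticAt ℝ (fun x => (omega y x : ℂ)) ξ := by
  have h1 : AnalyticAt ℝ (fun x => (Real.pi : ℂ) / (halfPeriod y x : ℂ)) ξ :=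
    analyticAt_const.div (analyticAt_halfPeriod hy hξ)
      (ofReal_ne_zero.2 (halfPeriod_pos hy hξ0 hξ).ne')
  refine h1.congr ?_
  filter_upwards [(by fun_prop : Continuous fun x : ℝ => 2 * x ^ 2).continuousAt.eventually_lt_const hξ,
    eventually_gt_nhds hξ0] with x hx hx0
  rw [omega_eq hy hx0 hx, ofReal_div]

/-- The derivative of `φ` with respect to the angle. -/
def phaseSpeed (y : ℝ) (p : ℝ × ℝ) : ℝ := omega y p.1 * slowness y p.1 p.2

lemma phaseSpeed_pos (hy : 0 < y) {p : ℝ × ℝ} (hp : p ∈ symDomain y) : 0 < phaseSpeed y p :=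
  mul_pos (omega_pos hy hp.1 hp.2) (slowness_pos hy hp.1 hp.2 _)

lemma isSymbol_omega (hy : 0 < y) : IsSymbol y fun p => (omega y p.1 : ℂ) where
  analytic p hp := AnalyticAt.comp (g := fun x => (omega y x : ℂ)) (analyticAt_omega hy hp.1 hp.2)
    analyticAt_fst
  periodic p := by simp

lemma IsSymbol.mul {g g' : ℝ × ℝ → ℂ} (hg : IsSymbol y g) (hg' : IsSymbol y g') :
    IsSymbol y fun p => g p * g' p where
  analytic p hp := (hg.analytic p hp).mul (hg'.analytic p hp)
  periodic p := by rw [hg.periodic, hg'.periodic]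

lemma IsSymbol.div {g g' : ℝ × ℝ → ℂ} (hg : IsSymbol y g) (hg' : IsSymbol y g')
    (h0 : ∀ p ∈ symDomain y, g' p ≠ 0) : IsSymbol y fun p => g p / g' p where
  analytic p hp := (hg.analytic p hp).div (hg'.analytic p hp) (h0 p hp)
  periodic p := by rw [hg.periodic, hg'.periodic]

lemma isSymbol_phaseSpeed (hy : 0 < y) : IsSymbol y fun p => (phaseSpeed y p : ℂ) := by
  have hper : ∀ ξ ϕ, slowness y ξ (ϕ + 2 * Real.pi) = slowness y ξ ϕ := fun ξ ϕ => by
    rw [two_mul, ← add_assoc, periodic_slowness, periodic_slowness]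
  have h : IsSymbol y fun p => (slowness y p.1 p.2 : ℂ) := by
    refine ⟨fun p hp => ?_, fun p => by simp [hper]⟩
    refine (analyticAt_ofReal_prod (G := fun p => cJ y p.1 p.2 / cΨ y p.1 p.2)
      ((analyticAt_cJ hy hp.2 p.2).div (analyticAt_cΨ hy hp.2 p.2) (cΨ_ne_zero hy hp.2 p.2))).congr ?_
    filter_upwards [isOpen_symDomain.mem_nhds hp] with z hz
    simp only [cJ_ofReal hy hz.2, cΨ_ofReal hy hz.2, slowness, ofReal_div]
  simpa [phaseSpeed] using (isSymbol_omega hy).mul h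

/-- Derivative of a symbol along the orbit. -/
def symDeriv (y : ℝ) (g : ℝ × ℝ → ℂ) (p : ℝ × ℝ) : ℂ := fderiv ℝ g p (0, 1) / phaseSpeed y p

lemma IsSymbol.symDeriv (hy : 0 < y) {g : ℝ × ℝ → ℂ} (hg : IsSymbol y g) :
    IsSymbol y (symDeriv y g) := by
  refine IsSymbol.div ⟨fun p hp => ?_, fun p => ?_⟩ (isSymbol_phaseSpeed hy) fun p hp =>
    ofReal_ne_zero.2 (phaseSpeed_pos hy hp).ne'
  · exact ((ContinuousLinearMap.apply ℝ ℂ ((0, 1) : ℝ × ℝ)).analyticAt _).comp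
      (hg.analytic p hp).fderiv
  · rw [← fderiv_comp_add_right]
    simp only [hg.periodic]

lemma isCompact_rectangle (a b c d : ℝ) : IsCompact (Icc a b ×ˢ Icc c d) :=
  isCompact_Icc.prod isCompact_Icc

lemma rectangle_subset {ξl ξu : ℝ} (hl : 0 < ξl) (hu : ξu < y / √2) {ξ : ℝ} (hξ : ξ ∈ Icc ξl ξu)
    (ϕ : ℝ) : (ξ, ϕ) ∈ symDomain y :=
  ⟨hl.trans_le hξ.1, two_mul_sq_lt (hl.trans_le hξ.1) (hξ.2.trans_lt hu)⟩

lemma IsSymbol.exists_bound {g : ℝ × ℝ → ℂ} (hg : IsSymbol y g) {ξl ξu : ℝ} (hl : 0 < ξl)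
    (hu : ξu < y / √2) : ∃ C : ℝ, 0 ≤ C ∧ ∀ ϕ ∈ Icc (Real.pi / 2) (5 * Real.pi / 2),
      (∀ ξ ∈ Icc ξl ξu, ‖g (ξ, ϕ)‖ ≤ C) ∧
      ∀ ξ ∈ Icc ξl ξu, ∀ ξ' ∈ Icc ξl ξu, ‖g (ξ, ϕ) - g (ξ', ϕ)‖ ≤ C * |ξ - ξ'| := by
  set R := Icc ξl ξu ×ˢ Icc (Real.pi / 2) (5 * Real.pi / 2)
  have hR : ∀ p ∈ R, p ∈ symDomain y := fun p hp => rectangle_subset hl hu hp.1 p.2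
  obtain ⟨C₁, h1⟩ := (isCompact_rectangle _ _ _ _).exists_bound_of_continuousOn (s := R) (f := g)
    fun p hp => (hg.analytic p (hR p hp)).continuousAt.continuousWithinAt
  obtain ⟨C₂, h2⟩ := (isCompact_rectangle _ _ _ _).exists_bound_of_continuousOn (s := R)
    (f := fderiv ℝ g) fun p hp => (hg.analytic p (hR p hp)).fderiv.continuousAt.continuousWithinAt
  refine ⟨max (max C₁ C₂) 0, le_max_right _ _, fun ϕ hϕ => ⟨fun ξ hξ => ?_, fun ξ hξ ξ' hξ' => ?_⟩⟩
  · exact (h1 _ ⟨hξ, hϕ⟩).trans ((le_max_left _ _).trans (le_max_left _ _))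
  · have h3 := Convex.norm_image_sub_le_of_norm_fderiv_le
      (fun p hp => (hg.analytic p (hR p hp)).differentiableAt)
      h2 ((convex_Icc _ _).prod (convex_Icc _ _)) (x := (ξ', ϕ)) (y := (ξ, ϕ)) ⟨hξ', hϕ⟩ ⟨hξ, hϕ⟩
    have h4 : ‖((ξ, ϕ) : ℝ × ℝ) - (ξ', ϕ)‖ = |ξ - ξ'| := by simp [Prod.norm_def]
    rw [h4] at h3
    exact h3.trans (mul_le_mul_of_nonneg_right ((le_max_right _ _).trans (le_max_left _ _))
      (abs_nonneg _))

/-- The variable `φ` as a function of the angle. -/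
def phase (y ξ ϕ : ℝ) : ℝ := omega y ξ * timeMap y ξ ϕ

lemma hasDerivAt_phase (hy : 0 < y) {ξ : ℝ} (hξ : 2 * ξ ^ 2 < y ^ 2) (ϕ : ℝ) :
    HasDerivAt (phase y ξ) (phaseSpeed y (ξ, ϕ)) ϕ :=
  (hasDerivAt_timeMap hy hξ ϕ).const_mul _

lemma phase_eq_integral (ξ ϕ : ℝ) :
    phase y ξ ϕ = ∫ s in (Real.pi / 2)..ϕ, phaseSpeed y (ξ, s) := by
  simp only [phase, timeMap, phaseSpeed, intervalIntegral.integral_const_mul]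

lemma phase_pi_div_two (ξ : ℝ) : phase y ξ (Real.pi / 2) = 0 := by simp [phase, timeMap_self]

lemma phase_add_two_pi (hy : 0 < y) {ξ : ℝ} (hξ0 : 0 < ξ) (hξ : 2 * ξ ^ 2 < y ^ 2) (ϕ : ℝ) :
    phase y ξ (ϕ + 2 * Real.pi) = phase y ξ ϕ + 2 * Real.pi := by
  have := (halfPeriod_pos hy hξ0 hξ).ne'
  rw [phase, phase, two_mul, ← add_assoc, timeMap_add_pi hy hξ, timeMap_add_pi hy hξ,
    omega_eq hy hξ0 hξ]
  field_simp
  ring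

lemma Theta_phase (hy : 0 < y) {ξ : ℝ} (hξ0 : 0 < ξ) (hξ : 2 * ξ ^ 2 < y ^ 2) (ϕ : ℝ) :
    Theta y ξ (phase y ξ ϕ) = ϕ := by
  rw [Theta_eq hy hξ0 hξ, phase, mul_div_cancel_left₀ _ (omega_pos hy hξ0 hξ).ne',
    angle_timeMap hy hξ0 hξ]

lemma continuous_phaseSpeed (hy : 0 < y) {ξ : ℝ} (hξ : 2 * ξ ^ 2 < y ^ 2) :
    Continuous fun ϕ => phaseSpeed y (ξ, ϕ) := by
  have := continuous_slowness hy hξ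
  simp only [phaseSpeed]
  fun_prop

lemma exists_phase_lipschitz (hy : 0 < y) {ξl ξu : ℝ} (hl : 0 < ξl) (hu : ξu < y / √2) :
    ∃ C : ℝ, 0 ≤ C ∧ ∀ ϕ ∈ Icc (Real.pi / 2) (5 * Real.pi / 2), ∀ ξ ∈ Icc ξl ξu, ∀ ξ' ∈ Icc ξl ξu,
      |phase y ξ ϕ - phase y ξ' ϕ| ≤ C * |ξ - ξ'| := by
  obtain ⟨C, hC0, hC⟩ := (isSymbol_phaseSpeed hy).exists_bound hl hu
  have hpi := Real.pi_pos
  refine ⟨C * (2 * Real.pi), by positivity, fun ϕ hϕ ξ hξ ξ' hξ' => ?_⟩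
  have h_int : ∀ ξ ∈ Icc ξl ξu, IntervalIntegrable (fun s => phaseSpeed y (ξ, s)) volume
      (Real.pi / 2) ϕ := fun ξ hξ =>
    (continuous_phaseSpeed hy (rectangle_subset hl hu hξ 0).2).intervalIntegrable _ _
  rw [phase_eq_integral, phase_eq_integral, ← intervalIntegral.integral_sub (h_int ξ hξ) (h_int ξ' hξ')]
  have h1 := intervalIntegral.norm_integral_le_of_norm_le_const (a := Real.pi / 2) (b := ϕ)
    (f := fun s => phaseSpeed y (ξ, s) - phaseSpeed y (ξ', s)) (C := C * |ξ - ξ'|) (fun s hs => by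
      rw [uIoc_of_le hϕ.1] at hs
      have := (hC s ⟨hs.1.le, hs.2.trans hϕ.2⟩).2 ξ hξ ξ' hξ'
      rwa [← ofReal_sub, norm_real] at this)
  refine h1.trans ?_
  have h2 : |ϕ - Real.pi / 2| ≤ 2 * Real.pi := by
    rw [abs_of_nonneg (by linarith [hϕ.1])]
    linarith [hϕ.2]
  calc C * |ξ - ξ'| * |ϕ - Real.pi / 2| ≤ C * |ξ - ξ'| * (2 * Real.pi) := by gcongr
    _ = _ := by ring

/-- Oscillatory integral with the phase `d * φ(ϕ)`. -/
def oscInt (y : ℝ) (g : ℝ × ℝ → ℂ) (d : ℤ) (ξ : ℝ) : ℂ :=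
  ∫ ϕ in (Real.pi / 2)..(5 * Real.pi / 2),
    g (ξ, ϕ) * exp (I * (-(d * phase y ξ ϕ) : ℝ)) * phaseSpeed y (ξ, ϕ)

lemma IsSymbol.continuous {g : ℝ × ℝ → ℂ} (hg : IsSymbol y g) {ξ : ℝ} (hξ0 : 0 < ξ)
    (hξ : 2 * ξ ^ 2 < y ^ 2) : Continuous fun ϕ => g (ξ, ϕ) :=
  continuous_iff_continuousAt.2 fun ϕ =>
    ContinuousAt.comp (g := g) (f := fun ϕ : ℝ => (ξ, ϕ))
      (hg.analytic (ξ, ϕ) ⟨hξ0, hξ⟩).continuousAt (by fun_prop)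

lemma continuous_phase (hy : 0 < y) {ξ : ℝ} (hξ : 2 * ξ ^ 2 < y ^ 2) : Continuous (phase y ξ) :=
  continuous_iff_continuousAt.2 fun ϕ => (hasDerivAt_phase hy hξ ϕ).continuousAt

/-- Integration by parts over one turn. The boundary terms cancel: `g` is periodic and the phase
advances by `2πd`. The new amplitude is again a symbol, so the step can be iterated. -/
lemma mul_oscInt (hy : 0 < y) {g : ℝ × ℝ → ℂ} (hg : IsSymbol y g) {ξ : ℝ} (hξ0 : 0 < ξ)
    (hξ : 2 * ξ ^ 2 < y ^ 2) (d : ℤ) :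
    I * d * oscInt y g d ξ = oscInt y (symDeriv y g) d ξ := by
  have hp : ∀ ϕ, (ξ, ϕ) ∈ symDomain y := fun ϕ => ⟨hξ0, hξ⟩
  have hgc := hg.continuous hξ0 hξ
  have hgd : ∀ ϕ, HasDerivAt (fun ϕ => g (ξ, ϕ)) (fderiv ℝ g (ξ, ϕ) (0, 1)) ϕ := fun ϕ =>
    (hg.analytic _ (hp ϕ)).differentiableAt.hasFDerivAt.comp_hasDerivAt ϕ
      ((hasDerivAt_const ϕ ξ).prodMk (hasDerivAt_id ϕ))
  have hsd : ∀ ϕ, fderiv ℝ g (ξ, ϕ) (0, 1) = symDeriv y g (ξ, ϕ) * phaseSpeed y (ξ, ϕ) := fun ϕ => by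
    rw [symDeriv, div_mul_cancel₀ _ (ofReal_ne_zero.2 (phaseSpeed_pos hy (hp ϕ)).ne')]
  have hdc : Continuous fun ϕ => symDeriv y g (ξ, ϕ) * phaseSpeed y (ξ, ϕ) :=
    ((hg.symDeriv hy).continuous hξ0 hξ).mul (continuous_ofReal.comp (continuous_phaseSpeed hy hξ))
  have he : ∀ ϕ, HasDerivAt (fun ϕ => exp (I * (-(d * phase y ξ ϕ) : ℝ)))
      (exp (I * (-(d * phase y ξ ϕ) : ℝ)) * (I * (-(d * phaseSpeed y (ξ, ϕ)) : ℝ))) ϕ := fun ϕ =>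
    (((hasDerivAt_phase hy hξ ϕ).const_mul (d : ℝ)).neg.ofReal_comp.const_mul I).cexp
  have hec : Continuous fun ϕ => exp (I * (-(d * phase y ξ ϕ) : ℝ)) :=
    continuous_iff_continuousAt.2 fun ϕ => (he ϕ).continuousAt
  have hsc := continuous_phaseSpeed hy hξ
  have ibp := intervalIntegral.integral_mul_deriv_eq_deriv_mul (a := Real.pi / 2)
    (b := 5 * Real.pi / 2) (fun ϕ _ => hgd ϕ) (fun ϕ _ => he ϕ)
    (by simp only [hsd]; exact hdc.intervalIntegrable _ _)
    ((hec.mul (by fun_prop)).intervalIntegrable _ _)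
  have hb : g (ξ, 5 * Real.pi / 2) = g (ξ, Real.pi / 2) := by
    rw [← hg.periodic (ξ, Real.pi / 2)]
    congr 1
    ext <;> simp
    ring
  have hph : phase y ξ (5 * Real.pi / 2) = 2 * Real.pi := by
    have := phase_add_two_pi hy hξ0 hξ (Real.pi / 2)
    rw [phase_pi_div_two, zero_add] at this
    rw [← this]
    ring_nf
  have hexp : exp (I * (-(d * phase y ξ (5 * Real.pi / 2)) : ℝ)) =
      exp (I * (-(d * phase y ξ (Real.pi / 2)) : ℝ)) := by
    rw [hph, phase_pi_div_two, mul_zero, neg_zero, ofReal_zero, mul_zero, exp_zero]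
    refine exp_eq_one_iff.2 ⟨-d, ?_⟩
    push_cast
    ring
  rw [hb, hexp, sub_self, zero_sub] at ibp
  rw [oscInt, oscInt, ← intervalIntegral.integral_const_mul, ← neg_inj,
    ← intervalIntegral.integral_neg]
  convert ibp using 1
  · refine intervalIntegral.integral_congr fun ϕ _ => ?_
    push_cast
    ring
  · rw [neg_inj]
    refine intervalIntegral.integral_congr fun ϕ _ => ?_
    simp only [hsd]
    ring

lemma norm_exp_sub_exp_le (a b : ℝ) : ‖exp (I * a) - exp (I * b)‖ ≤ |a - b| := by
  have h : exp (I * a) - exp (I * b) = exp (I * b) * (exp (I * (a - b : ℝ)) - 1) := by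
    rw [mul_sub, ← exp_add, mul_one]
    congr 2
    push_cast
    ring
  rw [h, norm_mul, norm_exp_I_mul_ofReal, one_mul]
  exact Real.norm_exp_I_mul_ofReal_sub_one_le

/-- The phase depends on `ξ` and is multiplied by `d`, hence the loss of a factor `1 + |d|` in the
Lipschitz bound. -/
lemma exists_oscInt_bound (hy : 0 < y) {g : ℝ × ℝ → ℂ} (hg : IsSymbol y g) {ξl ξu : ℝ}
    (hl : 0 < ξl) (hu : ξu < y / √2) : ∃ C : ℝ, 0 ≤ C ∧ ∀ d : ℤ,
      (∀ ξ ∈ Icc ξl ξu, ‖oscInt y g d ξ‖ ≤ C) ∧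
      ∀ ξ ∈ Icc ξl ξu, ∀ ξ' ∈ Icc ξl ξu,
        ‖oscInt y g d ξ - oscInt y g d ξ'‖ ≤ C * (1 + |(d : ℝ)|) * |ξ - ξ'| := by
  obtain ⟨C, hC0, hC⟩ := (hg.mul (isSymbol_phaseSpeed hy)).exists_bound hl hu
  obtain ⟨L, hL0, hL⟩ := exists_phase_lipschitz hy hl hu
  have hpi := Real.pi_pos
  have hle : Real.pi / 2 ≤ 5 * Real.pi / 2 := by linarith
  have hlen : |5 * Real.pi / 2 - Real.pi / 2| = 2 * Real.pi := by
    rw [abs_of_nonneg (by linarith)]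
    ring
  have hform : ∀ d ξ, oscInt y g d ξ = ∫ ϕ in (Real.pi / 2)..(5 * Real.pi / 2),
      (g (ξ, ϕ) * phaseSpeed y (ξ, ϕ)) * exp (I * (-(d * phase y ξ ϕ) : ℝ)) := fun d ξ =>
    intervalIntegral.integral_congr fun ϕ _ => by ring
  have h_int : ∀ d : ℤ, ∀ ξ ∈ Icc ξl ξu, IntervalIntegrable
      (fun ϕ => (g (ξ, ϕ) * phaseSpeed y (ξ, ϕ)) * exp (I * (-(d * phase y ξ ϕ) : ℝ))) volume
      (Real.pi / 2) (5 * Real.pi / 2) := fun d ξ hξ => by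
    have hξ' := rectangle_subset hl hu hξ 0
    have h1 := (hg.mul (isSymbol_phaseSpeed hy)).continuous hξ'.1 hξ'.2
    have h2 := continuous_phase hy hξ'.2
    exact Continuous.intervalIntegrable (h1.mul (by fun_prop)) _ _
  refine ⟨2 * Real.pi * (C + C * L), by positivity, fun d => ⟨fun ξ hξ => ?_, fun ξ hξ ξ' hξ' => ?_⟩⟩
  · rw [hform]
    have h1 := intervalIntegral.norm_integral_le_of_norm_le_const (a := Real.pi / 2)
      (b := 5 * Real.pi / 2)
      (f := fun ϕ => (g (ξ, ϕ) * phaseSpeed y (ξ, ϕ)) * exp (I * (-(d * phase y ξ ϕ) : ℝ)))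
      (C := C) (fun s hs => by
        rw [uIoc_of_le hle] at hs
        rw [norm_mul, norm_exp_I_mul_ofReal, mul_one]
        exact (hC s ⟨hs.1.le, hs.2⟩).1 ξ hξ)
    rw [hlen] at h1
    refine h1.trans ?_
    have : 0 ≤ 2 * Real.pi * (C * L) := by positivity
    linarith
  · rw [hform, hform, ← intervalIntegral.integral_sub (h_int d ξ hξ) (h_int d ξ' hξ')]
    have h1 := intervalIntegral.norm_integral_le_of_norm_le_const (a := Real.pi / 2)
      (b := 5 * Real.pi / 2)
      (f := fun ϕ => (g (ξ, ϕ) * phaseSpeed y (ξ, ϕ)) * exp (I * (-(d * phase y ξ ϕ) : ℝ)) -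
        (g (ξ', ϕ) * phaseSpeed y (ξ', ϕ)) * exp (I * (-(d * phase y ξ' ϕ) : ℝ)))
      (C := (C + C * L) * (1 + |(d : ℝ)|) * |ξ - ξ'|) (fun s hs => by
        rw [uIoc_of_le hle] at hs
        have hs' : s ∈ Icc (Real.pi / 2) (5 * Real.pi / 2) := ⟨hs.1.le, hs.2⟩
        set u := g (ξ, s) * phaseSpeed y (ξ, s)
        set u' := g (ξ', s) * phaseSpeed y (ξ', s)
        set e := exp (I * (-(d * phase y ξ s) : ℝ))
        set e' := exp (I * (-(d * phase y ξ' s) : ℝ))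
        have e1 : ‖e'‖ = 1 := norm_exp_I_mul_ofReal _
        have e2 : ‖e - e'‖ ≤ |(d : ℝ)| * (L * |ξ - ξ'|) := by
          refine (norm_exp_sub_exp_le _ _).trans ?_
          rw [show -(d * phase y ξ s) - -(d * phase y ξ' s) =
            -(d * (phase y ξ s - phase y ξ' s)) by ring, abs_neg, abs_mul]
          gcongr
          exact hL s hs' ξ hξ ξ' hξ'
        have u1 : ‖u‖ ≤ C := (hC s hs').1 ξ hξ
        have u2 : ‖u - u'‖ ≤ C * |ξ - ξ'| := (hC s hs').2 ξ hξ ξ' hξ'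
        calc ‖u * e - u' * e'‖ = ‖u * (e - e') + (u - u') * e'‖ := by congr 1; ring
          _ ≤ ‖u‖ * ‖e - e'‖ + ‖u - u'‖ * ‖e'‖ := by
            refine (norm_add_le _ _).trans ?_
            rw [norm_mul u, norm_mul (u - u')]
          _ ≤ C * (|(d : ℝ)| * (L * |ξ - ξ'|)) + C * |ξ - ξ'| * 1 := by
            rw [e1]
            gcongr
          _ ≤ (C + C * L) * (1 + |(d : ℝ)|) * |ξ - ξ'| := by
            have h1 : 0 ≤ C * |ξ - ξ'| * |(d : ℝ)| := by positivity
            have h2 : 0 ≤ C * L * |ξ - ξ'| := by positivity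
            linarith)
    rw [hlen] at h1
    refine h1.trans (le_of_eq ?_)
    ring

end Symbols

end

/-! ### Fourier coefficients of the system: decay and dependence on the parameter -/

section

open Set Filter Topology Complex ComplexConjugate MeasureTheory
open scoped NNReal

section CoefficientDecay

/-- Fourier coefficients of the restriction of a function to `[0, 2π)`. -/
def fc (f : ℝ → ℂ) (d : ℤ) : ℂ := fourierCoeff (onCircle f) d

lemma fc_eq (f : ℝ → ℂ) (d : ℤ) :
    fc f d = (1 / (2 * Real.pi) : ℝ) • ∫ x in (0 : ℝ)..(2 * Real.pi), exp (I * (-(d * x) : ℝ)) * f x := by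
  have h := fourierCoeff_eq_intervalIntegral (onCircle f) d 0
  rw [zero_add] at h
  rw [fc, h]
  congr 1
  have hpi := Real.pi_pos
  refine intervalIntegral.integral_congr_Ioo_of_le (by positivity) fun x hx => ?_
  have h2 : (x : Circ) = (x : AddCircle (2 * Real.pi)) := rfl
  rw [onCircle, AddCircle.liftIco_coe_apply (by rw [zero_add]; exact Ioo_subset_Ico_self hx),
    fourier_coe_apply, smul_eq_mul]
  congr 2
  have : (Real.pi : ℂ) ≠ 0 := ofReal_ne_zero.2 Real.pi_ne_zero
  push_cast
  field_simp

lemma fc_congr {f g : ℝ → ℂ} (h : ∀ φ, f φ = g φ) : fc f = fc g := by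
  rw [show f = g from funext h]

lemma fc_exp_mul (f : ℝ → ℂ) (d : ℤ) : fc (fun φ => exp (2 * I * φ) * f φ) d = fc f (d - 2) := by
  rw [fc_eq, fc_eq]
  congr 1
  refine intervalIntegral.integral_congr fun x _ => ?_
  rw [← mul_assoc, ← exp_add]
  congr 2
  push_cast
  ring

lemma fc_conj (f : ℝ → ℂ) (d : ℤ) : fc (fun φ => conj (f φ)) d = conj (fc f (-d)) := by
  rw [fc_eq, fc_eq, real_smul, real_smul, map_mul, conj_ofReal,
    intervalIntegral.intervalIntegral_eq_integral_uIoc, intervalIntegral.intervalIntegral_eq_integral_uIoc,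
    if_pos (by have := Real.pi_pos; positivity), one_smul, one_smul, ← integral_conj]
  congr 2
  funext x
  rw [map_mul, ← exp_conj]
  congr 2
  simp

/-- Families of sequences which decay rapidly, uniformly and in a Lipschitz way with respect to the
parameter. -/
def DecayLip (O : Set ℝ) (F : ℝ → ℤ → ℂ) : Prop :=
  ∀ k : ℕ, ∃ C : ℝ, 0 ≤ C ∧ ∀ d : ℤ, (∀ ξ ∈ O, ‖F ξ d‖ * (1 + |(d : ℝ)|) ^ k ≤ C) ∧
    ∀ ξ ∈ O, ∀ ξ' ∈ O, ‖F ξ d - F ξ' d‖ * (1 + |(d : ℝ)|) ^ k ≤ C * |ξ - ξ'|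

variable {O : Set ℝ} {F : ℝ → ℤ → ℂ}

lemma DecayLip.congr {F' : ℝ → ℤ → ℂ} (hF : DecayLip O F) (h : ∀ ξ ∈ O, ∀ d, F' ξ d = F ξ d) :
    DecayLip O F' := by
  intro k
  obtain ⟨C, hC0, hC⟩ := hF k
  refine ⟨C, hC0, fun d => ⟨fun ξ hξ => ?_, fun ξ hξ ξ' hξ' => ?_⟩⟩
  · rw [h ξ hξ]
    exact (hC d).1 ξ hξ
  · rw [h ξ hξ, h ξ' hξ']
    exact (hC d).2 ξ hξ ξ' hξ'

lemma DecayLip.conj (hF : DecayLip O F) : DecayLip O fun ξ d => conj (F ξ (-d)) := by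
  intro k
  obtain ⟨C, hC0, hC⟩ := hF k
  refine ⟨C, hC0, fun d => ⟨fun ξ hξ => ?_, fun ξ hξ ξ' hξ' => ?_⟩⟩
  · simpa using (hC (-d)).1 ξ hξ
  · rw [← map_sub, norm_conj]
    simpa using (hC (-d)).2 ξ hξ ξ' hξ'

lemma DecayLip.shift (hF : DecayLip O F) : DecayLip O fun ξ d => F ξ (d - 2) := by
  intro k
  obtain ⟨C, hC0, hC⟩ := hF k
  have key : ∀ d : ℤ, (1 + |(d : ℝ)|) ^ k ≤ 3 ^ k * (1 + |((d - 2 : ℤ) : ℝ)|) ^ k := fun d => by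
    rw [← mul_pow]
    gcongr
    push_cast
    have h1 : |(d : ℝ)| ≤ |(d : ℝ) - 2| + 2 := by
      have := abs_add_le ((d : ℝ) - 2) 2
      simpa using this
    linarith [abs_nonneg ((d : ℝ) - 2)]
  have key2 : ∀ (x B : ℝ) (d : ℤ), 0 ≤ x → x * (1 + |((d - 2 : ℤ) : ℝ)|) ^ k ≤ B →
      x * (1 + |(d : ℝ)|) ^ k ≤ 3 ^ k * B := fun x B d hx h => by
    calc x * (1 + |(d : ℝ)|) ^ k ≤ x * (3 ^ k * (1 + |((d - 2 : ℤ) : ℝ)|) ^ k) := by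
          gcongr
          exact key d
      _ = 3 ^ k * (x * (1 + |((d - 2 : ℤ) : ℝ)|) ^ k) := by ring
      _ ≤ _ := by gcongr
  refine ⟨3 ^ k * C, by positivity, fun d => ⟨fun ξ hξ => ?_, fun ξ hξ ξ' hξ' => ?_⟩⟩
  · exact key2 _ _ d (norm_nonneg _) ((hC (d - 2)).1 ξ hξ)
  · rw [mul_assoc]
    exact key2 _ _ d (norm_nonneg _) ((hC (d - 2)).2 ξ hξ ξ' hξ')

variable {y ξl ξu : ℝ}

/-- Substituting the angle for `φ` eliminates the inverse function `Θ`: the dependence on `ξ` is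
left in an analytic amplitude and an explicit phase. -/
lemma fc_comp_Theta (hy : 0 < y) {g : ℝ × ℝ → ℂ} (hg : IsSymbol y g) {ξ : ℝ} (hξ0 : 0 < ξ)
    (hξ : 2 * ξ ^ 2 < y ^ 2) (d : ℤ) :
    fc (fun φ => g (ξ, Theta y ξ φ)) d = (1 / (2 * Real.pi) : ℝ) • oscInt y g d ξ := by
  rw [fc_eq]
  congr 1
  have hgc := hg.continuous hξ0 hξ
  have hΘ := continuous_Theta hy hξ0 hξ
  have h := intervalIntegral.integral_deriv_smul_comp (a := Real.pi / 2) (b := 5 * Real.pi / 2)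
    (f := phase y ξ) (f' := fun ϕ => phaseSpeed y (ξ, ϕ))
    (g := fun x => exp (I * (-(d * x) : ℝ)) * g (ξ, Theta y ξ x))
    (fun ϕ _ => hasDerivAt_phase hy hξ ϕ) (continuous_phaseSpeed hy hξ).continuousOn
    (Continuous.mul (by fun_prop) (hgc.comp hΘ))
  have hph : phase y ξ (5 * Real.pi / 2) = 2 * Real.pi := by
    have := phase_add_two_pi hy hξ0 hξ (Real.pi / 2)
    rw [phase_pi_div_two, zero_add] at this
    rw [← this]
    ring_nf
  rw [phase_pi_div_two, hph] at h
  rw [← h, oscInt]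
  refine intervalIntegral.integral_congr fun ϕ _ => ?_
  simp only [Function.comp_apply, Theta_phase hy hξ0 hξ, real_smul]
  ring

lemma decayLip_oscInt (hy : 0 < y) (hl : 0 < ξl) (hu : ξu < y / √2) {g : ℝ × ℝ → ℂ}
    (hg : IsSymbol y g) : DecayLip (Icc ξl ξu) fun ξ d => oscInt y g d ξ := by
  have hiter : ∀ (k : ℕ) (g : ℝ × ℝ → ℂ), IsSymbol y g → ∃ C : ℝ, 0 ≤ C ∧ ∀ d : ℤ,
      (∀ ξ ∈ Icc ξl ξu, ‖oscInt y g d ξ‖ * |(d : ℝ)| ^ k ≤ C) ∧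
      ∀ ξ ∈ Icc ξl ξu, ∀ ξ' ∈ Icc ξl ξu,
        ‖oscInt y g d ξ - oscInt y g d ξ'‖ * |(d : ℝ)| ^ k ≤ C * (1 + |(d : ℝ)|) * |ξ - ξ'| := by
    intro k
    induction k with
    | zero => intro g hg; simpa using exists_oscInt_bound hy hg hl hu
    | succ k ih =>
      intro g hg
      obtain ⟨C, hC0, hC⟩ := ih _ (hg.symDeriv hy)
      refine ⟨C, hC0, fun d => ?_⟩
      have hd : ‖I * (d : ℂ)‖ = |(d : ℝ)| := by simp
      have hm : ∀ ξ ∈ Icc ξl ξu, I * d * oscInt y g d ξ = oscInt y (symDeriv y g) d ξ := fun ξ hξ =>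
        have := rectangle_subset hl hu hξ 0
        mul_oscInt hy hg this.1 this.2 d
      refine ⟨fun ξ hξ => ?_, fun ξ hξ ξ' hξ' => ?_⟩
      · have h1 := (hC d).1 ξ hξ
        rw [← hm ξ hξ, norm_mul, hd] at h1
        calc _ = |(d : ℝ)| * ‖oscInt y g d ξ‖ * |(d : ℝ)| ^ k := by ring
          _ ≤ C := h1
      · have h1 := (hC d).2 ξ hξ ξ' hξ'
        rw [← hm ξ hξ, ← hm ξ' hξ', ← mul_sub, norm_mul, hd] at h1
        calc _ = |(d : ℝ)| * ‖oscInt y g d ξ - oscInt y g d ξ'‖ * |(d : ℝ)| ^ k := by ring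
          _ ≤ _ := h1
  intro k
  obtain ⟨C₁, hC₁0, hC₁⟩ := hiter 0 g hg
  -- One integration by parts more than the order `k`, to pay for the factor `1 + |d|` lost in the
  -- Lipschitz bound.
  obtain ⟨C₂, hC₂0, hC₂⟩ := hiter (k + 1) g hg
  have hb : ∀ (x B₁ B₂ : ℝ) (d : ℤ), 0 ≤ x → x * |(d : ℝ)| ^ 0 ≤ B₁ → x * |(d : ℝ)| ^ (k + 1) ≤ B₂ →
      x * (1 + |(d : ℝ)|) ^ (k + 1) ≤ 2 ^ (k + 1) * (B₁ + B₂) := by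
    intro x B₁ B₂ d hx h1 h2
    have h3 : (1 + |(d : ℝ)|) ^ (k + 1) ≤ 2 ^ (k + 1) * (1 + |(d : ℝ)| ^ (k + 1)) := by
      have := add_pow_le (zero_le_one) (abs_nonneg (d : ℝ)) (k + 1)
      rw [one_pow] at this
      refine this.trans ?_
      gcongr
      · norm_num
      · simp
    calc x * (1 + |(d : ℝ)|) ^ (k + 1) ≤ x * (2 ^ (k + 1) * (1 + |(d : ℝ)| ^ (k + 1))) := by gcongr
      _ = 2 ^ (k + 1) * (x * |(d : ℝ)| ^ 0 + x * |(d : ℝ)| ^ (k + 1)) := by ring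
      _ ≤ _ := by gcongr
  refine ⟨2 ^ (k + 1) * (C₁ + C₂), by positivity, fun d => ⟨fun ξ hξ => ?_, fun ξ hξ ξ' hξ' => ?_⟩⟩
  · refine le_trans ?_ (hb _ _ _ d (norm_nonneg _) ((hC₁ d).1 ξ hξ) ((hC₂ d).1 ξ hξ))
    gcongr
    · linarith [abs_nonneg (d : ℝ)]
    · omega
  · have h := hb _ _ _ d (norm_nonneg _) ((hC₁ d).2 ξ hξ ξ' hξ') ((hC₂ d).2 ξ hξ ξ' hξ')
    have hpos : 0 < 1 + |(d : ℝ)| := by positivity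
    refine le_of_mul_le_mul_right ?_ hpos
    calc _ = ‖oscInt y g d ξ - oscInt y g d ξ'‖ * (1 + |(d : ℝ)|) ^ (k + 1) := by ring
      _ ≤ _ := h
      _ = _ := by ring

lemma param_bounds (hl : 0 < ξl) (hu : ξu < y / √2) {ξ : ℝ} (hξ : ξ ∈ Icc ξl ξu) :
    0 < ξ ∧ 2 * ξ ^ 2 < y ^ 2 := rectangle_subset hl hu hξ 0

lemma decayLip_comp_Theta (hy : 0 < y) (hl : 0 < ξl) (hu : ξu < y / √2) {g : ℝ × ℝ → ℂ}
    (hg : IsSymbol y g) : DecayLip (Icc ξl ξu) fun ξ => fc fun φ => g (ξ, Theta y ξ φ) := by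
  intro k
  have hpi := Real.pi_pos
  obtain ⟨C, hC0, hC⟩ := decayLip_oscInt hy hl hu hg k
  have hn : ‖(1 / (2 * Real.pi) : ℝ)‖ = 1 / (2 * Real.pi) := by
    rw [Real.norm_of_nonneg (by positivity)]
  refine ⟨1 / (2 * Real.pi) * C, by positivity, fun d => ⟨fun ξ hξ => ?_, fun ξ hξ ξ' hξ' => ?_⟩⟩
  · have h := param_bounds hl hu hξ
    beta_reduce
    rw [fc_comp_Theta hy hg h.1 h.2, norm_smul, hn, mul_assoc]
    gcongr
    exact (hC d).1 ξ hξ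
  · have h := param_bounds hl hu hξ
    have h' := param_bounds hl hu hξ'
    beta_reduce
    rw [fc_comp_Theta hy hg h.1 h.2, fc_comp_Theta hy hg h'.1 h'.2, ← smul_sub, norm_smul, hn,
      mul_assoc, mul_assoc]
    exact mul_le_mul_of_nonneg_left ((hC d).2 ξ hξ ξ' hξ') (by positivity)

lemma isSymbol_const (c : ℂ) : IsSymbol y fun _ => c := ⟨fun _ _ => analyticAt_const, fun _ => rfl⟩

lemma IsSymbol.add {g g' : ℝ × ℝ → ℂ} (hg : IsSymbol y g) (hg' : IsSymbol y g') :
    IsSymbol y fun p => g p + g' p where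
  analytic p hp := (hg.analytic p hp).add (hg'.analytic p hp)
  periodic p := by rw [hg.periodic, hg'.periodic]

lemma IsSymbol.sub {g g' : ℝ × ℝ → ℂ} (hg : IsSymbol y g) (hg' : IsSymbol y g') :
    IsSymbol y fun p => g p - g' p where
  analytic p hp := (hg.analytic p hp).sub (hg'.analytic p hp)
  periodic p := by rw [hg.periodic, hg'.periodic]

lemma periodic_cr (z ϕ : ℂ) : cr y z (ϕ + 2 * Real.pi) = cr y z ϕ := by
  simp [cr, cj, cP, cR, cos_add_two_pi, sin_add_two_pi]

lemma isSymbol_g₃ (hy : 0 < y) : IsSymbol y fun p => g₃ y p.1 p.2 where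
  analytic p hp := analyticAt_ofReal_prod (G := fun p => g₃ y p.1 p.2) (analyticAt_g₃ hy hp.2 p.2)
  periodic p := by simp [g₃, periodic_cr, sin_add_two_pi]

lemma isSymbol_g₄ (hy : 0 < y) : IsSymbol y fun p => g₄ y I p.1 p.2 where
  analytic p hp := analyticAt_ofReal_prod (G := fun p => g₄ y I p.1 p.2)
    (analyticAt_g₄ hy hp.2 p.2 (Or.inl rfl))
  periodic p := by simp [g₄, periodic_cr, cos_add_two_pi]

lemma isSymbol_g₀_div (hy : 0 < y) : IsSymbol y fun p => g₀ I p.2 / cJ y p.1 p.2 where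
  analytic p hp := analyticAt_ofReal_prod (G := fun p => g₀ I p.2 / cJ y p.1 p.2)
    (AnalyticAt.div (by unfold g₀; exact (((analyticAt_const.mul analyticAt_snd).neg).cexp))
      (analyticAt_cJ hy hp.2 p.2) (cJ_ne_zero hy hp.1 hp.2 p.2))
  periodic p := by
    have e : exp (-(2 * I * (p.2 + 2 * Real.pi))) = exp (-(2 * I * p.2)) := by
      rw [show -(2 * I * ((p.2 : ℂ) + 2 * Real.pi)) = -(2 * I * p.2) - (2 : ℤ) • (2 * Real.pi * I) by
        simp; ring, exp_periodic.sub_zsmul_eq]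
    simp [g₀, e, cJ, cj, cP, cR, cos_add_two_pi, sin_add_two_pi]

/-- `ρ₁`, as a function of the angle. -/
def s₁ (y : ℝ) (p : ℝ × ℝ) : ℂ := I + I / 2 * (g₃ y p.1 p.2 / omega y p.1)

/-- `e^{-2iφ} ρ₂`, as a function of the angle. -/
def s₂ (y : ℝ) (p : ℝ × ℝ) : ℂ :=
  -(I / 4) * ((g₀ I p.2 / cJ y p.1 p.2 - g₃ y p.1 p.2 - g₄ y I p.1 p.2) / omega y p.1)

/-- `ρ₃`, as a function of the angle. -/
def s₃ (y : ℝ) (p : ℝ × ℝ) : ℂ := -(I / 2) * (g₄ y I p.1 p.2 / omega y p.1)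

/-- `e^{-2iφ} ρ₄`, as a function of the angle. -/
def s₄ (y : ℝ) (p : ℝ × ℝ) : ℂ := I / 2 * (g₀ I p.2 / cJ y p.1 p.2 / omega y p.1)

lemma isSymbol_s (hy : 0 < y) :
    IsSymbol y (s₁ y) ∧ IsSymbol y (s₂ y) ∧ IsSymbol y (s₃ y) ∧ IsSymbol y (s₄ y) := by
  have hω : ∀ p ∈ symDomain y, (omega y p.1 : ℂ) ≠ 0 := fun p hp =>
    ofReal_ne_zero.2 (omega_pos hy hp.1 hp.2).ne'
  have ho := isSymbol_omega hy
  have h3 := isSymbol_g₃ hy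
  have h4 := isSymbol_g₄ hy
  have h0 := isSymbol_g₀_div hy
  exact ⟨(isSymbol_const I).add ((isSymbol_const _).mul (h3.div ho hω)),
    (isSymbol_const _).mul (((h0.sub h3).sub h4).div ho hω),
    (isSymbol_const _).mul (h4.div ho hω), (isSymbol_const _).mul (h0.div ho hω)⟩

lemma ρ_eq_s (hy : 0 < y) {ξ : ℝ} (hξ0 : 0 < ξ) (hξ : 2 * ξ ^ 2 < y ^ 2) (φ : ℝ) :
    ρ₁ y ξ φ = s₁ y (ξ, Theta y ξ φ) ∧ ρ₂ y ξ φ = exp (2 * I * φ) * s₂ y (ξ, Theta y ξ φ) ∧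
    ρ₃ y ξ φ = s₃ y (ξ, Theta y ξ φ) ∧ ρ₄ y ξ φ = exp (2 * I * φ) * s₄ y (ξ, Theta y ξ φ) := by
  have h3 : (omega y ξ : ℂ) ≠ 0 := ofReal_ne_zero.2 (omega_pos hy hξ0 hξ).ne'
  have e3 := inv_w₃_sq hy hξ0 hξ φ
  have e4 := inv_w₄_sq hy hξ0 hξ φ
  refine ⟨?_, ?_, ?_, ?_⟩
  · rw [ρ₁, s₁, ← e3]
    field_simp
  · rw [ρ₂, s₂, β_eq hy hξ0 hξ]
    field_simp
  · rw [ρ₃, s₃, ← e4]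
    field_simp
  · rw [ρ₄, s₄, κ_eq hy hξ0 hξ]
    field_simp

lemma decayLip_ρ (hy : 0 < y) (hl : 0 < ξl) (hu : ξu < y / √2) :
    DecayLip (Icc ξl ξu) (fun ξ => fc (ρ₁ y ξ)) ∧ DecayLip (Icc ξl ξu) (fun ξ => fc (ρ₂ y ξ)) ∧
    DecayLip (Icc ξl ξu) (fun ξ => fc (ρ₃ y ξ)) ∧ DecayLip (Icc ξl ξu) (fun ξ => fc (ρ₄ y ξ)) := by
  obtain ⟨h1, h2, h3, h4⟩ := isSymbol_s hy
  have key := fun ξ (hξ : ξ ∈ Icc ξl ξu) =>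
    ρ_eq_s hy (param_bounds hl hu hξ).1 (param_bounds hl hu hξ).2
  refine ⟨(decayLip_comp_Theta hy hl hu h1).congr fun ξ hξ d => ?_,
    (decayLip_comp_Theta hy hl hu h2).shift.congr fun ξ hξ d => ?_,
    (decayLip_comp_Theta hy hl hu h3).congr fun ξ hξ d => ?_,
    (decayLip_comp_Theta hy hl hu h4).shift.congr fun ξ hξ d => ?_⟩
  · rw [fc_congr fun φ => (key ξ hξ φ).1]
  · rw [fc_congr fun φ => (key ξ hξ φ).2.1, fc_exp_mul]
  · rw [fc_congr fun φ => (key ξ hξ φ).2.2.1]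
  · rw [fc_congr fun φ => (key ξ hξ φ).2.2.2, fc_exp_mul]

/-- Coefficients of the system satisfied by the modes `±1`: the part without delay. -/
def symb (y ξ : ℝ) (ς ς' : ℤˣ) (φ : ℝ) : ℂ :=
  if ς = 1 then (if ς = ς' then ρ₁ y ξ φ else ρ₂ y ξ φ)
  else conj (if ς = ς' then ρ₁ y ξ φ else ρ₂ y ξ φ)

/-- Coefficients of the system satisfied by the modes `±1`: the part with delay. -/
def symD (y ξ : ℝ) (ς ς' : ℤˣ) (φ : ℝ) : ℂ :=
  if ς = 1 then (if ς = ς' then ρ₃ y ξ φ else ρ₄ y ξ φ)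
  else conj (if ς = ς' then ρ₃ y ξ φ else ρ₄ y ξ φ)

/-- The kernel of the system satisfied by the Fourier coefficients. -/
def ker (y ξ : ℝ) (i j : Idx) : ℂ :=
  fc (symb y ξ i.2 j.2) (i.1 - j.1) + (-1) ^ j.1 * fc (symD y ξ i.2 j.2) (i.1 - j.1)

lemma decayLip_symb (hy : 0 < y) (hl : 0 < ξl) (hu : ξu < y / √2) (ς ς' : ℤˣ) :
    DecayLip (Icc ξl ξu) (fun ξ => fc (symb y ξ ς ς')) ∧
    DecayLip (Icc ξl ξu) (fun ξ => fc (symD y ξ ς ς')) := by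
  obtain ⟨h1, h2, h3, h4⟩ := decayLip_ρ hy hl hu
  have key : ∀ f : ℝ → ℝ → ℂ, DecayLip (Icc ξl ξu) (fun ξ => fc (f ξ)) →
      DecayLip (Icc ξl ξu) fun ξ => fc fun φ => if ς = 1 then f ξ φ else conj (f ξ φ) := by
    intro f hf
    by_cases a : ς = 1
    · simpa only [if_pos a] using hf
    · simp only [if_neg a]
      exact hf.conj.congr fun ξ _ d => fc_conj _ _
  constructor
  · refine key (fun ξ φ => if ς = ς' then ρ₁ y ξ φ else ρ₂ y ξ φ) ?_
    by_cases b : ς = ς'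
    · simpa only [if_pos b] using h1
    · simpa only [if_neg b] using h2
  · refine key (fun ξ φ => if ς = ς' then ρ₃ y ξ φ else ρ₄ y ξ φ) ?_
    by_cases b : ς = ς'
    · simpa only [if_pos b] using h3
    · simpa only [if_neg b] using h4

lemma gap_eq (i j : Idx) : gap i j = 1 + |((i.1 - j.1 : ℤ) : ℝ)| := by
  simp [gap]

lemma exists_kernelBound (hy : 0 < y) (hl : 0 < ξl) (hu : ξu < y / √2) :
    ∃ c : ℕ → ℝ≥0, (∀ ξ ∈ Icc ξl ξu, KernelBound c (ker y ξ)) ∧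
      ∀ ξ ∈ Icc ξl ξu, ∀ ξ' ∈ Icc ξl ξu,
        KernelBound (fun k => c k * ‖ξ - ξ'‖₊) fun i j => ker y ξ i j - ker y ξ' i j := by
  choose C₁ hC₁0 hC₁ using fun ς ς' k => (decayLip_symb hy hl hu ς ς').1 k
  choose C₂ hC₂0 hC₂ using fun ς ς' k => (decayLip_symb hy hl hu ς ς').2 k
  have hle : ∀ ς ς' k, C₁ ς ς' k + C₂ ς ς' k ≤ ∑ p : ℤˣ × ℤˣ, (C₁ p.1 p.2 k + C₂ p.1 p.2 k) :=
    fun ς ς' k => Finset.single_le_sum (f := fun p : ℤˣ × ℤˣ => C₁ p.1 p.2 k + C₂ p.1 p.2 k)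
      (fun p _ => add_nonneg (hC₁0 _ _ _) (hC₂0 _ _ _)) (Finset.mem_univ (ς, ς'))
  have hnn : ∀ k, 0 ≤ ∑ p : ℤˣ × ℤˣ, (C₁ p.1 p.2 k + C₂ p.1 p.2 k) := fun k =>
    Finset.sum_nonneg fun p _ => add_nonneg (hC₁0 _ _ _) (hC₂0 _ _ _)
  have hsign : ∀ m : ℤ, ‖((-1 : ℂ)) ^ m‖ = 1 := fun m => by simp
  refine ⟨fun k => ⟨_, hnn k⟩, fun ξ hξ k i j => ?_, fun ξ hξ ξ' hξ' k i j => ?_⟩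
  · have hg : 0 < gap i j ^ k := by rw [gap_eq]; positivity
    rw [← div_eq_mul_inv, le_div_iff₀ hg, ker, gap_eq]
    refine le_trans ?_ (hle i.2 j.2 k)
    refine le_trans (mul_le_mul_of_nonneg_right (norm_add_le _ _) (by positivity)) ?_
    rw [norm_mul, hsign, one_mul, add_mul]
    exact add_le_add ((hC₁ _ _ k _).1 ξ hξ) ((hC₂ _ _ k _).1 ξ hξ)
  · have hg : 0 < gap i j ^ k := by rw [gap_eq]; positivity
    rw [← div_eq_mul_inv, le_div_iff₀ hg, gap_eq]
    simp only [ker]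
    refine le_trans ?_ (mul_le_mul_of_nonneg_right (hle i.2 j.2 k) (abs_nonneg (ξ - ξ')))
    have e : ∀ a b c a' c' : ℂ, a + b * c - (a' + b * c') = (a - a') + b * (c - c') := by
      intros; ring
    rw [e]
    refine le_trans (mul_le_mul_of_nonneg_right (norm_add_le _ _) (by positivity)) ?_
    rw [norm_mul, hsign, one_mul, add_mul, add_mul]
    exact add_le_add ((hC₁ _ _ k _).2 ξ hξ ξ' hξ') ((hC₂ _ _ k _).2 ξ hξ ξ' hξ')

end CoefficientDecay

end

/-! ### Periodic solutions of linear 4 × 4 systems -/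

section

open Set Filter Topology Complex ComplexConjugate
open scoped NNReal

section PeriodicODE

lemma norm_mulVec_le {M : Mat4} {a : ℝ} (ha : ∀ i j, ‖M i j‖ ≤ a) (x : Fin 4 → ℂ) :
    ‖M.mulVec x‖ ≤ 4 * a * ‖x‖ := by
  have ha0 : 0 ≤ a := (norm_nonneg _).trans (ha 0 0)
  refine (pi_norm_le_iff_of_nonneg (by positivity)).2 fun i => ?_
  calc ‖M.mulVec x i‖ ≤ ∑ j, ‖M i j * x j‖ := by
        rw [Matrix.mulVec, dotProduct]
        exact norm_sum_le _ _
    _ ≤ ∑ _j : Fin 4, a * ‖x‖ := by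
      gcongr with j
      rw [norm_mul]
      gcongr
      · exact ha i j
      · exact norm_le_pi_norm x j
    _ = 4 * a * ‖x‖ := by simp; ring

lemma norm_linear_ode_le {𝒜 : ℝ → Mat4} {a : ℝ} (ha : ∀ φ i j, ‖𝒜 φ i j‖ ≤ a)
    {X G : ℝ → Fin 4 → ℂ} (hX : ∀ φ, HasDerivAt X ((𝒜 φ).mulVec (X φ) + G φ) φ) {g : ℝ} (hg : 0 ≤ g)
    (hG : ∀ φ, ‖G φ‖ ≤ g) {φ : ℝ} (hφ : φ ∈ Icc 0 (2 * Real.pi)) :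
    ‖X φ‖ ≤ (‖X 0‖ + g) * Real.exp ((4 * a + 1) * (2 * Real.pi)) := by
  have ha0 : 0 ≤ a := (norm_nonneg _).trans (ha 0 0 0)
  -- The extra 1 keeps the Gronwall rate positive when `a = 0`, and makes `g / K ≤ g`.
  have hK : 0 < 4 * a + 1 := by positivity
  have h := norm_le_gronwallBound_of_norm_deriv_right_le (f := X) (K := 4 * a + 1) (ε := g) (a := 0)
    (b := 2 * Real.pi) (fun φ _ => (hX φ).continuousAt.continuousWithinAt)
    (fun φ _ => (hX φ).hasDerivWithinAt) (le_refl ‖X 0‖) (fun φ _ => by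
      refine (norm_add_le _ _).trans (add_le_add ?_ (hG φ))
      refine (norm_mulVec_le (ha φ) _).trans ?_
      gcongr
      linarith) φ hφ
  refine h.trans ?_
  rw [gronwallBound_of_K_ne_0 hK.ne', sub_zero]
  have h1 : Real.exp ((4 * a + 1) * φ) ≤ Real.exp ((4 * a + 1) * (2 * Real.pi)) := by
    gcongr
    exact hφ.2
  have h2 : g / (4 * a + 1) ≤ g := div_le_self hg (by linarith)
  have h3 : 1 ≤ Real.exp ((4 * a + 1) * φ) := Real.one_le_exp (mul_nonneg hK.le hφ.1)
  calc _ ≤ ‖X 0‖ * Real.exp ((4 * a + 1) * (2 * Real.pi)) +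
        g * Real.exp ((4 * a + 1) * (2 * Real.pi)) :=
        add_le_add (mul_le_mul_of_nonneg_left h1 (norm_nonneg _))
          (mul_le_mul h2 (by linarith) (by linarith) hg)
    _ = _ := by ring

lemma norm_det_le {M : Mat4} {x : ℝ} (h : ∀ i j, ‖M i j‖ ≤ x) : ‖M.det‖ ≤ 24 * x ^ 4 := by
  have h1 : ‖M.det‖ ≤ (Fintype.card (Fin 4)).factorial • x ^ Fintype.card (Fin 4) :=
    Matrix.det_le (abv := NormedField.toAbsoluteValue ℂ) (A := M) (x := x) h
  simpa [Nat.factorial] using h1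

lemma norm_adjugate_le {M : Mat4} {x : ℝ} (hx : 1 ≤ x) (h : ∀ i j, ‖M i j‖ ≤ x) (i j : Fin 4) :
    ‖M.adjugate i j‖ ≤ 24 * x ^ 4 := by
  rw [Matrix.adjugate_apply]
  refine norm_det_le fun k l => ?_
  rw [Matrix.updateRow_apply]
  split_ifs
  · rw [Pi.single_apply]
    split_ifs
    · simpa using hx
    · simpa using zero_le_one.trans hx
  · exact h k l

/-- A priori estimate for the periodic solutions of a linear system, in terms of the determinant
`det (M(2π) - 1)`. -/
lemma exists_periodic_ode_bound (a : ℝ) (ha0 : 0 ≤ a) : ∃ C : ℝ, 0 ≤ C ∧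
    ∀ (𝒜 : ℝ → Mat4), (∀ φ i j, ‖𝒜 φ i j‖ ≤ a) → ∀ M : ℝ → Mat4, M 0 = 1 →
    (∀ φ i j, HasDerivAt (fun t => M t i j) ((𝒜 φ * M φ) i j) φ) →
    ∀ X G : ℝ → Fin 4 → ℂ, (∀ φ, HasDerivAt X ((𝒜 φ).mulVec (X φ) + G φ) φ) →
    X (2 * Real.pi) = X 0 → ∀ g, 0 ≤ g → (∀ φ, ‖G φ‖ ≤ g) → ∀ φ ∈ Icc 0 (2 * Real.pi),
    ‖(M (2 * Real.pi) - 1).det‖ * ‖X φ‖ ≤ C * g := by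
  set Q := Real.exp ((4 * a + 1) * (2 * Real.pi))
  have hpi := Real.pi_pos
  have hQ : 1 ≤ Q := Real.one_le_exp (by positivity)
  set R := 24 * (Q + 1) ^ 4
  have hR : 0 ≤ R := by positivity
  refine ⟨(4 * R * Q + R) * Q, by positivity, fun 𝒜 hA M hM0 hM X G hX hper g hg hG φ hφ => ?_⟩
  have h2π : 2 * Real.pi ∈ Icc 0 (2 * Real.pi) := ⟨by positivity, le_rfl⟩
  have hMv : ∀ v : Fin 4 → ℂ, ∀ φ, HasDerivAt (fun t => (M t).mulVec v)
      ((𝒜 φ).mulVec ((M φ).mulVec v)) φ := by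
    intro v φ
    refine hasDerivAt_pi.2 fun i => ?_
    have h1 : HasDerivAt (fun t => ∑ j, M t i j * v j) (∑ j, (𝒜 φ * M φ) i j * v j) φ :=
      HasDerivAt.fun_sum fun j _ => (hM φ i j).mul_const _
    refine h1.congr_deriv ?_
    rw [Matrix.mulVec_mulVec]
    rfl
  have hMb : ∀ i j, ‖(M (2 * Real.pi) - 1) i j‖ ≤ Q + 1 := by
    intro i j
    have h1 := norm_linear_ode_le hA (X := fun t => (M t).mulVec (Pi.single j 1)) (G := fun _ => 0)
      (fun φ => by simpa using hMv (Pi.single j 1) φ) le_rfl (fun φ => by simp) h2π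
    simp only [hM0, Matrix.mulVec_single_one, add_zero] at h1
    have h1' : ∀ i j, ‖(1 : Mat4) i j‖ ≤ 1 := fun i j => by
      rw [Matrix.one_apply]
      split_ifs <;> simp
    have h2 : ‖Matrix.col (1 : Mat4) j‖ ≤ 1 :=
      (pi_norm_le_iff_of_nonneg zero_le_one).2 fun i => h1' i j
    have h3 : ‖Matrix.col (M (2 * Real.pi)) j‖ ≤ Q :=
      h1.trans ((mul_le_mul_of_nonneg_right h2 (by positivity)).trans_eq (one_mul _))
    rw [Matrix.sub_apply]
    exact (norm_sub_le _ _).trans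
      (add_le_add ((norm_le_pi_norm (Matrix.col (M (2 * Real.pi)) j) i).trans h3) (h1' i j))
  set D := M (2 * Real.pi) - 1 with hD
  -- `Z` starts at 0, so it is controlled by the source alone, and periodicity of `X` gives `Z(2π) =
  -- -(M(2π) - 1) X(0)`. Applying the adjugate bounds `det · X(0)` without dividing by the
  -- determinant.
  set Z : ℝ → Fin 4 → ℂ := fun t => X t - (M t).mulVec (X 0) with hZdef
  have hZ : ∀ φ, HasDerivAt Z ((𝒜 φ).mulVec (Z φ) + G φ) φ := fun φ => by
    refine ((hX φ).sub (hMv (X 0) φ)).congr_deriv ?_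
    simp only [hZdef, Matrix.mulVec_sub]
    abel
  have hZ1 := norm_linear_ode_le hA hZ hg hG h2π
  have hZ0 : Z 0 = 0 := by simp [hZdef, hM0]
  rw [hZ0, norm_zero, zero_add] at hZ1
  have hZ2 : Z (2 * Real.pi) = -(D.mulVec (X 0)) := by
    simp [hZdef, hD, hper, Matrix.sub_mulVec]
  have hX0 : ‖D.det‖ * ‖X 0‖ ≤ 4 * R * (g * Q) := by
    have h1 : D.det • X 0 = -(D.adjugate.mulVec (Z (2 * Real.pi))) := by
      rw [hZ2, Matrix.mulVec_neg, neg_neg, Matrix.mulVec_mulVec, Matrix.adjugate_mul,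
        Matrix.smul_mulVec, Matrix.one_mulVec]
    rw [← norm_smul, h1, norm_neg]
    refine (norm_mulVec_le (norm_adjugate_le (by linarith) hMb) _).trans ?_
    gcongr
  have hdet : ‖D.det‖ ≤ R := norm_det_le hMb
  have hfin := norm_linear_ode_le hA hX hg hG hφ
  calc ‖D.det‖ * ‖X φ‖ ≤ ‖D.det‖ * ((‖X 0‖ + g) * Q) := by gcongr
    _ = (‖D.det‖ * ‖X 0‖ + ‖D.det‖ * g) * Q := by ring
    _ ≤ (4 * R * (g * Q) + R * g) * Q := by gcongr
    _ = _ := by ring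

end PeriodicODE

end

/-! ### Fourier series on the circle -/

section

open Set Filter Topology Complex ComplexConjugate MeasureTheory
open scoped NNReal ENNReal

section CircleFunctions

lemma onCircle_coe {f : ℝ → ℂ} (hf : Function.Periodic f (2 * Real.pi)) (x : ℝ) :
    onCircle f (x : Circ) = f x := by
  obtain ⟨n, hn, -⟩ := existsUnique_add_zsmul_mem_Ico Real.two_pi_pos x 0
  have h1 : (x : Circ) = ((x + n • (2 * Real.pi) : ℝ) : Circ) := by
    rw [AddCircle.coe_add, AddCircle.coe_zsmul, AddCircle.coe_period, smul_zero, add_zero]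
  rw [h1, onCircle, AddCircle.liftIco_coe_apply hn, hf.zsmul n x]

lemma continuous_onCircle {f : ℝ → ℂ} (hf : Function.Periodic f (2 * Real.pi)) (hc : Continuous f) :
    Continuous (onCircle f) :=
  AddCircle.liftIco_zero_continuous (by simpa using (hf 0).symm) hc.continuousOn

/-- The exponential `e^{imφ}`. -/
def expo (m : ℤ) (φ : ℝ) : ℂ := exp (I * (m * φ : ℝ))

lemma continuous_expo (m : ℤ) : Continuous (expo m) := by
  unfold expo
  fun_prop

lemma hasDerivAt_expo (m : ℤ) (φ : ℝ) : HasDerivAt (expo m) (I * m * expo m φ) φ := by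
  have h := (((hasDerivAt_id φ).const_mul (m : ℝ)).ofReal_comp.const_mul I).cexp
  refine h.congr_deriv ?_
  simp [expo]
  ring

lemma expo_add (m : ℤ) (φ ψ : ℝ) : expo m (φ + ψ) = expo m φ * expo m ψ := by
  rw [expo, expo, expo, ← exp_add]
  congr 1
  push_cast
  ring

lemma expo_pi (m : ℤ) : expo m Real.pi = (-1) ^ m := by
  rw [expo, ← exp_pi_mul_I, ← exp_int_mul]
  congr 1
  push_cast
  ring

lemma expo_two_pi (m : ℤ) : expo m (2 * Real.pi) = 1 := by
  rw [two_mul, expo_add, expo_pi, ← zpow_add₀ (by norm_num), ← two_mul, zpow_mul]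
  norm_num

lemma expo_periodic (m : ℤ) : Function.Periodic (expo m) (2 * Real.pi) := fun φ => by
  rw [expo_add, expo_two_pi, mul_one]

lemma fc_add {f g : ℝ → ℂ} (hf : Continuous f) (hg : Continuous g) (d : ℤ) :
    fc (fun φ => f φ + g φ) d = fc f d + fc g d := by
  simp only [fc_eq, mul_add]
  rw [intervalIntegral.integral_add, smul_add]
  all_goals exact Continuous.intervalIntegrable (by fun_prop) _ _

lemma fc_sub {f g : ℝ → ℂ} (hf : Continuous f) (hg : Continuous g) (d : ℤ) :
    fc (fun φ => f φ - g φ) d = fc f d - fc g d := by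
  simp only [fc_eq, mul_sub]
  rw [intervalIntegral.integral_sub, smul_sub]
  all_goals exact Continuous.intervalIntegrable (by fun_prop) _ _

lemma fc_sum {ι : Type*} (s : Finset ι) {f : ι → ℝ → ℂ} (hf : ∀ i, Continuous (f i)) (d : ℤ) :
    fc (fun φ => ∑ i ∈ s, f i φ) d = ∑ i ∈ s, fc (f i) d := by
  simp only [fc_eq, Finset.mul_sum]
  rw [intervalIntegral.integral_finsetSum, Finset.smul_sum]
  intro i _
  have := hf i
  exact Continuous.intervalIntegrable (by fun_prop) _ _

lemma fc_const_mul (c : ℂ) (f : ℝ → ℂ) (d : ℤ) : fc (fun φ => c * f φ) d = c * fc f d := by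
  simp only [fc_eq, mul_left_comm _ c]
  rw [intervalIntegral.integral_const_mul, mul_smul_comm]

lemma fc_mul_expo (f : ℝ → ℂ) (m d : ℤ) : fc (fun φ => f φ * expo m φ) d = fc f (d - m) := by
  rw [fc_eq, fc_eq]
  congr 1
  refine intervalIntegral.integral_congr fun x _ => ?_
  rw [expo, mul_left_comm, ← exp_add, mul_comm]
  congr 2
  push_cast
  ring

lemma fourier_coe (m : ℤ) (x : ℝ) : fourier m (x : Circ) = expo m x := by
  have : (Real.pi : ℂ) ≠ 0 := ofReal_ne_zero.2 Real.pi_ne_zero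
  rw [fourier_coe_apply, expo]
  congr 1
  push_cast
  field_simp

lemma onCircle_expo (m : ℤ) : onCircle (expo m) = fourier m := by
  funext x
  obtain ⟨x, rfl⟩ := QuotientAddGroup.mk_surjective x
  exact (onCircle_coe (expo_periodic m) x).trans (fourier_coe m x).symm

lemma fc_expo (m d : ℤ) : fc (expo m) d = if d = m then 1 else 0 := by
  rw [fc, onCircle_expo, fourierCoeff_fourier, Pi.single_apply]

lemma hasSum_fc {f : ℝ → ℂ} (hf : Function.Periodic f (2 * Real.pi)) (hc : Continuous f)
    (hs : Summable (fc f)) (φ : ℝ) : HasSum (fun d => fc f d * expo d φ) (f φ) := by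
  have h := has_pointwise_sum_fourier_series_of_summable
    (f := (⟨onCircle f, continuous_onCircle hf hc⟩ : C(Circ, ℂ))) hs (φ : Circ)
  rw [ContinuousMap.coe_mk, onCircle_coe hf] at h
  simp only [fourier_coe, smul_eq_mul] at h
  exact h

lemma enorm_le_tsum_fc {f : ℝ → ℂ} (hf : Function.Periodic f (2 * Real.pi)) (hc : Continuous f)
    (φ : ℝ) : ‖f φ‖ₑ ≤ ∑' d, ‖fc f d‖ₑ := by
  by_cases h : ∑' d, ‖fc f d‖ₑ = ∞
  · rw [h]
    exact le_top
  · have hs : Summable fun d => ‖fc f d‖ := by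
      have h1 := ENNReal.summable_toReal h
      simpa using h1
    have h2 := hasSum_fc hf hc hs.of_norm φ
    have hn : ∀ d, ‖fc f d * expo d φ‖ = ‖fc f d‖ := fun d => by
      rw [norm_mul, expo, norm_exp_I_mul_ofReal, mul_one]
    rw [← h2.tsum_eq]
    refine (enorm_tsum_le_tsum_enorm).trans (le_of_eq ?_)
    congr 1
    funext d
    rw [← ofReal_norm, hn, ofReal_norm]

lemma tsum_enorm_fc_sq_le {f : ℝ → ℂ} (hc : Continuous f) {B : ℝ} (hB0 : 0 ≤ B)
    (hB : ∀ φ ∈ Icc 0 (2 * Real.pi), ‖f φ‖ ≤ B) : ∑' d, ‖fc f d‖ₑ ^ 2 ≤ ENNReal.ofReal B ^ 2 := by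
  have hpi := Real.pi_pos
  have hab : (0 : ℝ) < 0 + 2 * Real.pi := lt_add_of_pos_right 0 two_pi_pos_fact.out
  have h0 : ∀ d, fc f d = fourierCoeffOn hab f d := fun d => fourierCoeff_liftIco_eq f d
  have hmem : MemLp f 2 (volume.restrict (Ioc 0 (0 + 2 * Real.pi))) := by
    refine MemLp.of_bound hc.aestronglyMeasurable B ?_
    filter_upwards [ae_restrict_mem measurableSet_Ioc] with x hx
    exact hB x ⟨hx.1.le, by simpa using hx.2⟩
  have hs := hasSum_sq_fourierCoeffOn hab hmem
  simp only [← h0] at hs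
  simp only [sub_zero, zero_add] at hs
  have h_int : ∫ x in (0 : ℝ)..(2 * Real.pi), ‖f x‖ ^ 2 ≤ 2 * Real.pi * B ^ 2 := by
    have h1 := intervalIntegral.norm_integral_le_of_norm_le_const (a := 0) (b := 2 * Real.pi)
      (f := fun x => ‖f x‖ ^ 2) (C := B ^ 2) (fun x hx => by
        rw [uIoc_of_le (by positivity)] at hx
        rw [norm_pow, norm_norm]
        gcongr
        exact hB x ⟨hx.1.le, hx.2⟩)
    rw [sub_zero, abs_of_pos (by positivity)] at h1
    exact (le_abs_self _).trans (h1.trans_eq (by ring))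
  have h2 : ∑' d, ‖fc f d‖ ^ 2 ≤ B ^ 2 := by
    rw [hs.tsum_eq, smul_eq_mul, inv_mul_le_iff₀ (by positivity)]
    exact h_int
  calc ∑' d, ‖fc f d‖ₑ ^ 2 = ENNReal.ofReal (∑' d, ‖fc f d‖ ^ 2) := by
        rw [ENNReal.ofReal_tsum_of_nonneg (fun d => by positivity) hs.summable]
        congr 1
        funext d
        rw [ENNReal.ofReal_pow (norm_nonneg _), ofReal_norm]
    _ ≤ ENNReal.ofReal (B ^ 2) := ENNReal.ofReal_le_ofReal h2
    _ = _ := ENNReal.ofReal_pow hB0 2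

end CircleFunctions

end

/-! ### The delay system on trigonometric polynomials -/

section

open Set Filter Topology Complex ComplexConjugate MeasureTheory
open scoped NNReal ENNReal

section Apriori

variable {y ξ ξl ξu : ℝ}

lemma continuous_periodic_ρ (hy : 0 < y) (hξ0 : 0 < ξ) (hξ : 2 * ξ ^ 2 < y ^ 2) :
    (Continuous (ρ₁ y ξ) ∧ Continuous (ρ₂ y ξ) ∧ Continuous (ρ₃ y ξ) ∧ Continuous (ρ₄ y ξ)) ∧
    Function.Periodic (ρ₁ y ξ) (2 * Real.pi) ∧ Function.Periodic (ρ₂ y ξ) (2 * Real.pi) ∧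
    Function.Periodic (ρ₃ y ξ) (2 * Real.pi) ∧ Function.Periodic (ρ₄ y ξ) (2 * Real.pi) := by
  have hΘ := continuous_Theta hy hξ0 hξ
  have key := ρ_eq_s hy hξ0 hξ
  obtain ⟨h1, h2, h3, h4⟩ := isSymbol_s hy
  have hc : ∀ g, IsSymbol y g → Continuous fun φ => g (ξ, Theta y ξ φ) := fun g hg =>
    (hg.continuous hξ0 hξ).comp hΘ
  have hp : ∀ g, IsSymbol y g → ∀ φ, g (ξ, Theta y ξ (φ + 2 * Real.pi)) = g (ξ, Theta y ξ φ) :=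
    fun g hg φ => by
      rw [Theta_two_pi hy hξ0 hξ, ← hg.periodic (ξ, Theta y ξ φ)]
      simp
  have he : ∀ φ : ℝ, exp (2 * I * (φ + 2 * Real.pi : ℝ)) = exp (2 * I * φ) := fun φ => by
    rw [show 2 * I * ((φ + 2 * Real.pi : ℝ) : ℂ) = 2 * I * φ + (2 : ℤ) • (2 * Real.pi * I) by
      push_cast; simp; ring, exp_periodic.zsmul]
  refine ⟨⟨?_, ?_, ?_, ?_⟩, fun φ => ?_, fun φ => ?_, fun φ => ?_, fun φ => ?_⟩
  · rw [funext fun φ => (key φ).1]; exact hc _ h1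
  · rw [funext fun φ => (key φ).2.1]; exact Continuous.mul (by fun_prop) (hc _ h2)
  · rw [funext fun φ => (key φ).2.2.1]; exact hc _ h3
  · rw [funext fun φ => (key φ).2.2.2]; exact Continuous.mul (by fun_prop) (hc _ h4)
  · rw [(key _).1, (key _).1, hp _ h1]
  · rw [(key _).2.1, (key _).2.1, hp _ h2, he]
  · rw [(key _).2.2.1, (key _).2.2.1, hp _ h3]
  · rw [(key _).2.2.2, (key _).2.2.2, hp _ h4, he]

lemma continuous_symb (hy : 0 < y) (hξ0 : 0 < ξ) (hξ : 2 * ξ ^ 2 < y ^ 2) (ς ς' : ℤˣ) :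
    Continuous (symb y ξ ς ς') ∧ Continuous (symD y ξ ς ς') := by
  obtain ⟨⟨h1, h2, h3, h4⟩, -⟩ := continuous_periodic_ρ hy hξ0 hξ
  unfold symb symD
  constructor <;> split_ifs <;>
    first | assumption | exact continuous_conj.comp (by assumption)

lemma periodic_symb (hy : 0 < y) (hξ0 : 0 < ξ) (hξ : 2 * ξ ^ 2 < y ^ 2) (ς ς' : ℤˣ) :
    Function.Periodic (symb y ξ ς ς') (2 * Real.pi) ∧
      Function.Periodic (symD y ξ ς ς') (2 * Real.pi) := by
  obtain ⟨-, h1, h2, h3, h4⟩ := continuous_periodic_ρ hy hξ0 hξ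
  constructor <;> intro φ
  · simp only [symb, h1 φ, h2 φ]
  · simp only [symD, h3 φ, h4 φ]

lemma A_eq_symb (φ : ℝ) : A y ξ φ =
    !![symb y ξ 1 1 φ, symb y ξ 1 (-1) φ, symD y ξ 1 1 φ, symD y ξ 1 (-1) φ;
       symb y ξ (-1) 1 φ, symb y ξ (-1) (-1) φ, symD y ξ (-1) 1 φ, symD y ξ (-1) (-1) φ;
       symD y ξ 1 1 (φ + Real.pi), symD y ξ 1 (-1) (φ + Real.pi), symb y ξ 1 1 (φ + Real.pi),
        symb y ξ 1 (-1) (φ + Real.pi);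
       symD y ξ (-1) 1 (φ + Real.pi), symD y ξ (-1) (-1) (φ + Real.pi),
        symb y ξ (-1) 1 (φ + Real.pi), symb y ξ (-1) (-1) (φ + Real.pi)] := by
  have h1 : ¬ (1 : ℤˣ) = -1 := by decide
  have h2 : ¬ (-1 : ℤˣ) = 1 := by decide
  simp only [A, symb, symD, if_true, if_neg h1, if_neg h2]

lemma norm_le_of_fc_le {f : ℝ → ℂ} (hf : Function.Periodic f (2 * Real.pi)) (hc : Continuous f)
    {C : ℝ} (hC : ∀ d : ℤ, ‖fc f d‖ * (1 + |(d : ℝ)|) ^ 2 ≤ C) (φ : ℝ) :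
    ‖f φ‖ ≤ C * ∑' d : ℤ, ((1 + |(d : ℝ)|) ^ 2)⁻¹ := by
  have hs := summable_inv_one_add_abs_sq.mul_left C
  have hle : ∀ d : ℤ, ‖fc f d‖ ≤ C * ((1 + |(d : ℝ)|) ^ 2)⁻¹ := fun d => by
    rw [← div_eq_mul_inv, le_div_iff₀ (by positivity)]
    exact hC d
  have h1 : Summable fun d => ‖fc f d‖ := Summable.of_nonneg_of_le (fun _ => norm_nonneg _) hle hs
  have h2 := hasSum_fc hf hc h1.of_norm φ
  have hn : ∀ d, ‖fc f d * expo d φ‖ = ‖fc f d‖ := fun d => by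
    rw [norm_mul, expo, norm_exp_I_mul_ofReal, mul_one]
  rw [← h2.tsum_eq, ← tsum_mul_left]
  exact tsum_of_norm_bounded hs.hasSum fun d => (hn d).le.trans (hle d)

lemma exists_A_bound (hy : 0 < y) (hl : 0 < ξl) (hu : ξu < y / √2) :
    ∃ a : ℝ, 0 ≤ a ∧ ∀ ξ ∈ Icc ξl ξu, ∀ φ i j, ‖A y ξ φ i j‖ ≤ a := by
  choose C₁ hC₁0 hC₁ using fun ς ς' => (decayLip_symb hy hl hu ς ς').1 2
  choose C₂ hC₂0 hC₂ using fun ς ς' => (decayLip_symb hy hl hu ς ς').2 2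
  set S := ∑' d : ℤ, ((1 + |(d : ℝ)|) ^ 2)⁻¹
  have hS : 0 ≤ S := tsum_nonneg fun d => by positivity
  set Z := ∑ p : ℤˣ × ℤˣ, (C₁ p.1 p.2 + C₂ p.1 p.2)
  have hnn : ∀ p : ℤˣ × ℤˣ, 0 ≤ C₁ p.1 p.2 + C₂ p.1 p.2 := fun p => add_nonneg (hC₁0 _ _) (hC₂0 _ _)
  have hle : ∀ ς ς', C₁ ς ς' + C₂ ς ς' ≤ Z :=
    fun ς ς' => Finset.single_le_sum (f := fun p : ℤˣ × ℤˣ => C₁ p.1 p.2 + C₂ p.1 p.2)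
      (fun p _ => hnn p) (Finset.mem_univ (ς, ς'))
  refine ⟨Z * S, mul_nonneg (Finset.sum_nonneg fun p _ => hnn p) hS, fun ξ hξ φ i j => ?_⟩
  obtain ⟨hξ0, hξ2⟩ := param_bounds hl hu hξ
  have b1 : ∀ ς ς' φ, ‖symb y ξ ς ς' φ‖ ≤ Z * S := fun ς ς' φ =>
    (norm_le_of_fc_le (periodic_symb hy hξ0 hξ2 ς ς').1 (continuous_symb hy hξ0 hξ2 ς ς').1
      (fun d => (hC₁ ς ς' d).1 ξ hξ) φ).trans
      (mul_le_mul_of_nonneg_right (by linarith [hle ς ς', hC₂0 ς ς']) hS)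
  have b2 : ∀ ς ς' φ, ‖symD y ξ ς ς' φ‖ ≤ Z * S := fun ς ς' φ =>
    (norm_le_of_fc_le (periodic_symb hy hξ0 hξ2 ς ς').2 (continuous_symb hy hξ0 hξ2 ς ς').2
      (fun d => (hC₂ ς ς' d).1 ξ hξ) φ).trans
      (mul_le_mul_of_nonneg_right (by linarith [hle ς ς', hC₁0 ς ς']) hS)
  rw [A_eq_symb]
  fin_cases i <;> fin_cases j <;> simp [b1, b2]

/-- The trigonometric polynomial with coefficients `v (·, ς)`. -/
def trig (S : Finset ℤ) (v : Idx → ℂ) (ς : ℤˣ) (φ : ℝ) : ℂ := ∑ m ∈ S, v (m, ς) * expo m φ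

/-- The derivative of a trigonometric polynomial. -/
def trigDeriv (S : Finset ℤ) (v : Idx → ℂ) (ς : ℤˣ) (φ : ℝ) : ℂ :=
  ∑ m ∈ S, (I * m * v (m, ς)) * expo m φ

/-- The system satisfied by the modes `±1`, applied to a trigonometric polynomial. -/
def trigSource (y ξ : ℝ) (S : Finset ℤ) (v : Idx → ℂ) (ς : ℤˣ) (φ : ℝ) : ℂ :=
  trigDeriv S v ς φ - ∑ ς', (symb y ξ ς ς' φ * trig S v ς' φ + symD y ξ ς ς' φ * trig S v ς' (φ + Real.pi))

variable {S : Finset ℤ} {v : Idx → ℂ}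

lemma continuous_trig (ς : ℤˣ) : Continuous (trig S v ς) :=
  continuous_finsetSum _ fun m _ => continuous_const.mul (continuous_expo m)

lemma continuous_trigDeriv (ς : ℤˣ) : Continuous (trigDeriv S v ς) :=
  continuous_finsetSum _ fun m _ => continuous_const.mul (continuous_expo m)

lemma hasDerivAt_trig (ς : ℤˣ) (φ : ℝ) : HasDerivAt (trig S v ς) (trigDeriv S v ς φ) φ := by
  have h : HasDerivAt (fun φ => ∑ m ∈ S, v (m, ς) * expo m φ)
      (∑ m ∈ S, v (m, ς) * (I * m * expo m φ)) φ :=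
    HasDerivAt.fun_sum fun m _ => (hasDerivAt_expo m φ).const_mul _
  refine h.congr_deriv (Finset.sum_congr rfl fun m _ => ?_)
  ring

lemma periodic_trig (ς : ℤˣ) : Function.Periodic (trig S v ς) (2 * Real.pi) := fun φ => by
  simp only [trig, expo_periodic _ φ]

lemma periodic_trigDeriv (ς : ℤˣ) : Function.Periodic (trigDeriv S v ς) (2 * Real.pi) := fun φ => by
  simp only [trigDeriv, expo_periodic _ φ]

lemma fc_trig (hS : ∀ i, v i ≠ 0 → i.1 ∈ S) (ς : ℤˣ) (d : ℤ) : fc (trig S v ς) d = v (d, ς) := by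
  have h := fc_sum S (f := fun m φ => v (m, ς) * expo m φ)
    (fun m => continuous_const.mul (continuous_expo m)) d
  rw [show trig S v ς = fun φ => ∑ m ∈ S, v (m, ς) * expo m φ from rfl, h]
  simp only [fc_const_mul, fc_expo, mul_ite, mul_one, mul_zero, Finset.sum_ite_eq]
  split_ifs with hd
  · rfl
  · by_contra hne
    exact hd (hS (d, ς) (Ne.symm hne))

lemma continuous_trigSource (hy : 0 < y) (hξ0 : 0 < ξ) (hξ : 2 * ξ ^ 2 < y ^ 2) (ς : ℤˣ) :
    Continuous (trigSource y ξ S v ς) := by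
  refine (continuous_trigDeriv ς).sub (continuous_finsetSum _ fun ς' _ => ?_)
  have h := continuous_symb hy hξ0 hξ ς ς'
  exact (h.1.mul (continuous_trig ς')).add
    (h.2.mul ((continuous_trig ς').comp (continuous_id.add continuous_const)))

lemma periodic_trigSource (hy : 0 < y) (hξ0 : 0 < ξ) (hξ : 2 * ξ ^ 2 < y ^ 2) (ς : ℤˣ) :
    Function.Periodic (trigSource y ξ S v ς) (2 * Real.pi) := fun φ => by
  simp only [trigSource, periodic_trigDeriv _ φ, (periodic_symb hy hξ0 hξ _ _).1 φ,
    (periodic_symb hy hξ0 hξ _ _).2 φ, periodic_trig _ φ, add_right_comm φ (2 * Real.pi),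
    periodic_trig _ (φ + Real.pi)]

/-- Products become convolutions and the delay multiplies the mode `m` by `(-1)^m`; thus `transport
(ker y ξ)` is the Fourier side of the delay equation. -/
lemma fc_trigSource (hy : 0 < y) (hξ0 : 0 < ξ) (hξ : 2 * ξ ^ 2 < y ^ 2)
    (hS : ∀ i, v i ≠ 0 → i.1 ∈ S) (ς : ℤˣ) (d : ℤ) :
    fc (trigSource y ξ S v ς) d = transport (ker y ξ) v (d, ς) := by
  have hcs := fun ς' => continuous_symb hy hξ0 hξ ς ς'
  have h1 : fc (trigDeriv S v ς) d = I * d * v (d, ς) :=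
    fc_trig (S := S) (v := fun i => I * i.1 * v i) (fun i hi => hS i (right_ne_zero_of_mul hi)) ς d
  have h2 : ∀ ς', fc (fun φ => symb y ξ ς ς' φ * trig S v ς' φ +
      symD y ξ ς ς' φ * trig S v ς' (φ + Real.pi)) d = ∑ m ∈ S, ker y ξ (d, ς) (m, ς') * v (m, ς') := by
    intro ς'
    have e : (fun φ => symb y ξ ς ς' φ * trig S v ς' φ + symD y ξ ς ς' φ * trig S v ς' (φ + Real.pi)) =
        fun φ => ∑ m ∈ S, (v (m, ς') * (symb y ξ ς ς' φ * expo m φ) +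
          ((-1) ^ m * v (m, ς')) * (symD y ξ ς ς' φ * expo m φ)) := by
      funext φ
      rw [trig, trig, Finset.mul_sum, Finset.mul_sum, ← Finset.sum_add_distrib]
      refine Finset.sum_congr rfl fun m _ => ?_
      rw [expo_add, expo_pi]
      ring
    have hc1 : ∀ m, Continuous fun φ => v (m, ς') * (symb y ξ ς ς' φ * expo m φ) := fun m =>
      continuous_const.mul ((hcs ς').1.mul (continuous_expo m))
    have hc2 : ∀ m : ℤ, Continuous fun φ => ((-1) ^ m * v (m, ς')) * (symD y ξ ς ς' φ * expo m φ) :=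
      fun m => continuous_const.mul ((hcs ς').2.mul (continuous_expo m))
    rw [e]
    refine (fc_sum S (f := fun m φ => v (m, ς') * (symb y ξ ς ς' φ * expo m φ) +
      ((-1) ^ m * v (m, ς')) * (symD y ξ ς ς' φ * expo m φ))
      (fun m => (hc1 m).add (hc2 m)) d).trans ?_
    refine Finset.sum_congr rfl fun m _ => ?_
    rw [fc_add (hc1 m) (hc2 m), fc_const_mul, fc_const_mul, fc_mul_expo, fc_mul_expo, ker]
    ring
  have hc3 : ∀ ς', Continuous fun φ => symb y ξ ς ς' φ * trig S v ς' φ +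
      symD y ξ ς ς' φ * trig S v ς' (φ + Real.pi) := fun ς' =>
    ((hcs ς').1.mul (continuous_trig ς')).add
      ((hcs ς').2.mul ((continuous_trig ς').comp (continuous_id.add continuous_const)))
  have h3 : fc (trigSource y ξ S v ς) d = fc (trigDeriv S v ς) d -
      fc (fun φ => ∑ ς', (symb y ξ ς ς' φ * trig S v ς' φ +
        symD y ξ ς ς' φ * trig S v ς' (φ + Real.pi))) d :=
    fc_sub (continuous_trigDeriv ς) (continuous_finsetSum _ fun ς' _ => hc3 ς') d
  rw [h3, h1, fc_sum _ hc3, transport, kmul, tsum_eq_sum (s := S ×ˢ Finset.univ)]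
  · rw [Finset.sum_product_right]
    simp only [h2]
  · intro j hj
    have : v j = 0 := by
      by_contra hne
      exact hj (Finset.mem_product.2 ⟨hS j hne, Finset.mem_univ _⟩)
    rw [this, mul_zero]

lemma sum_int_units {M : Type*} [AddCommMonoid M] (f : ℤˣ → M) : ∑ ς, f ς = f 1 + f (-1) := by
  rw [show (Finset.univ : Finset ℤˣ) = {1, -1} from by decide, Finset.sum_pair (by decide)]

/-- One-dimensional Sobolev embedding, by Cauchy–Schwarz with the summable weight `bracket⁻²`. It
turns an `H¹` source into a bounded one. -/
lemma exists_tsum_enorm_le : ∃ C : ℝ≥0, ∀ g : Idx → ℂ, ∑' i, ‖g i‖ₑ ≤ C * seqNorm 1 g := by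
  refine ⟨2 * gapSum + 1, fun g => ?_⟩
  have hb : ∀ i : Idx, 0 < bracket i ^ 2 := fun i => pow_pos (bracket_pos i) 2
  have h := tsum_mul_sq_le (fun i : Idx => ENNReal.ofReal ((bracket i ^ 2)⁻¹))
    fun i => ENNReal.ofReal (bracket i ^ 2) * ‖g i‖ₑ
  have e1 : ∀ i : Idx, ENNReal.ofReal ((bracket i ^ 2)⁻¹) * (ENNReal.ofReal (bracket i ^ 2) * ‖g i‖ₑ) =
      ‖g i‖ₑ := fun i => by
    rw [← mul_assoc, ← ENNReal.ofReal_mul (by have := hb i; positivity),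
      inv_mul_cancel₀ (hb i).ne', ENNReal.ofReal_one, one_mul]
  have e2 : ∀ i : Idx, ENNReal.ofReal ((bracket i ^ 2)⁻¹) *
      (ENNReal.ofReal (bracket i ^ 2) * ‖g i‖ₑ) ^ 2 = (ENNReal.ofReal (bracket i ^ (1 : ℝ)) * ‖g i‖ₑ) ^ 2 :=
    fun i => by
    rw [sq (ENNReal.ofReal (bracket i ^ 2) * ‖g i‖ₑ), ← mul_assoc, e1, Real.rpow_one, mul_pow,
      ENNReal.ofReal_pow (bracket_pos i).le]
    ring
  simp only [e1, e2] at h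
  rw [← l2_sq, ← seqNorm] at h
  have h3 : ∑' i : Idx, ENNReal.ofReal ((bracket i ^ 2)⁻¹) ≤ 2 * gapSum := by
    refine le_trans ?_ (mul_le_mul_right (tsum_gap (0, 1)) 2)
    rw [← ENNReal.tsum_mul_left]
    refine ENNReal.tsum_le_tsum fun i => ?_
    rw [show (2 : ℝ≥0∞) = ENNReal.ofReal 2 by simp, ← ENNReal.ofReal_mul (by norm_num)]
    refine ENNReal.ofReal_le_ofReal ?_
    have hg : 0 < gap (0, 1) i ^ 2 := pow_pos (gap_pos _ _) 2
    rw [← div_eq_mul_inv, inv_eq_one_div, div_le_div_iff₀ (hb i) hg, bracket_sq, gap]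
    have := sq_abs ((0 : ℤ) - (i.1 : ℝ))
    push_cast at this ⊢
    nlinarith [sq_nonneg (|(0 : ℝ) - i.1| - 1)]
  refine (ENNReal.pow_le_pow_left_iff two_ne_zero).1 (h.trans ?_)
  rw [mul_pow]
  gcongr
  refine h3.trans ?_
  push_cast
  calc (2 * gapSum : ℝ≥0∞) ≤ 2 * gapSum + 1 := le_self_add
    _ ≤ (2 * gapSum + 1) ^ 2 := le_self_pow₀ le_add_self two_ne_zero

/-- The a priori estimate for finitely supported sequences. -/
lemma exists_apriori_finite (hy : 0 < y) (hl : 0 < ξl) (hu : ξu < y / √2) :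
    ∃ C₀ : ℝ≥0, ∀ ξ ∈ Icc ξl ξu, ∀ δ : ℝ≥0, (δ : ℝ) ≤ ‖charDet y ξ‖ →
      ∀ v : Idx → ℂ, v.support.Finite →
        δ * seqNorm 0 v ≤ C₀ * seqNorm 1 (transport (ker y ξ) v) := by
  obtain ⟨a, ha0, ha⟩ := exists_A_bound hy hl hu
  obtain ⟨C, hC0, hC⟩ := exists_periodic_ode_bound a ha0
  obtain ⟨C₁, hC₁⟩ := exists_tsum_enorm_le
  -- The added 1 keeps the constant nonzero, so that the right-hand side is `∞` when the source is
  -- not in `H¹`.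
  refine ⟨2 * C.toNNReal * C₁ + 1, fun ξ hξ δ hδ v hv => ?_⟩
  obtain ⟨hξ0, hξ2⟩ := param_bounds hl hu hξ
  set g := transport (ker y ξ) v
  rcases eq_or_ne (seqNorm 1 g) ∞ with htop | htop
  · rw [htop, ENNReal.mul_top (by simp)]
    exact le_top
  rcases eq_or_ne δ 0 with rfl | hδ0
  · simp
  have hδpos : (0 : ℝ) < δ := NNReal.coe_pos.2 (pos_iff_ne_zero.2 hδ0)
  set S : Finset ℤ := hv.toFinset.image Prod.fst
  have hS : ∀ i, v i ≠ 0 → i.1 ∈ S := fun i hi =>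
    Finset.mem_image.2 ⟨i, hv.mem_toFinset.2 hi, rfl⟩
  set N : ℝ≥0∞ := C₁ * seqNorm 1 g
  have hN : N ≠ ∞ := ENNReal.mul_ne_top ENNReal.coe_ne_top htop
  have hsrc : ∀ ς φ, ‖trigSource y ξ S v ς φ‖ ≤ N.toReal := by
    intro ς φ
    have h1 : ‖trigSource y ξ S v ς φ‖ₑ ≤ N := by
      refine (enorm_le_tsum_fc (periodic_trigSource hy hξ0 hξ2 ς)
        (continuous_trigSource hy hξ0 hξ2 ς) φ).trans (le_trans ?_ (hC₁ g))
      simp only [fc_trigSource hy hξ0 hξ2 hS]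
      exact ENNReal.tsum_comp_le_tsum_of_injective (f := fun d : ℤ => (d, ς))
        (fun a b hab => (Prod.ext_iff.1 hab).1) fun i => ‖g i‖ₑ
    have h2 := ENNReal.toReal_mono hN h1
    rwa [toReal_enorm] at h2
  -- Doubling the unknown makes the equation local: the delay of a delayed component is `φ + 2π`,
  -- that is `φ` by periodicity.
  set X : ℝ → Fin 4 → ℂ := fun φ => ![trig S v 1 φ, trig S v (-1) φ, trig S v 1 (φ + Real.pi),
    trig S v (-1) (φ + Real.pi)] with hXdef
  set G : ℝ → Fin 4 → ℂ := fun φ => ![trigSource y ξ S v 1 φ, trigSource y ξ S v (-1) φ,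
    trigSource y ξ S v 1 (φ + Real.pi), trigSource y ξ S v (-1) (φ + Real.pi)] with hGdef
  have hX : ∀ φ, HasDerivAt X ((A y ξ φ).mulVec (X φ) + G φ) φ := by
    intro φ
    have hpp : ∀ ς, trig S v ς (φ + Real.pi + Real.pi) = trig S v ς φ := fun ς => by
      rw [add_assoc, ← two_mul]
      exact periodic_trig ς φ
    have hd : ∀ ς, HasDerivAt (fun φ => trig S v ς (φ + Real.pi)) (trigDeriv S v ς (φ + Real.pi)) φ :=
      fun ς => (hasDerivAt_trig ς (φ + Real.pi)).comp_add_const φ Real.pi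
    refine hasDerivAt_pi.2 fun i => ?_
    fin_cases i
    · refine (hasDerivAt_trig 1 φ).congr_deriv ?_
      simp [hXdef, hGdef, A_eq_symb, trigSource]
      ring
    · refine (hasDerivAt_trig (-1) φ).congr_deriv ?_
      simp [hXdef, hGdef, A_eq_symb, trigSource]
      ring
    · refine (hd 1).congr_deriv ?_
      simp [hXdef, hGdef, A_eq_symb, trigSource, hpp]
      ring
    · refine (hd (-1)).congr_deriv ?_
      simp [hXdef, hGdef, A_eq_symb, trigSource, hpp]
      ring
  have hper : X (2 * Real.pi) = X 0 := by
    have h1 : ∀ ς, trig S v ς (2 * Real.pi) = trig S v ς 0 := fun ς => by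
      simpa using periodic_trig (S := S) (v := v) ς 0
    have h2 : ∀ ς, trig S v ς (2 * Real.pi + Real.pi) = trig S v ς Real.pi := fun ς => by
      rw [add_comm]
      exact periodic_trig ς Real.pi
    simp only [hXdef, h1, h2, zero_add]
  have hM := isFundamentalMatrix_propagator hy hξ0 hξ2
  have hG : ∀ φ, ‖G φ‖ ≤ N.toReal := fun φ =>
    (pi_norm_le_iff_of_nonneg ENNReal.toReal_nonneg).2 fun i => by
      fin_cases i <;> exact hsrc _ _
  have hb := hC (A y ξ) (ha ξ hξ) _ hM.zero hM.deriv X G hX hper _ ENNReal.toReal_nonneg hG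
  rw [det_isFundamentalMatrix hy hξ0 hξ2 hM] at hb
  set B := C * N.toReal / δ
  have hB0 : 0 ≤ B := div_nonneg (mul_nonneg hC0 ENNReal.toReal_nonneg) hδpos.le
  have htrig : ∀ ς, ∀ φ ∈ Icc 0 (2 * Real.pi), ‖trig S v ς φ‖ ≤ B := by
    intro ς φ hφ
    have h1 : ‖trig S v ς φ‖ ≤ ‖X φ‖ := by
      rcases Int.units_eq_one_or ς with rfl | rfl
      · exact norm_le_pi_norm (X φ) 0
      · exact norm_le_pi_norm (X φ) 1
    rw [le_div_iff₀ hδpos, mul_comm]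
    calc (δ : ℝ) * ‖trig S v ς φ‖ ≤ ‖charDet y ξ‖ * ‖X φ‖ := by gcongr
      _ ≤ C * N.toReal := hb φ hφ
  -- Parseval for each of the two modes converts the sup bound into an `ℓ²` bound.
  have hsum : seqNorm 0 v ≤ 2 * ENNReal.ofReal B := by
    refine (ENNReal.pow_le_pow_left_iff two_ne_zero).1 ?_
    rw [seqNorm_zero_sq, ENNReal.tsum_prod (f := fun a b => ‖v (a, b)‖ₑ ^ 2), ENNReal.tsum_comm,
      tsum_fintype, sum_int_units]
    have h1 : ∀ ς, ∑' d, ‖v (d, ς)‖ₑ ^ 2 ≤ ENNReal.ofReal B ^ 2 := fun ς => by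
      have := tsum_enorm_fc_sq_le (continuous_trig (S := S) (v := v) ς) hB0 (htrig ς)
      simpa only [fc_trig hS] using this
    calc _ ≤ ENNReal.ofReal B ^ 2 + ENNReal.ofReal B ^ 2 := add_le_add (h1 1) (h1 (-1))
      _ ≤ ENNReal.ofReal B ^ 2 + ENNReal.ofReal B ^ 2 + 2 * ENNReal.ofReal B ^ 2 := le_self_add
      _ = (2 * ENNReal.ofReal B) ^ 2 := by ring
  have hδB : (δ : ℝ≥0∞) * ENNReal.ofReal B = C.toNNReal * N := by
    rw [← ENNReal.ofReal_coe_nnreal (p := δ), ← ENNReal.ofReal_mul hδpos.le,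
      mul_div_cancel₀ _ hδpos.ne', ENNReal.ofReal_mul hC0, ENNReal.ofReal_toReal hN]
    rfl
  calc (δ : ℝ≥0∞) * seqNorm 0 v ≤ δ * (2 * ENNReal.ofReal B) := by gcongr
    _ = 2 * (δ * ENNReal.ofReal B) := by ring
    _ = 2 * C.toNNReal * C₁ * seqNorm 1 g := by rw [hδB]; simp only [N]; ring
    _ ≤ _ := by
      push_cast
      gcongr
      exact le_self_add

end Apriori

end

/-! ### Functions on the torus carried by the modes ±1 -/

section

open Set Filter Topology Complex ComplexConjugate MeasureTheory
open scoped NNReal ENNReal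

section Torus

/-- The normalised Lebesgue measure on the torus. -/
abbrev dTorus : Measure (Circ × Circ) := dCirc.prod dCirc

/-- `L²` of the circle. -/
abbrev CircL2 : Type := Lp ℂ 2 dCirc

lemma norm_fourier_apply (j : ℤ) (x : Circ) : ‖fourier j x‖ = 1 := by
  rw [fourier_apply]
  exact Circle.norm_coe _

lemma integral_fourier_mul (m n : ℤ) :
    ∫ x : Circ, fourier m x * fourier n x ∂dCirc = if m + n = 0 then 1 else 0 := by
  have h := congrFun (fourierCoeff_fourier (T := 2 * Real.pi) n) (-m)
  rw [fourierCoeff, neg_neg, Pi.single_apply] at h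
  simp only [smul_eq_mul] at h
  rw [h]
  congr 1
  rw [eq_iff_iff]
  constructor <;> intro h <;> linarith

lemma memLp_tensor (f : CircL2) (j : ℤ) :
    MemLp (fun p : Circ × Circ => f p.1 * fourier j p.2) 2 dTorus := by
  have h : MemLp (fun p : Circ × Circ => f p.1) 2 dTorus :=
    (Lp.memLp f).comp_measurePreserving measurePreserving_fst
  refine h.congr_norm (h.1.mul ?_) (Eventually.of_forall fun p => ?_)
  · exact ((fourier j).continuous.comp continuous_snd).aestronglyMeasurable
  · rw [norm_mul, norm_fourier_apply, mul_one]

lemma ae_fst {P : Circ → Prop} (h : ∀ᵐ x ∂dCirc, P x) : ∀ᵐ p ∂dTorus, P p.1 :=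
  Measure.quasiMeasurePreserving_fst.ae h

/-- `f ↦ f(φ) e^{ijθ}`. -/
def tensor (j : ℤ) : CircL2 →ₗ[ℂ] L2 where
  toFun f := (memLp_tensor f j).toLp
  map_add' f g := by
    apply Lp.ext
    filter_upwards [(memLp_tensor (f + g) j).coeFn_toLp, (memLp_tensor f j).coeFn_toLp,
      (memLp_tensor g j).coeFn_toLp, Lp.coeFn_add (memLp_tensor f j).toLp (memLp_tensor g j).toLp,
      ae_fst (Lp.coeFn_add f g)] with p h1 h2 h3 h4 h5
    rw [h1, h4, Pi.add_apply, h2, h3, h5, Pi.add_apply, add_mul]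
  map_smul' c f := by
    apply Lp.ext
    filter_upwards [(memLp_tensor (c • f) j).coeFn_toLp, (memLp_tensor f j).coeFn_toLp,
      Lp.coeFn_smul c (memLp_tensor f j).toLp, ae_fst (Lp.coeFn_smul c f)] with p h1 h2 h3 h4
    rw [h1, RingHom.id_apply, h3, Pi.smul_apply, h2, h4, Pi.smul_apply, smul_eq_mul, smul_eq_mul,
      mul_assoc]

lemma tensor_ae (j : ℤ) (f : CircL2) : tensor j f =ᵐ[dTorus] fun p => f p.1 * fourier j p.2 :=
  (memLp_tensor f j).coeFn_toLp

/-- The coefficients at one of the modes `±1`. -/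
def splitMode (ς : ℤˣ) : Seq2 →ₗ[ℂ] lp (fun _ : ℤ => ℂ) 2 where
  toFun u := ⟨fun m => u (m, ς), by
    have h := lp.memℓp u
    have h' : Memℓp (fun m : ℤ => u (m, ς)) 2 := by
      rw [memℓp_gen_iff (by norm_num)] at h ⊢
      exact h.comp_injective (i := fun m : ℤ => (m, ς)) fun a b hab => (Prod.ext_iff.1 hab).1
    exact h'⟩
  map_add' u v := rfl
  map_smul' c u := rfl

/-- The function of `φ` multiplying `e^{±iθ}`. -/
def modeFun (ς : ℤˣ) : Seq2 →ₗ[ℂ] CircL2 :=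
  (fourierBasis (T := 2 * Real.pi)).repr.symm.toLinearEquiv.toLinearMap ∘ₗ splitMode ς

lemma fourierCoeff_modeFun (ς : ℤˣ) (u : Seq2) (m : ℤ) :
    fourierCoeff (modeFun ς u) m = u (m, ς) := by
  rw [← fourierBasis_repr]
  simp only [modeFun, LinearMap.comp_apply, LinearEquiv.coe_coe, LinearIsometryEquiv.coe_toLinearEquiv,
    LinearIsometryEquiv.apply_symm_apply]
  rfl

/-- The function on the torus with given coefficients at the modes `±1`. -/
def synth : Seq2 →ₗ[ℂ] L2 := ∑ ς : ℤˣ, tensor (ς : ℤ) ∘ₗ modeFun ς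

/-- A function on the torus localised on the modes `±1`. -/
def tensorSum (V : ℤˣ → Circ → ℂ) (p : Circ × Circ) : ℂ := ∑ ς : ℤˣ, V ς p.1 * fourier (ς : ℤ) p.2

lemma synth_ae (u : Seq2) : synth u =ᵐ[dTorus] tensorSum fun ς => modeFun ς u := by
  have h : synth u = tensor ((1 : ℤˣ) : ℤ) (modeFun 1 u) + tensor ((-1 : ℤˣ) : ℤ) (modeFun (-1) u) := by
    rw [synth, sum_int_units]
    rfl
  rw [h]
  filter_upwards [Lp.coeFn_add (tensor ((1 : ℤˣ) : ℤ) (modeFun 1 u))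
    (tensor ((-1 : ℤˣ) : ℤ) (modeFun (-1) u)), tensor_ae ((1 : ℤˣ) : ℤ) (modeFun 1 u),
    tensor_ae ((-1 : ℤˣ) : ℤ) (modeFun (-1) u)] with p h1 h2 h3
  rw [h1, Pi.add_apply, h2, h3, tensorSum, sum_int_units]

lemma coeff_congr_ae {h h' : Circ × Circ → ℂ} (H : h =ᵐ[dTorus] h') (k : ℤ × ℤ) :
    coeff h k = coeff h' k :=
  integral_congr_ae (by filter_upwards [H] with p hp; rw [hp])

lemma coeff_tensorSum {V : ℤˣ → Circ → ℂ} (hV : ∀ ς, Integrable (V ς) dCirc) (k : ℤ × ℤ) :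
    coeff (tensorSum V) k = ∑ ς : ℤˣ, if k.2 = ς then fourierCoeff (V ς) k.1 else 0 := by
  have hi : ∀ (n : ℤ) (f : Circ → ℂ), Integrable f dCirc → Integrable (fun x => fourier n x * f x) dCirc :=
    fun n f hf => hf.bdd_mul (c := 1) (fourier n).continuous.aestronglyMeasurable
      (Eventually.of_forall fun x => (norm_fourier_apply n x).le)
  have e : ∀ p : Circ × Circ, fourier (-k.1) p.1 * fourier (-k.2) p.2 * tensorSum V p =
      ∑ ς : ℤˣ, (fourier (-k.1) p.1 * V ς p.1) * (fourier (-k.2) p.2 * fourier (ς : ℤ) p.2) := fun p => by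
    rw [tensorSum, Finset.mul_sum]
    refine Finset.sum_congr rfl fun ς _ => ?_
    ring
  have hc : ∀ ς : ℤˣ, Integrable (fun x : Circ => fourier (-k.2) x * fourier (ς : ℤ) x) dCirc :=
    fun ς => hi _ _ ((fourier (ς : ℤ)).continuous.integrable_of_hasCompactSupport
      (HasCompactSupport.of_compactSpace _))
  simp only [coeff, e]
  rw [integral_finsetSum _ fun ς _ => (hi _ _ (hV ς)).mul_prod (hc ς)]
  refine Finset.sum_congr rfl fun ς _ => ?_
  rw [integral_prod_mul (fun x : Circ => fourier (-k.1) x * V ς x)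
    (fun x : Circ => fourier (-k.2) x * fourier (ς : ℤ) x), integral_fourier_mul]
  have : (-k.2 + (ς : ℤ) = 0) ↔ k.2 = ς := by constructor <;> intro h <;> linarith
  simp only [this, mul_ite, mul_one, mul_zero]
  rfl

lemma integrable_modeFun (ς : ℤˣ) (u : Seq2) : Integrable (modeFun ς u) dCirc :=
  (Lp.memLp (modeFun ς u)).integrable one_le_two

lemma coeff_synth (u : Seq2) (k : ℤ × ℤ) :
    coeff (synth u) k = ∑ ς : ℤˣ, if k.2 = ς then u (k.1, ς) else 0 := by
  rw [coeff_congr_ae (synth_ae u), coeff_tensorSum fun ς => integrable_modeFun ς u]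
  simp only [fourierCoeff_modeFun]

lemma coeff_synth_unit (u : Seq2) (i : Idx) : coeff (synth u) (i.1, (i.2 : ℤ)) = u i := by
  rw [coeff_synth, sum_int_units]
  obtain ⟨m, ς⟩ := i
  rcases Int.units_eq_one_or ς with rfl | rfl <;> simp

lemma coeff_synth_of_ne (u : Seq2) {k : ℤ × ℤ} (hk : |k.2| ≠ 1) : coeff (synth u) k = 0 := by
  rw [coeff_synth]
  refine Finset.sum_eq_zero fun ς _ => if_neg ?_
  rintro h
  apply hk
  rw [h]
  rcases Int.units_eq_one_or ς with rfl | rfl <;> simp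

/-- The coefficients of `e^{±iθ}` in a function on the torus. -/
def modeInt (h : Circ × Circ → ℂ) (ς : ℤˣ) (φ : Circ) : ℂ :=
  ∫ η, h (φ, η) * fourier (-(ς : ℤ)) η ∂dCirc

lemma modeProj_eq (h : Circ × Circ → ℂ) : modeProj h = tensorSum (modeInt h) := by
  funext p
  simp only [modeProj, tensorSum, sum_int_units, modeInt, Units.val_one, Units.val_neg, neg_neg]

lemma integral_tensorSum_mul (V : ℤˣ → Circ → ℂ) (φ : Circ) (n : ℤ) :
    ∫ η, tensorSum V (φ, η) * fourier n η ∂dCirc = ∑ ς : ℤˣ, if (ς : ℤ) + n = 0 then V ς φ else 0 := by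
  have e : ∀ η, tensorSum V (φ, η) * fourier n η =
      ∑ ς : ℤˣ, V ς φ * (fourier (ς : ℤ) η * fourier n η) := fun η => by
    rw [tensorSum, Finset.sum_mul]
    refine Finset.sum_congr rfl fun ς _ => ?_
    ring
  simp only [e]
  have hi : ∀ ς : ℤˣ, Integrable (fun η => V ς φ * (fourier (ς : ℤ) η * fourier n η)) dCirc :=
    fun ς => Integrable.const_mul
      ((((fourier (ς : ℤ)).continuous.mul (fourier n).continuous)).integrable_of_hasCompactSupport
        (HasCompactSupport.of_compactSpace _)) _
  rw [integral_finsetSum _ fun ς _ => hi ς]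
  refine Finset.sum_congr rfl fun ς _ => ?_
  rw [integral_const_mul, integral_fourier_mul]
  simp

lemma modeInt_tensorSum (V : ℤˣ → Circ → ℂ) (ς : ℤˣ) (φ : Circ) :
    modeInt (tensorSum V) ς φ = V ς φ := by
  rw [modeInt, integral_tensorSum_mul, sum_int_units]
  rcases Int.units_eq_one_or ς with rfl | rfl <;> simp

lemma ae_slice {h h' : Circ × Circ → ℂ} (H : h =ᵐ[dTorus] h') :
    ∀ᵐ φ ∂dCirc, (fun η => h (φ, η)) =ᵐ[dCirc] fun η => h' (φ, η) :=
  Measure.ae_ae_of_ae_prod H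

lemma modeInt_synth (u : Seq2) (ς : ℤˣ) : modeInt (synth u) ς =ᵐ[dCirc] modeFun ς u := by
  filter_upwards [ae_slice (synth_ae u)] with φ hφ
  rw [← modeInt_tensorSum (fun ς => modeFun ς u) ς φ, modeInt, modeInt]
  refine integral_congr_ae ?_
  filter_upwards [hφ] with η hη
  rw [hη]

lemma tensorSum_congr_ae {V V' : ℤˣ → Circ → ℂ} (h : ∀ ς, V ς =ᵐ[dCirc] V' ς) :
    tensorSum V =ᵐ[dTorus] tensorSum V' := by
  filter_upwards [ae_fst (h 1), ae_fst (h (-1))] with p h1 h2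
  rw [tensorSum, tensorSum, sum_int_units, sum_int_units, h1, h2]

lemma modeProj_synth (u : Seq2) : modeProj (synth u) =ᵐ[dTorus] synth u := by
  rw [modeProj_eq]
  exact (tensorSum_congr_ae (modeInt_synth u)).trans (synth_ae u).symm

lemma integral_synth (u : Seq2) : ∀ᵐ φ ∂dCirc, ∫ θ, synth u (φ, θ) ∂dCirc = 0 := by
  filter_upwards [ae_slice (synth_ae u)] with φ hφ
  rw [integral_congr_ae hφ]
  have h := integral_tensorSum_mul (fun ς => modeFun ς u) φ 0
  simp only [fourier_zero, mul_one] at h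
  rw [h]
  simp

end Torus

end

/-! ### Multiplication and half-period translation on the Fourier side -/

section

open Set Filter Topology Complex ComplexConjugate MeasureTheory
open scoped NNReal ENNReal

section Convolution

lemma inner_toLp_left {X : Type*} [TopologicalSpace X] [CompactSpace X] [MeasurableSpace X] [BorelSpace X]
    [SecondCountableTopologyEither X ℂ] {μ : Measure X} [IsFiniteMeasure μ] (g : C(X, ℂ)) (U : Lp ℂ 2 μ) :
    inner ℂ (ContinuousMap.toLp 2 μ ℂ g) U = ∫ x, conj (g x) * U x ∂μ := by
  rw [L2.inner_def]
  refine integral_congr_ae ?_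
  filter_upwards [ContinuousMap.coeFn_toLp (p := 2) (𝕜 := ℂ) μ g] with x hx
  rw [hx, RCLike.inner_apply, mul_comm]

lemma fourier_add_arg (n : ℤ) (x z : Circ) : fourier n (x + z) = fourier n x * fourier n z := by
  simp only [fourier_apply, zsmul_add, AddCircle.toCircle_add, Circle.coe_mul]

/-- The coefficient of `fU` at `l` is the inner product of `conj f · e_l` with `U`; expanding it in
the Fourier basis gives the convolution for every `L²` function `U`. -/
lemma hasSum_fourierCoeff_mul {f : Circ → ℂ} (hf : Continuous f) (U : CircL2) (l : ℤ) :
    HasSum (fun m : ℤ => fourierCoeff f (l - m) * fourierCoeff U m)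
      (fourierCoeff (fun x => f x * U x) l) := by
  let g : C(Circ, ℂ) := ⟨fun x => conj (f x) * fourier l x,
    (continuous_conj.comp hf).mul (fourier l).continuous⟩
  have hg : ∀ x : Circ, conj (g x) = f x * fourier (-l) x := fun x => by
    rw [fourier_neg]
    exact (map_mul _ _ _).trans (by rw [conj_conj])
  have h := (fourierBasis (T := 2 * Real.pi)).hasSum_inner_mul_inner
    (ContinuousMap.toLp 2 dCirc ℂ g) U
  have h0 : inner ℂ (ContinuousMap.toLp 2 dCirc ℂ g) U = fourierCoeff (fun x => f x * U x) l := by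
    rw [inner_toLp_left, fourierCoeff]
    congr 1
    funext x
    rw [hg, smul_eq_mul]
    ring
  rw [h0] at h
  have h1 : ∀ m, inner ℂ (ContinuousMap.toLp 2 dCirc ℂ g) (fourierBasis m) = fourierCoeff f (l - m) := by
    intro m
    rw [coe_fourierBasis, fourierLp, ContinuousMap.inner_toLp, fourierCoeff]
    congr 1
    funext x
    rw [hg, smul_eq_mul, neg_sub, sub_eq_add_neg, fourier_add]
    ring
  have h2 : ∀ m, inner ℂ (fourierBasis m) U = fourierCoeff U m := fun m => by
    rw [← fourierBasis_repr, HilbertBasis.repr_apply_apply]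
  simpa only [h1, h2] using h

lemma quasiMeasurePreserving_add_right (a : Circ) :
    Measure.QuasiMeasurePreserving (fun x : Circ => x + a) dCirc dCirc :=
  (measurePreserving_add_right dCirc a).quasiMeasurePreserving

/-- Translation by half a period. -/
def shift (U : CircL2) : CircL2 :=
  Lp.compMeasurePreserving _ (measurePreserving_add_right dCirc ((Real.pi : ℝ) : Circ)) U

lemma shift_ae (U : CircL2) : shift U =ᵐ[dCirc] fun x => U (x + ((Real.pi : ℝ) : Circ)) :=
  Lp.coeFn_compMeasurePreserving U _

lemma fourierCoeff_congr {f g : Circ → ℂ} (h : f =ᵐ[dCirc] g) (n : ℤ) :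
    fourierCoeff f n = fourierCoeff g n :=
  integral_congr_ae (by filter_upwards [h] with x hx; rw [hx])

lemma fourierCoeff_shift (U : CircL2) (m : ℤ) :
    fourierCoeff (shift U) m = (-1) ^ m * fourierCoeff U m := by
  rw [fourierCoeff_congr (shift_ae U), fourierCoeff, fourierCoeff]
  have h : ∀ x : Circ, fourier (-m) x • U (x + ((Real.pi : ℝ) : Circ)) =
      (fun z : Circ => (-1) ^ m * (fourier (-m) z * U z)) (x + ((Real.pi : ℝ) : Circ)) := fun x => by
    have h1 : fourier (-m) (x + ((Real.pi : ℝ) : Circ)) = fourier (-m) x * (-1) ^ m := by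
      rw [fourier_add_arg, fourier_coe, expo_pi, zpow_neg, ← inv_zpow, inv_neg, inv_one]
    beta_reduce
    rw [h1, smul_eq_mul, ← mul_assoc, mul_comm ((-1 : ℂ) ^ m), mul_assoc (fourier (-m) x),
      ← zpow_add₀ (by norm_num), ← two_mul, zpow_mul]
    norm_num
  simp only [h]
  rw [integral_add_right_eq_self (fun z : Circ => (-1) ^ m * (fourier (-m) z * U z)), integral_const_mul]
  rfl

end Convolution

/-! ### The integral operator `Q₁` on the modes ±1 -/

section Operator

/-- Writing `Re z = (z + conj z)/2`, only the opposite frequencies in `η` survive: the term in `θ -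
η` preserves the mode and the one in `θ + η` exchanges the two. -/
lemma integral_tensorSum_kernel (V : ℤˣ → Circ → ℂ) (φ θ : Circ) (a b : ℂ) :
    ∫ η, tensorSum V (φ, η) * (((a * fourier 1 (θ - η) + b * fourier 1 (θ + η)).re : ℝ) : ℂ) ∂dCirc =
      1 / 2 * (a * V 1 φ + b * V (-1) φ) * fourier 1 θ +
        1 / 2 * (conj a * V (-1) φ + conj b * V 1 φ) * fourier (-1) θ := by
  have e : ∀ η : Circ, tensorSum V (φ, η) *
      (((a * fourier 1 (θ - η) + b * fourier 1 (θ + η)).re : ℝ) : ℂ) =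
      1 / 2 * (conj a * fourier (-1) θ + b * fourier 1 θ) * (tensorSum V (φ, η) * fourier 1 η) +
      1 / 2 * (a * fourier 1 θ + conj b * fourier (-1) θ) * (tensorSum V (φ, η) * fourier (-1) η) := by
    intro η
    have h1 : fourier 1 (θ + η) = fourier 1 θ * fourier 1 η := fourier_add_arg 1 θ η
    have h2 : fourier 1 (θ - η) = fourier 1 θ * fourier (-1) η := by
      rw [sub_eq_add_neg, fourier_add_arg, fourier_apply (n := -1), fourier_apply (x := -η), one_zsmul,
        neg_one_zsmul]
    have h3 : ∀ z : ℂ, ((z.re : ℝ) : ℂ) = (z + conj z) / 2 := fun z => by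
      rw [add_conj]; push_cast; ring
    rw [h3, h1, h2]
    simp only [map_add, map_mul, ← fourier_neg, neg_neg]
    ring
  have hi : ∀ n : ℤ, Integrable (fun η => tensorSum V (φ, η) * fourier n η) dCirc := fun n => by
    refine Continuous.integrable_of_hasCompactSupport ?_ (HasCompactSupport.of_compactSpace _)
    have h : Continuous fun η => tensorSum V (φ, η) :=
      continuous_finsetSum _ fun ς _ => Continuous.mul (f := fun _ => V ς φ) continuous_const
        (fourier (ς : ℤ)).continuous
    exact h.mul (fourier n).continuous
  simp only [e]
  rw [integral_add ((hi 1).const_mul _) ((hi (-1)).const_mul _), integral_const_mul, integral_const_mul,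
    integral_tensorSum_mul, integral_tensorSum_mul, sum_int_units, sum_int_units]
  simp
  ring

/-- The operator `Q₁` on the coefficients of the modes `±1`. -/
def modeQ (y ξ : ℝ) (V : ℤˣ → Circ → ℂ) (ς : ℤˣ) (φ : Circ) : ℂ :=
  omega y ξ * (-(I * (ς : ℤ)) * ∑ ς', (onCircle (symb y ξ ς ς') φ * V ς' φ +
    onCircle (symD y ξ ς ς') φ * V ς' (φ + ((Real.pi : ℝ) : Circ))) - V ς φ)

lemma exists_onCircle (φ : Circ) : ∃ x : ℝ, ∀ f, onCircle f φ = f x :=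
  ⟨AddCircle.equivIco (2 * Real.pi) 0 φ, fun _ => rfl⟩

variable {y ξ : ℝ}

/-- In particular `Q₁` preserves the modes ±1. The term `-V` in `modeQ` removes the summand `i` that
`ρ₁` contains besides the contribution of `1/w₃²`. -/
lemma Q₁_tensorSum (hω : omega y ξ ≠ 0) (V : ℤˣ → Circ → ℂ) :
    Q₁ y ξ (tensorSum V) = tensorSum (modeQ y ξ V) := by
  funext p
  obtain ⟨φ, θ⟩ := p
  have h1 := integral_tensorSum_kernel V φ θ (onCircle (fun φ => 1 / w₃ y ξ φ ^ 2) φ)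
    (-(1 / 2 * onCircle (β y ξ) φ))
  have h2 := integral_tensorSum_kernel V (φ + ((Real.pi : ℝ) : Circ)) θ
    (-onCircle (fun φ => 1 / w₄ y ξ φ ^ 2) φ) (onCircle (κ y ξ) φ)
  have h3 : Q₁ y ξ (tensorSum V) (φ, θ) = _ + _ := congrArg₂ (· + ·)
    ((integral_congr_ae (Eventually.of_forall fun η => by
      rw [neg_mul, ← sub_eq_add_neg])).trans h1)
    ((integral_congr_ae (Eventually.of_forall fun η => by
      rw [neg_mul, neg_add_eq_sub])).trans h2)
  rw [h3, tensorSum, sum_int_units]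
  obtain ⟨x, hx⟩ := exists_onCircle φ
  have hω' : (omega y ξ : ℂ) ≠ 0 := ofReal_ne_zero.2 hω
  simp only [modeQ, hx, sum_int_units, symb, symD]
  generalize V 1 φ = v1
  generalize V (-1) φ = v2
  generalize V 1 (φ + ((Real.pi : ℝ) : Circ)) = v3
  generalize V (-1) (φ + ((Real.pi : ℝ) : Circ)) = v4
  have hn : (1 : ℤˣ) ≠ -1 := by decide
  simp only [if_true, if_neg hn, if_neg hn.symm, ρ₁, ρ₂, ρ₃, ρ₄, Units.val_one, Units.val_neg, Int.cast_one,
    Int.cast_neg]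
  have e3 : 1 / (2 * w₃ y ξ x ^ 2) = 1 / 2 * (1 / w₃ y ξ x ^ 2) := by rw [one_div_mul_one_div]
  have e4 : I / (2 * (omega y ξ : ℂ) * w₄ y ξ x ^ 2) = I / (2 * omega y ξ) * (1 / w₄ y ξ x ^ 2) := by
    rw [div_mul_div_comm, mul_one]
  rw [e3, e4]
  generalize (1 / w₃ y ξ x ^ 2) = a
  generalize (1 / w₄ y ξ x ^ 2) = d
  generalize β y ξ x = b
  generalize κ y ξ x = k
  simp only [map_add, map_mul, map_neg, map_div₀, conj_I, conj_ofReal, map_ofNat, map_one]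
  -- Once conjugation has been distributed, the coefficients and their conjugates are independent
  -- indeterminates, and the claim is a polynomial identity modulo `I² = -1`.
  generalize conj a = a'
  generalize conj d = d'
  generalize conj b = b'
  generalize conj k = k'
  field_simp
  ring_nf
  simp only [I_sq]
  ring

lemma memLp_mul {f : Circ → ℂ} (hf : Continuous f) (U : CircL2) :
    Integrable (fun x => f x * U x) dCirc := by
  obtain ⟨C, hC⟩ := isCompact_univ.exists_bound_of_continuousOn hf.continuousOn
  exact ((Lp.memLp U).integrable one_le_two).bdd_mul (c := C) hf.aestronglyMeasurable
    (Eventually.of_forall fun x => hC x (mem_univ x))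

lemma modeQ_congr_ae {V V' : ℤˣ → Circ → ℂ} (h : ∀ ς, V ς =ᵐ[dCirc] V' ς) (ς : ℤˣ) :
    modeQ y ξ V ς =ᵐ[dCirc] modeQ y ξ V' ς := by
  have h' : ∀ ς, ∀ᵐ x ∂dCirc, V ς (x + ((Real.pi : ℝ) : Circ)) = V' ς (x + ((Real.pi : ℝ) : Circ)) :=
    fun ς => (quasiMeasurePreserving_add_right ((Real.pi : ℝ) : Circ)).ae_eq_comp (h ς)
  filter_upwards [h 1, h (-1), h ς, h' 1, h' (-1)] with x h1 h2 h3 h4 h5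
  simp only [modeQ, sum_int_units, h1, h2, h3, h4, h5]

lemma integrable_fourierCoeff_modeQ (hy : 0 < y) (hξ0 : 0 < ξ) (hξ : 2 * ξ ^ 2 < y ^ 2) {c : ℕ → ℝ≥0}
    (hk : KernelBound c (ker y ξ)) (u : Seq2) (ς : ℤˣ) :
    Integrable (modeQ y ξ (fun ς => modeFun ς u) ς) dCirc ∧ ∀ l,
    fourierCoeff (modeQ y ξ (fun ς => modeFun ς u) ς) l =
      omega y ξ * (-(I * (ς : ℤ)) * kmul (ker y ξ) u (l, ς) - u (l, ς)) := by
  have hcs : ∀ ς', Continuous (onCircle (symb y ξ ς ς')) := fun ς' =>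
    continuous_onCircle (periodic_symb hy hξ0 hξ ς ς').1 (continuous_symb hy hξ0 hξ ς ς').1
  have hcd : ∀ ς', Continuous (onCircle (symD y ξ ς ς')) := fun ς' =>
    continuous_onCircle (periodic_symb hy hξ0 hξ ς ς').2 (continuous_symb hy hξ0 hξ ς ς').2
  let F : ℤˣ → Circ → ℂ := fun ς' x => onCircle (symb y ξ ς ς') x * modeFun ς' u x
  let G : ℤˣ → Circ → ℂ := fun ς' x => onCircle (symD y ξ ς ς') x * shift (modeFun ς' u) x
  have hF : ∀ ς', Integrable (F ς') dCirc := fun ς' => memLp_mul (hcs ς') _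
  have hG : ∀ ς', Integrable (G ς') dCirc := fun ς' => memLp_mul (hcd ς') _
  have hU := integrable_modeFun ς u
  have e : modeQ y ξ (fun ς => modeFun ς u) ς =ᵐ[dCirc]
      (omega y ξ : ℂ) • (-(I * (ς : ℤ)) • ((F 1 + G 1) + (F (-1) + G (-1))) + (-1 : ℂ) • ⇑(modeFun ς u)) := by
    filter_upwards [shift_ae (modeFun 1 u), shift_ae (modeFun (-1) u)] with x h1 h2
    simp only [modeQ, sum_int_units, Pi.smul_apply, Pi.add_apply, F, G, h1, h2, smul_eq_mul]
    ring
  have hI := ((hF 1).add (hG 1)).add ((hF (-1)).add (hG (-1)))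
  refine ⟨(integrable_congr e).2 (((hI.smul (-(I * (ς : ℤ)))).add (hU.smul (-1 : ℂ))).smul _), fun l => ?_⟩
  -- The row is absolutely summable by kernel decay, so it may be summed first over `m` at fixed
  -- sign, where each partial sum is a convolution formula.
  have hs : HasSum (fun j : Idx => ker y ξ (l, ς) j * u j) (∑ ς', (fourierCoeff (F ς') l + fourierCoeff (G ς') l)) := by
    have hsum := hk.summable (seqNorm_coe_ne_top u) (l, ς)
    have h1 : ∀ ς', HasSum (fun m : ℤ => ker y ξ (l, ς) (m, ς') * u (m, ς'))
        (fourierCoeff (F ς') l + fourierCoeff (G ς') l) := fun ς' => by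
      have := (hasSum_fourierCoeff_mul (hcs ς') (modeFun ς' u) l).add
        (hasSum_fourierCoeff_mul (hcd ς') (shift (modeFun ς' u)) l)
      convert this using 2 with m
      rw [fourierCoeff_shift, fourierCoeff_modeFun, ker, fc, fc]
      ring
    rw [← (Equiv.prodComm ℤˣ ℤ).hasSum_iff]
    have h2 := ((Equiv.prodComm ℤˣ ℤ).summable_iff.2 hsum).hasSum
    have h3 := h2.prod_fiberwise h1
    rw [← (hasSum_fintype _).unique h3] at h2
    exact h2
  rw [fourierCoeff_congr e, fourierCoeff.const_smul, fourierCoeff.add (hI.smul (-(I * (ς : ℤ)))) (hU.smul (-1 : ℂ)),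
    Pi.add_apply, fourierCoeff.const_smul, fourierCoeff.const_smul,
    fourierCoeff.add ((hF 1).add (hG 1)) ((hF (-1)).add (hG (-1))), fourierCoeff.add (hF 1) (hG 1),
    fourierCoeff.add (hF (-1)) (hG (-1)), kmul, hs.tsum_eq, sum_int_units, fourierCoeff_modeFun]
  simp only [Pi.add_apply, smul_eq_mul]
  ring

end Operator

end

/-! ### Reduction of `Π 𝕃₁ Π` to the transport system -/

section

open Set Filter Topology Complex ComplexConjugate MeasureTheory
open scoped NNReal ENNReal

section Operator

variable {y ξ : ℝ}

/-- The contribution of the correction of the transport speed. -/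
def drift (y ξ ε c₂ : ℝ) (i : Idx) : ℂ := -(I * (i.2 : ℤ)) * (ε * c₂ / omega y ξ : ℝ)

lemma coeff_tensorSum_unit {V : ℤˣ → Circ → ℂ} (hV : ∀ ς, Integrable (V ς) dCirc) (i : Idx) :
    coeff (tensorSum V) (i.1, (i.2 : ℤ)) = fourierCoeff (V i.2) i.1 := by
  rw [coeff_tensorSum hV, sum_int_units]
  obtain ⟨m, ς⟩ := i
  rcases Int.units_eq_one_or ς with rfl | rfl <;> simp

/-- At `j = ±1` the transport speed minus the Hilbert transform leaves `-ε² i j (ω₀ - ε c₂)`. The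
part with `ω₀` cancels the term `-u` of `Q₁`, the part with `c₂` is the drift, and `ε²ω₀` factors
out of everything. -/
lemma PiL₁Pi_synth (hy : 0 < y) (hξ0 : 0 < ξ) (hξ : 2 * ξ ^ 2 < y ^ 2) {c : ℕ → ℝ≥0}
    (hk : KernelBound c (ker y ξ)) (ε c₂ : ℝ) (u : Seq2) (i : Idx) :
    PiL₁Pi y ξ ε (speed y ξ ε c₂) (synth u) (i.1, (i.2 : ℤ)) =
      ε ^ 2 * omega y ξ * transport (addDiag (ker y ξ) (drift y ξ ε c₂)) u i := by
  have hω := omega_pos hy hξ0 hξ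
  have hω' : (omega y ξ : ℂ) ≠ 0 := ofReal_ne_zero.2 hω.ne'
  have habs : |((i.2 : ℤˣ) : ℤ)| = 1 := by
    rcases Int.units_eq_one_or i.2 with h | h <;> simp [h]
  have hsign : (((i.2 : ℤˣ) : ℤ).sign : ℂ) = ((i.2 : ℤ) : ℂ) := by
    rcases Int.units_eq_one_or i.2 with h | h <;> simp [h]
  have hsq : ((i.2 : ℤ) : ℂ) ^ 2 = 1 := by
    rcases Int.units_eq_one_or i.2 with h | h <;> simp [h]
  have hW : ∀ ς, modeQ y ξ (modeInt (synth u)) ς =ᵐ[dCirc] modeQ y ξ (fun ς => modeFun ς u) ς :=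
    modeQ_congr_ae (modeInt_synth u)
  have hq := fun ς => integrable_fourierCoeff_modeQ hy hξ0 hξ hk u ς
  have h1 : coeff (Q₁ y ξ (modeProj (synth u))) (i.1, (i.2 : ℤ)) =
      omega y ξ * (-(I * (i.2 : ℤ)) * kmul (ker y ξ) u i - u i) := by
    rw [modeProj_eq, Q₁_tensorSum hω.ne', coeff_tensorSum_unit fun ς => (integrable_congr (hW ς)).2 (hq ς).1,
      fourierCoeff_congr (hW i.2), (hq i.2).2]
  rw [PiL₁Pi, if_pos habs, L₁, h1, coeff_congr_ae (modeProj_synth u), coeff_synth_unit,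
    hk.transport_addDiag (seqNorm_coe_ne_top u), transport, drift, speed, hsign]
  generalize ((i.2 : ℤ) : ℂ) = z at *
  generalize kmul (ker y ξ) u i = k
  generalize u i = v
  push_cast
  field_simp
  ring_nf
  simp only [I_sq, hsq]
  ring

end Operator

/-! ### Extraction of the coefficients at the modes ±1, and Sobolev norms -/

section Analysis

/-- The exponentials carried by the modes `±1`. -/
def torusExp (i : Idx) : C(Circ × Circ, ℂ) :=
  ⟨fun p => fourier i.1 p.1 * fourier (i.2 : ℤ) p.2,
    ((fourier i.1).continuous.comp continuous_fst).mul ((fourier (i.2 : ℤ)).continuous.comp continuous_snd)⟩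

lemma inner_torusExp (i : Idx) (h : L2) :
    inner ℂ (ContinuousMap.toLp 2 dTorus ℂ (torusExp i)) h = coeff h (i.1, (i.2 : ℤ)) := by
  rw [inner_toLp_left, coeff]
  congr 1
  funext p
  rw [fourier_neg, fourier_neg, ← map_mul]
  rfl

lemma orthonormal_torusExp :
    Orthonormal ℂ fun i : Idx => (ContinuousMap.toLp 2 dTorus ℂ (torusExp i) : L2) := by
  classical
  rw [orthonormal_iff_ite]
  intro i j
  have h1 : ∀ p : Circ × Circ, torusExp j p * conj (torusExp i p) =
      (fourier j.1 p.1 * fourier (-i.1) p.1) * (fourier (j.2 : ℤ) p.2 * fourier (-(i.2 : ℤ)) p.2) := fun p => by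
    have : ∀ k : Idx, torusExp k p = fourier k.1 p.1 * fourier (k.2 : ℤ) p.2 := fun k => rfl
    rw [this, this, fourier_neg, fourier_neg, map_mul]
    ring
  rw [ContinuousMap.inner_toLp]
  simp only [h1]
  rw [integral_prod_mul (fun x : Circ => fourier j.1 x * fourier (-i.1) x)
    (fun x : Circ => fourier (j.2 : ℤ) x * fourier (-(i.2 : ℤ)) x), integral_fourier_mul, integral_fourier_mul]
  have e1 : j.1 + -i.1 = 0 ↔ i.1 = j.1 := by constructor <;> intro h <;> linarith
  have e2 : (j.2 : ℤ) + -(i.2 : ℤ) = 0 ↔ i.2 = j.2 := by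
    rw [Units.ext_iff]
    constructor <;> intro h <;> linarith
  simp only [e1, e2, Prod.ext_iff]
  split_ifs <;> simp_all

/-- The Fourier coefficients at the modes `±1`. -/
def analysis : L2 →ₗ[ℂ] Seq2 where
  toFun h := ⟨fun i => inner ℂ (ContinuousMap.toLp 2 dTorus ℂ (torusExp i)) h, by
    have h' : Memℓp (fun i : Idx => inner ℂ (ContinuousMap.toLp 2 dTorus ℂ (torusExp i)) h) 2 := by
      rw [memℓp_gen_iff (by norm_num)]
      simpa using orthonormal_torusExp.inner_products_summable h
    exact h'⟩
  map_add' f g := by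
    ext i
    exact inner_add_right _ _ _
  map_smul' c f := by
    ext i
    exact inner_smul_right _ _ _

lemma analysis_apply (h : L2) (i : Idx) : analysis h i = coeff h (i.1, (i.2 : ℤ)) := inner_torusExp i h

lemma coeff_eq_zero_of_modeProj {h : L2} (hh : modeProj h =ᵐ[dTorus] h) {k : ℤ × ℤ} (hk : |k.2| ≠ 1) :
    coeff h k = 0 := by
  have hi : Integrable (h : Circ × Circ → ℂ) dTorus := (Lp.memLp h).integrable one_le_two
  have hm : ∀ ς, Integrable (modeInt h ς) dCirc := fun ς => by
    have : Integrable (fun p : Circ × Circ => h p * fourier (-(ς : ℤ)) p.2) dTorus :=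
      hi.mul_bdd (c := 1) ((fourier (-(ς : ℤ))).continuous.comp continuous_snd).aestronglyMeasurable
        (Eventually.of_forall fun p => (norm_fourier_apply _ _).le)
    exact this.integral_prod_left
  rw [← coeff_congr_ae hh, modeProj_eq, coeff_tensorSum hm]
  refine Finset.sum_eq_zero fun ς _ => if_neg ?_
  rintro h
  apply hk
  rw [h]
  rcases Int.units_eq_one_or ς with rfl | rfl <;> simp

lemma weight_eq (s : ℝ) (i : Idx) (z : ℂ) :
    ENNReal.ofReal ((1 + (i.1 : ℝ) ^ 2 + ((i.2 : ℤ) : ℝ) ^ 2) ^ s * ‖z‖ ^ 2) =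
      (ENNReal.ofReal (bracket i ^ s) * ‖z‖ₑ) ^ 2 := by
  have h : (1 + (i.1 : ℝ) ^ 2 + ((i.2 : ℤ) : ℝ) ^ 2) = bracket i ^ 2 := by
    rw [bracket_sq]
    rcases Int.units_eq_one_or i.2 with h | h <;> rw [h] <;> push_cast <;> ring
  have hb := bracket_pos i
  rw [h, ← Real.rpow_natCast, ← Real.rpow_mul hb.le, mul_comm ((2 : ℕ) : ℝ), Real.rpow_mul hb.le, Real.rpow_natCast,
    ← mul_pow, ENNReal.ofReal_pow (by positivity), ENNReal.ofReal_mul (by positivity), ofReal_norm]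

lemma seqNorm_analysis_le (s : ℝ) (h : L2) : seqNorm s (analysis h) ≤ sobolevNorm s h := by
  rw [seqNorm, l2, sobolevNorm]
  gcongr
  have hinj : Function.Injective fun i : Idx => ((i.1, (i.2 : ℤ)) : ℤ × ℤ) := fun i j hij => by
    simp only [Prod.mk.injEq] at hij
    exact Prod.ext hij.1 (Units.ext hij.2)
  refine le_trans (le_of_eq ?_) (ENNReal.tsum_comp_le_tsum_of_injective hinj _)
  refine tsum_congr fun i => ?_
  rw [analysis_apply, ← weight_eq]

lemma sobolevNorm_synth (s : ℝ) (u : Seq2) : sobolevNorm s (synth u) = seqNorm s u := by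
  rw [seqNorm, l2, sobolevNorm]
  congr 1
  have hinj : Function.Injective fun i : Idx => ((i.1, (i.2 : ℤ)) : ℤ × ℤ) := fun i j hij => by
    simp only [Prod.mk.injEq] at hij
    exact Prod.ext hij.1 (Units.ext hij.2)
  rw [← hinj.tsum_eq]
  · refine tsum_congr fun i => ?_
    rw [← weight_eq, coeff_synth_unit]
  · intro k hk
    by_contra hk'
    refine hk ?_
    beta_reduce
    rw [coeff_synth_of_ne u, norm_zero, zero_pow two_ne_zero, mul_zero, ENNReal.ofReal_zero]
    intro h
    obtain ⟨ς, hς⟩ := Int.isUnit_iff_abs_eq.2 h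
    exact hk' ⟨(k.1, ς), by simp only [hς]⟩

end Analysis

end

/-! ### Real-valued functions -/

section

open Set Filter Topology Complex ComplexConjugate MeasureTheory
open scoped NNReal ENNReal

section Reality

/-- The action on Fourier coefficients of complex conjugation. -/
def reflect (u : Idx → ℂ) (i : Idx) : ℂ := conj (u (-i))

lemma seqNorm_reflect (s : ℝ) (u : Idx → ℂ) : seqNorm s (reflect u) = seqNorm s u := by
  rw [seqNorm, seqNorm, l2, l2, ← (Equiv.neg Idx).tsum_eq]
  congr 1
  refine tsum_congr fun i => ?_
  have h1 : bracket (-i) = bracket i := by simp [bracket]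
  have h2 : ‖conj (u i)‖ₑ = ‖u i‖ₑ := by rw [← ofReal_norm, ← ofReal_norm, norm_conj]
  simp only [reflect, Equiv.neg_apply, neg_neg, h1, h2]

/-- With this symmetry of the kernel the equation commutes with complex conjugation; uniqueness then
makes the solution real when the source is. -/
lemma transport_reflect {a : Idx → Idx → ℂ} (ha : ∀ i j, a (-i) (-j) = conj (a i j)) (u : Idx → ℂ) :
    transport a (reflect u) = reflect (transport a u) := by
  funext i
  have h : kmul a (reflect u) i = conj (kmul a u (-i)) := by
    rw [kmul, kmul, conj_tsum, ← (Equiv.neg Idx).tsum_eq]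
    refine tsum_congr fun j => ?_
    rw [map_mul, ← ha]
    simp [reflect]
  rw [transport, h, reflect, reflect, transport]
  simp

lemma symb_neg (y ξ : ℝ) (ς ς' : ℤˣ) : symb y ξ (-ς) (-ς') = (fun φ => conj (symb y ξ ς ς' φ)) ∧
    symD y ξ (-ς) (-ς') = fun φ => conj (symD y ξ ς ς' φ) := by
  constructor <;> funext φ <;>
    rcases Int.units_eq_one_or ς with rfl | rfl <;> rcases Int.units_eq_one_or ς' with rfl | rfl <;>
    simp [symb, symD, show (1 : ℤˣ) ≠ -1 by decide, show (-1 : ℤˣ) ≠ 1 by decide]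

lemma ker_neg (y ξ : ℝ) (i j : Idx) : ker y ξ (-i) (-j) = conj (ker y ξ i j) := by
  rw [ker, ker, Prod.snd_neg, Prod.snd_neg, Prod.fst_neg, Prod.fst_neg, (symb_neg _ _ _ _).1, (symb_neg _ _ _ _).2,
    fc_conj, fc_conj, map_add, map_mul, map_zpow₀, map_neg, map_one, zpow_neg, ← inv_zpow, inv_neg, inv_one,
    show -(-i.1 - -j.1) = i.1 - j.1 by ring]

lemma addDiag_ker_neg (y ξ ε c₂ : ℝ) (i j : Idx) :
    addDiag (ker y ξ) (drift y ξ ε c₂) (-i) (-j) = conj (addDiag (ker y ξ) (drift y ξ ε c₂) i j) := by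
  rw [addDiag, addDiag, ker_neg, map_add]
  simp only [neg_inj]
  split_ifs
  · rw [drift, drift, map_mul, conj_ofReal]
    simp
  · simp

lemma analysis_reflect {h : L2} (hh : ∀ᵐ p ∂dTorus, (h p).im = 0) : reflect (analysis h) = analysis h := by
  funext i
  rw [reflect, analysis_apply, analysis_apply, coeff, coeff, ← integral_conj]
  refine integral_congr_ae ?_
  filter_upwards [hh] with p hp
  rw [map_mul, map_mul, conj_eq_iff_im.2 hp, ← fourier_neg, ← fourier_neg]
  simp only [Prod.fst_neg, Prod.snd_neg, Units.val_neg, neg_neg]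

lemma fourierCoeff_star (U : CircL2) (m : ℤ) : fourierCoeff (star U : CircL2) m = conj (fourierCoeff U (-m)) := by
  rw [fourierCoeff, fourierCoeff, ← integral_conj]
  refine integral_congr_ae ?_
  filter_upwards [Lp.coeFn_star U] with x hx
  rw [hx, smul_eq_mul, smul_eq_mul, map_mul, ← fourier_neg, neg_neg]
  rfl

lemma modeFun_neg_one {u : Seq2} (hu : reflect u = u) : modeFun (-1) u = star (modeFun 1 u) := by
  apply (fourierBasis (T := 2 * Real.pi)).repr.injective
  ext m
  rw [fourierBasis_repr, fourierBasis_repr, fourierCoeff_star, fourierCoeff_modeFun, fourierCoeff_modeFun]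
  exact (congrFun hu (m, -1)).symm.trans (by simp [reflect])

lemma synth_real {u : Seq2} (hu : reflect u = u) : ∀ᵐ p ∂dTorus, (synth u p).im = 0 := by
  filter_upwards [synth_ae u, ae_fst (Lp.coeFn_star (modeFun 1 u))] with p h1 h2
  rw [h1, tensorSum, sum_int_units, modeFun_neg_one hu, h2, Units.val_neg, Units.val_one, fourier_neg]
  simp
  ring

end Reality

end

/-! ### Cutoff in the parameter and Lipschitz norms -/

section

open Set Filter Topology Complex ComplexConjugate MeasureTheory
open scoped NNReal ENNReal

section Estimates

variable {y ξl ξu : ℝ}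

/-- A cutoff which is supported away from a given set. -/
lemma exists_cutoff (S : Set ℝ) {σ : ℝ} (hσ0 : 0 < σ) (hσ1 : σ < 1) (ξl ξu : ℝ) :
    ∃ χ : ℝ → ℝ, (∀ ξ, |χ ξ| ≤ 1) ∧ (∀ ξ ξ', |χ ξ - χ ξ'| ≤ 2 / σ * |ξ - ξ'|) ∧
      (∀ ξ ∈ Icc ξl ξu, (∀ x ∈ S, σ ≤ |ξ - x|) → χ ξ = 1) ∧
      ∀ ξ, χ ξ ≠ 0 → ∀ x ∈ S, σ / 2 ≤ |ξ - x| := by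
  -- `Metric.infDist` to the empty set is 0 by convention. A point at distance at least 1 from the
  -- parameter interval makes the set nonempty and, as `σ < 1`, leaves the cutoff equal to 1 where
  -- it should be.
  set S' : Set ℝ := insert (ξu + 1) S
  have hne : S'.Nonempty := ⟨ξu + 1, mem_insert _ _⟩
  set r : ℝ → ℝ := fun ξ => Metric.infDist ξ S'
  have hr : ∀ ξ ξ', |r ξ - r ξ'| ≤ |ξ - ξ'| := fun ξ ξ' => by
    have h1 : r ξ ≤ r ξ' + dist ξ ξ' := Metric.infDist_le_infDist_add_dist
    have h2 : r ξ' ≤ r ξ + dist ξ' ξ := Metric.infDist_le_infDist_add_dist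
    rw [dist_comm, Real.dist_eq] at h2
    rw [Real.dist_eq] at h1
    rw [abs_le]
    constructor <;> linarith
  -- The affine function of the distance rises from 0 at `σ/2` to 1 at `σ`.
  refine ⟨fun ξ => max 0 (min 1 (2 / σ * r ξ - 1)), fun ξ => ?_, fun ξ ξ' => ?_, fun ξ hξ h => ?_,
    fun ξ h x hx => ?_⟩
  · rw [abs_of_nonneg (le_max_left _ _)]
    exact max_le zero_le_one (min_le_left _ _)
  · have h1 := abs_max_sub_max_le_max 0 (min 1 (2 / σ * r ξ - 1)) 0 (min 1 (2 / σ * r ξ' - 1))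
    have h2 := abs_min_sub_min_le_max 1 (2 / σ * r ξ - 1) 1 (2 / σ * r ξ' - 1)
    simp only [sub_self, abs_zero, abs_nonneg, max_eq_right] at h1 h2
    refine h1.trans (h2.trans ?_)
    rw [sub_sub_sub_cancel_right, ← mul_sub, abs_mul, abs_of_pos (by positivity : 0 < 2 / σ)]
    exact mul_le_mul_of_nonneg_left (hr ξ ξ') (by positivity)
  · have h1 : σ ≤ r ξ := by
      refine (Metric.le_infDist hne).2 fun {x} hx => ?_
      rw [Real.dist_eq]
      rcases mem_insert_iff.1 hx with rfl | hx
      · rw [abs_sub_comm, abs_of_nonneg (by linarith [hξ.2])]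
        linarith [hξ.2]
      · exact h x hx
    have h2 : 1 ≤ 2 / σ * r ξ - 1 := by
      have : 2 / σ * σ ≤ 2 / σ * r ξ := by gcongr
      rw [div_mul_cancel₀ _ hσ0.ne'] at this
      linarith
    beta_reduce
    rw [min_eq_left h2, max_eq_right zero_le_one]
  · by_contra hlt
    rw [not_le] at hlt
    refine h ?_
    have h1 : r ξ ≤ |ξ - x| := Metric.infDist_le_dist_of_mem (mem_insert_of_mem _ hx)
    have h2 : 2 / σ * r ξ ≤ 1 := by
      have : 2 / σ * r ξ ≤ 2 / σ * (σ / 2) := by gcongr; linarith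
      rwa [div_mul_div_cancel₀ hσ0.ne', div_self two_ne_zero] at this
    exact max_eq_left ((min_le_right _ _).trans (by linarith))

lemma exists_inv_omega_bound (hy : 0 < y) (hl : 0 < ξl) (hu : ξu < y / √2) :
    ∃ b : ℝ, 0 ≤ b ∧ (∀ ξ ∈ Icc ξl ξu, |(omega y ξ)⁻¹| ≤ b) ∧
      ∀ ξ ∈ Icc ξl ξu, ∀ ξ' ∈ Icc ξl ξu, |(omega y ξ)⁻¹ - (omega y ξ')⁻¹| ≤ b * |ξ - ξ'| := by
  obtain ⟨b, hb0, hb⟩ := ((isSymbol_const 1).div (isSymbol_omega hy) fun p hp =>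
    ofReal_ne_zero.2 (omega_pos hy hp.1 hp.2).ne').exists_bound hl hu
  have hpi := Real.pi_pos
  obtain ⟨h1, h2⟩ := hb Real.pi ⟨by linarith, by linarith⟩
  have e : ∀ ξ, (1 / (omega y ξ : ℂ)) = ((omega y ξ)⁻¹ : ℝ) := fun ξ => by push_cast; rw [one_div]
  refine ⟨b, hb0, fun ξ hξ => ?_, fun ξ hξ ξ' hξ' => ?_⟩
  · have := h1 ξ hξ
    rwa [e, norm_real, Real.norm_eq_abs] at this
  · have := h2 ξ hξ ξ' hξ'
    rwa [e, e, ← ofReal_sub, norm_real, Real.norm_eq_abs] at this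

variable {O : Set ℝ}

lemma sobolevNorm_le_lip (lam s : ℝ) (h : O → L2) (ξ : O) :
    sobolevNorm s (h ξ) ≤ lipSobolevNorm lam s h :=
  (le_iSup (fun ξ => sobolevNorm s (h ξ)) ξ).trans le_self_add

lemma sobolevNorm_sub_le_lip (lam s : ℝ) (h : O → L2) (ξ ξ' : O) :
    ENNReal.ofReal lam * sobolevNorm (s - 1) (h ξ - h ξ') ≤
      ENNReal.ofReal |(ξ : ℝ) - ξ'| * lipSobolevNorm lam s h := by
  by_cases hne : ξ = ξ'
  · subst hne
    have : sobolevNorm (s - 1) (0 : L2) = 0 := by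
      have := sobolevNorm_synth (s - 1) 0
      rw [map_zero] at this
      rw [this]
      exact seqNorm_zero _
    rw [sub_self, this, mul_zero]
    exact zero_le
  · have hpos : ENNReal.ofReal |(ξ : ℝ) - ξ'| ≠ 0 := by
      simpa [sub_eq_zero] using fun h => hne (Subtype.ext h)
    have h1 : sobolevNorm (s - 1) (h ξ - h ξ') / ENNReal.ofReal |(ξ : ℝ) - ξ'| ≤
        ⨆ (ξ₁ : O) (ξ₂ : O) (_ : ξ₁ ≠ ξ₂),
          sobolevNorm (s - 1) (h ξ₁ - h ξ₂) / ENNReal.ofReal |(ξ₁ : ℝ) - ξ₂| :=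
      le_iSup_of_le ξ (le_iSup_of_le ξ' (le_iSup_of_le hne le_rfl))
    have h2 := (mul_le_mul_right h1 (ENNReal.ofReal lam)).trans
      (le_add_self (b := ⨆ ξ, sobolevNorm s (h ξ)))
    rw [← mul_div_assoc, ENNReal.div_le_iff hpos ENNReal.ofReal_ne_top, mul_comm _ (ENNReal.ofReal |_|)] at h2
    exact h2

lemma lipSobolevNorm_le_of {lam s : ℝ} {h : O → L2} {a b : ℝ≥0∞} (h1 : ∀ ξ, sobolevNorm s (h ξ) ≤ a)
    (h2 : ∀ ξ ξ' : O, ENNReal.ofReal lam * sobolevNorm (s - 1) (h ξ - h ξ') ≤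
      ENNReal.ofReal |(ξ : ℝ) - ξ'| * b) : lipSobolevNorm lam s h ≤ a + b := by
  refine add_le_add (iSup_le h1) ?_
  simp only [ENNReal.mul_iSup]
  refine iSup_le fun ξ => iSup_le fun ξ' => iSup_le fun hne => ?_
  have hpos : ENNReal.ofReal |(ξ : ℝ) - ξ'| ≠ 0 := by
    simpa [sub_eq_zero] using fun h => hne (Subtype.ext h)
  rw [← mul_div_assoc, ENNReal.div_le_iff hpos ENNReal.ofReal_ne_top, mul_comm b]
  exact h2 ξ ξ'

lemma abs_le_of_lipNorm_le {lam K : ℝ} {c₂ : O → ℝ} (h : lipNorm lam c₂ ≤ ENNReal.ofReal K) (ξ : O) :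
    |c₂ ξ| ≤ max K 0 := by
  have h1 : ENNReal.ofReal |c₂ ξ| ≤ ENNReal.ofReal K :=
    (le_iSup (fun ξ => ENNReal.ofReal |c₂ ξ|) ξ).trans (le_self_add.trans h)
  rcases le_total 0 K with hK | hK
  · rw [max_eq_left hK]
    exact (ENNReal.ofReal_le_ofReal_iff hK).1 h1
  · rw [max_eq_right hK]
    rw [ENNReal.ofReal_of_nonpos hK] at h1
    simpa using h1

lemma abs_sub_le_of_lipNorm_le {lam K : ℝ} (hlam : 0 < lam) {c₂ : O → ℝ}
    (h : lipNorm lam c₂ ≤ ENNReal.ofReal K) (ξ ξ' : O) :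
    lam * |c₂ ξ - c₂ ξ'| ≤ max K 0 * |(ξ : ℝ) - ξ'| := by
  by_cases hne : ξ = ξ'
  · subst hne
    simp
  have hpos : ENNReal.ofReal |(ξ : ℝ) - ξ'| ≠ 0 := by
    simpa [sub_eq_zero] using fun h => hne (Subtype.ext h)
  have h1 : ENNReal.ofReal |c₂ ξ - c₂ ξ'| / ENNReal.ofReal |(ξ : ℝ) - ξ'| ≤
      ⨆ (ξ₁ : O) (ξ₂ : O) (_ : ξ₁ ≠ ξ₂),
        ENNReal.ofReal |c₂ ξ₁ - c₂ ξ₂| / ENNReal.ofReal |(ξ₁ : ℝ) - ξ₂| :=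
    le_iSup_of_le ξ (le_iSup_of_le ξ' (le_iSup_of_le hne le_rfl))
  have h2 : _ ≤ ENNReal.ofReal K := (mul_le_mul_right h1 (ENNReal.ofReal lam)).trans (le_add_self.trans h)
  rw [← mul_div_assoc, ENNReal.div_le_iff hpos ENNReal.ofReal_ne_top, ← ENNReal.ofReal_mul hlam.le] at h2
  have h3 : ENNReal.ofReal K = ENNReal.ofReal (max K 0) := by
    rw [ENNReal.ofReal, ENNReal.ofReal, Real.toNNReal, Real.toNNReal]
    simp
  rwa [h3, ← ENNReal.ofReal_mul (le_max_right _ _), ENNReal.ofReal_le_ofReal_iff (by positivity)] at h2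

lemma seqNorm_smul_coe (s : ℝ) (k : ℂ) (u : Seq2) : seqNorm s (k • u : Seq2) = ‖k‖ₑ * seqNorm s u :=
  seqNorm_const_mul s k u

/-- The Lipschitz estimate for a family `f v` built from solutions `v` and a cutoff `f`. -/
lemma lipSobolevNorm_synth_le {lam s : ℝ} (hlam1 : lam < 1) {D B N M : ℝ≥0} {h : O → L2} {v : O → Seq2}
    {f : O → ℝ} {G : Set O} (hf : ∀ ξ, |f ξ| ≤ B)
    (hfl : ∀ ξ ξ' : O, |f ξ - f ξ'| ≤ N * |(ξ : ℝ) - ξ'|) (hf0 : ∀ ξ, ξ ∉ G → f ξ = 0)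
    (hv : ∀ ξ ∈ G, seqNorm s (v ξ) ≤ D * sobolevNorm (s - 1) (h ξ))
    (hvl : ∀ ξ ∈ G, ∀ ξ' ∈ G, ENNReal.ofReal lam * seqNorm (s - 1) (v ξ - v ξ' : Seq2) ≤
      D * (ENNReal.ofReal lam * sobolevNorm (s - 1 - 1) (h ξ - h ξ') +
        ENNReal.ofReal |(ξ : ℝ) - ξ'| * (M * seqNorm s (v ξ')))) :
    lipSobolevNorm lam s (fun ξ => synth ((f ξ : ℂ) • v ξ)) ≤
      ((B * D + (B * (D * (1 + M * D)) + N * D) : ℝ≥0) : ℝ≥0∞) * lipSobolevNorm lam (s - 1) h := by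
  set H := lipSobolevNorm lam (s - 1) h
  have hlam : ENNReal.ofReal lam ≤ 1 := ENNReal.ofReal_le_one.2 hlam1.le
  have hfe : ∀ ξ, ‖(f ξ : ℂ)‖ₑ ≤ B := fun ξ => by
    rw [← ofReal_norm, norm_real, Real.norm_eq_abs]
    exact ENNReal.ofReal_le_of_le_toReal (hf ξ)
  have hfle : ∀ ξ ξ' : O, ‖((f ξ : ℂ) - f ξ')‖ₑ ≤ ENNReal.ofReal |(ξ : ℝ) - ξ'| * N := fun ξ ξ' => by
    rw [← ofReal_norm, ← ofReal_sub, norm_real, Real.norm_eq_abs, ← ENNReal.ofReal_coe_nnreal,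
      ← ENNReal.ofReal_mul (abs_nonneg _), mul_comm]
    exact ENNReal.ofReal_le_ofReal (hfl ξ ξ')
  have hvH : ∀ ξ ∈ G, seqNorm s (v ξ) ≤ D * H := fun ξ hξ =>
    (hv ξ hξ).trans (mul_le_mul_right (sobolevNorm_le_lip _ _ _ _) _)
  have hcut : ∀ ξ ξ' : O, ξ ∈ G → ENNReal.ofReal lam * (‖((f ξ : ℂ) - f ξ')‖ₑ * seqNorm (s - 1) (v ξ)) ≤
      ENNReal.ofReal |(ξ : ℝ) - ξ'| * ((N * D) * H) := fun ξ ξ' hξ => by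
    calc _ ≤ 1 * (ENNReal.ofReal |(ξ : ℝ) - ξ'| * N * (D * H)) := by
          refine mul_le_mul' hlam (mul_le_mul' (hfle ξ ξ') ?_)
          exact (seqNorm_mono (by linarith) _).trans (hvH ξ hξ)
      _ = _ := by ring
  refine (lipSobolevNorm_le_of (a := (B * D) * H) (b := (B * (D * (1 + M * D)) + N * D) * H)
    (fun ξ => ?_) fun ξ ξ' => ?_).trans (le_of_eq ?_)
  · rw [sobolevNorm_synth, seqNorm_smul_coe]
    by_cases hξ : ξ ∈ G
    · rw [mul_assoc]
      exact mul_le_mul' (hfe ξ) (hvH ξ hξ)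
    · simp [hf0 ξ hξ]
  · rw [← map_sub, sobolevNorm_synth]
    by_cases hξ : ξ ∈ G
    · by_cases hξ' : ξ' ∈ G
      -- Leibniz rule. Only the difference of the solutions loses a derivative; the other term loses
      -- none and pays the Lipschitz constant of `f`.
      · have e : (f ξ : ℂ) • v ξ - (f ξ' : ℂ) • v ξ' =
            (f ξ : ℂ) • (v ξ - v ξ') + ((f ξ : ℂ) - f ξ') • v ξ' := by module
        have h1 : seqNorm (s - 1) ((f ξ : ℂ) • v ξ - (f ξ' : ℂ) • v ξ' : Seq2) ≤
            ‖(f ξ : ℂ)‖ₑ * seqNorm (s - 1) (v ξ - v ξ' : Seq2) +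
              ‖((f ξ : ℂ) - f ξ')‖ₑ * seqNorm (s - 1) (v ξ') := by
          rw [e, ← seqNorm_smul_coe, ← seqNorm_smul_coe]
          exact seqNorm_add_le _ _ _
        have h2 : ENNReal.ofReal lam * (‖((f ξ : ℂ) - f ξ')‖ₑ * seqNorm (s - 1) (v ξ')) ≤
            ENNReal.ofReal |(ξ : ℝ) - ξ'| * ((N * D) * H) := by
          have := hcut ξ' ξ hξ'
          rwa [enorm_sub_rev, abs_sub_comm] at this
        have h3 : ENNReal.ofReal lam * seqNorm (s - 1) (v ξ - v ξ' : Seq2) ≤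
            ENNReal.ofReal |(ξ : ℝ) - ξ'| * (D * (1 + M * D) * H) := by
          refine (hvl ξ hξ ξ' hξ').trans ?_
          calc _ ≤ D * (ENNReal.ofReal |(ξ : ℝ) - ξ'| * H + ENNReal.ofReal |(ξ : ℝ) - ξ'| * (M * (D * H))) := by
                refine mul_le_mul_right (add_le_add (sobolevNorm_sub_le_lip lam (s - 1) h ξ ξ') ?_) _
                exact mul_le_mul_right (mul_le_mul_right (hvH ξ' hξ') _) _
            _ = _ := by ring
        calc _ ≤ ENNReal.ofReal lam * _ := mul_le_mul_right h1 _
          _ = ‖(f ξ : ℂ)‖ₑ * (ENNReal.ofReal lam * seqNorm (s - 1) (v ξ - v ξ' : Seq2)) +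
              ENNReal.ofReal lam * (‖((f ξ : ℂ) - f ξ')‖ₑ * seqNorm (s - 1) (v ξ')) := by ring
          _ ≤ B * (ENNReal.ofReal |(ξ : ℝ) - ξ'| * (D * (1 + M * D) * H)) +
              ENNReal.ofReal |(ξ : ℝ) - ξ'| * ((N * D) * H) :=
            add_le_add (mul_le_mul' (hfe ξ) h3) h2
          _ = _ := by ring
      -- Here `f ξ = f ξ - f ξ'` is itself at most `N|ξ - ξ'|`, so the uncontrolled vector `v ξ'`
      -- does not enter.
      · have h0 := hf0 ξ' hξ'
        have h1 := hcut ξ ξ' hξ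
        rw [h0, ofReal_zero, sub_zero] at h1
        rw [h0, ofReal_zero, zero_smul, sub_zero, seqNorm_smul_coe]
        refine h1.trans ?_
        gcongr
        exact le_add_self
    · have h0 := hf0 ξ hξ
      by_cases hξ' : ξ' ∈ G
      · have h1 := hcut ξ' ξ hξ'
        rw [h0, ofReal_zero, sub_zero, abs_sub_comm] at h1
        have e : (0 : ℂ) • v ξ - (f ξ' : ℂ) • v ξ' = (-(f ξ' : ℂ)) • v ξ' := by module
        rw [h0, ofReal_zero, e, seqNorm_smul_coe, enorm_neg]
        refine h1.trans ?_
        gcongr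
        exact le_add_self
      · rw [h0, hf0 ξ' hξ', ofReal_zero, zero_smul, zero_smul, sub_zero]
        have : seqNorm (s - 1) ((0 : Seq2) : Idx → ℂ) = 0 := seqNorm_zero _
        rw [this, mul_zero]
        exact zero_le
  · push_cast
    ring

end Estimates

end

/-! ### Inversion of the system away from the exceptional set -/

section

open Set Filter Topology Complex ComplexConjugate MeasureTheory
open scoped NNReal ENNReal

section InverseFamily

variable {y ξl ξu : ℝ}

lemma le_div_mul_of_mul_le {δ C : ℝ≥0} (hδ : δ ≠ 0) {x z : ℝ≥0∞} (h : δ * x ≤ C * z) :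
    x ≤ ((C / δ : ℝ≥0) : ℝ≥0∞) * z := by
  have h1 : ((δ⁻¹ : ℝ≥0) : ℝ≥0∞) * (δ * x) = x := by
    rw [← mul_assoc, ← ENNReal.coe_mul, inv_mul_cancel₀ hδ, ENNReal.coe_one, one_mul]
  rw [← h1, div_eq_mul_inv, mul_comm C, ENNReal.coe_mul, mul_assoc]
  exact mul_le_mul_right h _

lemma addDiag_sub (a b : Idx → Idx → ℂ) (μ ν : Idx → ℂ) :
    (fun i j => addDiag a μ i j - addDiag b ν i j) =
      addDiag (fun i j => a i j - b i j) (fun i => μ i - ν i) := by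
  funext i j
  simp only [addDiag]
  split_ifs <;> ring

lemma KernelBound.addDiag {a : Idx → Idx → ℂ} {c : ℕ → ℝ≥0} (ha : KernelBound c a) {μ : Idx → ℂ} {m : ℝ≥0}
    (hμ : ∀ i, ‖μ i‖ ≤ m) : KernelBound (fun k => c k + m) (addDiag a μ) :=
  ha.add (kernelBound_diag hμ)

lemma seqNorm_kmul_addDiag_le {c : ℕ → ℝ≥0} {r m : ℝ≥0} {d : Idx → Idx → ℂ}
    (hd : KernelBound (fun k => c k * r) d) {μ : Idx → ℂ} {lam : ℝ} (hlam0 : 0 ≤ lam) (hlam1 : lam ≤ 1)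
    (hμ : ∀ i, lam * ‖μ i‖ ≤ m * r) (s : ℝ) {u : Idx → ℂ} (hu : seqNorm 0 u ≠ ∞) :
    ENNReal.ofReal lam * seqNorm s (kmul (addDiag d μ) u) ≤
      r * (((c (decayOrder s) * schurConst s + m : ℝ≥0) : ℝ≥0∞) * seqNorm s u) := by
  have h1 : seqNorm s (kmul (addDiag d μ) u) ≤ seqNorm s (kmul d u) + seqNorm s (fun i => μ i * u i) := by
    rw [show kmul (addDiag d μ) u = fun i => kmul d u i + μ i * u i from funext fun i => hd.kmul_addDiag hu μ i]
    exact seqNorm_add_le _ _ _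
  have h2 : ENNReal.ofReal lam * seqNorm s (fun i => μ i * u i) ≤ (m * r : ℝ≥0) * seqNorm s u := by
    have e1 : ENNReal.ofReal lam = ‖(lam : ℂ)‖ₑ := by
      rw [← ofReal_norm, norm_real, Real.norm_of_nonneg hlam0]
    have e2 : ((m * r : ℝ≥0) : ℝ≥0∞) = ‖(((m * r : ℝ≥0) : ℝ) : ℂ)‖ₑ := by
      rw [← ofReal_norm, norm_real, Real.norm_of_nonneg (NNReal.coe_nonneg _), ENNReal.ofReal_coe_nnreal]
    rw [e1, e2, ← seqNorm_const_mul, ← seqNorm_const_mul]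
    refine seqNorm_mono_fun fun i => ?_
    rw [norm_mul, norm_mul, norm_mul, norm_real, norm_real, Real.norm_of_nonneg hlam0,
      Real.norm_of_nonneg (NNReal.coe_nonneg _), ← mul_assoc]
    gcongr
    exact hμ i
  calc _ ≤ ENNReal.ofReal lam * (seqNorm s (kmul d u) + seqNorm s (fun i => μ i * u i)) := mul_le_mul_right h1 _
    _ = ENNReal.ofReal lam * seqNorm s (kmul d u) + ENNReal.ofReal lam * seqNorm s (fun i => μ i * u i) := mul_add _ _ _
    _ ≤ 1 * ((c (decayOrder s) * r : ℝ≥0) * schurConst s * seqNorm s u) + (m * r : ℝ≥0) * seqNorm s u :=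
      add_le_add (mul_le_mul' (ENNReal.ofReal_le_one.2 hlam1) (hd.seqNorm_kmul_le s u)) h2
    _ = _ := by push_cast; ring

lemma norm_drift (y ξ ε c₂ : ℝ) (i : Idx) : ‖drift y ξ ε c₂ i‖ = |ε * c₂ / omega y ξ| := by
  have h : ‖((i.2 : ℤ) : ℂ)‖ = 1 := by
    rcases Int.units_eq_one_or i.2 with h | h <;> simp [h]
  rw [drift, norm_mul, norm_neg, norm_mul, norm_I, h, norm_real, Real.norm_eq_abs, one_mul, one_mul]

lemma norm_drift_sub (y ξ ξ' ε c₂ c₂' : ℝ) (i : Idx) :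
    ‖drift y ξ ε c₂ i - drift y ξ' ε c₂' i‖ = |ε * c₂ / omega y ξ - ε * c₂' / omega y ξ'| := by
  have h : ‖((i.2 : ℤ) : ℂ)‖ = 1 := by
    rcases Int.units_eq_one_or i.2 with h | h <;> simp [h]
  rw [drift, drift, ← mul_sub, ← ofReal_sub, norm_mul, norm_neg, norm_mul, norm_I, h, norm_real,
    Real.norm_eq_abs, one_mul, one_mul]

/-- The system satisfied by the Fourier coefficients of `ω⁻¹ ε⁻² Π 𝕃₁ Π h`. -/
abbrev system (y ε ξ c₂ : ℝ) : Idx → Idx → ℂ := addDiag (ker y ξ) (drift y ξ ε c₂)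

/-- Inversion of the system for parameters away from the exceptional set, with tame and Lipschitz
estimates. -/
lemma exists_inverse_family (hy : 0 < y) (hl : 0 < ξl) (hu : ξu < y / √2) :
    ∃ n : ℕ, ∀ K : ℝ, ∃ ε₁ : ℝ, 0 < ε₁ ∧ ∃ E M : ℝ → ℝ≥0, ∀ lam ε : ℝ, ∀ σ : ℝ≥0,
      0 < lam → lam < 1 → 0 < ε → 0 < σ → σ < 1 → ε ≤ ε₁ * σ ^ n →
      ∀ c₂ : Icc ξl ξu → ℝ, lipNorm lam c₂ ≤ ENNReal.ofReal K →
      ∃ T : Icc ξl ξu → Seq2 →ₗ[ℂ] Seq2,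
        (∀ ξ, ξ ∉ goodSet y ξl ξu (σ / 2) → T ξ = 0) ∧
        (∀ ξ ∈ goodSet y ξl ξu (σ / 2), ∀ g, transport (system y ε ξ (c₂ ξ)) (T ξ g) = g) ∧
        (∀ ξ ∈ goodSet y ξl ξu (σ / 2), ∀ g : Seq2, reflect g = g → reflect (T ξ g) = T ξ g) ∧
        ∀ s, 1 < s →
          (∀ ξ ∈ goodSet y ξl ξu (σ / 2), ∀ g,
            seqNorm s (T ξ g) ≤ ((E s / σ ^ n : ℝ≥0) : ℝ≥0∞) * seqNorm (s - 1) g) ∧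
          ∀ ξ ∈ goodSet y ξl ξu (σ / 2), ∀ ξ' ∈ goodSet y ξl ξu (σ / 2), ∀ g g' : Seq2,
            ENNReal.ofReal lam * seqNorm (s - 1) (T ξ g - T ξ' g' : Seq2) ≤
              ((E s / σ ^ n : ℝ≥0) : ℝ≥0∞) * (ENNReal.ofReal lam * seqNorm (s - 1 - 1) (g - g' : Seq2) +
                ENNReal.ofReal |(ξ : ℝ) - ξ'| * (M s * seqNorm s (T ξ' g'))) := by
  obtain ⟨n, c₁, hc₁, hdet⟩ := exists_charDet_lower_bound hy hl hu
  obtain ⟨c, hker, hkerl⟩ := exists_kernelBound hy hl hu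
  obtain ⟨C₀, hC₀⟩ := exists_apriori_finite hy hl hu
  obtain ⟨C, hC⟩ := exists_apriori c C₀
  obtain ⟨b, hb0, hb, hbl⟩ := exists_inv_omega_bound hy hl hu
  refine ⟨n, fun K => ?_⟩
  set c₀ : ℝ≥0 := min ⟨c₁, hc₁.le⟩ 1
  have hc₀ : 0 < c₀ := lt_min (by exact_mod_cast hc₁) one_pos
  set κ : ℝ≥0 := ⟨max K 0 * b, by positivity⟩
  set c' : ℕ → ℝ≥0 := fun k => c k + κ
  -- The condition `1 < s` is placed after the constant, so that the constant can be chosen as a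
  -- function of every real `s`. The level `s - 1` serves the Lipschitz estimate.
  have hreg : ∀ s : ℝ, ∃ C' : ℝ≥0, 1 < s → ∀ (a : Idx → Idx → ℂ) (δ : ℝ≥0), δ ≤ 1 → KernelBound c' a →
      ∀ u : Idx → ℂ, δ * seqNorm 0 u ≤ (2 * C : ℝ≥0) * seqNorm (-1) (transport a u) →
      δ * seqNorm s u ≤ C' * seqNorm (s - 1) (transport a u) ∧
      δ * seqNorm (s - 1) u ≤ C' * seqNorm (s - 1 - 1) (transport a u) := fun s => by
    by_cases hs : 1 < s
    · obtain ⟨C₁, h1⟩ := exists_seqNorm_le c' (2 * C) (s := s) (by linarith)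
      obtain ⟨C₂, h2⟩ := exists_seqNorm_le c' (2 * C) (s := s - 1) (by linarith)
      refine ⟨max C₁ C₂, fun _ a δ hδ ha u hu => ⟨(h1 a δ hδ ha u hu).trans ?_, (h2 a δ hδ ha u hu).trans ?_⟩⟩
      · exact mul_le_mul_left (by exact_mod_cast le_max_left _ _) _
      · exact mul_le_mul_left (by exact_mod_cast le_max_right _ _) _
    · exact ⟨0, fun h => absurd h hs⟩
  choose C' hC' using hreg
  -- Chosen so that the drift, of size `εκ`, satisfies the absorption condition `2Cεκ ≤ c₀(σ/2)^n`;
  -- the added 1 prevents a zero denominator.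
  set ε₁ : ℝ := min 1 (c₀ / (2 ^ n * (2 * C * κ + 1)))
  have hε₁ : 0 < ε₁ := lt_min one_pos (by positivity)
  refine ⟨ε₁, hε₁, fun s => C' s * 2 ^ n / c₀, fun s => c (decayOrder s) * schurConst s + 2 * κ, ?_⟩
  intro lam ε σ hlam0 hlam1 hε hσ hσ1 hεσ c₂ hc₂
  -- The lower bound of the determinant at distance `σ/2` instead of `σ`: the system must be
  -- inverted on the whole support of the cutoff.
  set δ : ℝ≥0 := c₀ * (σ / 2) ^ n
  have hδ0 : 0 < δ := by positivity
  have hσ2 : σ / 2 ≤ 1 := (NNReal.half_le_self σ).trans hσ1.le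
  have hδ1 : δ ≤ 1 := mul_le_one' (min_le_right _ _) (pow_le_one' hσ2 n)
  have hED : ∀ s, C' s / δ = C' s * 2 ^ n / c₀ / σ ^ n := fun s => by
    have h1 := hσ.ne'
    have h2 := hc₀.ne'
    simp only [δ, div_pow]
    field_simp
  have hσn : (σ : ℝ) ^ n ≤ 1 := pow_le_one₀ σ.2 (by exact_mod_cast hσ1.le)
  have hε1 : ε ≤ 1 := hεσ.trans (mul_le_one₀ (min_le_left _ _) (by positivity) hσn)
  have hparam := fun ξ : Icc ξl ξu => param_bounds hl hu ξ.2
  have hdrift : ∀ (ξ : Icc ξl ξu) i, ‖drift y ξ ε (c₂ ξ) i‖ ≤ (⟨ε, hε.le⟩ * κ : ℝ≥0) := fun ξ i => by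
    rw [norm_drift, mul_div_assoc, abs_mul, abs_of_pos hε, div_eq_mul_inv, abs_mul]
    exact mul_le_mul_of_nonneg_left (mul_le_mul (abs_le_of_lipNorm_le hc₂ ξ) (hb ξ ξ.2) (abs_nonneg _)
      (le_max_right _ _)) hε.le
  -- The variation of `c₂` is controlled only after multiplication by `lam`, which is why `lam`
  -- stays on the left; `ε ≤ 1` and `lam < 1` dispose of the rest.
  have hdriftl : ∀ (ξ ξ' : Icc ξl ξu) i, lam * ‖drift y ξ ε (c₂ ξ) i - drift y ξ' ε (c₂ ξ') i‖ ≤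
      (2 * κ : ℝ≥0) * ‖(ξ : ℝ) - ξ'‖₊ := fun ξ ξ' i => by
    have e : ε * c₂ ξ / omega y ξ - ε * c₂ ξ' / omega y ξ' = ε * ((c₂ ξ - c₂ ξ') * (omega y ξ)⁻¹ +
        c₂ ξ' * ((omega y ξ)⁻¹ - (omega y ξ')⁻¹)) := by ring
    have h1 : lam * |(c₂ ξ - c₂ ξ') * (omega y ξ)⁻¹| ≤ max K 0 * |(ξ : ℝ) - ξ'| * b := by
      rw [abs_mul, ← mul_assoc]
      exact mul_le_mul (abs_sub_le_of_lipNorm_le hlam0 hc₂ ξ ξ') (hb ξ ξ.2) (abs_nonneg _) (by positivity)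
    have h2 : lam * |c₂ ξ' * ((omega y ξ)⁻¹ - (omega y ξ')⁻¹)| ≤ max K 0 * (b * |(ξ : ℝ) - ξ'|) := by
      refine (mul_le_of_le_one_left (abs_nonneg _) hlam1.le).trans ?_
      rw [abs_mul]
      exact mul_le_mul (abs_le_of_lipNorm_le hc₂ ξ') (hbl ξ ξ.2 ξ' ξ'.2) (abs_nonneg _) (le_max_right _ _)
    rw [norm_drift_sub, e, abs_mul, abs_of_pos hε, mul_left_comm]
    refine (mul_le_of_le_one_left (by positivity) hε1).trans ?_
    refine (mul_le_mul_of_nonneg_left (abs_add_le _ _) hlam0.le).trans ?_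
    rw [mul_add]
    refine (add_le_add h1 h2).trans (le_of_eq ?_)
    rw [NNReal.coe_mul, coe_nnnorm, Real.norm_eq_abs]
    change _ = 2 * (max K 0 * b) * _
    ring
  have hK : ∀ ξ : Icc ξl ξu, KernelBound c' (system y ε ξ (c₂ ξ)) := fun ξ =>
    (hker ξ ξ.2).addDiag fun i => (hdrift ξ i).trans (mul_le_of_le_one_left κ.2 hε1)
  have hsmall : 2 * (C * (⟨ε, hε.le⟩ * κ)) ≤ δ := by
    rw [← NNReal.coe_le_coe]
    push_cast [δ]
    have h1 : ε ≤ c₀ / (2 ^ n * (2 * C * κ + 1)) * σ ^ n :=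
      hεσ.trans (mul_le_mul_of_nonneg_right (min_le_right _ _) (by positivity))
    calc 2 * ((C : ℝ) * (ε * κ)) ≤ (2 * C * κ + 1) * ε := by linarith
      _ ≤ (2 * C * κ + 1) * (c₀ / (2 ^ n * (2 * C * κ + 1)) * σ ^ n) := by gcongr
      _ = c₀ * (σ / 2) ^ n := by
        have : (2 * C * κ + 1 : ℝ) ≠ 0 := by positivity
        rw [div_pow]
        field_simp
  have hap : ∀ ξ ∈ goodSet y ξl ξu (σ / 2), ∀ u : Idx → ℂ, seqNorm 0 u ≠ ∞ →
      δ * seqNorm 0 u ≤ (2 * C : ℝ≥0) * seqNorm (-1) (transport (system y ε ξ (c₂ ξ)) u) := by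
    intro ξ hξ u hu
    have h1 : (δ : ℝ) ≤ ‖charDet y ξ‖ := by
      refine le_trans ?_ (hdet ξ ξ.2 (σ / 2) (by positivity) (by
        have : (σ : ℝ) < 1 := by exact_mod_cast hσ1
        linarith [σ.2]) hξ)
      push_cast [δ]
      gcongr
      exact min_le_left _ _
    push_cast
    exact (hker ξ ξ.2).apriori_addDiag (hC _ δ hδ1 (hker ξ ξ.2) (hC₀ ξ ξ.2 δ h1)) (hdrift ξ) hsmall hu
  have huniq : ∀ ξ ∈ goodSet y ξl ξu (σ / 2), ∀ u : Idx → ℂ, seqNorm 0 u ≠ ∞ →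
      transport (system y ε ξ (c₂ ξ)) u = 0 → u = 0 := by
    intro ξ hξ u hu h0
    have h1 := hap ξ hξ u hu
    rw [h0, show seqNorm (-1) (0 : Idx → ℂ) = 0 from seqNorm_zero _, mul_zero, nonpos_iff_eq_zero, mul_eq_zero] at h1
    refine eq_zero_of_seqNorm_eq_zero (h1.resolve_left ?_)
    exact_mod_cast hδ0.ne'
  have hT : ∀ ξ : Icc ξl ξu, ∃ T : Seq2 →ₗ[ℂ] Seq2, (ξ ∉ goodSet y ξl ξu (σ / 2) → T = 0) ∧
      (ξ ∈ goodSet y ξl ξu (σ / 2) → ∀ g, transport (system y ε ξ (c₂ ξ)) (T g) = g) := by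
    intro ξ
    by_cases hξ : ξ ∈ goodSet y ξl ξu (σ / 2)
    · obtain ⟨S, hS⟩ := (hK ξ).exists_solution fun u h =>
        Subtype.ext (huniq ξ hξ u (seqNorm_coe_ne_top u) h)
      exact ⟨S, fun h => absurd hξ h, fun _ => hS⟩
    · exact ⟨0, fun _ => rfl, fun h => absurd h hξ⟩
  choose T hT0 hT using hT
  refine ⟨T, hT0, hT, fun ξ hξ g hg => ?_, fun s hs => ⟨fun ξ hξ g => ?_, fun ξ hξ ξ' hξ' g g' => ?_⟩⟩
  · have h1 : seqNorm 0 (reflect (T ξ g)) ≠ ∞ := by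
      rw [seqNorm_reflect]
      exact seqNorm_coe_ne_top _
    -- The solution and its reflection solve the same equation, so uniqueness identifies them.
    have h2 : (fun i => reflect (T ξ g) i - T ξ g i) = 0 := by
      refine huniq ξ hξ _ (ne_top_of_le_ne_top (ENNReal.add_ne_top.2 ⟨h1, seqNorm_coe_ne_top (T ξ g)⟩)
        (seqNorm_sub_le 0 _ _)) ?_
      funext i
      rw [(hK ξ).transport_sub h1 (seqNorm_coe_ne_top _), transport_reflect (addDiag_ker_neg y ξ ε (c₂ ξ)),
        hT ξ hξ, hg, sub_self]
      rfl
    funext i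
    exact sub_eq_zero.1 (congrFun h2 i)
  · have h1 := (hC' s hs _ δ hδ1 (hK ξ) _ (hap ξ hξ _ (seqNorm_coe_ne_top (T ξ g)))).1
    rw [hT ξ hξ] at h1
    rw [← hED]
    exact le_div_mul_of_mul_le hδ0.ne' h1
  · have hne := seqNorm_coe_ne_top (T ξ g - T ξ' g')
    have h1 := (hC' s hs _ δ hδ1 (hK ξ) _ (hap ξ hξ _ hne)).2
    -- Resolvent identity: the difference of the solutions solves the system at `ξ`, with the
    -- variation of the kernel applied to the solution at `ξ'` as an additional source.
    have h2 : transport (system y ε ξ (c₂ ξ)) (T ξ g - T ξ' g' : Seq2) = fun i => (g i - g' i) +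
        kmul (fun i j => system y ε ξ (c₂ ξ) i j - system y ε ξ' (c₂ ξ') i j) (T ξ' g') i := by
      funext i
      refine ((hK ξ).transport_sub_sub (hK ξ') (seqNorm_coe_ne_top _) (seqNorm_coe_ne_top _) i).trans ?_
      rw [hT ξ hξ, hT ξ' hξ']
    have h3 := le_div_mul_of_mul_le hδ0.ne' h1
    rw [hED] at h3
    have h4 := seqNorm_kmul_addDiag_le (hkerl ξ ξ.2 ξ' ξ'.2) hlam0.le hlam1.le (hdriftl ξ ξ') s
      (seqNorm_coe_ne_top (T ξ' g'))
    have h5 : ((‖(ξ : ℝ) - ξ'‖₊ : ℝ≥0) : ℝ≥0∞) = ENNReal.ofReal |(ξ : ℝ) - ξ'| := by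
      rw [← Real.norm_eq_abs, ofReal_norm]
      rfl
    rw [h2, addDiag_sub] at h3
    refine (mul_le_mul_right (h3.trans (mul_le_mul_right (seqNorm_add_le _ _ _) _)) _).trans ?_
    rw [mul_left_comm, mul_add]
    refine mul_le_mul_right (add_le_add le_rfl ?_) _
    rw [← h5]
    exact (mul_le_mul_right (seqNorm_mono (by linarith) _) _).trans h4

end InverseFamily

end

/-! ### The right inverse -/

section

open Set Filter Topology Complex ComplexConjugate MeasureTheory
open scoped NNReal ENNReal

section RightInverse

variable {y ξl ξu : ℝ}

/-- The right inverse of `Π 𝕃₁ Π` away from the exceptional set. -/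
def rightInverse {O : Set ℝ} (f : O → ℝ) (T : O → Seq2 →ₗ[ℂ] Seq2) : (O → L2) →ₗ[ℂ] (O → L2) :=
  LinearMap.pi fun ξ => ((f ξ : ℂ) • (synth ∘ₗ T ξ ∘ₗ analysis)) ∘ₗ LinearMap.proj ξ

lemma rightInverse_apply {O : Set ℝ} (f : O → ℝ) (T : O → Seq2 →ₗ[ℂ] Seq2) (h : O → L2) (ξ : O) :
    rightInverse f T h ξ = synth ((f ξ : ℂ) • T ξ (analysis (h ξ))) := by
  rw [map_smul]
  rfl

/-- Coefficients at the modes ±1 are extracted, the system is inverted in `ℓ²`, and the result is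
multiplied by the cutoff. A single operator serves every `s`, since the tame estimates concern the
same `ℓ²` solution. -/
lemma exists_right_inverse (hy : 0 < y) (hl : 0 < ξl) (hu : ξu < y / √2) :
    ∃ n : ℕ, ∀ K : ℝ, ∃ ε₁ : ℝ, 0 < ε₁ ∧ ∃ C : ℝ → ℝ,
      ∀ lam ε σ : ℝ, 0 < lam → lam < 1 → 0 < ε → 0 < σ → σ < 1 → ε * (σ ^ n)⁻¹ ≤ ε₁ →
      ∀ c₂ : Icc ξl ξu → ℝ, lipNorm lam c₂ ≤ ENNReal.ofReal K →
      ∃ S : (Icc ξl ξu → L2) →ₗ[ℂ] (Icc ξl ξu → L2),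
        ∀ s : ℝ, 1 < s → ∀ h ∈ Xmode lam (s - 1),
          S h ∈ Xmode lam s ∧
          (IsRealFamily h → IsRealFamily (S h)) ∧
          lipSobolevNorm lam s (S h) ≤
            ENNReal.ofReal (C s * (ε ^ 2)⁻¹ * (σ ^ n)⁻¹) * lipSobolevNorm lam (s - 1) h ∧
          ∀ ξ₀ ∈ goodSet y ξl ξu σ, ∀ k : ℤ × ℤ,
            PiL₁Pi y ξ₀ ε (speed y ξ₀ ε (c₂ ξ₀)) (S h ξ₀) k = coeff (h ξ₀) k := by
  obtain ⟨n, hn⟩ := exists_inverse_family hy hl hu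
  obtain ⟨b, hb0, hb, hbl⟩ := exists_inv_omega_bound hy hl hu
  obtain ⟨c, hker, -⟩ := exists_kernelBound hy hl hu
  -- Inverting costs `σ^{-n}`, the resolvent identity uses the inverse twice, hence `σ^{-2n}`, and
  -- the slope of the cutoff contributes `σ^{-n-1}`; the exponent `2n + 1` dominates all three.
  refine ⟨2 * n + 1, fun K => ?_⟩
  obtain ⟨ε₁, hε₁, E, M, hT⟩ := hn K
  refine ⟨ε₁, hε₁, fun s => 5 * b * E s + b * E s * M s * E s, ?_⟩
  intro lam ε σ hlam0 hlam1 hε hσ0 hσ1 hεσ c₂ hc₂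
  lift σ to ℝ≥0 using hσ0.le
  have hσn : ε ≤ ε₁ * σ ^ n := by
    rw [← div_eq_mul_inv, div_le_iff₀ (by positivity)] at hεσ
    exact hεσ.trans (mul_le_mul_of_nonneg_left (pow_le_pow_of_le_one hσ0.le hσ1.le (by omega)) hε₁.le)
  obtain ⟨T, hT0, hTs, hTr, hTe⟩ := hT lam ε σ hlam0 hlam1 hε (by exact_mod_cast hσ0) (by exact_mod_cast hσ1) hσn c₂ hc₂
  obtain ⟨χ, hχ1, hχl, hχg, hχ0⟩ := exists_cutoff (exceptionalSet y) hσ0 hσ1 ξl ξu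
  -- The cutoff times the inverse of the prefactor `ε²ω₀` of `PiL₁Pi_synth`.
  set f : Icc ξl ξu → ℝ := fun ξ => χ ξ * ((ε ^ 2)⁻¹ * (omega y ξ)⁻¹)
  set B : ℝ≥0 := ⟨(ε ^ 2)⁻¹ * b, by positivity⟩
  -- The 3 is 2 from the slope `2/σ` of the cutoff plus 1 from the variation of `1/ω₀`, the latter
  -- bounded using `1 ≤ 1/σ`.
  set N : ℝ≥0 := ⟨3 * ((ε ^ 2)⁻¹ * b) * (σ : ℝ)⁻¹, by positivity⟩
  have hf : ∀ ξ, |f ξ| ≤ B := fun ξ => by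
    rw [abs_mul, abs_mul, abs_of_pos (by positivity : 0 < (ε ^ 2)⁻¹)]
    refine (mul_le_of_le_one_left (by positivity) (hχ1 ξ)).trans ?_
    exact mul_le_mul_of_nonneg_left (hb ξ ξ.2) (by positivity)
  have hfl : ∀ ξ ξ' : Icc ξl ξu, |f ξ - f ξ'| ≤ N * |(ξ : ℝ) - ξ'| := fun ξ ξ' => by
    have e : f ξ - f ξ' = (ε ^ 2)⁻¹ * ((χ ξ - χ ξ') * (omega y ξ)⁻¹ +
        χ ξ' * ((omega y ξ)⁻¹ - (omega y ξ')⁻¹)) := by ring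
    have h1 : |(χ ξ - χ ξ') * (omega y ξ)⁻¹| ≤ 2 / σ * |(ξ : ℝ) - ξ'| * b := by
      rw [abs_mul]
      exact mul_le_mul (hχl ξ ξ') (hb ξ ξ.2) (abs_nonneg _) (by positivity)
    have h2 : |χ ξ' * ((omega y ξ)⁻¹ - (omega y ξ')⁻¹)| ≤ (σ : ℝ)⁻¹ * (b * |(ξ : ℝ) - ξ'|) := by
      rw [abs_mul]
      exact mul_le_mul ((hχ1 ξ').trans ((one_le_inv₀ hσ0).2 hσ1.le)) (hbl ξ ξ.2 ξ' ξ'.2) (abs_nonneg _)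
        (by positivity)
    rw [e, abs_mul, abs_of_pos (by positivity : 0 < (ε ^ 2)⁻¹)]
    refine (mul_le_mul_of_nonneg_left ((abs_add_le _ _).trans (add_le_add h1 h2)) (by positivity)).trans
      (le_of_eq ?_)
    change _ = 3 * ((ε ^ 2)⁻¹ * b) * (σ : ℝ)⁻¹ * _
    ring
  have hf0 : ∀ ξ, ξ ∉ goodSet y ξl ξu (σ / 2) → f ξ = 0 := fun ξ hξ => by
    by_contra h
    exact hξ (hχ0 ξ fun h0 => h (by simp only [f, h0, zero_mul]))
  have hgood : goodSet y ξl ξu σ ⊆ goodSet y ξl ξu (σ / 2) := fun ξ hξ x hx =>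
    (half_le_self hσ0.le).trans (hξ x hx)
  refine ⟨rightInverse f T, fun s hs h hh => ?_⟩
  obtain ⟨⟨hhf, -⟩, hhm⟩ := hh
  have hS : rightInverse f T h = fun ξ => synth ((f ξ : ℂ) • T ξ (analysis (h ξ))) :=
    funext fun ξ => rightInverse_apply f T h ξ
  have hbound : lipSobolevNorm lam s (rightInverse f T h) ≤
      ENNReal.ofReal ((5 * b * E s + b * E s * M s * E s) * (ε ^ 2)⁻¹ * ((σ : ℝ) ^ (2 * n + 1))⁻¹) *
        lipSobolevNorm lam (s - 1) h := by
    rw [hS]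
    refine (lipSobolevNorm_synth_le hlam1 hf hfl hf0 (D := E s / σ ^ n) (M := M s)
      (fun ξ hξ => ((hTe s hs).1 ξ hξ _).trans (mul_le_mul_right (seqNorm_analysis_le _ _) _))
      fun ξ hξ ξ' hξ' => ((hTe s hs).2 ξ hξ ξ' hξ' _ _).trans ?_).trans ?_
    · refine mul_le_mul_right (add_le_add_left (mul_le_mul_right ?_ _) _) _
      rw [← map_sub]
      exact seqNorm_analysis_le _ _
    · refine mul_le_mul_left ?_ _
      rw [← ENNReal.ofReal_coe_nnreal]
      refine ENNReal.ofReal_le_ofReal ?_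
      set t : ℝ := (σ : ℝ)⁻¹
      have ht : 1 ≤ t := (one_le_inv₀ hσ0).2 hσ1.le
      have h1 : t ^ n ≤ t ^ (2 * n + 1) := pow_le_pow_right₀ ht (by omega)
      have h2 : t ^ (n + 1) ≤ t ^ (2 * n + 1) := pow_le_pow_right₀ ht (by omega)
      have h3 : t ^ (2 * n) ≤ t ^ (2 * n + 1) := pow_le_pow_right₀ ht (by omega)
      set p : ℝ := (ε ^ 2)⁻¹
      have hp : 0 ≤ p := by positivity
      have hE : 0 ≤ p * b * E s := by positivity
      have hM : 0 ≤ p * b * E s * M s * E s := by positivity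
      have e : ((B * (E s / σ ^ n) + (B * ((E s / σ ^ n) * (1 + M s * (E s / σ ^ n))) + N * (E s / σ ^ n)) : ℝ≥0) : ℝ) =
          2 * (p * b * E s * t ^ n) + p * b * E s * M s * E s * t ^ (2 * n) + 3 * (p * b * E s * t ^ (n + 1)) := by
        have e1 : (B : ℝ) = p * b := rfl
        have e2 : (N : ℝ) = 3 * (p * b) * t := rfl
        push_cast
        rw [e1, e2, div_eq_mul_inv, ← inv_pow]
        change _ * (_ * t ^ n) + _ = _
        ring
      rw [e, ← inv_pow]
      calc _ ≤ 2 * (p * b * E s * t ^ (2 * n + 1)) + p * b * E s * M s * E s * t ^ (2 * n + 1) +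
            3 * (p * b * E s * t ^ (2 * n + 1)) := by gcongr
        _ = _ := by ring
  refine ⟨⟨⟨hbound.trans_lt (ENNReal.mul_lt_top ENNReal.ofReal_lt_top hhf), fun ξ => ?_⟩, fun ξ => ?_⟩,
    fun hr ξ => ?_, hbound, fun ξ hξ k => ?_⟩
  · rw [rightInverse_apply]
    exact integral_synth _
  · rw [rightInverse_apply]
    exact modeProj_synth _
  · rw [rightInverse_apply]
    refine synth_real ?_
    by_cases hξ : ξ ∈ goodSet y ξl ξu (σ / 2)
    · have h1 := hTr ξ hξ _ (analysis_reflect (hr ξ))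
      funext i
      have h2 := congrFun h1 i
      change conj ((f ξ : ℂ) * T ξ (analysis (h ξ)) (-i)) = (f ξ : ℂ) * T ξ (analysis (h ξ)) i
      rw [map_mul, conj_ofReal]
      exact congrArg _ h2
    · rw [hf0 ξ hξ, ofReal_zero, zero_smul]
      funext i
      exact map_zero conj
  · obtain ⟨hξ0, hξ1⟩ := param_bounds hl hu ξ.2
    have hω := omega_pos hy hξ0 hξ1
    by_cases hk : |k.2| = 1
    · obtain ⟨ς, hς⟩ := Int.isUnit_iff_abs_eq.2 hk
      obtain ⟨l, j⟩ := k
      obtain rfl : (ς : ℤ) = j := hς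
      have hfξ : f ξ = (ε ^ 2)⁻¹ * (omega y ξ)⁻¹ := by
        simp only [f, hχg ξ ξ.2 hξ, one_mul]
      rw [rightInverse_apply, PiL₁Pi_synth hy hξ0 hξ1 (hker ξ ξ.2) ε (c₂ ξ) _ (l, ς)]
      have e1 : transport (addDiag (ker y ξ) (drift y ξ ε (c₂ ξ))) ((f ξ : ℂ) • T ξ (analysis (h ξ)) : Seq2) (l, ς) =
          f ξ * transport (system y ε ξ (c₂ ξ)) (T ξ (analysis (h ξ))) (l, ς) :=
        transport_const_mul _ _ _
      rw [e1, hTs ξ (hgood hξ), analysis_apply, hfξ]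
      have h1 : (omega y ξ : ℂ) ≠ 0 := ofReal_ne_zero.2 hω.ne'
      have h2 : (ε : ℂ) ≠ 0 := ofReal_ne_zero.2 hε.ne'
      push_cast
      field_simp
    · rw [PiL₁Pi, if_neg hk, coeff_eq_zero_of_modeProj (hhm ξ) hk]

end RightInverse

end

end Leapfrog

end

theorem proposition4p1 (y₀ ξl ξu : ℝ) (hy₀ : 0 < y₀) (hξl : 0 < ξl) (hξ : ξl < ξu)
    (hξu : ξu < y₀ / Real.sqrt 2) :
    ((Leapfrog.exceptionalSet y₀).Countable ∧
      ∀ x : ℝ, AccPt x (Filter.principal (Leapfrog.exceptionalSet y₀)) →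
        x = y₀ / Real.sqrt 2) ∧
    ∃ n : ℕ, ∀ K : ℝ, ∃ ε₁ : ℝ, 0 < ε₁ ∧ ∃ C : ℝ → ℝ,
      ∀ lam ε σ : ℝ, 0 < lam → lam < 1 → 0 < ε → 0 < σ → σ < 1 → ε * (σ ^ n)⁻¹ ≤ ε₁ →
      ∀ c₂ : Set.Icc ξl ξu → ℝ, Leapfrog.lipNorm lam c₂ ≤ ENNReal.ofReal K →
      ∃ S : (Set.Icc ξl ξu → Leapfrog.L2) →ₗ[ℂ] (Set.Icc ξl ξu → Leapfrog.L2),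
        ∀ s : ℝ, 1 < s → ∀ h ∈ Leapfrog.Xmode lam (s - 1),
          S h ∈ Leapfrog.Xmode lam s ∧
          (Leapfrog.IsRealFamily h → Leapfrog.IsRealFamily (S h)) ∧
          Leapfrog.lipSobolevNorm lam s (S h) ≤
            ENNReal.ofReal (C s * (ε ^ 2)⁻¹ * (σ ^ n)⁻¹) *
              Leapfrog.lipSobolevNorm lam (s - 1) h ∧
          ∀ ξ₀ ∈ Leapfrog.goodSet y₀ ξl ξu σ, ∀ k : ℤ × ℤ,
            Leapfrog.PiL₁Pi y₀ ξ₀ ε (Leapfrog.speed y₀ ξ₀ ε (c₂ ξ₀)) (S h ξ₀) k =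
              Leapfrog.coeff (h ξ₀) k :=
  ⟨⟨Leapfrog.countable_exceptionalSet hy₀, fun _ hx => Leapfrog.accPt_exceptionalSet hy₀ hx⟩,
    Leapfrog.exists_right_inverse hy₀ hξl hξu⟩
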